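/- Let $N,M$ be positive integers, let $\mathcal H^-$ (resp. $\mathcal H^+$) be the space of series $\sum_{i\ge0}f_iz^{-i}$ (resp. $\sum_{i\ge0}f_iz^{i}$) holomorphic in a neighbourhood of $|z|\ge1$ including $\infty$ (resp. of $|z|\le1$). For $(a,\hat a)\in(z^N+z^{N-1}\mathcal H^-)\times z^{-M}\mathcal H^+$, $a(z)=z^N+\sum_{i\le N-1}v_iz^i$, $\hat a(z)=\sum_{j\ge-M}\hat v_jz^j$, put $\zeta(z)=a(z)-\hat a(z)$ and $l(z)=a(z)_{>0}+\hat a(z)_{\le0}$. Let $\mathcal M_{N,M}$ be the set of those $(a,\hat a)$ with (M1) $\hat v_{-M}\ne0$; (M2) $a\hat a'-a'\hat a\ne0$, $\zeta'\neq0$, $l'\ne0$ at every point of $|z|=1$; (M3) $\zeta$ is injective and nowhere zero on $S^1=\{|z|=1\}$, and $\Gamma=\zeta(S^1)$ has winding number $1$ around $0$. The tangent space at each point is $z^{N-1}\mathcal H^-\times z^{-M}\mathcal H^+$, and a tangent vector $\partial=(X,\hat X)$ acts by $\partial\zeta=X-\hat X$, $\partial l=X_{>0}+\hat X_{\le0}$.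 For tangent vectors at a point let $$\langle\partial_1,\partial_2\rangle=-\frac1{2\pi \mathrm i}\oint_{|z|=1}\frac{\partial_1\zeta\,\partial_2\zeta}{z^2\zeta'(z)}\,dz-\Big(\operatorname*{res}_{z=\infty}+\operatorname*{res}_{z=0}\Big)\frac{\partial_1l\,\partial_2l}{z^2\,l'(z)}\,dz .$$ Coordinates $t^i$ ($i\in\mathbb Z$), $h^j$ ($1\le j\le N-1$), $\hat h^k$ ($0\le k\le M$) are defined at each point, up to the choice of branches of logarithms and roots, as follows. Let $z(\zeta)$ be the inverse of $\zeta:S^1\to\Gamma$ and $z(\zeta)=f_0(\zeta)^{-1}f_\infty(\zeta)$ on $\Gamma$, where $f_0$ and $f_\infty/\zeta$ are holomorphic and nowhere zero on the closed inside and the closed outside of $\Gamma$ respectively (that is, on neighbourhoods of these sets), and $f_\infty(\zeta)=\zeta+O(1)$ as $\zeta\to\infty$; then $\log f_0(\zeta)=-\sum_{i\ge0}t^i\zeta^i$ near $0$ and $\log\frac{f_\infty(\zeta)}{\zeta}=\sum_{i\ge1}t^{-i}\zeta^{-i}$ near $\infty$. Let $z(\chi)$ be the inverse function of $\chi(z)=l(z)^{1/N}$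 ($\chi\sim z$) near $z=\infty$ and $z(\hat\chi)$ that of a branch $\hat\chi(z)=l(z)^{1/M}$ near $z=0$; then, as $\chi\to\infty$ and $\hat\chi\to\infty$, $$\log z(\chi)=\log\chi-\frac1N\sum_{j=1}^{N-1}h^j\chi^{-j}+O(\chi^{-N}),\qquad \log z(\hat\chi)=-\log\hat\chi+\frac1M\sum_{k=0}^{M}\hat h^k\hat\chi^{-k}+O(\hat\chi^{-M-1}).$$ **Proposition.** (1) These coordinates are equivalently given by $$t^i=\frac1{2\pi \mathrm i}\oint_{|z|=1}\frac{\zeta(z)^{-i}}{i}\frac{dz}z\ (i\ne0),\qquad t^0=\frac1{2\pi \mathrm i}\oint_{|z|=1}\log\frac z{\zeta(z)}\,\frac{dz}z,$$ $$h^j=-\frac Nj\operatorname*{res}_{z=\infty}l(z)^{j/N}\frac{dz}z\ (1\le j\le N-1),\qquad \hat h^0=\log\hat v_{-M},\qquad \hat h^k=\frac Mk\operatorname*{res}_{z=0}l(z)^{k/M}\frac{dz}z\ (1\le k\le M),$$ where $\log(z/\zeta(z))$ is a continuous branch on $S^1$, $l^{j/N}=(l^{1/N})^j$ with $l^{1/N}\sim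 z$ at $\infty$, and $l^{k/M}=(l^{1/M})^k$ with $l^{1/M}\sim e^{\hat h^0/M}z^{-1}$ at $0$. (2) The coordinate vectors satisfy $$\Big\langle\frac{\partial}{\partial t^{i_1}},\frac{\partial}{\partial t^{i_2}}\Big\rangle=-\delta_{i_1+i_2,-1},\qquad \Big\langle\frac{\partial}{\partial h^{j_1}},\frac{\partial}{\partial h^{j_2}}\Big\rangle=\frac1N\delta_{j_1+j_2,N},\qquad \Big\langle\frac{\partial}{\partial\hat h^{k_1}},\frac{\partial}{\partial\hat h^{k_2}}\Big\rangle=\frac1M\delta_{k_1+k_2,M},$$ and all other pairings between them vanish. Here $\partial/\partial u$ is the velocity of a curve in $\mathcal M_{N,M}$ along which the coordinate $u$ is increased by the complex parameter $s$ and all the other coordinates are fixed. (3) Consequently $\langle\ ,\ \rangle$ is, at every point of $\mathcal M_{N,M}$, a symmetric bilinear form that is nondegenerate (only the zero vector is orthogonal to all tangent vectors), and it is flat with flat coordinates $t^i,h^j,\hat h^k$: these are local coordinates (they exist at every point and separate nearby points, every coordinate vector exists and is unique, and only the zero vector is orthogonal to all coordinate vectors), and the components of $\langle\ ,\ \rangle$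 in them are constant. -/

import Mathlib

open Filter Topology Asymptotics Metric Bornology
open scoped Real

noncomputable section

namespace TodaFrobenius

/-! ### The spaces of Laurent series -/

/-- Coefficient sequences of the Laurent series that converge in a neighbourhood of the unit
circle: geometric decay `|Xᵢ| ≤ C ρ ^ (-|i|)` for some `ρ > 1`. -/
def analyticLaurent : Submodule ℂ (ℤ → ℂ) where
  carrier := {X | ∃ ρ : ℝ, 1 < ρ ∧ ∃ C : ℝ, ∀ i : ℤ, ‖X i‖ ≤ C * ρ ^ (-|i|)}
  zero_mem' := ⟨2, one_lt_two, 0, fun i => by simp⟩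
  add_mem' := by
    rintro X Y ⟨ρ, hρ, C, hC⟩ ⟨σ, hσ, D, hD⟩
    refine ⟨min ρ σ, lt_min hρ hσ, |C| + |D|, fun i => ?_⟩
    have key : ∀ τ : ℝ, min ρ σ ≤ τ → τ ^ (-|i|) ≤ (min ρ σ) ^ (-|i|) := by
      intro τ h
      have h0 : 0 < min ρ σ := lt_trans one_pos (lt_min hρ hσ)
      obtain ⟨n, hn⟩ := Int.eq_ofNat_of_zero_le (abs_nonneg i)
      rw [hn, zpow_neg, zpow_neg, zpow_natCast, zpow_natCast]
      gcongr
    have hp : 0 ≤ ρ ^ (-|i|) := by positivity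
    have hq : 0 ≤ σ ^ (-|i|) := by positivity
    calc ‖(X + Y) i‖ ≤ ‖X i‖ + ‖Y i‖ := norm_add_le _ _
      _ ≤ C * ρ ^ (-|i|) + D * σ ^ (-|i|) := add_le_add (hC i) (hD i)
      _ ≤ |C| * ρ ^ (-|i|) + |D| * σ ^ (-|i|) := by
          gcongr <;> exact le_abs_self _
      _ ≤ |C| * (min ρ σ) ^ (-|i|) + |D| * (min ρ σ) ^ (-|i|) := by
          gcongr
          · exact key ρ (min_le_left _ _)
          · exact key σ (min_le_right _ _)
      _ = (|C| + |D|) * (min ρ σ) ^ (-|i|) := by ring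
  smul_mem' := by
    rintro c X ⟨ρ, hρ, C, hC⟩
    refine ⟨ρ, hρ, ‖c‖ * C, fun i => ?_⟩
    calc ‖(c • X) i‖ = ‖c‖ * ‖X i‖ := by simp
      _ ≤ ‖c‖ * (C * ρ ^ (-|i|)) := by gcongr; exact hC i
      _ = ‖c‖ * C * ρ ^ (-|i|) := by ring

/-- The space `z ^ n 𝓗⁻`: series `∑_{i ≤ n} Xᵢ zⁱ` such that `z ^ (-n) X(z)` is holomorphic on
(a neighbourhood of) `|z| ≥ 1`, the point at infinity included. -/
def spaceMinus (n : ℤ) : Submodule ℂ (ℤ → ℂ) where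
  carrier := {X | X ∈ analyticLaurent ∧ ∀ i, n < i → X i = 0}
  zero_mem' := ⟨analyticLaurent.zero_mem, fun _ _ => rfl⟩
  add_mem' := fun hX hY =>
    ⟨analyticLaurent.add_mem hX.1 hY.1, fun i hi => by simp [hX.2 i hi, hY.2 i hi]⟩
  smul_mem' := fun c _ hX =>
    ⟨analyticLaurent.smul_mem c hX.1, fun i hi => by simp [hX.2 i hi]⟩

/-- The space `z ^ n 𝓗⁺`: series `∑_{i ≥ n} Xᵢ zⁱ` such that `z ^ (-n) X(z)` is holomorphic on
(a neighbourhood of) `|z| ≤ 1`. -/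
def spacePlus (n : ℤ) : Submodule ℂ (ℤ → ℂ) where
  carrier := {X | X ∈ analyticLaurent ∧ ∀ i, i < n → X i = 0}
  zero_mem' := ⟨analyticLaurent.zero_mem, fun _ _ => rfl⟩
  add_mem' := fun hX hY =>
    ⟨analyticLaurent.add_mem hX.1 hY.1, fun i hi => by simp [hX.2 i hi, hY.2 i hi]⟩
  smul_mem' := fun c _ hX =>
    ⟨analyticLaurent.smul_mem c hX.1, fun i hi => by simp [hX.2 i hi]⟩

/-- The vector space `z ^ (N-1) 𝓗⁻ × z ^ (-M) 𝓗⁺`.  It is the tangent space at every point, and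
it also parametrizes the points of the coset `(z ^ N + z ^ (N-1) 𝓗⁻) × z ^ (-M) 𝓗⁺`:
the point with parameter `p = (v, v̂)` is `(a, â)`, where
`a(z) = z ^ N + ∑_{i ≤ N-1} vᵢ zⁱ` and `â(z) = ∑_{j ≥ -M} v̂ⱼ zʲ`. -/
abbrev Model (N M : ℕ) : Type :=
  ↥(spaceMinus ((N : ℤ) - 1)) × ↥(spacePlus (-(M : ℤ)))

/-- The value at `z` of a Laurent series. -/
def laurentSum (X : ℤ → ℂ) (z : ℂ) : ℂ := ∑' i : ℤ, X i * z ^ i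

/-- `(2πi)⁻¹ ∮_{|z| = 1} f(z) dz`. -/
def unitContour (f : ℂ → ℂ) : ℂ := (2 * π * Complex.I)⁻¹ * ∮ z in C(0, 1), f z

/-- The residue of `f(z) dz` at `z = 0`. -/
def resZero (f : ℂ → ℂ) : ℂ :=
  limUnder (𝓝[>] (0 : ℝ)) fun r => (2 * π * Complex.I)⁻¹ * ∮ z in C(0, r), f z

/-- The residue of `f(z) dz` at `z = ∞`. -/
def resInfty (f : ℂ → ℂ) : ℂ :=
  -limUnder (atTop : Filter ℝ) fun r => (2 * π * Complex.I)⁻¹ * ∮ z in C(0, r), f z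

section Point

variable {N M : ℕ}

/-- The coefficient `vᵢ` of a point, or `Xᵢ` of a tangent vector. -/
def coeff (p : Model N M) (i : ℤ) : ℂ := (p.1 : ℤ → ℂ) i

/-- The coefficient `v̂ⱼ` of a point, or `X̂ⱼ` of a tangent vector. -/
def coeffHat (p : Model N M) (j : ℤ) : ℂ := (p.2 : ℤ → ℂ) j

/-- The function `a(z) = z ^ N + ∑_{i ≤ N-1} vᵢ zⁱ`. -/
def aFun (p : Model N M) (z : ℂ) : ℂ := z ^ N + laurentSum (coeff p) z

/-- The function `â(z) = ∑_{j ≥ -M} v̂ⱼ zʲ`. -/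
def aHatFun (p : Model N M) (z : ℂ) : ℂ := laurentSum (coeffHat p) z

/-- The function `ζ(z) = a(z) - â(z)`. -/
def zeta (p : Model N M) (z : ℂ) : ℂ := aFun p z - aHatFun p z

/-- The derivative `∂_X l(z) = X(z)_{> 0} + X̂(z)_{≤ 0}` of `l(z)` along a tangent vector. -/
def dL (X : Model N M) (z : ℂ) : ℂ :=
  ∑ i ∈ Finset.Icc (1 : ℤ) ((N : ℤ) - 1), coeff X i * z ^ i
    + ∑ j ∈ Finset.Icc (-(M : ℤ)) 0, coeffHat X j * z ^ j

/-- The derivative `∂_X ζ(z) = X(z) - X̂(z)` of `ζ(z)` along a tangent vector. -/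
def dZeta (X : Model N M) (z : ℂ) : ℂ := laurentSum (coeff X) z - laurentSum (coeffHat X) z

/-- The function `l(z) = a(z)_{> 0} + â(z)_{≤ 0}` (for `N ≥ 1`). -/
def lFun (p : Model N M) (z : ℂ) : ℂ :=
  z ^ N + (∑ i ∈ Finset.Icc (1 : ℤ) ((N : ℤ) - 1), coeff p i * z ^ i
    + ∑ j ∈ Finset.Icc (-(M : ℤ)) 0, coeffHat p j * z ^ j)

/-- The winding number around `w` of the closed curve `z ↦ ζ(z)`, `|z| = 1`. -/
def winding (p : Model N M) (w : ℂ) : ℂ :=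
  unitContour fun z => deriv (zeta p) z / (zeta p z - w)

/-- The curve `Γ = ζ(S¹)`. -/
def curve (p : Model N M) : Set ℂ := zeta p '' sphere 0 1

/-- The inside of `Γ`. -/
def inside (p : Model N M) : Set ℂ := {w | w ∉ curve p ∧ winding p w ≠ 0}

/-- The outside of `Γ` in the finite plane. -/
def outside (p : Model N M) : Set ℂ := {w | w ∉ curve p ∧ winding p w = 0}

end Point

/-- The manifold `𝓜_{N,M}`. -/
structure IsPoint {N M : ℕ} (p : Model N M) : Prop where
  pole : coeffHat p (-(M : ℤ)) ≠ 0
  wronskian : ∀ z ∈ sphere (0 : ℂ) 1,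
    aFun p z * deriv (aHatFun p) z - deriv (aFun p) z * aHatFun p z ≠ 0
  deriv_zeta : ∀ z ∈ sphere (0 : ℂ) 1, deriv (zeta p) z ≠ 0
  deriv_l : ∀ z ∈ sphere (0 : ℂ) 1, deriv (lFun p) z ≠ 0
  zeta_ne_zero : ∀ z ∈ sphere (0 : ℂ) 1, zeta p z ≠ 0
  winding_one : winding p 0 = 1
  simple : Set.InjOn (zeta p) (sphere 0 1)

/-- The manifold `𝓜_{N,M}` as a set of parameters. -/
def manifold (N M : ℕ) : Set (Model N M) := {p | IsPoint p}

/-! ### The bilinear form -/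

/-- The bilinear form
`⟨X, Y⟩ = -(2πi)⁻¹ ∮ ∂_X ζ ∂_Y ζ / (z² ζ') dz - (res_∞ + res_0) ∂_X l ∂_Y l / (z² l') dz`. -/
def metric {N M : ℕ} (p X Y : Model N M) : ℂ :=
  -unitContour (fun z => dZeta X z * dZeta Y z / (z ^ 2 * deriv (zeta p) z))
    - resInfty (fun z => dL X z * dL Y z / (z ^ 2 * deriv (lFun p) z))
    - resZero (fun z => dL X z * dL Y z / (z ^ 2 * deriv (lFun p) z))

/-! ### The coordinates -/

/-- Labels of the coordinates `tⁱ` (`i ∈ ℤ`), `hʲ` (`1 ≤ j ≤ N-1`), `ĥᵏ` (`0 ≤ k ≤ M`). -/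
inductive Label (N M : ℕ) : Type
  | t (i : ℤ)
  | h (j : ↥(Finset.Icc 1 (N - 1)))
  | hHat (k : Fin (M + 1))
  deriving DecidableEq

section Coordinates

variable {N M : ℕ}

/-- The factorization `z(ζ) = f₀(ζ)⁻¹ f_∞(ζ)` on `Γ`, where `z(ζ)` is the inverse of
`ζ : S¹ → Γ`, with `f₀` and `f_∞ / ζ` holomorphic and invertible on the closed inside and the
closed outside of `Γ`, and with `f_∞(ζ) = ζ + O(1)`. -/
structure IsFactorization (p : Model N M) (f₀ fInf : ℂ → ℂ) : Prop where
  analytic_inside : AnalyticOnNhd ℂ f₀ (curve p ∪ inside p)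
  ne_zero_inside : ∀ w ∈ curve p ∪ inside p, f₀ w ≠ 0
  analytic_outside : AnalyticOnNhd ℂ (fun w => fInf w / w) (curve p ∪ outside p)
  ne_zero_outside : ∀ w ∈ curve p ∪ outside p, fInf w / w ≠ 0
  normalized : (fun w => fInf w - w) =O[cobounded ℂ] fun _ => (1 : ℂ)
  factor : ∀ z ∈ sphere (0 : ℂ) 1, z = (f₀ (zeta p z))⁻¹ * fInf (zeta p z)

/-- The `tⁱ` are the coefficients in `log f₀(ζ) = -∑_{i ≥ 0} tⁱ ζⁱ` near `0` and
`log (f_∞(ζ) / ζ) = ∑_{i ≥ 1} t⁻ⁱ ζ⁻ⁱ` near `∞`. -/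
def IsFactorizationT (p : Model N M) (t : ℤ → ℂ) : Prop :=
  ∃ f₀ fInf : ℂ → ℂ, IsFactorization p f₀ fInf ∧
    (∀ᶠ w in 𝓝 (0 : ℂ), ∃ S : ℂ,
      HasSum (fun i : ℕ => t (i : ℤ) * w ^ i) S ∧ f₀ w = Complex.exp (-S)) ∧
    (∀ᶠ w in cobounded ℂ, ∃ S : ℂ,
      HasSum (fun i : ℕ => t (-((i : ℤ) + 1)) * (w ^ (i + 1))⁻¹) S ∧
        fInf w / w = Complex.exp S)

/-- `χ` is the branch of `l ^ (1/N)` near `∞` with `χ(z) ~ z`. -/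
def IsRootAtInfty (p : Model N M) (χ : ℂ → ℂ) : Prop :=
  (∀ᶠ z in cobounded ℂ, DifferentiableAt ℂ χ z ∧ χ z ^ N = lFun p z) ∧
    Tendsto (fun z => χ z / z) (cobounded ℂ) (𝓝 1)

/-- `χ` is a branch of `l ^ (1/M)` in a punctured neighbourhood of `0`. -/
def IsRootAtZero (p : Model N M) (χ : ℂ → ℂ) : Prop :=
  ∀ᶠ z in 𝓝[≠] (0 : ℂ), DifferentiableAt ℂ χ z ∧ χ z ^ M = lFun p z

/-- The `hʲ` are the coefficients in
`log z(χ) = log χ - (1/N) ∑_{1 ≤ j ≤ N-1} hʲ χ⁻ʲ + O(χ⁻ᴺ)`, where `z(χ)` is the inverse function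
of `χ = l ^ (1/N)` near `∞`. -/
def IsInverseH (p : Model N M) (h : ↥(Finset.Icc 1 (N - 1)) → ℂ) : Prop :=
  ∃ χ Z : ℂ → ℂ, IsRootAtInfty p χ ∧
    (∀ᶠ z in cobounded ℂ, Z (χ z) = z) ∧ (∀ᶠ w in cobounded ℂ, χ (Z w) = w) ∧
    Tendsto Z (cobounded ℂ) (cobounded ℂ) ∧
    (fun w => Complex.log (Z w / w) + (1 / N : ℂ) * ∑ j, h j * (w ^ (j : ℕ))⁻¹)
      =O[cobounded ℂ] fun w => (w ^ N)⁻¹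

/-- The `ĥᵏ` are the coefficients in
`log z(χ̂) = -log χ̂ + (1/M) ∑_{0 ≤ k ≤ M} ĥᵏ χ̂⁻ᵏ + O(χ̂⁻ᴹ⁻¹)`, where `z(χ̂)` is the inverse
function of a branch `χ̂ = l ^ (1/M)` near `0`; the equality is written in exponential form, so
that any branch of `log (z χ̂)` is allowed. -/
def IsInverseHHat (p : Model N M) (hHat : Fin (M + 1) → ℂ) : Prop :=
  ∃ χ Z R : ℂ → ℂ, IsRootAtZero p χ ∧
    (∀ᶠ z in 𝓝[≠] (0 : ℂ), Z (χ z) = z) ∧ (∀ᶠ w in cobounded ℂ, χ (Z w) = w) ∧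
    Tendsto Z (cobounded ℂ) (𝓝[≠] 0) ∧
    R =O[cobounded ℂ] (fun w => (w ^ (M + 1))⁻¹) ∧
    ∀ᶠ w in cobounded ℂ,
      Z w = w⁻¹ * Complex.exp ((1 / M : ℂ) * ∑ k, hHat k * (w ^ (k : ℕ))⁻¹ + R w)

/-- `u` is a value at `p` of the coordinates `t, h, ĥ`, as defined by the factorization of `z(ζ)`
and by the inverse functions of `l ^ (1/N)` and `l ^ (1/M)`.  The values depend on the choice of
branches of logarithms and roots, so this is a relation. -/
def IsCoord (p : Model N M) (u : Label N M → ℂ) : Prop :=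
  IsFactorizationT p (fun i => u (.t i)) ∧ IsInverseH p (fun j => u (.h j)) ∧
    IsInverseHHat p (fun k => u (.hHat k))

/-- `tⁱ = (2πi)⁻¹ ∮ (ζ⁻ⁱ / i) dz/z` for `i ≠ 0` and `t⁰ = (2πi)⁻¹ ∮ log (z/ζ) dz/z`, with
a continuous branch of `log (z/ζ)` on the unit circle. -/
def IsContourT (p : Model N M) (t : ℤ → ℂ) : Prop :=
  (∀ i : ℤ, i ≠ 0 → t i = unitContour fun z => zeta p z ^ (-i) / i / z) ∧
  ∃ L : ℂ → ℂ, ContinuousOn L (sphere 0 1) ∧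
    (∀ z ∈ sphere (0 : ℂ) 1, Complex.exp (L z) = z / zeta p z) ∧
    t 0 = unitContour fun z => L z / z

/-- `hʲ = -(N/j) res_∞ l ^ (j/N) dz/z`. -/
def IsResidueH (p : Model N M) (h : ↥(Finset.Icc 1 (N - 1)) → ℂ) : Prop :=
  ∃ χ : ℂ → ℂ, IsRootAtInfty p χ ∧
    ∀ j : ↥(Finset.Icc 1 (N - 1)), h j = -((N : ℂ) / (j : ℕ)) * resInfty fun z => χ z ^ (j : ℕ) / z

/-- `ĥ⁰ = log v̂_{-M}` and `ĥᵏ = (M/k) res_0 l ^ (k/M) dz/z` for `1 ≤ k ≤ M`.  The branch of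
`l ^ (1/M)` is the one with `l ^ (1/M) ~ exp (ĥ⁰ / M) z⁻¹`. -/
def IsResidueHHat (p : Model N M) (hHat : Fin (M + 1) → ℂ) : Prop :=
  Complex.exp (hHat 0) = coeffHat p (-(M : ℤ)) ∧
    ∃ χ : ℂ → ℂ, IsRootAtZero p χ ∧
      Tendsto (fun z => z * χ z) (𝓝[≠] 0) (𝓝 (Complex.exp (hHat 0 / M))) ∧
      ∀ k : Fin (M + 1), k ≠ 0 →
        hHat k = (M : ℂ) / (k : ℕ) * resZero fun z => χ z ^ (k : ℕ) / z

/-- `u` is a value at `p` of the coordinates `t, h, ĥ`, as given by the contour and residue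
formulas. -/
def IsFormulaCoord (p : Model N M) (u : Label N M → ℂ) : Prop :=
  IsContourT p (fun i => u (.t i)) ∧ IsResidueH p (fun j => u (.h j)) ∧
    IsResidueHHat p (fun k => u (.hHat k))

/-- The constant Gram matrix. -/
def gram : Label N M → Label N M → ℂ
  | .t i₁, .t i₂ => if i₁ + i₂ = -1 then -1 else 0
  | .h j₁, .h j₂ => if (j₁ : ℕ) + (j₂ : ℕ) = N then 1 / (N : ℂ) else 0
  | .hHat k₁, .hHat k₂ => if (k₁ : ℕ) + (k₂ : ℕ) = M then 1 / (M : ℂ) else 0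
  | _, _ => 0

/-! ### Coordinate vector fields and flat coordinates -/

/-- The weighted sup distance `sup ρ ^ |i| |pᵢ - qᵢ|` is at most `ε`. -/
def Near (ρ ε : ℝ) (p q : Model N M) : Prop :=
  ∀ i : ℤ, ‖coeff p i - coeff q i‖ ≤ ε * ρ ^ (-|i|) ∧
    ‖coeffHat p i - coeffHat q i‖ ≤ ε * ρ ^ (-|i|)

/-- `X` is the complex derivative at `s = 0` of the curve `γ`, with respect to one of the
weighted sup norms whose union is the model space. -/
def HasVelocity (γ : ℂ → Model N M) (X : Model N M) : Prop :=
  ∃ ρ : ℝ, 1 < ρ ∧ ∀ ε : ℝ, 0 < ε → ∀ᶠ s in 𝓝 (0 : ℂ), Near ρ (ε * ‖s‖) (γ s) (γ 0 + s • X)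

/-- `X` is the coordinate vector `∂/∂u^α` at the point `p` with coordinates `u`: the velocity of
a curve in `𝓜_{N,M}` through `p` along which the coordinate `u^α` is `u^α + s` and all other
coordinates are fixed. -/
def IsCoordVector (p : Model N M) (u : Label N M → ℂ) (α : Label N M) (X : Model N M) : Prop :=
  ∃ γ : ℂ → Model N M, γ 0 = p ∧
    (∀ᶠ s in 𝓝 (0 : ℂ), γ s ∈ manifold N M ∧ IsCoord (γ s) (Function.update u α (u α + s))) ∧
    HasVelocity γ X

end Coordinates

/-- The functions `t, h, ĥ` are flat coordinates for `⟨ , ⟩` on `𝓜_{N,M}`: they are local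
coordinates (they exist everywhere and separate nearby points, the coordinate vectors exist, are
unique, and are total for the bilinear form), and the components of the bilinear form in them are
constant. -/
structure IsFlatCoordinateSystem (N M : ℕ) : Prop where
  exists_coord : ∀ p ∈ manifold N M, ∃ u, IsCoord p u
  separates : ∀ p ∈ manifold N M, ∀ ρ : ℝ, 1 < ρ → ∃ ε : ℝ, 0 < ε ∧
    ∀ q ∈ manifold N M, ∀ q' ∈ manifold N M, Near ρ ε q p → Near ρ ε q' p →
      ∀ u, IsCoord q u → IsCoord q' u → q = q'
  coordVector : ∀ p ∈ manifold N M, ∀ u, IsCoord p u → ∀ α, ∃! X, IsCoordVector p u α X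
  total : ∀ p ∈ manifold N M, ∀ u, IsCoord p u → ∀ X,
    (∀ α Y, IsCoordVector p u α Y → metric p X Y = 0) → X = 0
  constant : ∃ G : Label N M → Label N M → ℂ, ∀ p ∈ manifold N M, ∀ u, IsCoord p u →
    ∀ α β X Y, IsCoordVector p u α X → IsCoordVector p u β Y → metric p X Y = G α β

end TodaFrobenius

end

/-! A point, or a tangent vector, is the same thing as a pair (ζ, l): the coefficients of a and â
are recovered from those of ζ = a - â and of the Laurent polynomial l (`exists_model`, `model_ext`).
The bilinear form is the sum of a term in ζ and two residues in l. The tⁱ depend only on ζ, the hʲ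
and ĥᵏ only on the behaviour of l at its two poles.

For the tⁱ put L = log (z / ζ(z)), which is single-valued near the circle because ζ winds once
around 0. The conditions on the circle make ζ univalent on an annulus. The Cauchy transforms of L dζ
over a slightly larger and a slightly smaller circle are then holomorphic on the closed inside and
the closed outside of Γ, and on Γ they differ by L (`Univalent.circleIntegral_sub`). Their
exponentials give the factorization of z(ζ). Their coefficients at 0 and ∞ are the integrals of L
ζ^(-i-1) dζ, which integration by parts turns into the contour formulas (`Loop.contour_log`).
Uniqueness of the factorization is Liouville's theorem (`Loop.eq_const_of_glue`).

At a pole of order n, in the local coordinate u = z or u = 1/z, write l = P(u)/uⁿ = χⁿ with Λ = log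
P. The coefficients of Λ in powers of χ⁻¹ describe the inverse function of χ, and Lagrange inversion
(`IsLog.lagrange`) expresses them as residues. A `Chart` records one choice of all branches.
Different choices change t⁰ and ĥ⁰ by multiples of 2πi and multiply the other ĥᵏ by roots of unity.

The Gram matrix comes from a duality. The derivative of tⁱ along X is -(2πi)⁻¹ ∮ ζ^(-i-1) ∂ζ dz/z,
and at a pole the derivatives are the integrals of χ^k (∂l / l) du/u. The powers of ζ are total
(`Loop.eq_zero_of_orthogonal`), and a count of orders of vanishing shows that the derivatives at the
poles determine ∂l; hence a vector with all coordinate derivatives zero is zero. A vector dual to tⁱ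
must have ∂ζ = -z ζ' ζⁱ, so its pairing with X is minus the derivative of t^(-i-1) along X. At a
pole the residue is a convolution of coordinate derivatives (`IsLog.resZero_pairing`). Thus pairing
with a coordinate vector reads off the derivative in one dual coordinate, up to a nonzero constant
(`Chart.metric_of_dCoord`). Constancy of the components and nondegeneracy follow.

Coordinate vectors exist for two different reasons. For tⁱ there is an explicit curve: let Ψ be
inverse to y ↦ y exp(s ζ(y)ⁱ), replace ζ by ζ ∘ Ψ and keep l. Then the new logarithm is (L + s ζⁱ) ∘
Ψ, and a change of variables shows that exactly tⁱ grows, by s. For hʲ and ĥᵏ the inverse function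
theorem is applied to the N + M coefficients of l with ζ fixed.

To separate points, compare two nearby loops with the same tⁱ. Their Cauchy transforms of dz/z
agree, so the map z ↦ y matching equal values satisfies dy/y = dz/z, that is y = c z, and t⁰ forces
c = 1. Once ζ is known, strict differentiability of the pole coordinates in the coefficients of l
finishes the argument. -/

namespace TodaFrobenius

/-! ### Holomorphic functions on annuli and Laurent series with geometric decay -/

/-- The open annulus `σ⁻¹ < |z| < σ`. -/
def annulus (σ : ℝ) : Set ℂ := {z | σ⁻¹ < ‖z‖ ∧ ‖z‖ < σ}

theorem isOpen_annulus (σ : ℝ) : IsOpen (annulus σ) :=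
  (isOpen_lt continuous_const continuous_norm).inter (isOpen_lt continuous_norm continuous_const)

theorem ne_zero_of_mem_annulus {σ : ℝ} (hσ : 1 < σ) {z : ℂ} (hz : z ∈ annulus σ) : z ≠ 0 := by
  rintro rfl
  have := hz.1
  rw [norm_zero] at this
  have : 0 < σ⁻¹ := by positivity
  linarith

theorem annulus_mono {σ τ : ℝ} (hσ : 0 < σ) (h : σ ≤ τ) : annulus σ ⊆ annulus τ := fun _ hz =>
  ⟨lt_of_le_of_lt (inv_anti₀ hσ h) hz.1, lt_of_lt_of_le hz.2 h⟩

theorem sphere_subset_annulus {σ r : ℝ} (h1 : σ⁻¹ < r) (h2 : r < σ) :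
    sphere (0 : ℂ) r ⊆ annulus σ := by
  intro z hz
  rw [mem_sphere_zero_iff_norm] at hz
  exact ⟨hz ▸ h1, hz ▸ h2⟩

theorem unit_sphere_subset_annulus {σ : ℝ} (h : 1 < σ) : sphere (0 : ℂ) 1 ⊆ annulus σ :=
  sphere_subset_annulus (inv_lt_one_of_one_lt₀ h) h

/-- The exponential maps the convex strip log a < Re w < log b onto this set; for b ≤ 0 the set is
empty. -/
theorem isPreconnected_norm_between {a b : ℝ} (ha : 0 < a) :
    IsPreconnected {z : ℂ | a < ‖z‖ ∧ ‖z‖ < b} := by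
  rcases le_or_gt b 0 with hb | hb
  · convert isPreconnected_empty
    ext z
    simp only [Set.mem_ofPred_eq, Set.mem_empty_iff_false, iff_false, not_and, not_lt]
    intro _
    exact hb.trans (norm_nonneg z)
  have hset : {z : ℂ | a < ‖z‖ ∧ ‖z‖ < b} = 
      Complex.exp '' {w | Real.log a < w.re ∧ w.re < Real.log b} := by
    ext z
    constructor
    · rintro ⟨h1, h2⟩
      have hz : z ≠ 0 := by
        rintro rfl
        simp at h1; linarith
      have hz' : 0 < ‖z‖ := norm_pos_iff.2 hz
      refine ⟨Complex.log z, ⟨?_, ?_⟩, Complex.exp_log hz⟩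
      · rw [Complex.log_re]; exact Real.log_lt_log ha h1
      · rw [Complex.log_re]; exact Real.log_lt_log hz' h2
    · rintro ⟨w, ⟨h1, h2⟩, rfl⟩
      simp only [Set.mem_ofPred_eq, Complex.norm_exp]
      exact ⟨(Real.log_lt_iff_lt_exp ha).1 h1, (Real.lt_log_iff_exp_lt hb).1 h2⟩
  rw [hset]
  refine IsPreconnected.image ?_ _ Complex.continuous_exp.continuousOn
  have : Convex ℝ {w : ℂ | Real.log a < w.re ∧ w.re < Real.log b} :=
    (convex_halfSpace_re_gt _).inter (convex_halfSpace_re_lt _)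
  exact this.isPreconnected

theorem norm_zpow_le {τ : ℝ} (hτ : 1 ≤ τ) {z : ℂ} (h1 : τ⁻¹ ≤ ‖z‖) (h2 : ‖z‖ ≤ τ) (i : ℤ) :
    ‖z ^ i‖ ≤ τ ^ |i| := by
  have hτ0 : 0 < τ := by linarith
  rw [norm_zpow]
  rcases le_total 0 i with h | h
  · rw [abs_of_nonneg h]
    exact zpow_le_zpow_left₀ h (norm_nonneg _) h2
  · rw [abs_of_nonpos h, ← inv_inv (‖z‖), inv_zpow, ← zpow_neg]
    refine zpow_le_zpow_left₀ (by omega) (by positivity) ?_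
    exact inv_le_of_inv_le₀ hτ0 h1

theorem summable_int_abs {f : ℕ → ℝ} (hf : Summable f) : Summable fun i : ℤ => f i.natAbs := by
  refine Summable.of_nat_of_neg_add_one (f := fun i : ℤ => f i.natAbs) (by simpa using hf) ?_
  have := (summable_nat_add_iff 1).2 hf
  refine this.congr fun n => ?_
  congr 1

/-- The geometric decay condition on Laurent coefficients. -/
def Decay (ρ C : ℝ) (X : ℤ → ℂ) : Prop := ∀ i : ℤ, ‖X i‖ ≤ C * ρ ^ (-|i|)

theorem Decay.nonneg {ρ C : ℝ} {X : ℤ → ℂ} (h : Decay ρ C X) : 0 ≤ C := by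
  have := (norm_nonneg _).trans (h 0)
  simpa using this

theorem zpow_neg_abs_mul {ρ τ : ℝ} (i : ℤ) :
    ρ ^ (-|i|) * τ ^ |i| = (τ / ρ) ^ i.natAbs := by
  have : |i| = (i.natAbs : ℤ) := (Int.natCast_natAbs i).symm
  rw [this, zpow_neg, zpow_natCast, zpow_natCast, div_pow]
  ring

theorem Decay.mono {ρ ρ' C : ℝ} {X : ℤ → ℂ} (h : Decay ρ C X) (h0 : 0 < ρ') (hρ : ρ' ≤ ρ) :
    Decay ρ' C X := fun i => by
  refine (h i).trans (mul_le_mul_of_nonneg_left ?_ h.nonneg)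
  have : |i| = (i.natAbs : ℤ) := (Int.natCast_natAbs i).symm
  rw [this, zpow_neg, zpow_neg, zpow_natCast, zpow_natCast]
  gcongr

theorem Decay.mem {ρ C : ℝ} {X : ℤ → ℂ} (hρ : 1 < ρ) (h : Decay ρ C X) : X ∈ analyticLaurent :=
  ⟨ρ, hρ, C, h⟩

/-- The constant `∑ (1 + |i|) (τ / ρ) ^ |i| τ`. -/
noncomputable def lipConst (ρ τ : ℝ) : ℝ := ∑' i : ℤ, (1 + (i.natAbs : ℝ)) * (τ / ρ) ^ i.natAbs * τ

theorem summable_lipConst {ρ τ : ℝ} (hτ : 0 < τ) (h : τ < ρ) :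
    Summable fun i : ℤ => (1 + (i.natAbs : ℝ)) * (τ / ρ) ^ i.natAbs * τ := by
  refine Summable.mul_right _ (summable_int_abs (f := fun n => (1 + (n : ℝ)) * (τ / ρ) ^ n) ?_)
  have hq : ‖τ / ρ‖ < 1 := by
    rw [Real.norm_of_nonneg (div_nonneg hτ.le (by linarith))]
    exact (div_lt_one (by linarith)).2 h
  have h1 := summable_geometric_of_norm_lt_one hq
  have h2 := summable_pow_mul_geometric_of_norm_lt_one 1 hq
  refine (h1.add h2).congr fun n => ?_
  simp; ring

theorem lipConst_pos {ρ τ : ℝ} (hτ : 0 < τ) (h : τ < ρ) : 0 < lipConst ρ τ := by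
  have hρ : 0 < ρ := by linarith
  have hq : 0 < τ / ρ := by positivity
  refine (summable_lipConst hτ h).tsum_pos (fun i => ?_) 0 (by simpa using hτ)
  have := pow_pos hq i.natAbs
  positivity

theorem Decay.norm_term_le {ρ C τ : ℝ} {X : ℤ → ℂ} (h : Decay ρ C X) (hτ : 1 ≤ τ) {z : ℂ}
    (h1 : τ⁻¹ ≤ ‖z‖) (h2 : ‖z‖ ≤ τ) (i : ℤ) : ‖X i * z ^ i‖ ≤ C * (τ / ρ) ^ i.natAbs := by
  rw [norm_mul]
  calc ‖X i‖ * ‖z ^ i‖ ≤ (C * ρ ^ (-|i|)) * τ ^ |i| :=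
        mul_le_mul (h i) (norm_zpow_le hτ h1 h2 i) (norm_nonneg _) ((norm_nonneg _).trans (h i))
    _ = C * (τ / ρ) ^ i.natAbs := by rw [mul_assoc, zpow_neg_abs_mul]

/-- The extra factors are at least 1. They are there so that the single constant `lipConst` bounds
the values, the Lipschitz constants and the derivatives of Laurent sums. -/
theorem Decay.norm_term_le' {ρ C τ : ℝ} {X : ℤ → ℂ} (h : Decay ρ C X) (hρ : 0 < ρ) (hτ : 1 ≤ τ) {z : ℂ}
    (h1 : τ⁻¹ ≤ ‖z‖) (h2 : ‖z‖ ≤ τ) (i : ℤ) :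
    ‖X i * z ^ i‖ ≤ C * ((1 + (i.natAbs : ℝ)) * (τ / ρ) ^ i.natAbs * τ) := by
  refine (h.norm_term_le hτ h1 h2 i).trans (mul_le_mul_of_nonneg_left ?_ h.nonneg)
  have : 0 ≤ (τ / ρ) ^ i.natAbs := by positivity
  have h3 : (1 : ℝ) ≤ (1 + (i.natAbs : ℝ)) := by simp
  nlinarith [mul_nonneg this (sub_nonneg.2 h3), mul_nonneg (mul_nonneg this (by linarith : (0:ℝ) ≤ (1 + (i.natAbs : ℝ)))) (sub_nonneg.2 hτ)]

theorem Decay.summable {ρ C τ : ℝ} {X : ℤ → ℂ} (h : Decay ρ C X) (hτ : 1 ≤ τ) (hρ : τ < ρ) {z : ℂ}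
    (h1 : τ⁻¹ ≤ ‖z‖) (h2 : ‖z‖ ≤ τ) : Summable fun i => X i * z ^ i :=
  .of_norm_bounded ((summable_lipConst (by linarith) hρ).mul_left C)
    (h.norm_term_le' (by linarith) hτ h1 h2)

theorem exists_between_of_mem_annulus {ρ : ℝ} (hρ : 1 < ρ) {z : ℂ} (hz : z ∈ annulus ρ) :
    ∃ τ, 1 < τ ∧ τ < ρ ∧ z ∈ annulus τ := by
  have h0 : 0 < ‖z‖ := norm_pos_iff.2 (ne_zero_of_mem_annulus hρ hz)
  obtain ⟨τ, h1, h2⟩ := exists_between (max_lt (max_lt hz.2 (inv_lt_of_inv_lt₀ (by linarith) hz.1)) hρ)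
  rw [max_lt_iff, max_lt_iff] at h1
  exact ⟨τ, h1.2, h2, inv_lt_of_inv_lt₀ h0 h1.1.2, h1.1.1⟩

theorem Decay.hasSum {ρ C : ℝ} {X : ℤ → ℂ} (hρ : 1 < ρ) (h : Decay ρ C X) {z : ℂ}
    (hz : z ∈ annulus ρ) : HasSum (fun i => X i * z ^ i) (laurentSum X z) := by
  obtain ⟨τ, h1, h2, h3⟩ := exists_between_of_mem_annulus hρ hz
  exact (h.summable h1.le h2 h3.1.le h3.2.le).hasSum

theorem Decay.norm_laurentSum_le {ρ C τ : ℝ} {X : ℤ → ℂ} (h : Decay ρ C X) (hτ : 1 ≤ τ)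
    (hρ : τ < ρ) {z : ℂ} (h1 : τ⁻¹ ≤ ‖z‖) (h2 : ‖z‖ ≤ τ) :
    ‖laurentSum X z‖ ≤ C * lipConst ρ τ := by
  have hs := summable_lipConst (by linarith : 0 < τ) hρ
  rw [lipConst, ← tsum_mul_left]
  exact tsum_of_norm_bounded (hs.mul_left C).hasSum (h.norm_term_le' (by linarith) hτ h1 h2)

theorem norm_zpow_sub_zpow_le {τ : ℝ} (hτ : 1 ≤ τ) {z y : ℂ} (hz1 : τ⁻¹ ≤ ‖z‖) (hz2 : ‖z‖ ≤ τ)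
    (hy1 : τ⁻¹ ≤ ‖y‖) (hy2 : ‖y‖ ≤ τ) (i : ℤ) :
    ‖z ^ i - y ^ i‖ ≤ i.natAbs * τ ^ |i| * τ * ‖z - y‖ := by
  have hτ0 : 0 < τ := by linarith
  -- The factor τ on the left replaces τ^(n-1) by τ^n on the right and keeps the induction free of
  -- truncated subtraction. Since τ ≥ 1 it is dropped for i ≥ 0; for i ≤ 0 it cancels one factor of
  -- the bound τ² ‖z - y‖ for ‖z⁻¹ - y⁻¹‖.
  have key : ∀ (n : ℕ) (a b : ℂ), ‖a‖ ≤ τ → ‖b‖ ≤ τ → ‖a ^ n - b ^ n‖ * τ ≤ n * τ ^ n * ‖a - b‖ := by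
    intro n a b ha hb
    induction n with
    | zero => simp
    | succ n ih =>
      have : a ^ (n + 1) - b ^ (n + 1) = a * (a ^ n - b ^ n) + (a - b) * b ^ n := by ring
      rw [this]
      have hb' : ‖b ^ n‖ ≤ τ ^ n := by rw [norm_pow]; exact pow_le_pow_left₀ (norm_nonneg _) hb n
      calc ‖a * (a ^ n - b ^ n) + (a - b) * b ^ n‖ * τ
          ≤ (‖a‖ * ‖a ^ n - b ^ n‖ + ‖a - b‖ * ‖b ^ n‖) * τ := by
            gcongr; refine (norm_add_le _ _).trans ?_; rw [norm_mul, norm_mul]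
        _ = ‖a‖ * (‖a ^ n - b ^ n‖ * τ) + ‖a - b‖ * ‖b ^ n‖ * τ := by ring
        _ ≤ τ * (n * τ ^ n * ‖a - b‖) + ‖a - b‖ * τ ^ n * τ := by gcongr
        _ = _ := by push_cast; ring
  have hmul : ∀ {x : ℝ}, 0 ≤ x → x ≤ x * τ := fun hx => le_mul_of_one_le_right hx hτ
  rcases le_total 0 i with h | h
  · obtain ⟨n, rfl⟩ := Int.eq_ofNat_of_zero_le h
    simp only [zpow_natCast, Int.natAbs_natCast, Nat.abs_cast]
    have := key n z y hz2 hy2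
    have h0 := hmul (norm_nonneg (z ^ n - y ^ n))
    have h1 : 0 ≤ n * τ ^ n * ‖z - y‖ := by positivity
    have h2 := hmul h1
    calc _ ≤ _ := h0
      _ ≤ _ := this
      _ ≤ _ := h2
      _ = _ := by ring
  · obtain ⟨n, hn⟩ := Int.eq_ofNat_of_zero_le (neg_nonneg.2 h)
    obtain rfl : i = -n := by omega
    have hz0 : 0 < ‖z‖ := lt_of_lt_of_le (by positivity) hz1
    have hy0 : 0 < ‖y‖ := lt_of_lt_of_le (by positivity) hy1
    have hz3 : ‖z⁻¹‖ ≤ τ := by rw [norm_inv]; exact inv_le_of_inv_le₀ hτ0 hz1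
    have hy3 : ‖y⁻¹‖ ≤ τ := by rw [norm_inv]; exact inv_le_of_inv_le₀ hτ0 hy1
    simp only [zpow_neg, zpow_natCast, Int.natAbs_neg, Int.natAbs_natCast, abs_neg, Nat.abs_cast,
      ← inv_pow]
    have := key n z⁻¹ y⁻¹ hz3 hy3
    have h4 : ‖z⁻¹ - y⁻¹‖ ≤ τ * τ * ‖z - y‖ := by
      have : z⁻¹ - y⁻¹ = z⁻¹ * y⁻¹ * (y - z) := by
        have := norm_pos_iff.1 hz0
        have := norm_pos_iff.1 hy0
        field_simp
      rw [this, norm_mul, norm_mul, norm_sub_rev y z]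
      gcongr
    refine le_of_mul_le_mul_right (this.trans ?_) hτ0
    calc (n : ℝ) * τ ^ n * ‖z⁻¹ - y⁻¹‖ ≤ n * τ ^ n * (τ * τ * ‖z - y‖) := by gcongr
      _ = _ := by ring

/-- Comparing the series term by term gives a Lipschitz bound on the whole closed annulus, which is
not convex, so that the mean value inequality does not apply directly. -/
theorem Decay.norm_laurentSum_sub_le {ρ C τ : ℝ} {X : ℤ → ℂ} (h : Decay ρ C X) (hτ : 1 ≤ τ)
    (hρ : τ < ρ) {z y : ℂ} (hz1 : τ⁻¹ ≤ ‖z‖) (hz2 : ‖z‖ ≤ τ) (hy1 : τ⁻¹ ≤ ‖y‖) (hy2 : ‖y‖ ≤ τ) :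
    ‖laurentSum X z - laurentSum X y‖ ≤ C * lipConst ρ τ * ‖z - y‖ := by
  have hs := summable_lipConst (by linarith : 0 < τ) hρ
  have hρ0 : 0 < ρ := by linarith
  rw [laurentSum, laurentSum, ← (h.summable hτ hρ hz1 hz2).tsum_sub (h.summable hτ hρ hy1 hy2),
    lipConst, ← tsum_mul_left, ← tsum_mul_right]
  refine tsum_of_norm_bounded ((hs.mul_left C).mul_right _).hasSum fun i => ?_
  rw [← mul_sub, norm_mul]
  calc ‖X i‖ * ‖z ^ i - y ^ i‖ ≤ (C * ρ ^ (-|i|)) * (i.natAbs * τ ^ |i| * τ * ‖z - y‖) :=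
        mul_le_mul (h i) (norm_zpow_sub_zpow_le hτ hz1 hz2 hy1 hy2 i) (norm_nonneg _)
          ((norm_nonneg _).trans (h i))
    _ = C * (i.natAbs * (ρ ^ (-|i|) * τ ^ |i|) * τ) * ‖z - y‖ := by ring
    _ ≤ _ := by
      rw [zpow_neg_abs_mul]
      have := h.nonneg
      gcongr
      linarith

theorem Decay.differentiableOn {ρ C : ℝ} {X : ℤ → ℂ} (hρ : 1 < ρ) (h : Decay ρ C X) :
    DifferentiableOn ℂ (laurentSum X) (annulus ρ) := by
  intro z hz
  obtain ⟨τ, h1, h2, h3⟩ := exists_between_of_mem_annulus hρ hz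
  have := Complex.differentiableOn_tsum_of_summable_norm (F := fun (i : ℤ) z => X i * z ^ i)
    ((summable_lipConst (by linarith : 0 < τ) h2).mul_left C)
    (fun i w hw => ((differentiableAt_zpow.2
      (.inl (ne_zero_of_mem_annulus h1 hw))).const_mul _).differentiableWithinAt)
    (isOpen_annulus τ) (fun i w hw => h.norm_term_le' (by linarith) h1.le hw.1.le hw.2.le i)
  exact (this.differentiableAt ((isOpen_annulus τ).mem_nhds h3)).differentiableWithinAt

theorem Decay.hasDerivAt {ρ C : ℝ} {X : ℤ → ℂ} (hρ : 1 < ρ) (h : Decay ρ C X) {z : ℂ}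
    (hz : z ∈ annulus ρ) : HasSum (fun i : ℤ => X i * (i * z ^ (i - 1))) (deriv (laurentSum X) z) := by
  obtain ⟨τ, h1, h2, h3⟩ := exists_between_of_mem_annulus hρ hz
  have := Complex.hasSum_deriv_of_summable_norm (F := fun (i : ℤ) z => X i * z ^ i)
    ((summable_lipConst (by linarith : 0 < τ) h2).mul_left C)
    (fun i w hw => ((differentiableAt_zpow.2
      (.inl (ne_zero_of_mem_annulus h1 hw))).const_mul _).differentiableWithinAt)
    (isOpen_annulus τ) (fun i w hw => h.norm_term_le' (by linarith) h1.le hw.1.le hw.2.le i) h3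
  have e : (fun i : ℤ => X i * (i * z ^ (i - 1))) = fun i => deriv (fun z => X i * z ^ i) z := by
    funext i
    rw [deriv_const_mul _ (differentiableAt_zpow.2 (.inl (ne_zero_of_mem_annulus hρ hz))),
      deriv_zpow]
  rw [e]
  exact this

theorem isPreconnected_annulus {σ : ℝ} (hσ : 1 < σ) : IsPreconnected (annulus σ) :=
  isPreconnected_norm_between (by positivity)

/-! ### Contour integrals in an annulus -/

theorem circleIntegral_eq_of_annulus {σ a b : ℝ} (hσ : 1 < σ) {f : ℂ → ℂ}
    (hf : DifferentiableOn ℂ f (annulus σ)) (ha : σ⁻¹ < a) (ha' : a < σ) (hb : σ⁻¹ < b)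
    (hb' : b < σ) : (∮ z in C(0, a), f z) = ∮ z in C(0, b), f z := by
  have key : ∀ {a b : ℝ}, σ⁻¹ < a → a ≤ b → b < σ →
      (∮ z in C(0, b), f z) = ∮ z in C(0, a), f z := by
    intro a b ha hab hb
    have ha0 : 0 < a := lt_trans (by positivity) ha
    have hsub : closedBall (0 : ℂ) b \ ball 0 a ⊆ annulus σ := by
      rintro z ⟨h1, h2⟩
      rw [mem_closedBall_zero_iff] at h1
      rw [mem_ball_zero_iff, not_lt] at h2
      exact ⟨ha.trans_le h2, h1.trans_lt hb⟩
    refine Complex.circleIntegral_eq_of_differentiable_on_annulus_off_countable ha0 hab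
      Set.countable_empty (hf.continuousOn.mono hsub) fun z hz => ?_
    refine hf.differentiableAt ((isOpen_annulus σ).mem_nhds (hsub ⟨?_, ?_⟩))
    · exact ball_subset_closedBall hz.1.1
    · exact fun h => hz.1.2 (ball_subset_closedBall h)
  rcases le_total a b with h | h
  · exact (key ha h hb').symm
  · exact key hb h ha'

theorem unitContour_eq_of_annulus {σ a : ℝ} (hσ : 1 < σ) {f : ℂ → ℂ}
    (hf : DifferentiableOn ℂ f (annulus σ)) (ha : σ⁻¹ < a) (ha' : a < σ) :
    unitContour f = (2 * π * Complex.I)⁻¹ * ∮ z in C(0, a), f z := by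
  rw [unitContour, circleIntegral_eq_of_annulus hσ hf (inv_lt_one_of_one_lt₀ hσ) hσ ha ha']

theorem unitContour_congr {f g : ℂ → ℂ} (h : Set.EqOn f g (sphere 0 1)) :
    unitContour f = unitContour g := by
  rw [unitContour, unitContour, circleIntegral.integral_congr zero_le_one h]

theorem hasSum_circleIntegral {ι : Type*} [Countable ι] {r : ℝ} (hr : 0 ≤ r) {F : ι → ℂ → ℂ}
    {f : ℂ → ℂ} {u : ι → ℝ} (hF : ∀ i, ContinuousOn (F i) (sphere 0 r)) (hu : Summable u)
    (hle : ∀ i, ∀ z ∈ sphere (0 : ℂ) r, ‖F i z‖ ≤ u i)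
    (hs : ∀ z ∈ sphere (0 : ℂ) r, HasSum (fun i => F i z) (f z)) :
    HasSum (fun i => ∮ z in C(0, r), F i z) (∮ z in C(0, r), f z) := by
  have hmem : ∀ θ, circleMap 0 r θ ∈ sphere (0 : ℂ) r := circleMap_mem_sphere 0 hr
  refine intervalIntegral.hasSum_integral_of_dominated_convergence (fun i _ => r * u i)
    (fun i => ?_) (fun i => ?_) ?_ ?_ ?_
  · have h1 : Continuous (deriv (circleMap 0 r)) := by
      simp only [funext (deriv_circleMap 0 r)]
      fun_prop
    exact (h1.smul ((hF i).comp_continuous (continuous_circleMap 0 r) hmem)).aestronglyMeasurable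
  · refine .of_forall fun θ _ => ?_
    rw [norm_smul, deriv_circleMap, norm_mul, Complex.norm_I, norm_circleMap_zero, mul_one,
      abs_of_nonneg hr]
    exact mul_le_mul_of_nonneg_left (hle i _ (hmem θ)) hr
  · exact .of_forall fun θ _ => hu.mul_left r
  · exact intervalIntegrable_const
  · exact .of_forall fun θ _ => (hs _ (hmem θ)).const_smul _

theorem HasSum.of_eq {ι : Type*} {F G : ι → ℂ} {a b : ℂ} (h : HasSum F a) (hF : ∀ i, G i = F i)
    (hb : b = a) : HasSum G b := by
  rw [hb, funext hF]
  exact h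

theorem circleIntegral_zpow {r : ℝ} (hr : 0 < r) (i : ℤ) :
    (∮ z in C(0, r), z ^ i) = if i = -1 then 2 * π * Complex.I else 0 := by
  split_ifs with h
  · subst h
    simpa using circleIntegral.integral_sub_center_inv 0 hr.ne'
  · simpa using circleIntegral.integral_sub_zpow_of_ne h 0 0 r

theorem laurentSum_coeff {X : ℤ → ℂ} {r : ℝ} (hr : 0 < r) (hX : Summable fun i => ‖X i‖ * r ^ i)
    (i : ℤ) : (∮ z in C(0, r), laurentSum X z * z ^ (-i - 1)) = 2 * π * Complex.I * X i := by
  have h0 : ∀ z ∈ sphere (0 : ℂ) r, z ≠ 0 := fun z hz => by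
    rintro rfl
    simp at hz
    exact hr.ne hz
  have hn : ∀ (j : ℤ), ∀ z ∈ sphere (0 : ℂ) r, ‖X j * z ^ j‖ = ‖X j‖ * r ^ j := fun j z hz => by
    rw [norm_mul, norm_zpow, mem_sphere_zero_iff_norm.1 hz]
  have := hasSum_circleIntegral hr.le (F := fun j z => X j * z ^ j * z ^ (-i - 1))
    (f := fun z => laurentSum X z * z ^ (-i - 1)) (u := fun j => ‖X j‖ * r ^ j * r ^ (-i - 1))
    (fun j => ?_) (hX.mul_right _) (fun j z hz => ?_) (fun z hz => ?_)
  · refine this.unique ?_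
    have h1 : ∀ j : ℤ, (∮ z in C(0, r), X j * z ^ j * z ^ (-i - 1))
        = if j = i then 2 * π * Complex.I * X i else 0 := by
      intro j
      have : (∮ z in C(0, r), X j * z ^ j * z ^ (-i - 1)) = ∮ z in C(0, r), X j * z ^ (j - i - 1) := by
        refine circleIntegral.integral_congr hr.le fun z hz => ?_
        rw [mul_assoc, ← zpow_add₀ (h0 z hz)]
        congr 2
        ring
      rw [this, circleIntegral.integral_const_mul, circleIntegral_zpow hr]
      by_cases h : j = i
      · subst h; simp; ring
      · rw [if_neg (by omega), if_neg h, mul_zero]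
    simp_rw [h1]
    exact hasSum_ite_eq i _
  · refine ContinuousOn.mul (continuousOn_const.mul ?_) ?_ <;>
    exact fun z hz => (continuousAt_zpow₀ z _ (.inl (h0 z hz))).continuousWithinAt
  · rw [norm_mul, hn j z hz, norm_zpow, mem_sphere_zero_iff_norm.1 hz]
  · have : Summable fun j => X j * z ^ j := .of_norm (hX.congr fun j => (hn j z hz).symm)
    exact this.hasSum.mul_right _

theorem Decay.coeff_eq {ρ C : ℝ} {X : ℤ → ℂ} (hρ : 1 < ρ) (h : Decay ρ C X) (i : ℤ) :
    unitContour (fun z => laurentSum X z * z ^ (-i - 1)) = X i := by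
  have : Summable fun i => ‖X i‖ * (1 : ℝ) ^ i := by
    obtain ⟨τ, h1, h2⟩ := exists_between hρ
    refine .of_nonneg_of_le (fun i => by positivity) (fun i => ?_)
      ((summable_lipConst (by linarith) h2).mul_left C)
    have := h.norm_term_le' (τ := τ) (z := 1) (by linarith) h1.le
      (by simpa using (inv_lt_one_of_one_lt₀ h1).le) (by simpa using h1.le) i
    simpa using this
  rw [unitContour, laurentSum_coeff one_pos this, ← mul_assoc, inv_mul_cancel₀, one_mul]
  simp [Real.pi_ne_zero]

/-- The Laurent coefficients of a function on the unit circle. -/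
noncomputable def laurentCoeff (f : ℂ → ℂ) (i : ℤ) : ℂ := unitContour fun z => f z * z ^ (-i - 1)

theorem differentiableOn_zpow_annulus {σ : ℝ} (hσ : 1 < σ) (i : ℤ) :
    DifferentiableOn ℂ (fun z : ℂ => z ^ i) (annulus σ) := fun _ hz =>
  (differentiableAt_zpow.2 (.inl (ne_zero_of_mem_annulus hσ hz))).differentiableWithinAt

theorem norm_two_pi_I_inv_mul_le {r C : ℝ} {f : ℂ → ℂ} (hr : 0 ≤ r)
    (h : ∀ z ∈ sphere (0 : ℂ) r, ‖f z‖ ≤ C) :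
    ‖(2 * π * Complex.I)⁻¹ * ∮ z in C(0, r), f z‖ ≤ r * C := by
  simpa using circleIntegral.norm_two_pi_i_inv_smul_integral_le_of_norm_le_const hr h

/-- Coefficients of index i ≥ 0 are computed on the circle of radius τ, those of index i ≤ 0 on the
circle of radius τ⁻¹. The constant is the sup bound C itself; this later converts sup estimates on
an annulus into the weighted norms of `Near`. -/
theorem decay_laurentCoeff {σ τ C : ℝ} (hτ : 1 < τ) (hτσ : τ < σ) {f : ℂ → ℂ}
    (hf : DifferentiableOn ℂ f (annulus σ)) (h1 : ∀ z ∈ sphere (0 : ℂ) τ, ‖f z‖ ≤ C)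
    (h2 : ∀ z ∈ sphere (0 : ℂ) τ⁻¹, ‖f z‖ ≤ C) : Decay τ C (laurentCoeff f) := by
  have hσ : 1 < σ := hτ.trans hτσ
  have hτ0 : 0 < τ := by linarith
  have hinv : σ⁻¹ < τ⁻¹ := inv_strictAnti₀ hτ0 hτσ
  have hinv1 : τ⁻¹ < 1 := inv_lt_one_of_one_lt₀ hτ
  intro i
  have hd : DifferentiableOn ℂ (fun z => f z * z ^ (-i - 1)) (annulus σ) :=
    hf.mul (differentiableOn_zpow_annulus hσ _)
  rcases le_total 0 i with h | h
  · rw [laurentCoeff, unitContour_eq_of_annulus hσ hd (a := τ) (by linarith) hτσ, abs_of_nonneg h]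
    refine (norm_two_pi_I_inv_mul_le hτ0.le (C := C * τ ^ (-i - 1)) fun z hz => ?_).trans_eq ?_
    · rw [norm_mul, norm_zpow, mem_sphere_zero_iff_norm.1 hz]
      exact mul_le_mul_of_nonneg_right (h1 z hz) (by positivity)
    · rw [zpow_sub_one₀ hτ0.ne']; field_simp
  · rw [laurentCoeff, unitContour_eq_of_annulus hσ hd (a := τ⁻¹) hinv (by linarith), abs_of_nonpos h]
    refine (norm_two_pi_I_inv_mul_le (inv_nonneg.2 hτ0.le) (C := C * (τ⁻¹) ^ (-i - 1)) fun z hz => ?_).trans_eq ?_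
    · rw [norm_mul, norm_zpow, mem_sphere_zero_iff_norm.1 hz]
      exact mul_le_mul_of_nonneg_right (h2 z hz) (by positivity)
    · rw [zpow_sub_one₀ (by positivity), inv_inv, neg_neg, inv_zpow', neg_neg]
      field_simp


/-! ### Univalent functions on an annulus -/

/-- `f` is holomorphic on the annulus of radius `σ` and expands distances by at least `δ`. -/
structure Univalent (f : ℂ → ℂ) (σ δ : ℝ) : Prop where
  one_lt : 1 < σ
  pos : 0 < δ
  diff : DifferentiableOn ℂ f (annulus σ)
  bound : ∀ z ∈ annulus σ, ∀ y ∈ annulus σ, δ * ‖z - y‖ ≤ ‖f z - f y‖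

theorem annulus_mem_nhds {σ : ℝ} {z : ℂ} (hz : z ∈ annulus σ) : annulus σ ∈ 𝓝 z :=
  (isOpen_annulus σ).mem_nhds hz

theorem differentiableOn_deriv_annulus {f : ℂ → ℂ} {σ : ℝ} (hf : DifferentiableOn ℂ f (annulus σ)) :
    DifferentiableOn ℂ (deriv f) (annulus σ) := hf.deriv (isOpen_annulus σ)

theorem univalent_id {σ : ℝ} (hσ : 1 < σ) : Univalent (fun z => z) σ 1 :=
  ⟨hσ, one_pos, differentiableOn_id, fun z _ y _ => by simp⟩

namespace Univalent

variable {f φ : ℂ → ℂ} {σ δ : ℝ} {z : ℂ}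

theorem mono (hf : Univalent f σ δ) {τ : ℝ} (h1 : 1 < τ) (h2 : τ ≤ σ) : Univalent f τ δ :=
  have h := annulus_mono (by linarith) h2
  ⟨h1, hf.pos, hf.diff.mono h, fun z hz y hy => hf.bound z (h hz) y (h hy)⟩

theorem injOn (hf : Univalent f σ δ) : Set.InjOn f (annulus σ) := by
  intro z hz y hy h
  have := hf.bound z hz y hy
  rw [h, sub_self, norm_zero] at this
  have h2 : ‖z - y‖ ≤ 0 := by
    by_contra! h3
    have := mul_pos hf.pos h3
    linarith
  exact sub_eq_zero.1 (norm_le_zero_iff.1 h2)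

theorem differentiableAt (hf : Univalent f σ δ) (hz : z ∈ annulus σ) : DifferentiableAt ℂ f z :=
  hf.diff.differentiableAt (annulus_mem_nhds hz)

/-- The slopes of f at z are bounded below by δ, hence so is their limit. -/
theorem deriv_ne_zero (hf : Univalent f σ δ) (hz : z ∈ annulus σ) : deriv f z ≠ 0 := by
  have h := (hasDerivAt_iff_tendsto_slope.1 (hf.differentiableAt hz).hasDerivAt).norm
  have : δ ≤ ‖deriv f z‖ := by
    refine ge_of_tendsto h ?_
    filter_upwards [self_mem_nhdsWithin, mem_nhdsWithin_of_mem_nhds (annulus_mem_nhds hz)] with y hy hy'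
    rw [slope_def_field, norm_div, le_div_iff₀ (norm_pos_iff.2 (sub_ne_zero.2 hy))]
    exact hf.bound y hy' z hz
  exact norm_pos_iff.1 (hf.pos.trans_le this)

theorem map_nhds (hf : Univalent f σ δ) (hz : z ∈ annulus σ) : map f (𝓝 z) = 𝓝 (f z) := by
  have := (hf.diff.analyticAt (annulus_mem_nhds hz)).hasStrictDerivAt
  exact this.map_nhds_eq (hf.deriv_ne_zero hz)

theorem isOpen_image (hf : Univalent f σ δ) {s : Set ℂ} (hs : IsOpen s) (h : s ⊆ annulus σ) :
    IsOpen (f '' s) := by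
  rw [isOpen_iff_mem_nhds]
  rintro _ ⟨z, hz, rfl⟩
  rw [← hf.map_nhds (h hz)]
  exact image_mem_map (hs.mem_nhds hz)

/-- The residue theorem for `φ / (f - f z₁)` in an annulus. -/
theorem circleIntegral_sub (hf : Univalent f σ δ) (hφ : DifferentiableOn ℂ φ (annulus σ))
    {a b : ℝ} (ha : σ⁻¹ < a) (hb : b < σ) (haz : a < ‖z‖) (hzb : ‖z‖ < b) :
    (∮ y in C(0, b), φ y / (f y - f z)) - (∮ y in C(0, a), φ y / (f y - f z))
      = 2 * π * Complex.I * (φ z / deriv f z) := by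
  have hσ := hf.one_lt
  have hz : z ∈ annulus σ := ⟨ha.trans haz, hzb.trans hb⟩
  have ha0 : 0 < a := lt_trans (by positivity) ha
  have hzn := annulus_mem_nhds hz
  have hg := (Complex.differentiableOn_dslope hzn).2 hf.diff
  have hg0 : ∀ y ∈ annulus σ, dslope f z y ≠ 0 := by
    intro y hy
    rcases eq_or_ne y z with rfl | h
    · rw [dslope_same]; exact hf.deriv_ne_zero hy
    · rw [dslope_of_ne _ h, slope_def_field]
      exact div_ne_zero (sub_ne_zero.2 fun e => h (hf.injOn hy hz e)) (sub_ne_zero.2 h)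
  -- h(y) = φ(y) (y - z) / (f y - f z) is holomorphic on the whole annulus, and `dslope h z` is φ /
  -- (f - f z) minus h(z) / (y - z). Its integrals over both circles agree, so the difference comes
  -- only from h(z) / (y - z), where h(z) = φ z / f'(z).
  set h : ℂ → ℂ := fun y => φ y / dslope f z y with hh
  have hd : DifferentiableOn ℂ h (annulus σ) := hφ.div hg hg0
  have hd' := (Complex.differentiableOn_dslope hzn).2 hd
  have key := circleIntegral_eq_of_annulus hσ hd' (a := b) (b := a) (by linarith) hb ha (by linarith)
  have hr : ∀ r, 0 < r → r ≠ ‖z‖ → σ⁻¹ < r → r < σ → (∮ y in C(0, r), dslope h z y)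
      = (∮ y in C(0, r), φ y / (f y - f z)) - h z * ∮ y in C(0, r), (y - z)⁻¹ := by
    intro r hr0 hrz hr1 hr2
    have hne : ∀ y ∈ sphere (0 : ℂ) r, y ≠ z := by
      rintro y hy rfl
      exact hrz (mem_sphere_zero_iff_norm.1 hy).symm
    have hsub := sphere_subset_annulus hr1 hr2
    have hc : ContinuousOn (fun y => h z * (y - z)⁻¹) (sphere (0 : ℂ) r) :=
      continuousOn_const.mul ((continuousOn_id.sub continuousOn_const).inv₀
        fun y hy => sub_ne_zero.2 (hne y hy))
    have hc' : ContinuousOn (fun y => φ y / (f y - f z)) (sphere (0 : ℂ) r) :=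
      (hφ.continuousOn.mono hsub).div ((hf.diff.continuousOn.mono hsub).sub continuousOn_const)
        fun y hy => sub_ne_zero.2 fun e => hne y hy (hf.injOn (hsub hy) hz e)
    rw [← circleIntegral.integral_const_mul, ← circleIntegral.integral_sub
      (hc'.circleIntegrable hr0.le) (hc.circleIntegrable hr0.le)]
    refine circleIntegral.integral_congr hr0.le fun y hy => ?_
    have h1 := sub_ne_zero.2 (hne y hy)
    have h2 : f y - f z ≠ 0 := sub_ne_zero.2 fun e => hne y hy (hf.injOn (hsub hy) hz e)
    rw [dslope_of_ne _ (hne y hy), slope_def_field, sub_div, div_eq_mul_inv (h z)]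
    congr 1
    simp only [hh]
    rw [dslope_of_ne _ (hne y hy), slope_def_field]
    field_simp
  have hb0 : 0 < b := by linarith
  rw [hr b hb0 hzb.ne' (by linarith) hb, hr a ha0 haz.ne ha (by linarith),
    circleIntegral.integral_sub_inv_of_mem_ball (by simpa using hzb)] at key
  have h0 : (∮ y in C(0, a), (y - z)⁻¹) = 0 := by
    refine Complex.circleIntegral_eq_zero_of_differentiable_on_off_countable ha0.le
      Set.countable_empty ?_ ?_
    · refine (continuousOn_id.sub continuousOn_const).inv₀ fun y hy => sub_ne_zero.2 ?_
      rintro rfl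
      rw [mem_closedBall_zero_iff] at hy; exact absurd haz (not_lt.2 hy)
    · intro y hy
      refine (differentiableAt_id.sub_const z).inv (sub_ne_zero.2 ?_)
      rintro rfl
      have := mem_ball_zero_iff.1 hy.1
      exact absurd haz (not_lt.2 this.le)
  rw [h0] at key
  have h3 : h z = φ z / deriv f z := by rw [hh]; simp [dslope_same]
  rw [← h3]
  linear_combination key

end Univalent

theorem circleIntegral_div_sub_eq {f φ : ℂ → ℂ} {σ a b : ℝ} (hσ : 1 < σ)
    (hf : DifferentiableOn ℂ f (annulus σ)) (hφ : DifferentiableOn ℂ φ (annulus σ))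
    (ha : σ⁻¹ < a) (hab : a ≤ b) (hb : b < σ) {w : ℂ}
    (hw : ∀ z : ℂ, a ≤ ‖z‖ → ‖z‖ ≤ b → f z ≠ w) :
    (∮ y in C(0, a), φ y / (f y - w)) = ∮ y in C(0, b), φ y / (f y - w) := by
  have ha0 : 0 < a := lt_trans (by positivity) ha
  have hsub : closedBall (0 : ℂ) b \ ball 0 a ⊆ annulus σ := by
    rintro z ⟨h1, h2⟩
    rw [mem_closedBall_zero_iff] at h1
    rw [mem_ball_zero_iff, not_lt] at h2
    exact ⟨ha.trans_le h2, h1.trans_lt hb⟩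
  have hw' : ∀ z ∈ closedBall (0 : ℂ) b \ ball 0 a, f z - w ≠ 0 := by
    rintro z ⟨h1, h2⟩
    rw [mem_closedBall_zero_iff] at h1
    rw [mem_ball_zero_iff, not_lt] at h2
    exact sub_ne_zero.2 (hw z h2 h1)
  symm
  refine Complex.circleIntegral_eq_of_differentiable_on_annulus_off_countable ha0 hab
    Set.countable_empty ((hφ.continuousOn.mono hsub).div
      ((hf.continuousOn.mono hsub).sub continuousOn_const) hw') fun z hz => ?_
  have hz' : z ∈ closedBall (0 : ℂ) b \ ball 0 a :=
    ⟨ball_subset_closedBall hz.1.1, fun h => hz.1.2 (ball_subset_closedBall h)⟩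
  have hn := annulus_mem_nhds (hsub hz')
  exact (hφ.differentiableAt hn).div ((hf.differentiableAt hn).sub_const w) (hw' z hz')

/-! ### Cauchy transforms -/

/-- The Cauchy transform `w ↦ (2πi)⁻¹ ∮_{|z| = r} φ(z) / (ψ(z) - w) dz`. -/
noncomputable def cauchyTr (φ ψ : ℂ → ℂ) (r : ℝ) (w : ℂ) : ℂ :=
  (2 * π * Complex.I)⁻¹ * ∮ z in C(0, r), φ z / (ψ z - w)

section CauchyTr

variable {φ ψ : ℂ → ℂ} {r : ℝ}

theorem exists_bound_sphere (hφ : ContinuousOn φ (sphere 0 r)) :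
    ∃ B, 0 ≤ B ∧ ∀ z ∈ sphere (0 : ℂ) r, ‖φ z‖ ≤ B := by
  obtain ⟨B, hB⟩ := (isCompact_sphere (0 : ℂ) r).exists_bound_of_continuousOn hφ
  exact ⟨max B 0, le_max_right _ _, fun z hz => (hB z hz).trans (le_max_left _ _)⟩

/-- The geometric series in w / (ψ - w₀), integrated term by term. -/
theorem cauchyTr_hasSum (hr : 0 ≤ r) (hφ : ContinuousOn φ (sphere 0 r))
    (hψ : ContinuousOn ψ (sphere 0 r)) {w₀ w : ℂ} {d : ℝ} (hd : 0 < d)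
    (h : ∀ z ∈ sphere (0 : ℂ) r, d ≤ ‖ψ z - w₀‖) (hw : ‖w‖ < d) :
    HasSum (fun n : ℕ => w ^ n *
      ((2 * π * Complex.I)⁻¹ * ∮ z in C(0, r), φ z * ((ψ z - w₀) ^ (n + 1))⁻¹))
      (cauchyTr φ ψ r (w₀ + w)) := by
  obtain ⟨B, hB0, hB⟩ := exists_bound_sphere hφ
  have hne : ∀ z ∈ sphere (0 : ℂ) r, ψ z - w₀ ≠ 0 := fun z hz =>
    norm_pos_iff.1 (hd.trans_le (h z hz))
  have := hasSum_circleIntegral hr (F := fun (n : ℕ) z => w ^ n * (φ z * ((ψ z - w₀) ^ (n + 1))⁻¹))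
    (f := fun z => φ z / (ψ z - (w₀ + w))) (u := fun n => (‖w‖ / d) ^ n * (B / d))
    (fun n => continuousOn_const.mul (hφ.mul (((hψ.sub continuousOn_const).pow _).inv₀
      fun z hz => pow_ne_zero _ (hne z hz))))
    ((summable_geometric_of_lt_one (by positivity) ((div_lt_one hd).2 hw)).mul_right _)
    (fun n z hz => ?_) (fun z hz => ?_)
  · simp only [circleIntegral.integral_const_mul] at this
    exact HasSum.of_eq (this.mul_left (2 * π * Complex.I)⁻¹) (fun n => by ring) rfl
  · have h1 := h z hz
    rw [norm_mul, norm_mul, norm_inv, norm_pow, norm_pow, div_pow]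
    calc ‖w‖ ^ n * (‖φ z‖ * (‖ψ z - w₀‖ ^ (n + 1))⁻¹) ≤ ‖w‖ ^ n * (B * (d ^ (n + 1))⁻¹) := by
          gcongr
          exact hB z hz
      _ = _ := by rw [pow_succ]; field_simp
  · have h1 := h z hz
    have h2 : ‖w / (ψ z - w₀)‖ < 1 := by
      rw [norm_div, div_lt_one (hd.trans_le h1)]
      linarith
    have h3 := (hasSum_geometric_of_norm_lt_one h2).mul_left (φ z / (ψ z - w₀))
    have h4 : ψ z - w₀ - w ≠ 0 := by
      intro e
      have : w = ψ z - w₀ := by linear_combination -e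
      rw [this] at hw
      linarith
    have h5 := hne z hz
    refine HasSum.of_eq h3 (fun n => ?_) ?_
    · rw [div_pow, pow_succ]; field_simp
    · have : 1 - w / (ψ z - w₀) ≠ 0 := by
        rw [one_sub_div h5]; exact div_ne_zero h4 h5
      rw [← sub_sub, one_sub_div h5]
      field_simp

theorem exists_dist_sphere (hψ : ContinuousOn ψ (sphere 0 r)) {w : ℂ} (hw : w ∉ ψ '' sphere 0 r) :
    ∃ d, 0 < d ∧ ∀ z ∈ sphere (0 : ℂ) r, d ≤ ‖ψ z - w‖ := by
  have hc := ((isCompact_sphere (0 : ℂ) r).image_of_continuousOn hψ).isClosed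
  obtain ⟨d, hd, h⟩ := Metric.isOpen_iff.1 hc.isOpen_compl w hw
  refine ⟨d, hd, fun z hz => ?_⟩
  by_contra! h1
  exact h (by rwa [mem_ball, dist_eq_norm]) ⟨z, hz, rfl⟩

theorem hasFPowerSeriesAt_of_hasSum {F : ℂ → ℂ} {c : ℕ → ℂ} {w₀ : ℂ}
    (h : ∀ᶠ w in 𝓝 (0 : ℂ), HasSum (fun n : ℕ => c n * w ^ n) (F (w₀ + w))) :
    HasFPowerSeriesAt F (FormalMultilinearSeries.ofScalars ℂ c) w₀ := by
  rw [hasFPowerSeriesAt_iff]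
  filter_upwards [h] with w hw
  refine HasSum.of_eq hw (fun n => ?_) rfl
  simp [FormalMultilinearSeries.coeff_ofScalars, mul_comm]

theorem coeff_eq_of_hasSum {c d : ℕ → ℂ}
    (h : ∀ᶠ w in 𝓝 (0 : ℂ), ∃ S, HasSum (fun n : ℕ => c n * w ^ n) S ∧
      HasSum (fun n : ℕ => d n * w ^ n) S) : c = d := by
  have h1 : HasFPowerSeriesAt (fun w => ∑' n : ℕ, c n * w ^ n)
      (FormalMultilinearSeries.ofScalars ℂ c) 0 := by
    refine hasFPowerSeriesAt_of_hasSum ?_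
    filter_upwards [h] with w ⟨S, hS, _⟩
    rw [zero_add]
    exact hS.summable.hasSum
  have h2 : HasFPowerSeriesAt (fun w => ∑' n : ℕ, c n * w ^ n)
      (FormalMultilinearSeries.ofScalars ℂ d) 0 := by
    refine hasFPowerSeriesAt_of_hasSum ?_
    filter_upwards [h] with w ⟨S, hS, hS'⟩
    rw [zero_add, hS.tsum_eq]
    exact hS'
  have := h1.eq_formalMultilinearSeries h2
  funext n
  have h3 := congrArg (fun p => FormalMultilinearSeries.coeff p n) this
  simpa [FormalMultilinearSeries.coeff_ofScalars] using h3

theorem cauchyTr_analyticAt (hr : 0 ≤ r) (hφ : ContinuousOn φ (sphere 0 r))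
    (hψ : ContinuousOn ψ (sphere 0 r)) {w : ℂ} (hw : w ∉ ψ '' sphere 0 r) :
    AnalyticAt ℂ (cauchyTr φ ψ r) w := by
  obtain ⟨d, hd, h⟩ := exists_dist_sphere hψ hw
  refine ⟨_, hasFPowerSeriesAt_of_hasSum (c := fun n => (2 * π * Complex.I)⁻¹ *
    ∮ z in C(0, r), φ z * ((ψ z - w) ^ (n + 1))⁻¹) ?_⟩
  filter_upwards [ball_mem_nhds (0 : ℂ) hd] with y hy
  exact HasSum.of_eq (cauchyTr_hasSum hr hφ hψ hd h (by simpa using hy)) (fun n => mul_comm _ _) rfl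

theorem cauchyTr_hasSum_zero (hr : 0 ≤ r) (hφ : ContinuousOn φ (sphere 0 r))
    (hψ : ContinuousOn ψ (sphere 0 r)) (h0 : ∀ z ∈ sphere (0 : ℂ) r, ψ z ≠ 0) :
    ∀ᶠ w in 𝓝 (0 : ℂ), HasSum (fun n : ℕ => w ^ n *
      ((2 * π * Complex.I)⁻¹ * ∮ z in C(0, r), φ z * (ψ z ^ (n + 1))⁻¹)) (cauchyTr φ ψ r w) := by
  obtain ⟨d, hd, h⟩ := exists_dist_sphere hψ (w := 0) (by rintro ⟨z, hz, h⟩; exact h0 z hz h)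
  filter_upwards [ball_mem_nhds (0 : ℂ) hd] with y hy
  simpa using cauchyTr_hasSum hr hφ hψ hd h (by simpa using hy)

theorem cauchyTr_hasSum_of_lt (hr : 0 ≤ r) (hφ : ContinuousOn φ (sphere 0 r))
    (hψ : ContinuousOn ψ (sphere 0 r)) {D : ℝ} (hD0 : 0 ≤ D) (hD : ∀ z ∈ sphere (0 : ℂ) r, ‖ψ z‖ ≤ D)
    {w : ℂ} (hw : D < ‖w‖) : HasSum (fun n : ℕ => -((w ^ (n + 1))⁻¹ *
      ((2 * π * Complex.I)⁻¹ * ∮ z in C(0, r), φ z * ψ z ^ n))) (cauchyTr φ ψ r w) := by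
  obtain ⟨B, hB0, hB⟩ := exists_bound_sphere hφ
  have hw0 : 0 < ‖w‖ := hD0.trans_lt hw
  have hw1 : w ≠ 0 := norm_pos_iff.1 hw0
  have := hasSum_circleIntegral hr (F := fun (n : ℕ) z => -((w ^ (n + 1))⁻¹ * (φ z * ψ z ^ n)))
    (f := fun z => φ z / (ψ z - w)) (u := fun n => (D / ‖w‖) ^ n * (B / ‖w‖))
    (fun n => (continuousOn_const.mul (hφ.mul (hψ.pow _))).neg)
    ((summable_geometric_of_lt_one (by positivity) ((div_lt_one hw0).2 hw)).mul_right _)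
    (fun n z hz => ?_) (fun z hz => ?_)
  · refine HasSum.of_eq (this.mul_left (2 * π * Complex.I)⁻¹) (fun n => ?_) rfl
    have e : ∀ z, -((w ^ (n + 1))⁻¹ * (φ z * ψ z ^ n)) = -(w ^ (n + 1))⁻¹ * (φ z * ψ z ^ n) :=
      fun z => by ring
    simp only [e, circleIntegral.integral_const_mul]
    ring
  · have h1 := hB z hz
    have h2 := hD z hz
    rw [norm_neg, norm_mul, norm_mul, norm_inv, norm_pow, norm_pow, div_pow]
    calc (‖w‖ ^ (n + 1))⁻¹ * (‖φ z‖ * ‖ψ z‖ ^ n) ≤ (‖w‖ ^ (n + 1))⁻¹ * (B * D ^ n) := by gcongr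
      _ = _ := by rw [pow_succ]; field_simp
  · have h2 : ‖ψ z / w‖ < 1 := by
      rw [norm_div, div_lt_one hw0]
      exact (hD z hz).trans_lt hw
    have h3 := (hasSum_geometric_of_norm_lt_one h2).mul_left (-(φ z / w))
    have h4 : w - ψ z ≠ 0 := by
      intro e
      have : w = ψ z := by linear_combination e
      rw [this] at hw
      exact absurd (hD z hz) (not_le.2 hw)
    refine HasSum.of_eq h3 (fun n => ?_) ?_
    · rw [div_pow, pow_succ]; field_simp
    · rw [one_sub_div hw1, ← neg_sub w]
      field_simp

theorem cauchyTr_hasSum_infty (hr : 0 ≤ r) (hφ : ContinuousOn φ (sphere 0 r))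
    (hψ : ContinuousOn ψ (sphere 0 r)) :
    ∀ᶠ w in cobounded ℂ, HasSum (fun n : ℕ => -((w ^ (n + 1))⁻¹ *
      ((2 * π * Complex.I)⁻¹ * ∮ z in C(0, r), φ z * ψ z ^ n))) (cauchyTr φ ψ r w) := by
  obtain ⟨D, hD0, hD⟩ := exists_bound_sphere hψ
  have : ∀ᶠ w in cobounded ℂ, D < ‖w‖ := by
    simpa using (tendsto_norm_cobounded_atTop (E := ℂ)).eventually (eventually_gt_atTop D)
  filter_upwards [this] with w hw
  exact cauchyTr_hasSum_of_lt hr hφ hψ hD0 hD hw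

theorem cauchyTr_tendsto (hr : 0 ≤ r) (hφ : ContinuousOn φ (sphere 0 r))
    (hψ : ContinuousOn ψ (sphere 0 r)) :
    cauchyTr φ ψ r =O[cobounded ℂ] fun w => w⁻¹ := by
  obtain ⟨B, hB0, hB⟩ := exists_bound_sphere hφ
  obtain ⟨D, hD0, hD⟩ := exists_bound_sphere hψ
  refine IsBigO.of_bound (r * (B * 2)) ?_
  have : ∀ᶠ w in cobounded ℂ, 2 * D + 1 < ‖w‖ := by
    simpa using (tendsto_norm_cobounded_atTop (E := ℂ)).eventually (eventually_gt_atTop (2 * D + 1))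
  filter_upwards [this] with w hw
  rw [mul_assoc]
  refine norm_two_pi_I_inv_mul_le hr fun z hz => ?_
  have h1 := hD z hz
  have h3 : ‖w‖ / 2 ≤ ‖ψ z - w‖ := by
    have := norm_sub_norm_le w (ψ z)
    rw [norm_sub_rev] at this
    linarith
  have hw0 : 0 < ‖w‖ := by linarith
  rw [norm_div, norm_inv]
  calc ‖φ z‖ / ‖ψ z - w‖ ≤ B / (‖w‖ / 2) := by
        gcongr
        exact hB z hz
    _ = B * 2 * ‖w‖⁻¹ := by field_simp

end CauchyTr

/-! ### The inside and the outside of the image of the unit circle -/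

theorem eq_of_eventually_const {F : ℂ → ℂ} {U : Set ℂ} (hU : IsOpen U) (hc : IsPreconnected U)
    (h : ∀ z ∈ U, ∀ᶠ y in 𝓝 z, F y = F z) {z y : ℂ} (hz : z ∈ U) (hy : y ∈ U) : F z = F y := by
  have hd : ∀ z ∈ U, HasDerivAt F 0 z := fun z hz =>
    (hasDerivAt_const z (F z)).congr_of_eventuallyEq (h z hz)
  exact hU.is_const_of_deriv_eq_zero hc (fun z hz => (hd z hz).differentiableAt.differentiableWithinAt)
    (fun z hz => (hd z hz).deriv) hz hy

/-- The winding number around `w` of the image of the circle of radius `r`. -/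
noncomputable def windNum (f : ℂ → ℂ) (r : ℝ) (w : ℂ) : ℂ := cauchyTr (deriv f) f r w

/-- The image of the unit circle. -/
def curveOf (f : ℂ → ℂ) : Set ℂ := f '' sphere 0 1

/-- The inside of the image of the unit circle. -/
def insideOf (f : ℂ → ℂ) : Set ℂ := {w | w ∉ curveOf f ∧ windNum f 1 w ≠ 0}

/-- The outside of the image of the unit circle. -/
def outsideOf (f : ℂ → ℂ) : Set ℂ := {w | w ∉ curveOf f ∧ windNum f 1 w = 0}

/-- A univalent function without zeros that maps the unit circle to a curve around `0`. -/
structure Loop (f : ℂ → ℂ) (σ δ : ℝ) : Prop extends Univalent f σ δ where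
  ne_zero : ∀ z ∈ annulus σ, f z ≠ 0
  wind : windNum f 1 0 = 1

variable {f φ : ℂ → ℂ} {σ δ : ℝ} {z w : ℂ}

/-- After expansion in powers of y - w, every term of positive degree is the integral of the
derivative of a power of (f - w)⁻¹ and vanishes. This gives local constancy without using that the
winding number is an integer. -/
theorem windNum_eventually {r : ℝ} (hσ : 1 < σ) (hf : DifferentiableOn ℂ f (annulus σ))
    (h1 : σ⁻¹ < r) (h2 : r < σ) (hw : w ∉ f '' sphere 0 r) :
    ∀ᶠ y in 𝓝 w, windNum f r y = windNum f r w := by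
  have hr : 0 < r := lt_trans (by positivity) h1
  have hsub := sphere_subset_annulus h1 h2
  have hfc := hf.continuousOn.mono hsub
  have hdc := (differentiableOn_deriv_annulus hf).continuousOn.mono hsub
  obtain ⟨d, hd, h⟩ := exists_dist_sphere hfc hw
  have key : ∀ n : ℕ, n ≠ 0 → (∮ z in C(0, r), deriv f z * ((f z - w) ^ (n + 1))⁻¹) = 0 := by
    intro n hn
    refine circleIntegral.integral_eq_zero_of_hasDerivWithinAt (f := fun z => -(n : ℂ)⁻¹ * ((f z - w) ^ n)⁻¹)
      hr.le fun z hz => HasDerivAt.hasDerivWithinAt ?_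
    have h0 : f z - w ≠ 0 := norm_pos_iff.1 (hd.trans_le (h z hz))
    have hn' : (n : ℂ) ≠ 0 := Nat.cast_ne_zero.2 hn
    have h3 := ((hf.differentiableAt (annulus_mem_nhds (hsub hz))).hasDerivAt.sub_const w)
    have h4 := ((h3.fun_pow n).fun_inv (pow_ne_zero n h0)).const_mul (-(n : ℂ)⁻¹)
    refine h4.congr_deriv ?_
    obtain ⟨m, rfl⟩ := Nat.exists_eq_succ_of_ne_zero hn
    rw [Nat.succ_eq_add_one, Nat.add_sub_cancel]
    field_simp
    ring
  have hs : ∀ y : ℂ, ‖y‖ < d → windNum f r (w + y) =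
      (2 * π * Complex.I)⁻¹ * ∮ z in C(0, r), deriv f z * (f z - w)⁻¹ := by
    intro y hy
    refine (cauchyTr_hasSum hr.le hdc hfc hd h hy).unique ?_
    convert hasSum_single (0 : ℕ) ?_ using 1
    · simp
    · intro n hn
      rw [key n hn]; simp
  filter_upwards [ball_mem_nhds w hd] with y hy
  have h1 := hs (y - w) (by simpa [dist_eq_norm] using hy)
  have h2 := hs 0 (by simpa using hd)
  rw [add_sub_cancel] at h1
  rw [add_zero] at h2
  rw [h1, h2]

theorem isOpen_norm_between (a b : ℝ) : IsOpen {z : ℂ | a < ‖z‖ ∧ ‖z‖ < b} :=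
  (isOpen_lt continuous_const continuous_norm).inter (isOpen_lt continuous_norm continuous_const)

namespace Univalent

theorem isClosed_curve (hf : Univalent f σ δ) : IsClosed (curveOf f) :=
  ((isCompact_sphere (0 : ℂ) 1).image_of_continuousOn
    (hf.diff.continuousOn.mono (unit_sphere_subset_annulus hf.one_lt))).isClosed

theorem notMem_image_sphere (hf : Univalent f σ δ) {r : ℝ} (h1 : σ⁻¹ < r) (h2 : r < σ)
    (hz : z ∈ annulus σ) (hzr : ‖z‖ ≠ r) : f z ∉ f '' sphere 0 r := by
  rintro ⟨y, hy, h⟩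
  have := hf.injOn (sphere_subset_annulus h1 h2 hy) hz h
  rw [← this] at hzr
  exact hzr (mem_sphere_zero_iff_norm.1 hy)

theorem windNum_const (hf : Univalent f σ δ) {r a b : ℝ} (h1 : σ⁻¹ < r) (h2 : r < σ)
    (ha : σ⁻¹ ≤ a) (hb : b ≤ σ) (hr : r ≤ a ∨ b ≤ r) {z y : ℂ} (hz : a < ‖z‖ ∧ ‖z‖ < b)
    (hy : a < ‖y‖ ∧ ‖y‖ < b) : windNum f r (f z) = windNum f r (f y) := by
  have ha0 : 0 < a := lt_of_lt_of_le (by have := hf.one_lt; positivity) ha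
  refine eq_of_eventually_const (F := fun z => windNum f r (f z)) (isOpen_norm_between a b)
    (isPreconnected_norm_between ha0) (fun x hx => ?_) hz hy
  have hx' : x ∈ annulus σ := ⟨ha.trans_lt hx.1, hx.2.trans_le hb⟩
  have := windNum_eventually hf.one_lt hf.diff h1 h2 (hf.notMem_image_sphere h1 h2 hx' ?_)
  · exact (hf.differentiableAt hx').continuousAt.eventually this
  · rcases hr with hr | hr
    · exact (hr.trans_lt hx.1).ne'
    · exact (hx.2.trans_le hr).ne

theorem windNum_sub (hf : Univalent f σ δ) {a b : ℝ} (ha : σ⁻¹ < a) (hb : b < σ) (haz : a < ‖z‖)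
    (hzb : ‖z‖ < b) : windNum f b (f z) - windNum f a (f z) = 1 := by
  have hz : z ∈ annulus σ := ⟨ha.trans haz, hzb.trans hb⟩
  have := hf.circleIntegral_sub (differentiableOn_deriv_annulus hf.diff) ha hb haz hzb
  rw [windNum, windNum, cauchyTr, cauchyTr, ← mul_sub, this, div_self (hf.deriv_ne_zero hz), mul_one,
    inv_mul_cancel₀ Complex.two_pi_I_ne_zero]

theorem windNum_eq_of_not_between (hf : Univalent f σ δ) {a b : ℝ} (ha : σ⁻¹ < a) (hab : a ≤ b)
    (hb : b < σ) (hz : z ∈ annulus σ) (hzab : ‖z‖ < a ∨ b < ‖z‖) :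
    windNum f a (f z) = windNum f b (f z) := by
  rw [windNum, windNum, cauchyTr, cauchyTr, circleIntegral_div_sub_eq hf.one_lt hf.diff
    (differentiableOn_deriv_annulus hf.diff) ha hab hb fun y h1 h2 e => ?_]
  have := hf.injOn (show y ∈ annulus σ from ⟨ha.trans_le h1, h2.trans_lt hb⟩) hz e
  subst this
  rcases hzab with h | h <;> linarith

/-- Compare the unit circle with a slightly smaller circle of radius a. For a < |z| < 1 the two
winding numbers around f z differ by 1. The one along the smaller circle stays constant as z moves
out past |z| = 1, and there it agrees with the one along the unit circle. -/
theorem exists_windNum (hf : Univalent f σ δ) : ∃ c : ℂ, (∀ z ∈ annulus σ, 1 < ‖z‖ →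
    windNum f 1 (f z) = c) ∧ ∀ z ∈ annulus σ, ‖z‖ < 1 → windNum f 1 (f z) = 1 + c := by
  have hσ := hf.one_lt
  have hi : σ⁻¹ < 1 := inv_lt_one_of_one_lt₀ hσ
  obtain ⟨a, ha, ha1⟩ := exists_between hi
  obtain ⟨b, hb1, hb⟩ := exists_between hσ
  obtain ⟨a', ha', haa⟩ := exists_between ha1
  have hn : ∀ x : ℝ, 0 < x → ‖(x : ℂ)‖ = x := fun x hx => by
    rw [Complex.norm_real, Real.norm_of_nonneg hx.le]
  have hinv : 0 < σ⁻¹ := by positivity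
  have hbn := hn b (by linarith)
  have han := hn a' (by linarith)
  have hout : ∀ z ∈ annulus σ, 1 < ‖z‖ → windNum f 1 (f z) = windNum f 1 (f b) := fun z hz h =>
    hf.windNum_const hi hσ hi.le le_rfl (.inl le_rfl) ⟨h, hz.2⟩ ⟨by rw [hbn]; exact hb1, by rw [hbn]; exact hb⟩
  refine ⟨_, hout, fun z hz h => ?_⟩
  rw [hf.windNum_const (y := (a' : ℂ)) hi hσ le_rfl hσ.le (.inr le_rfl) ⟨hz.1, h⟩
    ⟨by rw [han]; linarith, by rw [han]; linarith⟩]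
  have h1 := hf.windNum_sub (z := (a' : ℂ)) ha hσ (by rw [han]; linarith) (by rw [han]; linarith)
  have h2 := hf.windNum_const (r := a) (z := (a' : ℂ)) (y := (b : ℂ)) ha (by linarith) ha.le le_rfl
    (.inl le_rfl) ⟨by rw [han]; linarith, by rw [han]; linarith⟩ ⟨by rw [hbn]; linarith, by rw [hbn]; linarith⟩
  have h3 := hf.windNum_eq_of_not_between (z := (b : ℂ)) ha ha1.le hσ
    ⟨by rw [hbn]; linarith, by rw [hbn]; linarith⟩ (.inr (by rw [hbn]; linarith))
  rw [h2, h3] at h1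
  linear_combination h1

theorem curve_subset_image (hf : Univalent f σ δ) : curveOf f ⊆ f '' annulus σ :=
  Set.image_mono (unit_sphere_subset_annulus hf.one_lt)

/-- A subset of the complement of the curve that is open and closed there and misses a
neighbourhood of the curve is empty. -/
theorem eq_empty_of_clopen (hf : Univalent f σ δ) {S : Set ℂ} (ho : IsOpen S)
    (hd : ∀ z ∈ annulus σ, f z ∉ S) (hc : ∀ w, w ∉ curveOf f → w ∉ S → ∀ᶠ y in 𝓝 w, y ∉ S) :
    S = ∅ := by
  have hcl : IsClosed S := by
    rw [← isOpen_compl_iff, isOpen_iff_mem_nhds]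
    intro w hw
    by_cases h : w ∈ curveOf f
    · have := (hf.isOpen_image (isOpen_annulus σ) subset_rfl).mem_nhds (hf.curve_subset_image h)
      filter_upwards [this]
      rintro _ ⟨z, hz, rfl⟩
      exact hd z hz
    · exact hc w h hw
  rcases isClopen_iff.1 ⟨hcl, ho⟩ with h | h
  · exact h
  · exact absurd (h ▸ Set.mem_univ _) (hd 1 (unit_sphere_subset_annulus hf.one_lt (by simp)))

theorem windNum_eventually_one (hf : Univalent f σ δ) (hw : w ∉ curveOf f) :
    ∀ᶠ y in 𝓝 w, y ∉ curveOf f ∧ windNum f 1 y = windNum f 1 w :=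
  Filter.Eventually.and (hf.isClosed_curve.isOpen_compl.mem_nhds hw)
    (windNum_eventually hf.one_lt hf.diff (inv_lt_one_of_one_lt₀ hf.one_lt) hf.one_lt hw)

end Univalent

namespace Loop

/-- Points with a third value would form a clopen set that misses a neighbourhood of the curve, so
only the values c and 1 + c of `Univalent.exists_windNum` occur. The winding number tends to 0 at
infinity and is 1 at the origin, which forces c = 0. -/
theorem windNum_outer (hf : Loop f σ δ) : (∀ z ∈ annulus σ, 1 < ‖z‖ → windNum f 1 (f z) = 0) ∧
    (∀ z ∈ annulus σ, ‖z‖ < 1 → windNum f 1 (f z) = 1) ∧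
    ∀ w, w ∉ curveOf f → windNum f 1 w = 0 ∨ windNum f 1 w = 1 := by
  obtain ⟨c, h1, h2⟩ := hf.exists_windNum
  have hS : {w | w ∉ curveOf f ∧ windNum f 1 w ≠ c ∧ windNum f 1 w ≠ 1 + c} = ∅ := by
    refine hf.eq_empty_of_clopen ?_ ?_ ?_
    · rw [isOpen_iff_mem_nhds]
      rintro w ⟨hw, hw'⟩
      filter_upwards [hf.windNum_eventually_one hw] with y hy
      exact ⟨hy.1, by rw [hy.2]; exact hw'⟩
    · rintro z hz ⟨h3, h4, h5⟩
      rcases lt_trichotomy ‖z‖ 1 with h | h | h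
      · exact h5 (h2 z hz h)
      · exact h3 ⟨z, by simpa using h, rfl⟩
      · exact h4 (h1 z hz h)
    · intro w hw hw'
      filter_upwards [hf.windNum_eventually_one hw] with y hy
      rintro ⟨h3, h4⟩
      exact hw' ⟨hw, hy.2 ▸ h4⟩
  have hall : ∀ w, w ∉ curveOf f → windNum f 1 w = c ∨ windNum f 1 w = 1 + c := by
    intro w hw
    by_contra! h
    exact (hS ▸ (⟨hw, h⟩ : w ∈ {w | w ∉ curveOf f ∧ windNum f 1 w ≠ c ∧ windNum f 1 w ≠ 1 + c}) : w ∈ (∅ : Set ℂ))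
  have hi := unit_sphere_subset_annulus hf.one_lt
  have h0 : (0 : ℂ) ∉ curveOf f := by
    rintro ⟨z, hz, h⟩
    exact hf.ne_zero z (hi hz) h
  have hfc := hf.diff.continuousOn.mono hi
  have hdc := (differentiableOn_deriv_annulus hf.diff).continuousOn.mono hi
  have ht : Tendsto (windNum f 1) (cobounded ℂ) (𝓝 0) :=
    (cauchyTr_tendsto zero_le_one hdc hfc).trans_tendsto tendsto_inv₀_cobounded
  have hout : ∀ᶠ w in cobounded ℂ, w ∉ curveOf f :=
    ((isCompact_sphere (0 : ℂ) 1).image_of_continuousOn hfc).isBounded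
  have hsmall : ∀ᶠ w in cobounded ℂ, ‖windNum f 1 w‖ < 1 := by
    simpa using ht.norm.eventually (gt_mem_nhds (by simp : ‖(0 : ℂ)‖ < 1))
  obtain ⟨w, hw1, hw2⟩ := (hout.and hsmall).exists
  have hc : c = 0 := by
    rcases hall 0 h0 with h | h
    · rw [hf.wind] at h
      rcases hall w hw1 with h' | h' <;> rw [h', ← h] at hw2 <;> norm_num at hw2
    · rw [hf.wind] at h
      linear_combination -h
  subst hc
  exact ⟨h1, by simpa using h2, by simpa using hall⟩

theorem mem_outside (hf : Loop f σ δ) (hz : z ∈ annulus σ) (h : 1 < ‖z‖) : f z ∈ outsideOf f :=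
  ⟨hf.notMem_image_sphere (inv_lt_one_of_one_lt₀ hf.one_lt) hf.one_lt hz h.ne',
    hf.windNum_outer.1 z hz h⟩

theorem mem_inside (hf : Loop f σ δ) (hz : z ∈ annulus σ) (h : ‖z‖ < 1) : f z ∈ insideOf f :=
  ⟨hf.notMem_image_sphere (inv_lt_one_of_one_lt₀ hf.one_lt) hf.one_lt hz h.ne,
    by rw [hf.windNum_outer.2.1 z hz h]; exact one_ne_zero⟩

theorem zero_mem_inside (hf : Loop f σ δ) : (0 : ℂ) ∈ insideOf f :=
  ⟨by
    rintro ⟨z, hz, h⟩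
    exact hf.ne_zero z (unit_sphere_subset_annulus hf.one_lt hz) h, by
    rw [hf.wind]; exact one_ne_zero⟩

theorem eventually_mem_outside (hf : Loop f σ δ) : ∀ᶠ w in cobounded ℂ, w ∈ outsideOf f := by
  have hi := unit_sphere_subset_annulus hf.one_lt
  have hfc := hf.diff.continuousOn.mono hi
  have hdc := (differentiableOn_deriv_annulus hf.diff).continuousOn.mono hi
  have ht : Tendsto (windNum f 1) (cobounded ℂ) (𝓝 0) :=
    (cauchyTr_tendsto zero_le_one hdc hfc).trans_tendsto tendsto_inv₀_cobounded
  have hout : ∀ᶠ w in cobounded ℂ, w ∉ curveOf f :=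
    ((isCompact_sphere (0 : ℂ) 1).image_of_continuousOn hfc).isBounded
  have hsmall : ∀ᶠ w in cobounded ℂ, ‖windNum f 1 w‖ < 1 := by
    simpa using ht.norm.eventually (gt_mem_nhds (by simp : ‖(0 : ℂ)‖ < 1))
  filter_upwards [hout, hsmall] with w hw1 hw2
  refine ⟨hw1, (hf.windNum_outer.2.2 w hw1).resolve_right fun h => ?_⟩
  rw [h] at hw2
  norm_num at hw2

theorem isOpen_inside (hf : Loop f σ δ) : IsOpen (insideOf f) := by
  rw [isOpen_iff_mem_nhds]
  rintro w ⟨hw, hw'⟩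
  filter_upwards [hf.windNum_eventually_one hw] with y hy
  exact ⟨hy.1, by rw [hy.2]; exact hw'⟩

theorem isOpen_outside (hf : Loop f σ δ) : IsOpen (outsideOf f) := by
  rw [isOpen_iff_mem_nhds]
  rintro w ⟨hw, hw'⟩
  filter_upwards [hf.windNum_eventually_one hw] with y hy
  exact ⟨hy.1, by rw [hy.2]; exact hw'⟩

/-- An open and closed part of the complement of the curve is preconnected if it meets only one
side of the curve. -/
theorem isPreconnected_of_side (hf : Loop f σ δ) {U V A : Set ℂ} (hU : IsOpen U) (hV : IsOpen V)
    (hUV : Disjoint U V) (hcov : ∀ w, w ∉ curveOf f → w ∈ U ∨ w ∈ V)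
    (hA : IsPreconnected A) (hAU : A ⊆ U)
    (hann : ∀ z ∈ annulus σ, f z ∈ U → f z ∈ A) : IsPreconnected U := by
  -- If u contains A, the part of U lying in v misses the image of the annulus, so
  -- `eq_empty_of_clopen` removes it.
  have main : ∀ u v : Set ℂ, IsOpen u → IsOpen v → U ⊆ u ∪ v → U ∩ (u ∩ v) = ∅ → A ⊆ u → U ⊆ u := by
    intro u v hu hv huv hemp hAu
    have : U ∩ v = ∅ := by
      refine hf.eq_empty_of_clopen (hU.inter hv) ?_ ?_
      · rintro z hz ⟨h1, h2⟩
        exact (hemp ▸ (⟨h1, hAu (hann z hz h1), h2⟩ : f z ∈ U ∩ (u ∩ v)) : f z ∈ (∅ : Set ℂ))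
      · intro w hw hw'
        rcases hcov w hw with h | h
        · have hwu : w ∈ u := (huv h).resolve_right fun h' => hw' ⟨h, h'⟩
          filter_upwards [(hU.inter hu).mem_nhds ⟨h, hwu⟩] with y hy hy'
          exact (hemp ▸ (⟨hy.1, hy.2, hy'.2⟩ : y ∈ U ∩ (u ∩ v)) : y ∈ (∅ : Set ℂ))
        · filter_upwards [hV.mem_nhds h] with y hy hy'
          exact Set.disjoint_left.1 hUV hy'.1 hy
    intro w hw
    refine (huv hw).resolve_right fun h => ?_
    exact (this ▸ (⟨hw, h⟩ : w ∈ U ∩ v) : w ∈ (∅ : Set ℂ))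
  rw [isPreconnected_iff_subset_of_disjoint]
  intro u v hu hv huv hemp
  have h1 : A ∩ (u ∩ v) = ∅ := Set.eq_empty_of_subset_empty (hemp ▸ Set.inter_subset_inter_left _ hAU)
  rcases isPreconnected_iff_subset_of_disjoint.1 hA u v hu hv (hAU.trans huv) h1 with h | h
  · exact .inl (main u v hu hv huv hemp h)
  · exact .inr (main v u hv hu (Set.union_comm u v ▸ huv) (Set.inter_comm u v ▸ hemp) h)

theorem isPreconnected_inside (hf : Loop f σ δ) : IsPreconnected (insideOf f) := by
  have hσ := hf.one_lt
  have hi : σ⁻¹ < 1 := inv_lt_one_of_one_lt₀ hσ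
  have hsub : {z : ℂ | σ⁻¹ < ‖z‖ ∧ ‖z‖ < 1} ⊆ annulus σ := fun z hz => ⟨hz.1, hz.2.trans hσ⟩
  refine hf.isPreconnected_of_side (A := f '' {z : ℂ | σ⁻¹ < ‖z‖ ∧ ‖z‖ < 1}) hf.isOpen_inside
    hf.isOpen_outside ?_ ?_ ?_ ?_ ?_
  · exact Set.disjoint_left.2 fun w h1 h2 => h1.2 h2.2
  · intro w hw
    by_cases h : windNum f 1 w = 0
    · exact .inr ⟨hw, h⟩
    · exact .inl ⟨hw, h⟩
  · exact (isPreconnected_norm_between (by positivity)).image _ (hf.diff.continuousOn.mono hsub)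
  · rintro _ ⟨z, hz, rfl⟩
    exact hf.mem_inside (hsub hz) hz.2
  · intro z hz h
    refine ⟨z, ⟨hz.1, ?_⟩, rfl⟩
    by_contra! h1
    rcases h1.eq_or_lt with h2 | h2
    · exact h.1 ⟨z, by simpa using h2.symm, rfl⟩
    · exact h.2 (hf.mem_outside hz h2).2

theorem isPreconnected_outside (hf : Loop f σ δ) : IsPreconnected (outsideOf f) := by
  have hσ := hf.one_lt
  have hi : σ⁻¹ < 1 := inv_lt_one_of_one_lt₀ hσ
  have hsub : {z : ℂ | 1 < ‖z‖ ∧ ‖z‖ < σ} ⊆ annulus σ := fun z hz => ⟨hi.trans hz.1, hz.2⟩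
  refine hf.isPreconnected_of_side (A := f '' {z : ℂ | 1 < ‖z‖ ∧ ‖z‖ < σ}) hf.isOpen_outside
    hf.isOpen_inside ?_ ?_ ?_ ?_ ?_
  · exact Set.disjoint_left.2 fun w h1 h2 => h2.2 h1.2
  · intro w hw
    by_cases h : windNum f 1 w = 0
    · exact .inl ⟨hw, h⟩
    · exact .inr ⟨hw, h⟩
  · exact (isPreconnected_norm_between one_pos).image _ (hf.diff.continuousOn.mono hsub)
  · rintro _ ⟨z, hz, rfl⟩
    exact hf.mem_outside (hsub hz) hz.1
  · intro z hz h
    refine ⟨z, ⟨?_, hz.2⟩, rfl⟩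
    by_contra! h1
    rcases h1.eq_or_lt with h2 | h2
    · exact h.1 ⟨z, by simpa using h2, rfl⟩
    · exact (hf.mem_inside hz h2).2 h.2

/-- A function that is holomorphic on the closed inside and vanishes near `0` vanishes. -/
theorem eqOn_inside (hf : Loop f σ δ) {F : ℂ → ℂ} (hF : AnalyticOnNhd ℂ F (insideOf f))
    (h : ∀ᶠ w in 𝓝 0, F w = 0) : ∀ w ∈ insideOf f, F w = 0 :=
  hF.eqOn_zero_of_preconnected_of_eventuallyEq_zero hf.isPreconnected_inside hf.zero_mem_inside h

theorem eqOn_outside (hf : Loop f σ δ) {F : ℂ → ℂ} (hF : AnalyticOnNhd ℂ F (outsideOf f))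
    (h : ∀ᶠ w in cobounded ℂ, F w = 0) : ∀ w ∈ outsideOf f, F w = 0 := by
  have h1 : ∀ᶠ w in cobounded ℂ, F =ᶠ[𝓝 w] 0 := by
    obtain ⟨R, -, hR⟩ := (hasBasis_cobounded_norm (E := ℂ)).eventually_iff.1 h
    refine (hasBasis_cobounded_norm (E := ℂ)).eventually_iff.2 ⟨R + 1, trivial, fun w hw => ?_⟩
    have : IsOpen {w : ℂ | R < ‖w‖} := isOpen_lt continuous_const continuous_norm
    filter_upwards [this.mem_nhds (show R < ‖w‖ by have : R + 1 ≤ ‖w‖ := hw; linarith)] with y hy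
    exact hR (le_of_lt hy)
  obtain ⟨w, hw1, hw2⟩ := (hf.eventually_mem_outside.and h1).exists
  exact hF.eqOn_zero_of_preconnected_of_eventuallyEq_zero hf.isPreconnected_outside hw1 hw2

/-- A connected set with more than one point has no isolated points. This lets the identity theorem
be applied along the curve in `eq_const_of_glue`. -/
theorem accPt_curve (hf : Loop f σ δ) (hw : w ∈ curveOf f) : AccPt w (𝓟 (curveOf f)) := by
  have hi := unit_sphere_subset_annulus hf.one_lt
  have hp : IsPreconnected (curveOf f) :=
    (isPreconnected_sphere (by simp) 0 1).image _ (hf.diff.continuousOn.mono hi)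
  have hn : (curveOf f).Nontrivial := by
    refine ⟨f 1, ⟨1, by simp, rfl⟩, f (-1), ⟨-1, by simp, rfl⟩, fun e => ?_⟩
    have := hf.injOn (hi (by simp)) (hi (by simp)) e
    norm_num at this
  exact hp.preperfect_of_nontrivial hn w hw

/-- Two functions that are holomorphic on the closed inside and the closed outside, agree on the
curve and tend to `c` at infinity are equal to `c`. -/
theorem eq_const_of_glue (hf : Loop f σ δ) {F G : ℂ → ℂ} {c : ℂ}
    (hF : AnalyticOnNhd ℂ F (curveOf f ∪ insideOf f))
    (hG : AnalyticOnNhd ℂ G (curveOf f ∪ outsideOf f)) (hFG : ∀ w ∈ curveOf f, F w = G w)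
    (hc : Tendsto G (cobounded ℂ) (𝓝 c)) :
    (∀ w ∈ curveOf f ∪ insideOf f, F w = c) ∧ ∀ w ∈ curveOf f ∪ outsideOf f, G w = c := by
  classical
  -- On the curve itself H is F. Near a point of the curve F and G agree by the identity theorem, so
  -- H is entire and Liouville's theorem applies.
  set H : ℂ → ℂ := fun w => if w ∈ outsideOf f then G w else F w with hH
  have hin : ∀ w ∈ insideOf f, w ∉ outsideOf f := fun w h1 h2 => h1.2 h2.2
  have hcur : ∀ w ∈ curveOf f, w ∉ outsideOf f := fun w h1 h2 => h2.1 h1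
  have hd : Differentiable ℂ H := by
    intro w
    by_cases h1 : w ∈ curveOf f
    · have hfr : ∃ᶠ y in 𝓝[≠] w, F y = G y := by
        have := accPt_iff_frequently_nhdsNE.1 (hf.accPt_curve h1)
        exact this.mono fun y hy => hFG y hy
      have := ((hF w (.inl h1)).frequently_eq_iff_eventually_eq (hG w (.inl h1))).1 hfr
      refine (hF w (.inl h1)).differentiableAt.congr_of_eventuallyEq ?_
      filter_upwards [this] with y hy
      simp only [hH]
      split_ifs
      · exact hy.symm
      · rfl
    · by_cases h2 : w ∈ outsideOf f
      · refine (hG w (.inr h2)).differentiableAt.congr_of_eventuallyEq ?_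
        filter_upwards [hf.isOpen_outside.mem_nhds h2] with y hy
        simp only [hH, if_pos hy]
      · have h3 : w ∈ insideOf f := ⟨h1, fun h => h2 ⟨h1, h⟩⟩
        refine (hF w (.inr h3)).differentiableAt.congr_of_eventuallyEq ?_
        filter_upwards [hf.isOpen_inside.mem_nhds h3] with y hy
        simp only [hH, if_neg (hin y hy)]
  have ht : Tendsto H (cocompact ℂ) (𝓝 c) := by
    rw [← cobounded_eq_cocompact]
    refine hc.congr' ?_
    filter_upwards [hf.eventually_mem_outside] with y hy
    simp only [hH, if_pos hy]
  have hconst := hd.eq_const_of_tendsto_cocompact ht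
  have hval : ∀ w, H w = c := fun w => by rw [hconst]; rfl
  have hFv : ∀ w, w ∉ outsideOf f → F w = c := fun w hw => by
    have := hval w
    simpa only [hH, if_neg hw] using this
  refine ⟨?_, ?_⟩
  · rintro w (h | h)
    · exact hFv w (hcur w h)
    · exact hFv w (hin w h)
  · rintro w (h | h)
    · rw [← hFG w h]; exact hFv w (hcur w h)
    · have := hval w
      simpa only [hH, if_pos h] using this

end Loop

/-! ### Laurent expansions and primitives -/

section Laurent

variable {f : ℂ → ℂ} {σ : ℝ} {z : ℂ}

theorem exists_decay_laurentCoeff {τ : ℝ} (hτ : 1 < τ) (hτσ : τ < σ)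
    (hf : DifferentiableOn ℂ f (annulus σ)) : ∃ C, Decay τ C (laurentCoeff f) := by
  have hi : σ⁻¹ < τ⁻¹ := inv_strictAnti₀ (by linarith) hτσ
  have hi1 := inv_lt_one_of_one_lt₀ hτ
  have h1 := hf.continuousOn.mono (sphere_subset_annulus (by linarith) hτσ)
  have h2 := hf.continuousOn.mono (sphere_subset_annulus hi (by linarith))
  obtain ⟨B, hB0, hB⟩ := exists_bound_sphere h1
  obtain ⟨D, hD0, hD⟩ := exists_bound_sphere h2
  exact ⟨max B D, decay_laurentCoeff hτ hτσ hf (fun z hz => (hB z hz).trans (le_max_left _ _))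
    fun z hz => (hD z hz).trans (le_max_right _ _)⟩

/-- Cauchy's formula on an annulus is `Univalent.circleIntegral_sub` for the identity map; the outer
and the inner Cauchy transform expand into the nonnegative and the negative powers. -/
theorem hasSum_laurentCoeff (hσ : 1 < σ) (hf : DifferentiableOn ℂ f (annulus σ))
    (hz : z ∈ annulus σ) : HasSum (fun i => laurentCoeff f i * z ^ i) (f z) := by
  obtain ⟨a, ha, haz⟩ := exists_between hz.1
  obtain ⟨b, hbz, hb⟩ := exists_between hz.2
  have hinv : 0 < σ⁻¹ := by positivity
  have ha0 : 0 < a := by linarith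
  have hb0 : 0 < b := by linarith
  have key := (univalent_id hσ).circleIntegral_sub hf ha hb haz hbz
  have e : f z = cauchyTr f (fun y => y) b z - cauchyTr f (fun y => y) a z := by
    rw [cauchyTr, cauchyTr, ← mul_sub, key, deriv_id'', div_one,
      inv_mul_cancel_left₀ Complex.two_pi_I_ne_zero]
  have hcoef : ∀ (r : ℝ), σ⁻¹ < r → r < σ → ∀ i : ℤ,
      laurentCoeff f i = (2 * π * Complex.I)⁻¹ * ∮ y in C(0, r), f y * y ^ (-i - 1) := fun r h1 h2 i =>
    unitContour_eq_of_annulus hσ (hf.mul (differentiableOn_zpow_annulus hσ _)) h1 h2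
  have h1 := cauchyTr_hasSum (w₀ := 0) (w := z) hb0.le (hf.continuousOn.mono
    (sphere_subset_annulus (by linarith) hb)) (ψ := fun y => y) continuousOn_id hb0
    (fun y hy => by rw [sub_zero, mem_sphere_zero_iff_norm.1 hy]) hbz
  have h2 := cauchyTr_hasSum_of_lt (w := z) ha0.le (hf.continuousOn.mono
    (sphere_subset_annulus ha (by linarith))) (ψ := fun y => y) continuousOn_id ha0.le
    (fun y hy => (mem_sphere_zero_iff_norm.1 hy).le) haz
  rw [zero_add] at h1
  rw [e, sub_eq_add_neg]
  refine HasSum.of_nat_of_neg_add_one (HasSum.of_eq h1 (fun n => ?_) rfl)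
    (HasSum.of_eq h2.neg (fun n => ?_) rfl)
  · rw [hcoef b (by linarith) hb, mul_comm, zpow_natCast]
    congr 2
    refine circleIntegral.integral_congr hb0.le fun y hy => ?_
    simp only [sub_zero]
    rw [← zpow_natCast y, ← zpow_neg]
    congr 2
    push_cast; ring
  · have e1 : (∮ y in C(0, a), f y * y ^ (-(-((n : ℤ) + 1)) - 1)) = ∮ y in C(0, a), f y * y ^ n := by
      refine circleIntegral.integral_congr ha0.le fun y hy => ?_
      rw [← zpow_natCast y]
      congr 2
      ring
    rw [hcoef a ha (by linarith), e1, zpow_neg, neg_neg, ← zpow_natCast z]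
    push_cast
    ring

theorem laurentSum_laurentCoeff (hσ : 1 < σ) (hf : DifferentiableOn ℂ f (annulus σ))
    (hz : z ∈ annulus σ) : laurentSum (laurentCoeff f) z = f z :=
  (hasSum_laurentCoeff hσ hf hz).tsum_eq

theorem exists_primitive (hσ : 1 < σ) (hf : DifferentiableOn ℂ f (annulus σ))
    (h0 : unitContour f = 0) : ∃ F : ℂ → ℂ, ∀ z ∈ annulus σ, HasDerivAt F (f z) z := by
  set X := laurentCoeff f with hX
  -- At i = 0 division by zero makes the coefficient 0, which is consistent because X (-1), the
  -- integral of f, vanishes.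
  set Y : ℤ → ℂ := fun i => X (i - 1) / i with hY
  have hX0 : X (-1) = 0 := by
    rw [hX, laurentCoeff, ← h0]
    simp
  refine ⟨laurentSum Y, fun z hz => ?_⟩
  obtain ⟨τ, h1, h2, h3⟩ := exists_between_of_mem_annulus hσ hz
  obtain ⟨C, hC⟩ := exists_decay_laurentCoeff h1 h2 hf
  have hτ0 : 0 < τ := by linarith
  have hD : Decay τ (C * τ) Y := by
    intro i
    rcases eq_or_ne i 0 with rfl | hi
    · simp only [hY]
      have := hC.nonneg
      simp
      positivity
    · have h4 : (1 : ℝ) ≤ ‖(i : ℂ)‖ := by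
        rw [Complex.norm_intCast]
        exact_mod_cast Int.one_le_abs hi
      calc ‖Y i‖ = ‖X (i - 1)‖ / ‖(i : ℂ)‖ := norm_div _ _
        _ ≤ ‖X (i - 1)‖ := div_le_self (norm_nonneg _) h4
        _ ≤ C * τ ^ (-|i - 1|) := hC _
        _ ≤ C * (τ * τ ^ (-|i|)) := by
          refine mul_le_mul_of_nonneg_left ?_ hC.nonneg
          rw [← zpow_one_add₀ hτ0.ne']
          refine zpow_le_zpow_right₀ h1.le ?_
          have := abs_sub_abs_le_abs_sub i 1
          have h5 : |i| ≤ |i - 1| + 1 := by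
            calc |i| = |(i - 1) + 1| := by ring_nf
              _ ≤ _ := abs_add_le _ _
          linarith
        _ = _ := by ring
  have hd := hD.hasDerivAt h1 h3
  have hs := (Equiv.subRight (1 : ℤ)).hasSum_iff.2 (hasSum_laurentCoeff hσ hf hz)
  have : deriv (laurentSum Y) z = f z := by
    refine hd.unique (HasSum.of_eq hs (fun i => ?_) rfl)
    simp only [hY, Function.comp, Equiv.subRight_apply]
    rcases eq_or_ne i 0 with rfl | hi
    · simp [← hX, hX0]
    · have : (i : ℂ) ≠ 0 := Int.cast_ne_zero.2 hi
      rw [hX]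
      field_simp
  rw [← this]
  exact ((hD.differentiableOn h1).differentiableAt (annulus_mem_nhds h3)).hasDerivAt

end Laurent

namespace Loop

variable {f φ : ℂ → ℂ} {σ δ : ℝ} {z w : ℂ}

/-- F ∘ f is holomorphic on σ⁻¹ < |z| < b and vanishes for |z| < 1, so the identity theorem carries
the vanishing across the curve. This is meant for Cauchy transforms over circles of radius at least
b. -/
theorem vanish_inner (hf : Loop f σ δ) {b : ℝ} (hb1 : 1 < b) (hb : b ≤ σ) {F : ℂ → ℂ}
    (h1 : AnalyticOnNhd ℂ F (insideOf f)) (h2 : ∀ z : ℂ, 1 ≤ ‖z‖ → ‖z‖ < b → AnalyticAt ℂ F (f z))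
    (h0 : ∀ᶠ w in 𝓝 0, F w = 0) (hz1 : σ⁻¹ < ‖z‖) (hz2 : ‖z‖ < b) : F (f z) = 0 := by
  have hσ := hf.one_lt
  have hi : σ⁻¹ < 1 := inv_lt_one_of_one_lt₀ hσ
  have hsub : {z : ℂ | σ⁻¹ < ‖z‖ ∧ ‖z‖ < b} ⊆ annulus σ := fun z hz => ⟨hz.1, hz.2.trans_le hb⟩
  have han : AnalyticOnNhd ℂ (F ∘ f) {z : ℂ | σ⁻¹ < ‖z‖ ∧ ‖z‖ < b} := by
    intro z hz
    refine AnalyticAt.comp ?_ (hf.diff.analyticAt (annulus_mem_nhds (hsub hz)))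
    rcases lt_or_ge ‖z‖ 1 with h | h
    · exact h1 _ (hf.mem_inside (hsub hz) h)
    · exact h2 z h hz.2
  obtain ⟨a, ha, ha1⟩ := exists_between hi
  have ha0 : 0 < a := lt_trans (by positivity) ha
  have hna : ‖(a : ℂ)‖ = a := by rw [Complex.norm_real, Real.norm_of_nonneg ha0.le]
  have hv := hf.eqOn_inside h1 h0
  refine han.eqOn_zero_of_preconnected_of_eventuallyEq_zero (isPreconnected_norm_between (by positivity))
    (z₀ := (a : ℂ)) ⟨by rw [hna]; exact ha, by rw [hna]; linarith⟩ ?_ ⟨hz1, hz2⟩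
  filter_upwards [(isOpen_norm_between σ⁻¹ 1).mem_nhds (show σ⁻¹ < ‖(a : ℂ)‖ ∧ ‖(a : ℂ)‖ < 1 by rw [hna]; exact ⟨ha, ha1⟩)] with y hy
  exact hv _ (hf.mem_inside ⟨hy.1, hy.2.trans hσ⟩ hy.2)

theorem vanish_outer (hf : Loop f σ δ) {a : ℝ} (ha1 : a < 1) (ha : σ⁻¹ ≤ a) {F : ℂ → ℂ}
    (h1 : AnalyticOnNhd ℂ F (outsideOf f)) (h2 : ∀ z : ℂ, a < ‖z‖ → ‖z‖ ≤ 1 → AnalyticAt ℂ F (f z))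
    (h0 : ∀ᶠ w in cobounded ℂ, F w = 0) (hz1 : a < ‖z‖) (hz2 : ‖z‖ < σ) : F (f z) = 0 := by
  have hσ := hf.one_lt
  have hi : σ⁻¹ < 1 := inv_lt_one_of_one_lt₀ hσ
  have hinv : 0 < σ⁻¹ := by positivity
  have hsub : {z : ℂ | a < ‖z‖ ∧ ‖z‖ < σ} ⊆ annulus σ := fun z hz => ⟨ha.trans_lt hz.1, hz.2⟩
  have han : AnalyticOnNhd ℂ (F ∘ f) {z : ℂ | a < ‖z‖ ∧ ‖z‖ < σ} := by
    intro z hz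
    refine AnalyticAt.comp ?_ (hf.diff.analyticAt (annulus_mem_nhds (hsub hz)))
    rcases lt_or_ge 1 ‖z‖ with h | h
    · exact h1 _ (hf.mem_outside (hsub hz) h)
    · exact h2 z hz.1 h
  obtain ⟨b, hb1, hb⟩ := exists_between hσ
  have hnb : ‖(b : ℂ)‖ = b := by rw [Complex.norm_real, Real.norm_of_nonneg (by linarith)]
  have hv := hf.eqOn_outside h1 h0
  refine han.eqOn_zero_of_preconnected_of_eventuallyEq_zero (isPreconnected_norm_between (by linarith))
    (z₀ := (b : ℂ)) ⟨by rw [hnb]; linarith, by rw [hnb]; exact hb⟩ ?_ ⟨hz1, hz2⟩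
  filter_upwards [(isOpen_norm_between 1 σ).mem_nhds (show 1 < ‖(b : ℂ)‖ ∧ ‖(b : ℂ)‖ < σ by rw [hnb]; exact ⟨hb1, hb⟩)] with y hy
  exact hv _ (hf.mem_outside ⟨hi.trans hy.1, hy.2⟩ hy.1)

theorem notMem_image_outer (hf : Loop f σ δ) {b : ℝ} (hb1 : 1 < b) (hb : b < σ)
    (hw : w ∈ curveOf f ∪ insideOf f) : w ∉ f '' sphere 0 b := by
  have hi : σ⁻¹ < 1 := inv_lt_one_of_one_lt₀ hf.one_lt
  rintro ⟨z, hz, rfl⟩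
  have hz' := mem_sphere_zero_iff_norm.1 hz
  have := hf.mem_outside (z := z) ⟨by linarith, by linarith⟩ (by linarith)
  rcases hw with h | h
  · exact this.1 h
  · exact h.2 this.2

theorem notMem_image_inner (hf : Loop f σ δ) {a : ℝ} (ha1 : a < 1) (ha : σ⁻¹ < a)
    (hw : w ∈ curveOf f ∪ outsideOf f) : w ∉ f '' sphere 0 a := by
  have hσ := hf.one_lt
  rintro ⟨z, hz, rfl⟩
  have hz' := mem_sphere_zero_iff_norm.1 hz
  have := hf.mem_inside (z := z) ⟨by linarith, by linarith⟩ (by linarith)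
  rcases hw with h | h
  · exact this.1 h
  · exact this.2 h.2

theorem differentiableOn_zpow (hf : Loop f σ δ) (i : ℤ) :
    DifferentiableOn ℂ (fun z => f z ^ i) (annulus σ) := fun z hz =>
  ((hf.differentiableAt hz).zpow (.inl (hf.ne_zero z hz))).differentiableWithinAt

/-- The powers of `f` are total: a function orthogonal to all of them vanishes. -/
theorem eq_zero_of_orthogonal (hf : Loop f σ δ) (hφ : DifferentiableOn ℂ φ (annulus σ))
    (h : ∀ i : ℤ, unitContour (fun z => φ z * f z ^ i) = 0) : ∀ z ∈ sphere (0 : ℂ) 1, φ z = 0 := by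
  intro z hz
  have hσ := hf.one_lt
  have hi : σ⁻¹ < 1 := inv_lt_one_of_one_lt₀ hσ
  obtain ⟨a, ha, ha1⟩ := exists_between hi
  obtain ⟨b, hb1, hb⟩ := exists_between hσ
  have ha0 : 0 < a := lt_trans (by positivity) ha
  have hb0 : 0 < b := by linarith
  have hsa := sphere_subset_annulus ha (by linarith)
  have hsb := sphere_subset_annulus (by linarith) hb
  have hz' := mem_sphere_zero_iff_norm.1 hz
  have hint : ∀ r, σ⁻¹ < r → r < σ → ∀ i : ℤ,
      (2 * π * Complex.I)⁻¹ * (∮ y in C(0, r), φ y * f y ^ i) = 0 := fun r h1 h2 i =>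
    (unitContour_eq_of_annulus hσ (hφ.mul (hf.differentiableOn_zpow i)) h1 h2).symm.trans (h i)
  -- The Taylor coefficients at 0 of the outer transform are the pairings with negative powers of f,
  -- so it vanishes near 0 and hence up to the curve and beyond. The inner transform vanishes in the
  -- same way, starting from infinity. Their difference φ z / f'(z) is therefore 0.
  have hI : cauchyTr φ f b (f z) = 0 := by
    refine hf.vanish_inner hb1 hb.le (fun w hw => ?_) (fun y h1 h2 => ?_) ?_ (by linarith) (by linarith)
    · exact cauchyTr_analyticAt hb0.le (hφ.continuousOn.mono hsb) (hf.diff.continuousOn.mono hsb)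
        (hf.notMem_image_outer hb1 hb (.inr hw))
    · exact cauchyTr_analyticAt hb0.le (hφ.continuousOn.mono hsb) (hf.diff.continuousOn.mono hsb)
        (hf.notMem_image_sphere (by linarith) hb ⟨by linarith, by linarith⟩ h2.ne)
    · filter_upwards [cauchyTr_hasSum_zero hb0.le (hφ.continuousOn.mono hsb)
        (hf.diff.continuousOn.mono hsb) fun y hy => hf.ne_zero y (hsb hy)] with w hw
      refine hw.unique (HasSum.of_eq hasSum_zero (fun n => ?_) rfl)
      have := hint b (by linarith) hb (-(n + 1 : ℕ))
      simp only [zpow_neg, zpow_natCast] at this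
      rw [this, mul_zero]
  have hE : cauchyTr φ f a (f z) = 0 := by
    refine hf.vanish_outer ha1 ha.le (fun w hw => ?_) (fun y h1 h2 => ?_) ?_ (by linarith) (by linarith)
    · exact cauchyTr_analyticAt ha0.le (hφ.continuousOn.mono hsa) (hf.diff.continuousOn.mono hsa)
        (hf.notMem_image_inner ha1 ha (.inr hw))
    · exact cauchyTr_analyticAt ha0.le (hφ.continuousOn.mono hsa) (hf.diff.continuousOn.mono hsa)
        (hf.notMem_image_sphere ha (by linarith) ⟨by linarith, by linarith⟩ h1.ne')
    · filter_upwards [cauchyTr_hasSum_infty ha0.le (hφ.continuousOn.mono hsa)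
        (hf.diff.continuousOn.mono hsa)] with w hw
      refine hw.unique (HasSum.of_eq hasSum_zero (fun n => ?_) rfl)
      have := hint a ha (by linarith) n
      simp only [zpow_natCast] at this
      rw [this, mul_zero, neg_zero]
  have := hf.circleIntegral_sub (z := z) hφ ha hb (by linarith) (by linarith)
  have h2 : 2 * π * Complex.I * (φ z / deriv f z) = 0 := by
    have e1 : (∮ y in C(0, b), φ y / (f y - f z)) = 0 :=
      (mul_eq_zero.1 hI).resolve_left (inv_ne_zero Complex.two_pi_I_ne_zero)
    have e2 : (∮ y in C(0, a), φ y / (f y - f z)) = 0 :=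
      (mul_eq_zero.1 hE).resolve_left (inv_ne_zero Complex.two_pi_I_ne_zero)
    rw [← this, e1, e2, sub_zero]
  have h3 := (mul_eq_zero.1 h2).resolve_left Complex.two_pi_I_ne_zero
  exact (div_eq_zero_iff.1 h3).resolve_right (hf.deriv_ne_zero (unit_sphere_subset_annulus hσ hz))

/-- A branch of `log (z / f(z))` on the annulus. -/
theorem exists_log (hf : Loop f σ δ) : ∃ L : ℂ → ℂ, ∀ z ∈ annulus σ,
    HasDerivAt L (z⁻¹ - deriv f z / f z) z ∧ Complex.exp (L z) = z / f z := by
  have hσ := hf.one_lt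
  have h1 : DifferentiableOn ℂ (fun z : ℂ => z⁻¹) (annulus σ) :=
    fun z hz => (differentiableAt_inv (ne_zero_of_mem_annulus hσ hz)).differentiableWithinAt
  have h2 : DifferentiableOn ℂ (fun z => deriv f z / f z) (annulus σ) :=
    (differentiableOn_deriv_annulus hf.diff).div hf.diff hf.ne_zero
  have hsub := unit_sphere_subset_annulus hσ
  -- Both z and f wind once around 0, so the difference of their logarithmic derivatives has zero
  -- integral and a single-valued primitive.
  obtain ⟨F, hF⟩ := exists_primitive hσ (h1.sub h2) (by
    rw [unitContour]
    have e : (∮ z in C(0, 1), ((fun z : ℂ => z⁻¹) - fun z => deriv f z / f z) z) =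
      (∮ z in C(0, 1), z⁻¹) - ∮ z in C(0, 1), deriv f z / f z :=
      circleIntegral.integral_sub ((h1.continuousOn.mono hsub).circleIntegrable zero_le_one)
        ((h2.continuousOn.mono hsub).circleIntegrable zero_le_one)
    have hw := hf.wind
    simp only [windNum, cauchyTr, sub_zero] at hw
    have h3 : (∮ z in C((0 : ℂ), 1), z⁻¹) = 2 * π * Complex.I := by
      simpa using circleIntegral.integral_sub_center_inv 0 one_ne_zero
    rw [e, mul_sub, hw, h3, inv_mul_cancel₀ Complex.two_pi_I_ne_zero, sub_self])
  have hz0 : ∀ z ∈ annulus σ, z ≠ 0 := fun z hz => ne_zero_of_mem_annulus hσ hz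
  set G : ℂ → ℂ := fun z => Complex.exp (F z) * (f z / z) with hG
  have hGd : ∀ z ∈ annulus σ, HasDerivAt G 0 z := by
    intro z hz
    have h3 := (hF z hz).cexp.fun_mul ((hf.differentiableAt hz).hasDerivAt.fun_div (hasDerivAt_id z) (hz0 z hz))
    refine h3.congr_deriv ?_
    have := hz0 z hz
    have := hf.ne_zero z hz
    simp only [Pi.sub_apply, id]
    field_simp
    ring
  have hone : (1 : ℂ) ∈ annulus σ := hsub (by simp)
  have hconst : ∀ z ∈ annulus σ, G z = G 1 := fun z hz =>
    (isOpen_annulus σ).is_const_of_deriv_eq_zero (isPreconnected_annulus hσ)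
      (fun z hz => (hGd z hz).differentiableAt.differentiableWithinAt)
      (fun z hz => (hGd z hz).deriv) hz hone
  have hG1 : G 1 ≠ 0 := by
    simp only [hG, div_one]
    exact mul_ne_zero (Complex.exp_ne_zero _) (hf.ne_zero 1 hone)
  refine ⟨fun z => F z - Complex.log (G 1), fun z hz => ⟨(hF z hz).sub_const _, ?_⟩⟩
  rw [Complex.exp_sub, Complex.exp_log hG1, ← hconst z hz]
  have := hz0 z hz
  have := hf.ne_zero z hz
  have := Complex.exp_ne_zero (F z)
  simp only [hG]
  field_simp

end Loop

/-! ### The coordinates `tⁱ` -/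

theorem unitContour_add {f g : ℂ → ℂ} (hf : ContinuousOn f (sphere 0 1))
    (hg : ContinuousOn g (sphere 0 1)) :
    unitContour (fun z => f z + g z) = unitContour f + unitContour g := by
  rw [unitContour, circleIntegral.integral_add (hf.circleIntegrable zero_le_one)
    (hg.circleIntegrable zero_le_one), mul_add]
  rfl

theorem unitContour_sub {f g : ℂ → ℂ} (hf : ContinuousOn f (sphere 0 1))
    (hg : ContinuousOn g (sphere 0 1)) :
    unitContour (fun z => f z - g z) = unitContour f - unitContour g := by
  rw [unitContour, circleIntegral.integral_sub (hf.circleIntegrable zero_le_one)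
    (hg.circleIntegrable zero_le_one), mul_sub]
  rfl

theorem unitContour_const_mul (c : ℂ) (f : ℂ → ℂ) :
    unitContour (fun z => c * f z) = c * unitContour f := by
  rw [unitContour, circleIntegral.integral_const_mul, mul_left_comm]
  rfl

/-- The exponential of the difference of the two sums is identically 1, so the difference has zero
derivative and is constant. The constant is a period of exp, and only the coefficients of index 0
can differ. -/
theorem coeff_eq_of_exp_hasSum {c d : ℕ → ℂ} (h : ∀ᶠ w in 𝓝 (0 : ℂ), ∃ S T : ℂ,
    HasSum (fun n : ℕ => c n * w ^ n) S ∧ HasSum (fun n : ℕ => d n * w ^ n) T ∧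
      Complex.exp S = Complex.exp T) :
    Complex.exp (c 0) = Complex.exp (d 0) ∧ ∀ n, n ≠ 0 → c n = d n := by
  set U : ℂ → ℂ := fun w => ∑' n : ℕ, (c n - d n) * w ^ n with hU
  have hs : ∀ᶠ w in 𝓝 (0 : ℂ), HasSum (fun n : ℕ => (c n - d n) * w ^ n) (U w) ∧
      Complex.exp (U w) = 1 := by
    filter_upwards [h] with w ⟨S, T, hS, hT, he⟩
    have h1 : HasSum (fun n : ℕ => (c n - d n) * w ^ n) (S - T) :=
      HasSum.of_eq (hS.sub hT) (fun n => by ring) rfl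
    have h2 : U w = S - T := h1.tsum_eq
    exact ⟨h2 ▸ h1, by rw [h2, Complex.exp_sub, he, div_self (Complex.exp_ne_zero _)]⟩
  have hp : HasFPowerSeriesAt U (FormalMultilinearSeries.ofScalars ℂ fun n => c n - d n) 0 := by
    refine hasFPowerSeriesAt_of_hasSum ?_
    filter_upwards [hs] with w hw
    simpa using hw.1
  have han := hp.analyticAt
  have hU0 : U 0 = c 0 - d 0 := by
    refine hs.self_of_nhds.1.unique (HasSum.of_eq (hasSum_ite_eq 0 (c 0 - d 0)) (fun n => ?_) rfl)
    rcases eq_or_ne n 0 with rfl | hn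
    · simp
    · simp [hn]
  have hd : ∀ᶠ w in 𝓝 (0 : ℂ), deriv U w = 0 := by
    have h1 : ∀ᶠ w in 𝓝 (0 : ℂ), (fun y => Complex.exp (U y)) =ᶠ[𝓝 w] fun _ => 1 := by
      have := (hs.mono fun w hw => hw.2).eventually_nhds
      exact this
    filter_upwards [h1, han.eventually_analyticAt] with w hw hw'
    have h2 := hw'.differentiableAt.hasDerivAt.cexp
    have h3 := (hasDerivAt_const w (1 : ℂ)).congr_of_eventuallyEq hw
    have h4 := h2.unique h3
    exact (mul_eq_zero.1 h4).resolve_left (Complex.exp_ne_zero _)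
  have hconst : ∀ᶠ w in 𝓝 (0 : ℂ), U w = c 0 - d 0 := by
    obtain ⟨ε, hε, h1⟩ := Metric.eventually_nhds_iff_ball.1 (hd.and han.eventually_analyticAt)
    filter_upwards [ball_mem_nhds (0 : ℂ) hε] with w hw
    rw [← hU0]
    exact isOpen_ball.is_const_of_deriv_eq_zero (convex_ball (0 : ℂ) ε).isPreconnected
      (fun y hy => (h1 y hy).2.differentiableAt.differentiableWithinAt) (fun y hy => (h1 y hy).1) hw
      (mem_ball_self hε)
  refine ⟨?_, fun n hn => ?_⟩
  · have := hs.self_of_nhds.2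
    rw [hU0, Complex.exp_sub, div_eq_one_iff_eq (Complex.exp_ne_zero _)] at this
    exact this
  · have := coeff_eq_of_hasSum (c := fun n => c n - d n) (d := fun n => if n = 0 then c 0 - d 0 else 0) (by
      filter_upwards [hs, hconst] with w hw hw'
      refine ⟨U w, hw.1, ?_⟩
      rw [hw']
      refine HasSum.of_eq (hasSum_ite_eq 0 (c 0 - d 0)) (fun n => ?_) rfl
      rcases eq_or_ne n 0 with rfl | hn
      · simp
      · simp [hn])
    have h1 := congrFun this n
    simp only [if_neg hn] at h1
    exact sub_eq_zero.1 h1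

theorem exp_eq_iff_exists {a b : ℂ} :
    Complex.exp a = Complex.exp b ↔ ∃ n : ℤ, a = b + n * (2 * π * Complex.I) :=
  Complex.exp_eq_exp_iff_exists_int

/-- The contour form of the coordinates `tⁱ`, written with a logarithm `L` of `z / f(z)`. -/
noncomputable def tFun (f L : ℂ → ℂ) (i : ℤ) : ℂ :=
  if i = 0 then unitContour fun z => L z / z else unitContour fun z => f z ^ (-i) / i / z

section Parts

variable {f L : ℂ → ℂ} {σ δ : ℝ}

theorem unitContour_sub_eq_zero {g h P : ℂ → ℂ} (hg : ContinuousOn g (sphere 0 1))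
    (hh : ContinuousOn h (sphere 0 1))
    (hP : ∀ z ∈ sphere (0 : ℂ) 1, HasDerivAt P (g z - h z) z) : unitContour g = unitContour h := by
  have := circleIntegral.integral_eq_zero_of_hasDerivWithinAt zero_le_one
    fun z hz => (hP z hz).hasDerivWithinAt
  rw [circleIntegral.integral_sub (hg.circleIntegrable zero_le_one)
    (hh.circleIntegrable zero_le_one), sub_eq_zero] at this
  rw [unitContour, unitContour, this]

/-- Integration by parts with dL = dz/z - df/f: the primitives are -L²/2 for i = 0 and -L f^(-i)/i +
f^(-i)/i² otherwise. The left side is the form in which the coefficients of the Cauchy transform of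
L df appear. -/
theorem Loop.contour_log (hf : Loop f σ δ)
    (hL : ∀ z ∈ annulus σ, HasDerivAt L (z⁻¹ - deriv f z / f z) z) (i : ℤ) :
    unitContour (fun z => L z * deriv f z * f z ^ (-i - 1)) = tFun f L i := by
  have hσ := hf.one_lt
  have hsub := unit_sphere_subset_annulus hσ
  have hLc : ContinuousOn L (sphere 0 1) := fun z hz =>
    (hL z (hsub hz)).continuousAt.continuousWithinAt
  have hfc := hf.diff.continuousOn.mono hsub
  have hdc := (differentiableOn_deriv_annulus hf.diff).continuousOn.mono hsub
  have hzc : ∀ j : ℤ, ContinuousOn (fun z => f z ^ j) (sphere 0 1) := fun j =>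
    (hf.differentiableOn_zpow j).continuousOn.mono hsub
  have hz0 : ∀ z ∈ sphere (0 : ℂ) 1, z ≠ 0 := fun z hz => ne_zero_of_mem_annulus hσ (hsub hz)
  rw [tFun]
  split_ifs with h
  · subst h
    refine unitContour_sub_eq_zero (P := fun z => -(L z ^ 2) / 2) ((hLc.mul hdc).mul (hzc _))
      (hLc.div continuousOn_id hz0) fun z hz => ?_
    refine (((hL z (hsub hz)).fun_pow 2).fun_neg.div_const 2).congr_deriv ?_
    have := hz0 z hz
    have := hf.ne_zero z (hsub hz)
    simp
    field_simp
    ring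
  · have hi : (i : ℂ) ≠ 0 := Int.cast_ne_zero.2 h
    refine unitContour_sub_eq_zero (P := fun z => -(L z * f z ^ (-i)) / i + f z ^ (-i) / i ^ 2)
      ((hLc.mul hdc).mul (hzc _)) (((hzc _).div_const _).div continuousOn_id hz0) fun z hz => ?_
    have h0 := hz0 z hz
    have hf0 := hf.ne_zero z (hsub hz)
    have h1 := (hasDerivAt_zpow (-i) (f z) (.inl hf0)).comp z
      (hf.differentiableAt (hsub hz)).hasDerivAt
    have h2 := (((hL z (hsub hz)).fun_mul h1).fun_neg.div_const (i : ℂ)).fun_add (h1.div_const ((i : ℂ) ^ 2))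
    refine h2.congr_deriv ?_
    simp only [Function.comp]
    rw [zpow_sub_one₀ hf0]
    push_cast
    field_simp
    ring

end Parts

variable {N M : ℕ} {p : Model N M} {σ δ : ℝ} {L : ℂ → ℂ} {t t' : ℤ → ℂ}

/-- Let C_b and C_a be the Cauchy transforms of L dζ over circles slightly outside and slightly
inside the unit circle. The factors are exp(-C_b) and w exp(-C_a). Each is holomorphic a little
beyond Γ from its own side, and C_b - C_a = L on Γ is the factorization. The expansions are read off
from `Loop.contour_log`. -/
theorem isFactorizationT_tFun (hf : Loop (zeta p) σ δ) (hL : ∀ z ∈ annulus σ,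
    HasDerivAt L (z⁻¹ - deriv (zeta p) z / zeta p z) z ∧ Complex.exp (L z) = z / zeta p z) :
    IsFactorizationT p (tFun (zeta p) L) := by
  have hσ := hf.one_lt
  set f := zeta p with hfdef
  have hi : σ⁻¹ < 1 := inv_lt_one_of_one_lt₀ hσ
  obtain ⟨a, ha, ha1⟩ := exists_between hi
  obtain ⟨b, hb1, hb⟩ := exists_between hσ
  have ha0 : 0 < a := lt_trans (by positivity) ha
  have hb0 : 0 < b := by linarith
  have hsub := unit_sphere_subset_annulus hσ
  have hsa := sphere_subset_annulus ha (by linarith)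
  have hsb := sphere_subset_annulus (by linarith) hb
  set φ : ℂ → ℂ := fun z => L z * deriv f z with hφdef
  have hφ : DifferentiableOn ℂ φ (annulus σ) := fun z hz =>
    ((hL z hz).1.differentiableAt.mul ((differentiableOn_deriv_annulus hf.diff).differentiableAt
      (annulus_mem_nhds hz))).differentiableWithinAt
  have hint : ∀ r, σ⁻¹ < r → r < σ → ∀ i : ℤ,
      (2 * π * Complex.I)⁻¹ * (∮ y in C(0, r), φ y * f y ^ (-i - 1)) = tFun f L i := fun r h1 h2 i =>
    (unitContour_eq_of_annulus hσ (hφ.mul (hf.differentiableOn_zpow (-i - 1))) h1 h2).symm.trans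
      (hf.contour_log (fun z hz => (hL z hz).1) i)
  have hIan : ∀ w ∈ curve p ∪ inside p, AnalyticAt ℂ (cauchyTr φ f b) w := fun w hw =>
    cauchyTr_analyticAt hb0.le (hφ.continuousOn.mono hsb) (hf.diff.continuousOn.mono hsb)
      (hf.notMem_image_outer hb1 hb hw)
  have hEan : ∀ w ∈ curve p ∪ outside p, AnalyticAt ℂ (cauchyTr φ f a) w := fun w hw =>
    cauchyTr_analyticAt ha0.le (hφ.continuousOn.mono hsa) (hf.diff.continuousOn.mono hsa)
      (hf.notMem_image_inner ha1 ha hw)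
  have hw0 : ∀ w ∈ curve p ∪ outside p, w ≠ 0 := by
    rintro w (⟨z, hz, rfl⟩ | h) rfl'
    · exact hf.ne_zero z (hsub hz) rfl'
    · subst rfl'
      exact hf.zero_mem_inside.2 h.2
  have hcb : Tendsto (fun w : ℂ => w⁻¹) (cobounded ℂ) (𝓝 0) := tendsto_inv₀_cobounded
  have hEt : cauchyTr φ f a =O[cobounded ℂ] fun w => w⁻¹ :=
    cauchyTr_tendsto ha0.le (hφ.continuousOn.mono hsa) (hf.diff.continuousOn.mono hsa)
  have hne0 : ∀ᶠ w : ℂ in cobounded ℂ, w ≠ 0 := by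
    simpa using (tendsto_norm_cobounded_atTop (E := ℂ)).eventually_gt_atTop 0
  refine ⟨fun w => Complex.exp (-cauchyTr φ f b w), fun w => w * Complex.exp (-cauchyTr φ f a w),
    ⟨?_, ?_, ?_, ?_, ?_, ?_⟩, ?_, ?_⟩
  · exact fun w hw => (hIan w hw).neg.cexp
  · exact fun w _ => Complex.exp_ne_zero _
  · intro w hw
    refine (hEan w hw).neg.cexp.congr ?_
    filter_upwards [isOpen_ne.mem_nhds (hw0 w hw)] with y hy
    rw [mul_div_cancel_left₀ _ hy]
    rfl
  · intro w hw
    rw [mul_div_cancel_left₀ _ (hw0 w hw)]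
    exact Complex.exp_ne_zero _
  · have h1 : (fun w => Complex.exp (-cauchyTr φ f a w) - 1) =O[cobounded ℂ] fun w => w⁻¹ := by
      have h2 : (fun u => Complex.exp (-u) - 1) =O[𝓝 0] fun u : ℂ => u := by
        have h3 : HasDerivAt (fun u : ℂ => Complex.exp (-u)) _ 0 := (hasDerivAt_neg (0 : ℂ)).cexp
        simpa using h3.isBigO_sub
      exact (h2.comp_tendsto (hEt.trans_tendsto hcb)).trans hEt
    have h2 := (isBigO_refl (fun w : ℂ => w) (cobounded ℂ)).mul h1
    refine (h2.congr_left fun w => ?_).trans ?_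
    · ring
    · refine IsBigO.of_bound 1 ?_
      filter_upwards [hne0] with w hw
      simp [hw]
  · intro z hz
    have hz' := mem_sphere_zero_iff_norm.1 hz
    have key := hf.circleIntegral_sub (z := z) hφ ha hb (by linarith) (by linarith)
    have hd := hf.deriv_ne_zero (hsub hz)
    have e : cauchyTr φ f b (f z) - cauchyTr φ f a (f z) = L z := by
      rw [cauchyTr, cauchyTr, ← mul_sub, key, inv_mul_cancel_left₀ Complex.two_pi_I_ne_zero, hφdef]
      exact mul_div_cancel_right₀ _ hd
    have h0 := hf.ne_zero z (hsub hz)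
    have h1 := (hL z (hsub hz)).2
    rw [← e, Complex.exp_sub] at h1
    rw [Complex.exp_neg, Complex.exp_neg, inv_inv]
    have h2 := Complex.exp_ne_zero (cauchyTr φ f a (f z))
    field_simp at h1 ⊢
    linear_combination -h1
  · filter_upwards [cauchyTr_hasSum_zero hb0.le (hφ.continuousOn.mono hsb)
        (hf.diff.continuousOn.mono hsb) fun y hy => hf.ne_zero y (hsb hy)] with w hw
    refine ⟨_, HasSum.of_eq hw (fun n => ?_) rfl, rfl⟩
    have := hint b (by linarith) hb n
    have e : (-(n : ℤ) - 1) = -(n + 1 : ℕ) := by push_cast; ring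
    rw [e] at this
    simp only [zpow_neg, zpow_natCast] at this
    rw [this, mul_comm]
  · filter_upwards [cauchyTr_hasSum_infty ha0.le (hφ.continuousOn.mono hsa)
        (hf.diff.continuousOn.mono hsa), hne0] with w hw hw'
    refine ⟨_, HasSum.of_eq hw.neg (fun n => ?_) rfl, mul_div_cancel_left₀ _ hw'⟩
    have := hint a ha (by linarith) (-((n : ℤ) + 1))
    have e : (-(-((n : ℤ) + 1)) - 1) = n := by ring
    rw [e] at this
    simp only [zpow_natCast] at this
    rw [this, neg_neg, mul_comm]

theorem IsFactorizationT.shift (h : IsFactorizationT p t) (h0 : Complex.exp (t' 0) = Complex.exp (t 0))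
    (hi : ∀ i, i ≠ 0 → t' i = t i) : IsFactorizationT p t' := by
  obtain ⟨f₀, fInf, h1, h2, h3⟩ := h
  refine ⟨f₀, fInf, h1, ?_, ?_⟩
  · filter_upwards [h2] with w ⟨S, hS, hS'⟩
    refine ⟨S + (t' 0 - t 0), HasSum.of_eq (hS.add (hasSum_ite_eq 0 (t' 0 - t 0))) (fun n => ?_) rfl, ?_⟩
    · rcases eq_or_ne n 0 with rfl | hn
      · simp
      · simp [hn, hi n (by exact_mod_cast hn)]
    · rw [hS', Complex.exp_neg, Complex.exp_neg, Complex.exp_add, Complex.exp_sub, h0,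
        div_self (Complex.exp_ne_zero _), mul_one]
  · filter_upwards [h3] with w ⟨S, hS, hS'⟩
    refine ⟨S, HasSum.of_eq hS (fun n => ?_) rfl, hS'⟩
    rw [hi _ (by omega)]

theorem IsFactorization.tendsto {f₀ fInf : ℂ → ℂ} (h : IsFactorization p f₀ fInf) :
    Tendsto (fun w => fInf w / w) (cobounded ℂ) (𝓝 1) := by
  have hne0 : ∀ᶠ w : ℂ in cobounded ℂ, w ≠ 0 := by
    simpa using (tendsto_norm_cobounded_atTop (E := ℂ)).eventually_gt_atTop 0
  have h1 := h.normalized.mul (isBigO_refl (fun w : ℂ => w⁻¹) (cobounded ℂ))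
  have h2 : Tendsto (fun w : ℂ => (1 : ℂ) * w⁻¹) (cobounded ℂ) (𝓝 0) := by
    simpa using (tendsto_inv₀_cobounded : Tendsto (fun w : ℂ => w⁻¹) (cobounded ℂ) (𝓝 0))
  have h3 := (h1.trans_tendsto h2).const_add 1
  rw [add_zero] at h3
  refine h3.congr' ?_
  filter_upwards [hne0] with w hw
  field_simp
  ring

/-- The quotient of the inner factors and the quotient of the outer factors agree on Γ, and the
latter tends to 1 at infinity, so by `Loop.eq_const_of_glue` both are 1. The coefficients of the
logarithms are then unique up to a period in t 0. -/
theorem isFactorizationT_unique (hf : Loop (zeta p) σ δ) (h : IsFactorizationT p t)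
    (h' : IsFactorizationT p t') :
    Complex.exp (t 0) = Complex.exp (t' 0) ∧ ∀ i, i ≠ 0 → t i = t' i := by
  obtain ⟨f₀, fInf, h1, h2, h3⟩ := h
  obtain ⟨f₀', fInf', h1', h2', h3'⟩ := h'
  have hsub := unit_sphere_subset_annulus hf.one_lt
  have hglue := hf.eq_const_of_glue (F := fun w => f₀ w / f₀' w)
    (G := fun w => (fInf w / w) / (fInf' w / w)) (c := 1)
    (fun w hw => (h1.analytic_inside w hw).div (h1'.analytic_inside w hw) (h1'.ne_zero_inside w hw))
    (fun w hw => (h1.analytic_outside w hw).div (h1'.analytic_outside w hw) (h1'.ne_zero_outside w hw))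
    (by
      rintro _ ⟨z, hz, rfl⟩
      have hw : zeta p z ∈ curve p := ⟨z, hz, rfl⟩
      have e1 := h1.factor z hz
      have e2 := h1'.factor z hz
      have n1 := h1.ne_zero_inside _ (.inl hw)
      have n2 := h1'.ne_zero_inside _ (.inl hw)
      have n3 := (div_ne_zero_iff.1 (h1'.ne_zero_outside _ (.inl hw))).1
      have n4 := hf.ne_zero z (hsub hz)
      have e3 : (f₀ (zeta p z))⁻¹ * fInf (zeta p z) = (f₀' (zeta p z))⁻¹ * fInf' (zeta p z) :=
        e1.symm.trans e2
      field_simp at e3 ⊢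
      linear_combination -e3)
    (by simpa [Pi.div_def] using h1.tendsto.div h1'.tendsto one_ne_zero)
  have hin := coeff_eq_of_exp_hasSum (c := fun n => t n) (d := fun n => t' n) (by
    filter_upwards [h2, h2', hf.isOpen_inside.mem_nhds hf.zero_mem_inside] with w ⟨S, hS, e⟩ ⟨S', hS', e'⟩ hw
    refine ⟨S, S', hS, hS', ?_⟩
    have := hglue.1 w (.inr hw)
    simp only [e, e', Complex.exp_neg] at this
    have := Complex.exp_ne_zero S
    have := Complex.exp_ne_zero S'
    field_simp at *
    tauto)
  -- The expansion at infinity is read in the variable w⁻¹; a zero constant term is prepended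
  -- because the series starts at w⁻¹.
  have hout := coeff_eq_of_exp_hasSum (c := fun n => if n = 0 then 0 else t (-n))
    (d := fun n => if n = 0 then 0 else t' (-n)) (by
    have key : ∀ᶠ w in cobounded ℂ, ∃ S T : ℂ,
        HasSum (fun n : ℕ => (if n = 0 then 0 else t (-n)) * w⁻¹ ^ n) S ∧
        HasSum (fun n : ℕ => (if n = 0 then 0 else t' (-n)) * w⁻¹ ^ n) T ∧
        Complex.exp S = Complex.exp T := by
      filter_upwards [h3, h3', hf.eventually_mem_outside] with w ⟨S, hS, e⟩ ⟨S', hS', e'⟩ hw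
      refine ⟨S, S', ?_, ?_, ?_⟩
      · rw [← hasSum_nat_add_iff' 1]
        refine HasSum.of_eq hS (fun n => ?_) (by simp)
        simp
      · rw [← hasSum_nat_add_iff' 1]
        refine HasSum.of_eq hS' (fun n => ?_) (by simp)
        simp
      · have := hglue.2 w (.inr hw)
        simp only [e, e'] at this
        exact (div_eq_one_iff_eq (Complex.exp_ne_zero _)).1 this
    have h4 := tendsto_inv₀_nhdsNE_zero.eventually key
    simp only [inv_inv] at h4
    have h5 := eventually_nhdsWithin_iff.1 h4
    filter_upwards [h5] with w hw
    rcases eq_or_ne w 0 with rfl | hw0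
    · refine ⟨0, 0, ?_, ?_, rfl⟩ <;>
      · refine HasSum.of_eq hasSum_zero (fun n => ?_) rfl
        rcases eq_or_ne n 0 with rfl | hn <;> simp [*]
    · exact hw hw0)
  refine ⟨by simpa using hin.1, fun i hi => ?_⟩
  obtain ⟨n, rfl | rfl⟩ := i.eq_nat_or_neg
  · exact hin.2 n (by exact_mod_cast hi)
  · have hn : n ≠ 0 := by rintro rfl; simp at hi
    simpa [hn] using hout.2 n hn

theorem isFactorizationT_iff (hf : Loop (zeta p) σ δ) (hL : ∀ z ∈ annulus σ,
    HasDerivAt L (z⁻¹ - deriv (zeta p) z / zeta p z) z ∧ Complex.exp (L z) = z / zeta p z) :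
    IsFactorizationT p t ↔ Complex.exp (t 0) = Complex.exp (tFun (zeta p) L 0) ∧
      ∀ i, i ≠ 0 → t i = tFun (zeta p) L i :=
  ⟨fun h => isFactorizationT_unique hf h (isFactorizationT_tFun hf hL),
    fun h => (isFactorizationT_tFun hf hL).shift h.1 h.2⟩

theorem unitContour_inv : unitContour (fun z => z⁻¹) = 1 := by
  have h3 : (∮ z in C((0 : ℂ), 1), z⁻¹) = 2 * π * Complex.I := by
    simpa using circleIntegral.integral_sub_center_inv 0 one_ne_zero
  rw [unitContour, h3, inv_mul_cancel₀ Complex.two_pi_I_ne_zero]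

/-- Two continuous logarithms differ by an integer multiple of 2πi that is constant on the connected
circle, and adding c to L adds c to the contour integral. Hence the contour formula has the same
indeterminacy as the factorization. -/
theorem isContourT_iff (hf : Loop (zeta p) σ δ) (hL : ∀ z ∈ annulus σ,
    HasDerivAt L (z⁻¹ - deriv (zeta p) z / zeta p z) z ∧ Complex.exp (L z) = z / zeta p z) :
    IsContourT p t ↔ Complex.exp (t 0) = Complex.exp (tFun (zeta p) L 0) ∧
      ∀ i, i ≠ 0 → t i = tFun (zeta p) L i := by
  have hsub := unit_sphere_subset_annulus hf.one_lt
  have hz0 : ∀ z ∈ sphere (0 : ℂ) 1, z ≠ 0 := fun z hz => ne_zero_of_mem_annulus hf.one_lt (hsub hz)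
  have hLc : ContinuousOn L (sphere 0 1) := fun z hz =>
    (hL z (hsub hz)).1.continuousAt.continuousWithinAt
  have hinv : ContinuousOn (fun z : ℂ => z⁻¹) (sphere 0 1) := continuousOn_id.inv₀ hz0
  have hadd : ∀ c : ℂ, unitContour (fun z => (L z + c) / z) = unitContour (fun z => L z / z) + c := by
    intro c
    have e := unitContour_add (f := fun z => L z / z) (g := fun z => c * z⁻¹)
      (hLc.div continuousOn_id hz0) (continuousOn_const.mul hinv)
    rw [unitContour_const_mul, unitContour_inv, mul_one] at e
    rw [← e]
    exact unitContour_congr fun z _ => by rw [add_div, div_eq_mul_inv c]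
  constructor
  · rintro ⟨h1, L', hL'c, hL', h2⟩
    have hex : ∀ z ∈ sphere (0 : ℂ) 1, ∃ n : ℤ, (L' z - L z) / (2 * π * Complex.I) = n := by
      intro z hz
      obtain ⟨n, hn⟩ := exp_eq_iff_exists.1 ((hL' z hz).trans (hL z (hsub hz)).2.symm)
      refine ⟨n, ?_⟩
      rw [hn, add_sub_cancel_left, mul_div_cancel_right₀ _ Complex.two_pi_I_ne_zero]
    have hpre : IsPreconnected ((fun z => (L' z - L z) / (2 * π * Complex.I)) '' sphere 0 1) :=
      (isPreconnected_sphere (by simp) 0 1).image _ ((hL'c.sub hLc).div_const _)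
    have hdisc : ((fun z => (L' z - L z) / (2 * π * Complex.I)) '' sphere 0 1).Subsingleton := by
      refine (Set.countable_range (Int.cast : ℤ → ℂ)).isTotallyDisconnected _ ?_ hpre
      rintro _ ⟨z, hz, rfl⟩
      obtain ⟨n, hn⟩ := hex z hz
      exact ⟨n, hn.symm⟩
    have hone : (1 : ℂ) ∈ sphere (0 : ℂ) 1 := by simp
    obtain ⟨n, hn⟩ := hex 1 hone
    have hall : ∀ z ∈ sphere (0 : ℂ) 1, L' z = L z + n * (2 * π * Complex.I) := by
      intro z hz
      have := hdisc ⟨z, hz, rfl⟩ ⟨1, hone, rfl⟩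
      simp only [hn] at this
      have h2pi := Complex.two_pi_I_ne_zero
      rw [div_eq_iff h2pi] at this
      linear_combination this
    refine ⟨?_, fun i hi => ?_⟩
    · rw [exp_eq_iff_exists]
      refine ⟨n, ?_⟩
      rw [h2, tFun, if_pos rfl, ← hadd]
      exact unitContour_congr fun z hz => by simp only [hall z hz]
    · rw [h1 i hi, tFun, if_neg hi]
  · rintro ⟨h1, h2⟩
    obtain ⟨n, hn⟩ := exp_eq_iff_exists.1 h1
    refine ⟨fun i hi => ?_, fun z => L z + n * (2 * π * Complex.I), hLc.add continuousOn_const,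
      fun z hz => ?_, ?_⟩
    · rw [h2 i hi, tFun, if_neg hi]
    · rw [← (hL z (hsub hz)).2, exp_eq_iff_exists]
      exact ⟨n, rfl⟩
    · rw [hn, hadd, tFun, if_pos rfl]


/-! ### The functions attached to a point of the manifold -/

theorem Decay.sub {ρ C D : ℝ} {X Y : ℤ → ℂ} (h : Decay ρ C X) (h' : Decay ρ D Y) :
    Decay ρ (C + D) (X - Y) := fun i => by
  rw [add_mul]
  exact (norm_sub_le _ _).trans (add_le_add (h i) (h' i))

theorem Decay.add {ρ C D : ℝ} {X Y : ℤ → ℂ} (h : Decay ρ C X) (h' : Decay ρ D Y) :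
    Decay ρ (C + D) (X + Y) := fun i => by
  rw [add_mul]
  exact (norm_add_le _ _).trans (add_le_add (h i) (h' i))

theorem Decay.mono_const {ρ C D : ℝ} {X : ℤ → ℂ} (hρ : 0 < ρ) (h : Decay ρ C X) (hCD : C ≤ D) :
    Decay ρ D X := fun i => (h i).trans (mul_le_mul_of_nonneg_right hCD (by positivity))

theorem Decay.laurentSum_sub {ρ C D : ℝ} {X Y : ℤ → ℂ} (hρ : 1 < ρ) (h : Decay ρ C X)
    (h' : Decay ρ D Y) {z : ℂ} (hz : z ∈ annulus ρ) :
    laurentSum (X - Y) z = laurentSum X z - laurentSum Y z :=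
  (HasSum.of_eq ((h.hasSum hρ hz).sub (h'.hasSum hρ hz))
    (fun i => by simp only [Pi.sub_apply]; ring) rfl).tsum_eq

theorem Decay.laurentSum_add {ρ C D : ℝ} {X Y : ℤ → ℂ} (hρ : 1 < ρ) (h : Decay ρ C X)
    (h' : Decay ρ D Y) {z : ℂ} (hz : z ∈ annulus ρ) :
    laurentSum (X + Y) z = laurentSum X z + laurentSum Y z :=
  (HasSum.of_eq ((h.hasSum hρ hz).add (h'.hasSum hρ hz))
    (fun i => by simp only [Pi.add_apply]; ring) rfl).tsum_eq

theorem laurentSum_smul (c : ℂ) (X : ℤ → ℂ) (z : ℂ) : laurentSum (c • X) z = c * laurentSum X z := by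
  simp only [laurentSum, ← tsum_mul_left, Pi.smul_apply, smul_eq_mul, mul_assoc]

theorem Decay.norm_deriv_le {ρ C τ : ℝ} {X : ℤ → ℂ} (h : Decay ρ C X) (hτ : 1 < τ) (hρ : τ < ρ)
    {z : ℂ} (hz : z ∈ annulus τ) : ‖deriv (laurentSum X) z‖ ≤ C * lipConst ρ τ := by
  have h0 : 0 ≤ C * lipConst ρ τ := mul_nonneg h.nonneg (lipConst_pos (by linarith) hρ).le
  refine norm_deriv_le_of_lip' h0 ?_
  filter_upwards [annulus_mem_nhds hz] with y hy
  exact h.norm_laurentSum_sub_le hτ.le hρ hy.1.le hy.2.le hz.1.le hz.2.le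

section Point

variable {N M : ℕ}

/-- The Laurent coefficients of `dZeta X`. -/
def zCoeff (X : Model N M) : ℤ → ℂ := coeff X - coeffHat X

/-- The Laurent coefficients of `dL X`. -/
def lCoeff (X : Model N M) (i : ℤ) : ℂ :=
  if 1 ≤ i then coeff X i else if -(M : ℤ) ≤ i then coeffHat X i else 0

theorem coeff_eq_zero (X : Model N M) {i : ℤ} (hi : (N : ℤ) ≤ i) : coeff X i = 0 :=
  X.1.2.2 i (by omega)

theorem coeffHat_eq_zero (X : Model N M) {i : ℤ} (hi : i < -(M : ℤ)) : coeffHat X i = 0 :=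
  X.2.2.2 i hi

theorem exists_decay (X : Model N M) : ∃ ρ, 1 < ρ ∧ ∃ C, Decay ρ C (coeff X) ∧ Decay ρ C (coeffHat X) := by
  obtain ⟨ρ, hρ, C, hC⟩ := X.1.2.1
  obtain ⟨ρ', hρ', C', hC'⟩ := X.2.2.1
  have h : 1 < min ρ ρ' := lt_min hρ hρ'
  exact ⟨min ρ ρ', h, max C C', (Decay.mono hC (by linarith) (min_le_left _ _)).mono_const
    (by linarith) (le_max_left _ _), (Decay.mono hC' (by linarith) (min_le_right _ _)).mono_const
    (by linarith) (le_max_right _ _)⟩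

theorem decay_lCoeff {X : Model N M} {ρ C : ℝ} (hρ : 0 < ρ) (h : Decay ρ C (coeff X))
    (h' : Decay ρ C (coeffHat X)) : Decay ρ C (lCoeff X) := by
  intro i
  rw [lCoeff]
  split_ifs
  · exact h i
  · exact h' i
  · rw [norm_zero]; exact mul_nonneg h.nonneg (by positivity)

theorem dZeta_eq {X : Model N M} {ρ C : ℝ} (hρ : 1 < ρ) (h : Decay ρ C (coeff X))
    (h' : Decay ρ C (coeffHat X)) {z : ℂ} (hz : z ∈ annulus ρ) :
    dZeta X z = laurentSum (zCoeff X) z := (h.laurentSum_sub hρ h' hz).symm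

theorem dL_eq (X : Model N M) (z : ℂ) : dL X z = laurentSum (lCoeff X) z := by
  have h1 : laurentSum (lCoeff X) z =
      ∑ i ∈ Finset.Icc (1 : ℤ) ((N : ℤ) - 1) ∪ Finset.Icc (-(M : ℤ)) 0, lCoeff X i * z ^ i := by
    refine tsum_eq_sum fun i hi => ?_
    rw [Finset.mem_union, Finset.mem_Icc, Finset.mem_Icc] at hi
    rw [lCoeff]
    split_ifs
    · rw [coeff_eq_zero X (by omega), zero_mul]
    · omega
    · rw [zero_mul]
  rw [h1, Finset.sum_union, dL]
  · congr 1
    · refine Finset.sum_congr rfl fun i hi => ?_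
      rw [lCoeff, if_pos (Finset.mem_Icc.1 hi).1]
    · refine Finset.sum_congr rfl fun i hi => ?_
      rw [Finset.mem_Icc] at hi
      rw [lCoeff, if_neg (by omega), if_pos hi.1]
  · refine Finset.disjoint_left.2 fun i hi hi' => ?_
    rw [Finset.mem_Icc] at hi hi'
    omega

theorem zeta_eq (p : Model N M) (z : ℂ) : zeta p z = z ^ N + dZeta p z := by
  rw [zeta, aFun, aHatFun, dZeta]; ring

theorem lFun_eq (p : Model N M) (z : ℂ) : lFun p z = z ^ N + dL p z := rfl

theorem differentiableOn_dZeta {X : Model N M} {ρ C : ℝ} (hρ : 1 < ρ) (h : Decay ρ C (coeff X))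
    (h' : Decay ρ C (coeffHat X)) : DifferentiableOn ℂ (dZeta X) (annulus ρ) :=
  (h.differentiableOn hρ).sub (h'.differentiableOn hρ)

theorem differentiableOn_aFun {p : Model N M} {ρ C : ℝ} (hρ : 1 < ρ) (h : Decay ρ C (coeff p)) :
    DifferentiableOn ℂ (aFun p) (annulus ρ) :=
  (differentiableOn_pow N).add (h.differentiableOn hρ)

theorem differentiableOn_zeta {p : Model N M} {ρ C : ℝ} (hρ : 1 < ρ) (h : Decay ρ C (coeff p))
    (h' : Decay ρ C (coeffHat p)) : DifferentiableOn ℂ (zeta p) (annulus ρ) :=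
  (differentiableOn_aFun hρ h).sub (h'.differentiableOn hρ)

theorem differentiableAt_dL (X : Model N M) {z : ℂ} (hz : z ≠ 0) : DifferentiableAt ℂ (dL X) z := by
  unfold dL
  refine DifferentiableAt.add (DifferentiableAt.fun_sum fun i _ => ?_)
    (DifferentiableAt.fun_sum fun i _ => ?_) <;>
  exact (differentiableAt_zpow.2 (.inl hz)).const_mul _

theorem differentiableAt_lFun (p : Model N M) {z : ℂ} (hz : z ≠ 0) : DifferentiableAt ℂ (lFun p) z :=
  (differentiableAt_pow N).add (differentiableAt_dL p hz)

end Point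

/-! ### Univalence in a neighbourhood of the circle -/

/-- Each z in the annulus lies at distance |‖z‖ - 1| from the point z / ‖z‖ of the circle, and 1 -
σ⁻¹ ≤ σ - 1, so the annulus is contained in a thickening of the circle. -/
theorem exists_annulus_subset {W : Set ℂ} (hW : IsOpen W) (h : sphere (0 : ℂ) 1 ⊆ W) {B : ℝ}
    (hB : 1 < B) : ∃ σ, 1 < σ ∧ σ < B ∧ annulus σ ⊆ W := by
  obtain ⟨ε, hε, h1⟩ := (isCompact_sphere (0 : ℂ) 1).exists_thickening_subset_open hW h
  obtain ⟨σ, h2, h3⟩ := exists_between (lt_min hB (by linarith : 1 < 1 + ε))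
  refine ⟨σ, h2, h3.trans_le (min_le_left _ _), fun z hz => h1 ?_⟩
  have h4 := h3.trans_le (min_le_right _ _)
  have hz0 : z ≠ 0 := ne_zero_of_mem_annulus h2 hz
  have hn : 0 < ‖z‖ := norm_pos_iff.2 hz0
  have hn' : (‖z‖ : ℂ) ≠ 0 := by exact_mod_cast hn.ne'
  rw [mem_thickening_iff]
  refine ⟨z / ‖z‖, by simp [hn.ne'], ?_⟩
  have e : z - z / ‖z‖ = (z / ‖z‖) * ((‖z‖ - 1 : ℝ) : ℂ) := by
    push_cast; field_simp
  rw [dist_eq_norm, e, norm_mul, norm_div, Complex.norm_real, Complex.norm_real, norm_norm,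
    div_self hn.ne', one_mul, Real.norm_eq_abs, abs_lt]
  refine ⟨?_, by linarith [hz.2]⟩
  have h5 : 1 - (σ - 1) ≤ σ⁻¹ := by
    rw [← sub_nonneg]
    have : σ⁻¹ - (1 - (σ - 1)) = (σ - 1) ^ 2 / σ := by field_simp; ring
    rw [this]; positivity
  linarith [hz.1]

/-- On the diagonal the bound comes from strict differentiability, with δ = |f'(z)| / 2; off the
diagonal it comes from continuity of |f z - f y| > 0. -/
theorem exists_local_expansion {f : ℂ → ℂ} {σ : ℝ} (hσ : 1 < σ)
    (hf : DifferentiableOn ℂ f (annulus σ)) (hd : ∀ z ∈ sphere (0 : ℂ) 1, deriv f z ≠ 0)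
    (hi : Set.InjOn f (sphere 0 1)) {q : ℂ × ℂ} (h1 : q.1 ∈ sphere (0 : ℂ) 1)
    (h2 : q.2 ∈ sphere (0 : ℂ) 1) :
    ∃ δ, 0 < δ ∧ ∀ᶠ r in 𝓝 q, δ * ‖r.1 - r.2‖ ≤ ‖f r.1 - f r.2‖ := by
  obtain ⟨z, y⟩ := q
  have hsub := unit_sphere_subset_annulus hσ
  simp only at h1 h2
  rcases eq_or_ne z y with rfl | hne
  · have hs := (hf.analyticAt (annulus_mem_nhds (hsub h1))).hasStrictDerivAt
    have hpos : 0 < ‖deriv f z‖ / 2 := half_pos (norm_pos_iff.2 (hd z h1))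
    have hs' : (fun r : ℂ × ℂ => f r.1 - f r.2 - (r.1 - r.2) • deriv f z)
        =o[𝓝 (z, z)] fun r : ℂ × ℂ => r.1 - r.2 := by
      simpa using hs.hasStrictFDerivAt.isLittleO
    refine ⟨_, hpos, ?_⟩
    filter_upwards [hs'.def hpos] with r hr
    have h3 := norm_sub_norm_le ((r.1 - r.2) • deriv f z) (f r.1 - f r.2)
    rw [norm_sub_rev ((r.1 - r.2) • deriv f z), norm_smul] at h3
    linarith
  · have hpos : 0 < ‖f z - f y‖ := norm_pos_iff.2 (sub_ne_zero.2 fun e => hne (hi h1 h2 e))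
    have hc1 : ContinuousAt (fun r : ℂ × ℂ => ‖f r.1 - f r.2‖) (z, y) :=
      (((hf.continuousOn.continuousAt (annulus_mem_nhds (hsub h1))).comp (x := (z, y)) continuousAt_fst).sub
        ((hf.continuousOn.continuousAt (annulus_mem_nhds (hsub h2))).comp (x := (z, y)) continuousAt_snd)).norm
    have hc2 : ContinuousAt (fun r : ℂ × ℂ => ‖r.1 - r.2‖) (z, y) := by fun_prop
    refine ⟨‖f z - f y‖ / 2 / (‖z - y‖ + 1), by positivity, ?_⟩
    filter_upwards [hc1.eventually (lt_mem_nhds (half_lt_self hpos)),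
      hc2.eventually (gt_mem_nhds (lt_add_one ‖z - y‖))] with r hr1 hr2
    refine le_trans ?_ hr1.le
    rw [div_mul_eq_mul_div, div_le_iff₀ (by positivity)]
    exact mul_le_mul_of_nonneg_left hr2.le (by positivity)

/-- The local bounds are made uniform over the compact set of pairs and extended to a product
neighbourhood by the tube lemma. A linear lower bound, unlike mere injectivity, survives
perturbations with small Lipschitz constant (`Loop.perturb`). -/
theorem exists_univalent {f : ℂ → ℂ} {σ₀ : ℝ} (hσ : 1 < σ₀)
    (hf : DifferentiableOn ℂ f (annulus σ₀)) (hd : ∀ z ∈ sphere (0 : ℂ) 1, deriv f z ≠ 0)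
    (hi : Set.InjOn f (sphere 0 1)) : ∃ σ, 1 < σ ∧ σ < σ₀ ∧ ∃ δ, Univalent f σ δ := by
  have hK : IsCompact (sphere (0 : ℂ) 1 ×ˢ sphere (0 : ℂ) 1) :=
    (isCompact_sphere 0 1).prod (isCompact_sphere 0 1)
  obtain ⟨δ, hδ, U, hU, hKU, h⟩ : ∃ δ, 0 < δ ∧ ∃ U : Set (ℂ × ℂ), IsOpen U ∧
      sphere (0 : ℂ) 1 ×ˢ sphere (0 : ℂ) 1 ⊆ U ∧ ∀ r ∈ U, δ * ‖r.1 - r.2‖ ≤ ‖f r.1 - f r.2‖ := by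
    refine hK.induction_on (p := fun s => ∃ δ, 0 < δ ∧ ∃ U : Set (ℂ × ℂ), IsOpen U ∧
      s ⊆ U ∧ ∀ r ∈ U, δ * ‖r.1 - r.2‖ ≤ ‖f r.1 - f r.2‖) ?_ ?_ ?_ ?_
    · exact ⟨1, one_pos, ∅, isOpen_empty, subset_rfl, fun r hr => hr.elim⟩
    · rintro s t hst ⟨δ, hδ, U, hU, htU, h⟩
      exact ⟨δ, hδ, U, hU, hst.trans htU, h⟩
    · rintro s t ⟨δ, hδ, U, hU, hsU, h⟩ ⟨δ', hδ', U', hU', hsU', h'⟩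
      refine ⟨min δ δ', lt_min hδ hδ', U ∪ U', hU.union hU', Set.union_subset_union hsU hsU', ?_⟩
      rintro r (hr | hr)
      · exact (mul_le_mul_of_nonneg_right (min_le_left _ _) (norm_nonneg _)).trans (h r hr)
      · exact (mul_le_mul_of_nonneg_right (min_le_right _ _) (norm_nonneg _)).trans (h' r hr)
    · intro q hq
      obtain ⟨δ, hδ, h⟩ := exists_local_expansion hσ hf hd hi hq.1 hq.2
      obtain ⟨U, hU1, hU2, hU3⟩ := _root_.eventually_nhds_iff.1 h
      exact ⟨U, mem_nhdsWithin_of_mem_nhds (hU2.mem_nhds hU3), δ, hδ, U, hU2, subset_rfl, hU1⟩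
  obtain ⟨u, v, hu, hv, hsu, hsv, huv⟩ :=
    generalized_tube_lemma (isCompact_sphere (0 : ℂ) 1) (isCompact_sphere (0 : ℂ) 1) hU hKU
  obtain ⟨σ, h1, h2, h3⟩ := exists_annulus_subset (hu.inter hv) (Set.subset_inter hsu hsv) hσ
  exact ⟨σ, h1, h2, δ, h1, hδ, hf.mono (annulus_mono (by linarith) h2.le), fun z hz y hy =>
    h (z, y) (huv ⟨(h3 hz).1, (h3 hy).2⟩)⟩

theorem exists_loop {f : ℂ → ℂ} {σ₀ : ℝ} (hσ : 1 < σ₀)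
    (hf : DifferentiableOn ℂ f (annulus σ₀)) (hd : ∀ z ∈ sphere (0 : ℂ) 1, deriv f z ≠ 0)
    (hi : Set.InjOn f (sphere 0 1)) (h0 : ∀ z ∈ sphere (0 : ℂ) 1, f z ≠ 0)
    (hw : windNum f 1 0 = 1) : ∃ σ, 1 < σ ∧ σ < σ₀ ∧ ∃ δ, Loop f σ δ := by
  obtain ⟨σ, h1, h2, δ, h3⟩ := exists_univalent hσ hf hd hi
  have hopen : IsOpen {z ∈ annulus σ | f z ≠ 0} :=
    h3.diff.continuousOn.isOpen_inter_preimage (isOpen_annulus σ) isOpen_ne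
  obtain ⟨τ, h4, h5, h6⟩ := exists_annulus_subset hopen
    (fun z hz => ⟨unit_sphere_subset_annulus h1 hz, h0 z hz⟩) h1
  exact ⟨τ, h4, h5.trans h2, δ, h3.mono h4 h5.le, fun z hz => (h6 hz).2, hw⟩

section Stability

variable {N M : ℕ} {p q : Model N M}

theorem IsPoint.exists_loop (hp : IsPoint p) {σ₀ C : ℝ} (hσ : 1 < σ₀) (h : Decay σ₀ C (coeff p))
    (h' : Decay σ₀ C (coeffHat p)) : ∃ σ, 1 < σ ∧ σ < σ₀ ∧ ∃ δ, Loop (zeta p) σ δ :=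
  TodaFrobenius.exists_loop hσ (differentiableOn_zeta hσ h h') hp.deriv_zeta hp.simple
    hp.zeta_ne_zero (by have := hp.winding_one; simpa [winding, windNum, cauchyTr, unitContour] using this)

/-- A loop remains a loop under a perturbation that is small together with its Lipschitz constant. -/
theorem Loop.perturb {f g : ℂ → ℂ} {σ δ m κ : ℝ} (hf : Loop f σ δ)
    (hg : DifferentiableOn ℂ g (annulus σ)) (hm : ∀ z ∈ annulus σ, m ≤ ‖f z‖) (hκm : κ < m)
    (hκδ : κ ≤ δ / 2) (h1 : ∀ z ∈ annulus σ, ‖g z - f z‖ ≤ κ)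
    (h2 : ∀ z ∈ annulus σ, ∀ y ∈ annulus σ, ‖(g z - f z) - (g y - f y)‖ ≤ κ * ‖z - y‖) :
    Loop g σ (δ / 2) := by
  have hσ := hf.one_lt
  have hsub := unit_sphere_subset_annulus hσ
  have hg0 : ∀ z ∈ annulus σ, g z ≠ 0 := by
    intro z hz e
    have := h1 z hz
    rw [e, zero_sub, norm_neg] at this
    linarith [hm z hz]
  refine ⟨⟨hσ, half_pos hf.pos, hg, fun z hz y hy => ?_⟩, hg0, ?_⟩
  · have h3 := hf.bound z hz y hy
    have h4 := h2 z hz y hy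
    have e : g z - g y = (f z - f y) + ((g z - f z) - (g y - f y)) := by ring
    have h5 := norm_sub_le_norm_add (f z - f y) ((g z - f z) - (g y - f y))
    rw [← e] at h5
    have h6 := mul_le_mul_of_nonneg_right hκδ (norm_nonneg (z - y))
    linarith
  · rw [← hf.wind]
    -- g / f stays in the disc of radius 1 around 1, so log (g / f) is a primitive of the difference
    -- of the logarithmic derivatives, and the winding numbers agree.
    have hratio : ∀ z ∈ annulus σ, g z / f z ∈ Complex.slitPlane := by
      intro z hz
      have hfz := hf.ne_zero z hz
      have : g z / f z = 1 + (g z - f z) / f z := by field_simp; ring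
      rw [this]
      refine Complex.mem_slitPlane_of_norm_lt_one ?_
      rw [norm_div, div_lt_one (norm_pos_iff.2 hfz)]
      exact (h1 z hz).trans_lt (hκm.trans_le (hm z hz))
    have hc : ∀ {k : ℂ → ℂ}, DifferentiableOn ℂ k (annulus σ) → (∀ z ∈ annulus σ, k z ≠ 0) →
        ContinuousOn (fun z => deriv k z / (k z - 0)) (sphere 0 1) := fun hk hk0 => by
      simp only [sub_zero]
      exact ((differentiableOn_deriv_annulus hk).div hk hk0).continuousOn.mono hsub
    refine unitContour_sub_eq_zero (P := fun z => Complex.log (g z / f z)) (hc hg hg0)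
      (hc hf.diff hf.ne_zero) fun z hz => ?_
    have hfz := hf.ne_zero z (hsub hz)
    have hgz := hg0 z (hsub hz)
    have h3 := ((hg.differentiableAt (annulus_mem_nhds (hsub hz))).hasDerivAt.fun_div
      (hf.differentiableAt (hsub hz)).hasDerivAt hfz).clog (hratio z (hsub hz))
    refine h3.congr_deriv ?_
    simp only [sub_zero]
    field_simp

theorem exists_lower_bound {f : ℂ → ℂ} {σ τ δ : ℝ} (hf : Loop f σ δ) (hτ : 1 < τ) (hτσ : τ < σ) :
    ∃ m, 0 < m ∧ ∀ z ∈ annulus τ, m ≤ ‖f z‖ := by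
  have hK : IsCompact {z : ℂ | τ⁻¹ ≤ ‖z‖ ∧ ‖z‖ ≤ τ} := by
    refine (isCompact_closedBall (0 : ℂ) τ).of_isClosed_subset ?_ fun z hz => by simpa using hz.2
    exact (isClosed_le continuous_const continuous_norm).inter
      (isClosed_le continuous_norm continuous_const)
  have hi : σ⁻¹ < τ⁻¹ := inv_strictAnti₀ (by linarith) hτσ
  have hsub : {z : ℂ | τ⁻¹ ≤ ‖z‖ ∧ ‖z‖ ≤ τ} ⊆ annulus σ := fun z hz =>
    ⟨hi.trans_le hz.1, hz.2.trans_lt hτσ⟩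
  have hne : {z : ℂ | τ⁻¹ ≤ ‖z‖ ∧ ‖z‖ ≤ τ}.Nonempty :=
    ⟨1, by simpa using ⟨(inv_lt_one_of_one_lt₀ hτ).le, hτ.le⟩⟩
  obtain ⟨z, hz, hz'⟩ := hK.exists_isMinOn hne (hf.diff.continuousOn.mono hsub).norm
  exact ⟨‖f z‖, norm_pos_iff.2 (hf.ne_zero z (hsub hz)), fun y hy => hz' ⟨hy.1.le, hy.2.le⟩⟩

theorem Near.decay_zCoeff {ρ ε : ℝ} (h : Near ρ ε q p) :
    Decay ρ (2 * ε) (zCoeff q - zCoeff p) := fun i => by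
  have e : (zCoeff q - zCoeff p) i = (coeff q i - coeff p i) - (coeffHat q i - coeffHat p i) := by
    simp only [zCoeff, Pi.sub_apply]; ring
  rw [e]
  refine (norm_sub_le _ _).trans ?_
  linarith [(h i).1, (h i).2]

theorem Near.decay {ρ ε σ C : ℝ} (h : Near ρ ε q p) (hσ : 0 < σ) (hσρ : σ ≤ ρ)
    (h1 : Decay σ C (coeff p)) (h2 : Decay σ C (coeffHat p)) :
    Decay σ (C + ε) (coeff q) ∧ Decay σ (C + ε) (coeffHat q) := by
  have h3 : Decay ρ ε (coeff q - coeff p) := fun i => (h i).1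
  have h4 : Decay ρ ε (coeffHat q - coeffHat p) := fun i => (h i).2
  have h5 := h1.add (h3.mono hσ hσρ)
  have h6 := h2.add (h4.mono hσ hσρ)
  rw [add_sub_cancel] at h5 h6
  exact ⟨h5, h6⟩

/-- Nearby points define loops on a common annulus. -/
theorem exists_near_loop {σ₁ σ τ δ C ρ : ℝ} (hf : Loop (zeta p) σ δ) (hτ : 1 < τ) (hτσ : τ < σ)
    (hσ₁ : σ < σ₁) (h1 : Decay σ₁ C (coeff p)) (h2 : Decay σ₁ C (coeffHat p)) (hρ : τ < ρ) {η : ℝ}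
    (hη : 0 < η) : ∃ ε, 0 < ε ∧ ∀ q : Model N M, Near ρ ε q p → Loop (zeta q) τ (δ / 2) ∧
      ∀ z ∈ annulus τ, ‖zeta q z - zeta p z‖ < η := by
  obtain ⟨m, hm, hm'⟩ := exists_lower_bound hf hτ hτσ
  have hτ0 : 0 < τ := by linarith
  have hlip := lipConst_pos hτ0 hρ
  obtain ⟨κ, hκ, hκ'⟩ := exists_between (lt_min (lt_min hm (half_pos hf.pos)) hη)
  rw [lt_min_iff, lt_min_iff] at hκ'
  -- The coefficients of ζ are differences of two sequences, whence the factor 2. With this ε both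
  -- the change of ζ and its Lipschitz constant are at most κ.
  refine ⟨κ / (2 * lipConst ρ τ), by positivity, fun q hq => ?_⟩
  obtain ⟨h3, h4⟩ := hq.decay (σ := min σ₁ ρ) (lt_min (by linarith) (by linarith)) (min_le_right _ _)
    (h1.mono (lt_min (by linarith) (by linarith)) (min_le_left _ _))
    (h2.mono (lt_min (by linarith) (by linarith)) (min_le_left _ _))
  have hmin : τ < min σ₁ ρ := lt_min (by linarith) hρ
  have hsub : annulus τ ⊆ annulus (min σ₁ ρ) := annulus_mono hτ0 hmin.le
  have hdec := hq.decay_zCoeff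
  have hκe : 2 * (κ / (2 * lipConst ρ τ)) * lipConst ρ τ = κ := by field_simp
  have hdiff : ∀ z ∈ annulus τ, zeta q z - zeta p z = laurentSum (zCoeff q - zCoeff p) z := by
    intro z hz
    rw [zeta_eq, zeta_eq, dZeta_eq (by linarith) h3 h4 (hsub hz), dZeta_eq (X := p) (ρ := σ₁) (by linarith) h1 h2
      (annulus_mono hτ0 (by linarith) hz)]
    have h5 := Decay.laurentSum_sub (ρ := min σ₁ ρ) (by linarith) (h3.sub h4)
      ((h1.mono (by linarith) (min_le_left _ _)).sub (h2.mono (by linarith) (min_le_left _ _))) (hsub hz)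
    rw [zCoeff, zCoeff, h5]; ring
  have hbound : ∀ z ∈ annulus τ, ‖zeta q z - zeta p z‖ ≤ κ := by
    intro z hz
    rw [hdiff z hz, ← hκe]
    exact hdec.norm_laurentSum_le hτ.le hρ hz.1.le hz.2.le
  refine ⟨?_, fun z hz => (hbound z hz).trans_lt hκ'.2⟩
  have hf' : Loop (zeta p) τ δ := ⟨hf.toUnivalent.mono hτ hτσ.le,
    fun z hz => hf.ne_zero z (annulus_mono hτ0 hτσ.le hz), hf.wind⟩
  refine hf'.perturb ((differentiableOn_zeta (by linarith) h3 h4).mono hsub) hm' hκ'.1.1 hκ'.1.2.le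
    hbound fun z hz y hy => ?_
  rw [hdiff z hz, hdiff y hy, ← hκe]
  exact hdec.norm_laurentSum_sub_le hτ.le hρ hz.1.le hz.2.le hy.1.le hy.2.le

theorem eventually_ne_zero_of_near {F : Model N M → ℂ → ℂ} {ρ : ℝ} {m : ℝ} (hm : 0 < m)
    (h0 : ∀ z ∈ sphere (0 : ℂ) 1, m ≤ ‖F p z‖)
    (h : ∃ K, 0 ≤ K ∧ ∀ ε, 0 < ε → ε ≤ 1 → ∀ q, Near ρ ε q p → ∀ z ∈ sphere (0 : ℂ) 1,
      ‖F q z - F p z‖ ≤ K * ε) :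
    ∃ ε, 0 < ε ∧ ε ≤ 1 ∧ ∀ q, Near ρ ε q p → ∀ z ∈ sphere (0 : ℂ) 1, F q z ≠ 0 := by
  obtain ⟨K, hK, h⟩ := h
  have hε : 0 < min 1 (m / (2 * (K + 1))) := lt_min one_pos (by positivity)
  refine ⟨_, hε, min_le_left _ _, fun q hq z hz e => ?_⟩
  have h1 := h _ hε (min_le_left _ _) q hq z hz
  rw [e, zero_sub, norm_neg] at h1
  have h2 : K * min 1 (m / (2 * (K + 1))) ≤ K * (m / (2 * (K + 1))) :=
    mul_le_mul_of_nonneg_left (min_le_right _ _) hK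
  have h3 : K * (m / (2 * (K + 1))) ≤ m / 2 := by
    rw [mul_div_assoc', div_le_div_iff₀ (by positivity) two_pos]
    nlinarith
  linarith [h0 z hz]

theorem exists_min_sphere {F : ℂ → ℂ} (hF : ContinuousOn F (sphere 0 1))
    (h : ∀ z ∈ sphere (0 : ℂ) 1, F z ≠ 0) : ∃ m, 0 < m ∧ ∀ z ∈ sphere (0 : ℂ) 1, m ≤ ‖F z‖ := by
  obtain ⟨z, hz, hz'⟩ := (isCompact_sphere (0 : ℂ) 1).exists_isMinOn ⟨1, by simp⟩ hF.norm
  exact ⟨‖F z‖, norm_pos_iff.2 (h z hz), fun y hy => hz' hy⟩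

theorem Near.mono {ρ ε ε' : ℝ} (hρ : 0 < ρ) (h : Near ρ ε q p) (hε : ε ≤ ε') : Near ρ ε' q p :=
  fun i => ⟨(h i).1.trans (mul_le_mul_of_nonneg_right hε (by positivity)),
    (h i).2.trans (mul_le_mul_of_nonneg_right hε (by positivity))⟩

/-- All conditions are open in the weighted norm: the loop conditions by `exists_near_loop`, those
on the Wronskian and l' because these functions are bounded away from 0 on the circle and change by
O(ε), the pole condition because it concerns one coefficient. -/
theorem isPoint_of_near (hp : IsPoint p) {ρ : ℝ} (hρ : 1 < ρ) :
    ∃ ε, 0 < ε ∧ ∀ q : Model N M, Near ρ ε q p → IsPoint q := by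
  obtain ⟨σ₁, hσ₁, C, h1, h2⟩ := exists_decay p
  obtain ⟨σ, hσ, hσσ, δ, hf⟩ := hp.exists_loop hσ₁ h1 h2
  obtain ⟨τ, hτ, hτ'⟩ := exists_between (lt_min hσ hρ)
  rw [lt_min_iff] at hτ'
  have hτ0 : 0 < τ := by linarith
  have hρ0 : 0 < ρ := by linarith
  have hlip := lipConst_pos hτ0 hτ'.2
  have hsub := unit_sphere_subset_annulus hτ
  obtain ⟨ε₁, hε₁, hloop⟩ := exists_near_loop hf hτ hτ'.1 hσσ h1 h2 hτ'.2 one_pos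
  have hq : ∀ ε, 0 < ε → ε ≤ 1 → ∀ q, Near ρ ε q p → ∀ z ∈ sphere (0 : ℂ) 1,
      ‖aFun q z - aFun p z‖ ≤ lipConst ρ τ * ε ∧
      ‖aHatFun q z - aHatFun p z‖ ≤ lipConst ρ τ * ε ∧
      ‖deriv (aFun q) z - deriv (aFun p) z‖ ≤ lipConst ρ τ * ε ∧
      ‖deriv (aHatFun q) z - deriv (aHatFun p) z‖ ≤ lipConst ρ τ * ε ∧
      ‖deriv (lFun q) z - deriv (lFun p) z‖ ≤ lipConst ρ τ * ε := by
    intro ε hε _ q hq z hz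
    have hmin : 1 < min σ₁ ρ := lt_min hσ₁ hρ
    obtain ⟨h3, h4⟩ := hq.decay (σ := min σ₁ ρ) (by linarith) (min_le_right _ _)
      (h1.mono (by linarith) (min_le_left _ _)) (h2.mono (by linarith) (min_le_left _ _))
    have h1' := h1.mono (ρ' := min σ₁ ρ) (by linarith) (min_le_left _ _)
    have h2' := h2.mono (ρ' := min σ₁ ρ) (by linarith) (min_le_left _ _)
    have e1 : Decay ρ ε (coeff q - coeff p) := fun i => (hq i).1
    have e2 : Decay ρ ε (coeffHat q - coeffHat p) := fun i => (hq i).2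
    have e3 : Decay ρ ε (lCoeff q - lCoeff p) := by
      intro i
      simp only [Pi.sub_apply, lCoeff]
      split_ifs
      · exact e1 i
      · exact e2 i
      · rw [sub_zero, norm_zero]; positivity
    have hsub' := unit_sphere_subset_annulus hmin
    have hz1 : z ∈ annulus τ := hsub hz
    have hzn := mem_sphere_zero_iff_norm.1 hz
    have hi : τ⁻¹ ≤ ‖z‖ := hz1.1.le
    have hz0 : z ≠ 0 := ne_zero_of_mem_annulus hτ hz1
    have hev : ∀ᶠ y in 𝓝 z, y ∈ annulus (min σ₁ ρ) := annulus_mem_nhds (hsub' hz)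
    have f1 : ∀ y ∈ annulus (min σ₁ ρ), aFun q y - aFun p y = laurentSum (coeff q - coeff p) y := by
      intro y hy
      rw [h3.laurentSum_sub hmin h1' hy, aFun, aFun]; ring
    have f2 : ∀ y ∈ annulus (min σ₁ ρ), aHatFun q y - aHatFun p y
        = laurentSum (coeffHat q - coeffHat p) y := by
      intro y hy
      rw [h4.laurentSum_sub hmin h2' hy, aHatFun, aHatFun]
    have f3 : ∀ y ∈ annulus (min σ₁ ρ), lFun q y - lFun p y = laurentSum (lCoeff q - lCoeff p) y := by
      intro y hy
      rw [(decay_lCoeff (by linarith) h3 h4).laurentSum_sub hmin (decay_lCoeff (by linarith) h1' h2') hy,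
        ← dL_eq, ← dL_eq, lFun_eq, lFun_eq]; ring
    have da := (differentiableOn_aFun hmin h3).differentiableAt hev
    have da' := (differentiableOn_aFun hmin h1').differentiableAt hev
    have dh : DifferentiableAt ℂ (aHatFun q) z := (h4.differentiableOn hmin).differentiableAt hev
    have dh' : DifferentiableAt ℂ (aHatFun p) z := (h2'.differentiableOn hmin).differentiableAt hev
    have dl := differentiableAt_lFun q hz0
    have dl' := differentiableAt_lFun p hz0
    rw [mul_comm]
    refine ⟨?_, ?_, ?_, ?_, ?_⟩
    · rw [f1 z (hsub' hz)]; exact e1.norm_laurentSum_le hτ.le hτ'.2 hi hz1.2.le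
    · rw [f2 z (hsub' hz)]; exact e2.norm_laurentSum_le hτ.le hτ'.2 hi hz1.2.le
    · rw [← deriv_fun_sub da da', Filter.EventuallyEq.deriv_eq (hev.mono f1)]
      exact e1.norm_deriv_le hτ hτ'.2 hz1
    · rw [← deriv_fun_sub dh dh', Filter.EventuallyEq.deriv_eq (hev.mono f2)]
      exact e2.norm_deriv_le hτ hτ'.2 hz1
    · rw [← deriv_fun_sub dl dl', Filter.EventuallyEq.deriv_eq (hev.mono f3)]
      exact e3.norm_deriv_le hτ hτ'.2 hz1
  have hc1 := (differentiableOn_aFun hσ₁ h1).continuousOn.mono (unit_sphere_subset_annulus hσ₁)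
  have hc2 : ContinuousOn (aHatFun p) (sphere 0 1) :=
    (h2.differentiableOn hσ₁).continuousOn.mono (unit_sphere_subset_annulus hσ₁)
  have hc3 := (differentiableOn_deriv_annulus (differentiableOn_aFun hσ₁ h1)).continuousOn.mono
    (unit_sphere_subset_annulus hσ₁)
  have hc4 : ContinuousOn (deriv (aHatFun p)) (sphere 0 1) :=
    (differentiableOn_deriv_annulus (h2.differentiableOn hσ₁)).continuousOn.mono
      (unit_sphere_subset_annulus hσ₁)
  have hc5 : ContinuousOn (deriv (lFun p)) (sphere 0 1) := by
    have : DifferentiableOn ℂ (lFun p) (annulus τ) := fun z hz =>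
      (differentiableAt_lFun p (ne_zero_of_mem_annulus hτ hz)).differentiableWithinAt
    exact (differentiableOn_deriv_annulus this).continuousOn.mono hsub
  obtain ⟨m₁, hm₁, hw⟩ := exists_min_sphere ((hc1.mul hc4).sub (hc3.mul hc2)) hp.wronskian
  obtain ⟨m₂, hm₂, hl⟩ := exists_min_sphere hc5 hp.deriv_l
  obtain ⟨B₁, hB₁, b1⟩ := exists_bound_sphere hc1
  obtain ⟨B₂, hB₂, b2⟩ := exists_bound_sphere hc2
  obtain ⟨B₃, hB₃, b3⟩ := exists_bound_sphere hc3
  obtain ⟨B₄, hB₄, b4⟩ := exists_bound_sphere hc4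
  set lip := lipConst ρ τ with hlipdef
  obtain ⟨ε₂, hε₂, -, hwq⟩ := eventually_ne_zero_of_near (p := p) (ρ := ρ)
    (F := fun q z => aFun q z * deriv (aHatFun q) z - deriv (aFun q) z * aHatFun q z) hm₁ hw
    ⟨lip * (B₁ + B₂ + B₃ + B₄ + 2 * lip), by positivity, fun ε hε hε1 q hnear z hz => by
      obtain ⟨g1, g2, g3, g4, -⟩ := hq ε hε hε1 q hnear z hz
      have e : aFun q z * deriv (aHatFun q) z - deriv (aFun q) z * aHatFun q z
          - (aFun p z * deriv (aHatFun p) z - deriv (aFun p) z * aHatFun p z)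
          = (aFun p z * (deriv (aHatFun q) z - deriv (aHatFun p) z)
            + (aFun q z - aFun p z) * deriv (aHatFun p) z)
            + (aFun q z - aFun p z) * (deriv (aHatFun q) z - deriv (aHatFun p) z)
            - ((deriv (aFun p) z * (aHatFun q z - aHatFun p z)
            + (deriv (aFun q) z - deriv (aFun p) z) * aHatFun p z)
            + (deriv (aFun q) z - deriv (aFun p) z) * (aHatFun q z - aHatFun p z)) := by ring
      rw [e]
      refine (norm_sub_le _ _).trans ((add_le_add ((norm_add_le _ _).trans (add_le_add_left (norm_add_le _ _) _))
        ((norm_add_le _ _).trans (add_le_add_left (norm_add_le _ _) _))).trans ?_)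
      simp only [norm_mul]
      have k1 := mul_le_mul (b1 z hz) g4 (norm_nonneg _) hB₁
      have k2 := mul_le_mul g1 (b4 z hz) (norm_nonneg _) (by positivity)
      have k3 := mul_le_mul g1 g4 (norm_nonneg _) (by positivity)
      have k4 := mul_le_mul (b3 z hz) g2 (norm_nonneg _) hB₃
      have k5 := mul_le_mul g3 (b2 z hz) (norm_nonneg _) (by positivity)
      have k6 := mul_le_mul g3 g2 (norm_nonneg _) (by positivity)
      have k7 : lip * ε * (lip * ε) ≤ lip * lip * ε := by
        have : lip * lip * ε * ε ≤ lip * lip * ε * 1 := mul_le_mul_of_nonneg_left hε1 (by positivity)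
        linarith
      linarith⟩
  obtain ⟨ε₃, hε₃, -, hlq⟩ := eventually_ne_zero_of_near (p := p) (ρ := ρ)
    (F := fun q z => deriv (lFun q) z) hm₂ hl
    ⟨lip, hlip.le, fun ε hε hε1 q hnear z hz => (hq ε hε hε1 q hnear z hz).2.2.2.2⟩
  have hpole : 0 < ‖coeffHat p (-(M : ℤ))‖ * ρ ^ (|(-(M : ℤ))|) / 2 :=
    half_pos (mul_pos (norm_pos_iff.2 hp.pole) (zpow_pos hρ0 _))
  refine ⟨min (min ε₁ ε₂) (min ε₃ _), lt_min (lt_min hε₁ hε₂) (lt_min hε₃ hpole), fun q hnear => ?_⟩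
  have n1 := hnear.mono hρ0 ((min_le_left _ _).trans (min_le_left _ _))
  have n2 := hnear.mono hρ0 ((min_le_left _ _).trans (min_le_right _ _))
  have n3 := hnear.mono hρ0 ((min_le_right _ _).trans (min_le_left _ _))
  have n4 := hnear.mono hρ0 ((min_le_right _ _).trans (min_le_right _ _))
  obtain ⟨hL, -⟩ := hloop q n1
  refine ⟨fun e => ?_, hwq q n2, fun z hz => hL.deriv_ne_zero (hsub hz), hlq q n3,
    fun z hz => hL.ne_zero z (hsub hz), ?_, hL.injOn.mono hsub⟩
  · have := (n4 (-(M : ℤ))).2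
    rw [e, zero_sub, norm_neg, zpow_neg] at this
    have h5 : 0 < ρ ^ (|(-(M : ℤ))|) := zpow_pos hρ0 _
    have h6 := norm_pos_iff.2 hp.pole
    rw [div_mul_eq_mul_div, mul_assoc, mul_inv_cancel₀ h5.ne', mul_one] at this
    linarith
  · simpa [winding, windNum, cauchyTr, unitContour] using hL.wind

end Stability

/-! ### Residues -/

theorem circleIntegral_eq_of_punctured {f : ℂ → ℂ} {r a b : ℝ}
    (hf : ∀ z : ℂ, z ≠ 0 → ‖z‖ < r → DifferentiableAt ℂ f z) (ha : 0 < a) (hab : a ≤ b) (hb : b < r) :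
    (∮ z in C(0, b), f z) = ∮ z in C(0, a), f z := by
  have hd : ∀ z ∈ closedBall (0 : ℂ) b \ ball 0 a, DifferentiableAt ℂ f z := by
    rintro z ⟨h1, h2⟩
    rw [mem_closedBall_zero_iff] at h1
    rw [mem_ball_zero_iff, not_lt] at h2
    exact hf z (norm_pos_iff.1 (ha.trans_le h2)) (h1.trans_lt hb)
  refine Complex.circleIntegral_eq_of_differentiable_on_annulus_off_countable ha hab
    Set.countable_empty (fun z hz => (hd z hz).continuousAt.continuousWithinAt) fun z hz => ?_
  exact hd z ⟨ball_subset_closedBall hz.1.1, fun h => hz.1.2 (ball_subset_closedBall h)⟩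

theorem circleIntegral_eq_of_punctured' {f : ℂ → ℂ} {r a b : ℝ}
    (hf : ∀ z : ℂ, z ≠ 0 → ‖z‖ < r → DifferentiableAt ℂ f z) (ha : 0 < a) (ha' : a < r) (hb : 0 < b)
    (hb' : b < r) : (∮ z in C(0, b), f z) = ∮ z in C(0, a), f z := by
  rcases le_total a b with h | h
  · exact circleIntegral_eq_of_punctured hf ha h hb'
  · exact (circleIntegral_eq_of_punctured hf hb h ha').symm

/-- On a punctured disc of holomorphy the integral does not depend on the radius, so the limit
defining the residue is that of a constant. -/
theorem resZero_eq {f : ℂ → ℂ} {r s : ℝ} (hf : ∀ z : ℂ, z ≠ 0 → ‖z‖ < r → DifferentiableAt ℂ f z)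
    (hs : 0 < s) (hsr : s < r) : resZero f = (2 * π * Complex.I)⁻¹ * ∮ z in C(0, s), f z := by
  refine Tendsto.limUnder_eq (tendsto_const_nhds.congr' ?_)
  filter_upwards [Ioo_mem_nhdsGT (hs.trans hsr)] with a ha
  rw [circleIntegral_eq_of_punctured' hf ha.1 ha.2 hs hsr]

theorem resZero_congr {f g : ℂ → ℂ} (h : f =ᶠ[𝓝[≠] 0] g) : resZero f = resZero g := by
  obtain ⟨r, hr, h'⟩ := Metric.eventually_nhds_iff_ball.1 (eventually_nhdsWithin_iff.1 h)
  rw [resZero, resZero, limUnder, limUnder]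
  congr 1
  refine Filter.map_congr ?_
  filter_upwards [Ioo_mem_nhdsGT hr] with s hs
  congr 1
  refine circleIntegral.integral_congr hs.1.le fun z hz => ?_
  have hz' := mem_sphere_zero_iff_norm.1 hz
  refine h' z (by rw [mem_ball_zero_iff, hz']; exact hs.2) ?_
  exact norm_pos_iff.1 (by rw [hz']; exact hs.1)

theorem circleIntegral_inv {f : ℂ → ℂ} {r : ℝ} (hr : 0 < r) :
    (∮ u in C(0, r), f u⁻¹ / u ^ 2) = ∮ z in C(0, r⁻¹), f z := by
  have hper : Function.Periodic (fun θ : ℝ => deriv (circleMap 0 r⁻¹) θ • f (circleMap 0 r⁻¹ θ)) (2 * π) := by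
    intro θ
    simp only [deriv_circleMap]
    rw [periodic_circleMap]
  have h1 : ∀ θ : ℝ, deriv (circleMap 0 r) θ • (f (circleMap 0 r θ)⁻¹ / (circleMap 0 r θ) ^ 2)
      = deriv (circleMap 0 r⁻¹) (-θ) • f (circleMap 0 r⁻¹ (-θ)) := by
    intro θ
    have e : (circleMap 0 r θ)⁻¹ = circleMap 0 r⁻¹ (-θ) := by
      simp only [circleMap, zero_add, mul_inv, ← Complex.exp_neg]
      push_cast
      ring_nf
    have h0 : circleMap 0 r θ ≠ 0 := circleMap_ne_center hr.ne'
    rw [deriv_circleMap, deriv_circleMap, ← e, smul_eq_mul, smul_eq_mul]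
    field_simp
  rw [circleIntegral, circleIntegral]
  simp_rw [h1]
  rw [intervalIntegral.integral_comp_neg (fun θ => deriv (circleMap 0 r⁻¹) θ • f (circleMap 0 r⁻¹ θ))]
  have := hper.intervalIntegral_add_eq (-(2 * π)) 0
  simpa using this

/-- The substitution z = u⁻¹ exchanges the circles of radius r and r⁻¹. It lets both poles of l be
treated as a pole at u = 0. -/
theorem resInfty_eq_resZero (f : ℂ → ℂ) : resInfty f = -resZero fun u => f u⁻¹ / u ^ 2 := by
  rw [resInfty, resZero, limUnder, limUnder]
  congr 2
  have h1 : (atTop : Filter ℝ) = map (fun r => r⁻¹) (𝓝[>] 0) := by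
    rw [← inv_nhdsGT_zero]; rfl
  rw [h1, map_map]
  refine Filter.map_congr ?_
  filter_upwards [self_mem_nhdsWithin] with r hr
  rw [circleIntegral_inv hr]
  rfl

/-- The integral does not change when the radius shrinks, and it is at most a constant times the
radius. -/
theorem circleIntegral_eq_zero_of_bounded {f : ℂ → ℂ} {r s : ℝ}
    (hf : ∀ z : ℂ, z ≠ 0 → ‖z‖ < r → DifferentiableAt ℂ f z) (hs : 0 < s) (hsr : s < r)
    (hb : f =O[𝓝[≠] 0] fun _ => (1 : ℂ)) : (∮ z in C(0, s), f z) = 0 := by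
  obtain ⟨C, hC0, hC⟩ := hb.exists_nonneg
  obtain ⟨ε, hε, h'⟩ := Metric.eventually_nhds_iff_ball.1 (eventually_nhdsWithin_iff.1 hC.bound)
  have hlim : Tendsto (fun a : ℝ => 2 * π * a * C) (𝓝[>] 0) (𝓝 0) := by
    have : Continuous fun a : ℝ => 2 * π * a * C := by fun_prop
    simpa using (this.tendsto 0).mono_left nhdsWithin_le_nhds
  have : ‖∮ z in C(0, s), f z‖ ≤ 0 := by
    refine ge_of_tendsto hlim ?_
    filter_upwards [Ioo_mem_nhdsGT (lt_min hε (hs.trans hsr))] with a ha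
    have ha' := lt_min_iff.1 ha.2
    rw [circleIntegral_eq_of_punctured' hf ha.1 ha'.2 hs hsr]
    refine circleIntegral.norm_integral_le_of_norm_le_const ha.1.le fun z hz => ?_
    have hz' := mem_sphere_zero_iff_norm.1 hz
    simpa using h' z (by rw [mem_ball_zero_iff, hz']; exact ha'.1)
      (norm_pos_iff.1 (by rw [hz']; exact ha.1))
  exact norm_le_zero_iff.1 this

/-! ### Logarithms and roots on a disc -/

/-- `Q` is holomorphic and has no zeros on the disc of radius `r`; the function `Q(u) / u` then has
a simple pole at `0`. -/
structure Invertible₀ (Q : ℂ → ℂ) (r : ℝ) : Prop where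
  pos : 0 < r
  diff : DifferentiableOn ℂ Q (ball 0 r)
  ne_zero : ∀ u ∈ ball (0 : ℂ) r, Q u ≠ 0

namespace Invertible₀

variable {Q : ℂ → ℂ} {r s : ℝ}

theorem mono (hQ : Invertible₀ Q r) (hs : 0 < s) (hsr : s ≤ r) : Invertible₀ Q s :=
  ⟨hs, hQ.diff.mono (ball_subset_ball hsr), fun u hu => hQ.ne_zero u (ball_subset_ball hsr hu)⟩

theorem differentiableAt (hQ : Invertible₀ Q r) {u : ℂ} (hu : u ∈ ball (0 : ℂ) r) :
    DifferentiableAt ℂ Q u := hQ.diff.differentiableAt (isOpen_ball.mem_nhds hu)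

theorem differentiableAt_deriv (hQ : Invertible₀ Q r) {u : ℂ} (hu : u ∈ ball (0 : ℂ) r) :
    DifferentiableAt ℂ (deriv Q) u :=
  (hQ.diff.deriv isOpen_ball).differentiableAt (isOpen_ball.mem_nhds hu)

theorem exists_log (hQ : Invertible₀ Q r) {ℓ : ℂ} (hℓ : Complex.exp ℓ = Q 0) :
    ∃ Λ : ℂ → ℂ, DifferentiableOn ℂ Λ (ball 0 r) ∧ Λ 0 = ℓ ∧
      ∀ u ∈ ball (0 : ℂ) r, Complex.exp (Λ u) = Q u := by
  obtain ⟨F, hF⟩ := ((hQ.diff.deriv isOpen_ball).div hQ.diff hQ.ne_zero).isExactOn_ball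
  have h0 : (0 : ℂ) ∈ ball (0 : ℂ) r := mem_ball_self hQ.pos
  have hΛ : ∀ u ∈ ball (0 : ℂ) r, HasDerivAt (fun u => F u - F 0 + ℓ) (deriv Q u / Q u) u :=
    fun u hu => ((hF u hu).sub_const _).add_const _
  refine ⟨fun u => F u - F 0 + ℓ, fun u hu => (hΛ u hu).differentiableAt.differentiableWithinAt,
    by simp, fun u hu => ?_⟩
  have hG : ∀ u ∈ ball (0 : ℂ) r, HasDerivAt (fun u => Complex.exp (F u - F 0 + ℓ) / Q u) 0 u := by
    intro u hu
    refine ((hΛ u hu).cexp.fun_div (hQ.differentiableAt hu).hasDerivAt (hQ.ne_zero u hu)).congr_deriv ?_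
    have := hQ.ne_zero u hu
    field_simp
    ring
  have := isOpen_ball.is_const_of_deriv_eq_zero (convex_ball (0 : ℂ) r).isPreconnected
    (fun y hy => (hG y hy).differentiableAt.differentiableWithinAt) (fun y hy => (hG y hy).deriv) hu h0
  simp only [sub_self, zero_add, hℓ, div_self (hQ.ne_zero 0 h0)] at this
  exact (div_eq_one_iff_eq (hQ.ne_zero u hu)).1 this

/-! ### Expansions in powers of `u / Q(u)` -/

theorem hasDerivAt_pole (hQ : Invertible₀ Q r) {u : ℂ} (hu0 : u ≠ 0) (hu : u ∈ ball (0 : ℂ) r) :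
    HasDerivAt (fun u => Q u / u) ((deriv Q u * u - Q u) / u ^ 2) u := by
  simpa using (hQ.differentiableAt hu).hasDerivAt.fun_div (hasDerivAt_id u) hu0

/-- The integral of `χ ^ k dχ` for `χ(u) = Q(u) / u`. -/
theorem circleIntegral_zpow_pole (hQ : Invertible₀ Q r) (hs : 0 < s) (hsr : s < r) (k : ℤ) :
    (2 * π * Complex.I)⁻¹ * (∮ u in C(0, s), (Q u / u) ^ k * ((deriv Q u * u - Q u) / u ^ 2))
      = if k = -1 then -1 else 0 := by
  have hball : ∀ u ∈ sphere (0 : ℂ) s, u ≠ 0 ∧ u ∈ ball (0 : ℂ) r := fun u hu => by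
    rw [mem_sphere_zero_iff_norm] at hu
    exact ⟨norm_pos_iff.1 (hu ▸ hs), by rw [mem_ball_zero_iff, hu]; exact hsr⟩
  split_ifs with h
  · subst h
    have h1 : (∮ u in C(0, s), (Q u / u) ^ (-1 : ℤ) * ((deriv Q u * u - Q u) / u ^ 2))
        = ∮ u in C(0, s), (deriv Q u / Q u - u⁻¹) := by
      refine circleIntegral.integral_congr hs.le fun u hu => ?_
      obtain ⟨h1, h2⟩ := hball u hu
      have := hQ.ne_zero u h2
      simp only [zpow_neg_one]
      field_simp
    have hc : ContinuousOn (fun u => deriv Q u / Q u) (closedBall 0 s) := fun u hu => by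
      have hu' : u ∈ ball (0 : ℂ) r := closedBall_subset_ball hsr hu
      exact ((hQ.differentiableAt_deriv hu').div (hQ.differentiableAt hu')
        (hQ.ne_zero u hu')).continuousAt.continuousWithinAt
    have h2 : (∮ u in C(0, s), deriv Q u / Q u) = 0 := by
      refine Complex.circleIntegral_eq_zero_of_differentiable_on_off_countable hs.le
        Set.countable_empty hc fun u hu => ?_
      have hu' : u ∈ ball (0 : ℂ) r := ball_subset_ball hsr.le hu.1
      exact (hQ.differentiableAt_deriv hu').div (hQ.differentiableAt hu') (hQ.ne_zero u hu')
    have h3 : (∮ u in C((0 : ℂ), s), u⁻¹) = 2 * π * Complex.I := by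
      simpa using circleIntegral.integral_sub_center_inv 0 hs.ne'
    have hinv : ContinuousOn (fun u : ℂ => u⁻¹) (sphere 0 s) :=
      continuousOn_id.inv₀ fun u hu => (hball u hu).1
    rw [h1, circleIntegral.integral_sub ((hc.mono sphere_subset_closedBall).circleIntegrable hs.le)
      (hinv.circleIntegrable hs.le), h2, h3, zero_sub,
      mul_neg, inv_mul_cancel₀ Complex.two_pi_I_ne_zero]
  · have hk : ((k + 1 : ℤ) : ℂ) ≠ 0 := Int.cast_ne_zero.2 (by omega)
    rw [circleIntegral.integral_eq_zero_of_hasDerivWithinAt (f := fun u => (Q u / u) ^ (k + 1) / ((k + 1 : ℤ) : ℂ))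
      hs.le fun u hu => HasDerivAt.hasDerivWithinAt ?_, mul_zero]
    obtain ⟨h1, h2⟩ := hball u hu
    have h3 : Q u / u ≠ 0 := div_ne_zero (hQ.ne_zero u h2) h1
    have := (HasDerivAt.comp (h₂ := fun y : ℂ => y ^ (k + 1)) (h := fun u => Q u / u) u
      (hasDerivAt_zpow (k + 1) _ (.inl h3)) (hQ.hasDerivAt_pole h1 h2)).div_const ((k + 1 : ℤ) : ℂ)
    refine this.congr_deriv ?_
    rw [add_sub_cancel_right]
    field_simp

/-- One step writes α = α(0) + (u / Q) β, where β is Q times the difference quotient of α at 0; then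
the same is done with β. -/
theorem exists_expansion (hQ : Invertible₀ Q r) (K : ℕ) : ∀ {α : ℂ → ℂ}, AnalyticAt ℂ α 0 →
    ∃ c : ℕ → ℂ, c 0 = α 0 ∧
      (fun u => α u - ∑ m ∈ Finset.range (K + 1), c m * (u / Q u) ^ m) =O[𝓝 0] fun u => u ^ (K + 1) := by
  have h0 : (0 : ℂ) ∈ ball (0 : ℂ) r := mem_ball_self hQ.pos
  have hQan : AnalyticAt ℂ Q 0 := hQ.diff.analyticAt (isOpen_ball.mem_nhds h0)
  have hstep : ∀ {α : ℂ → ℂ}, AnalyticAt ℂ α 0 → ∃ β : ℂ → ℂ, AnalyticAt ℂ β 0 ∧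
      ∀ᶠ u in 𝓝 0, α u = α 0 + u / Q u * β u := by
    intro α hα
    have hev := hα.eventually_analyticAt
    obtain ⟨ε, hε, hε'⟩ := Metric.eventually_nhds_iff_ball.1 hev
    have hd : DifferentiableOn ℂ (dslope α 0) (ball 0 ε) :=
      (Complex.differentiableOn_dslope (ball_mem_nhds 0 hε)).2 fun u hu =>
        (hε' u hu).differentiableAt.differentiableWithinAt
    refine ⟨fun u => Q u * dslope α 0 u, hQan.mul (hd.analyticAt (ball_mem_nhds 0 hε)), ?_⟩
    filter_upwards [isOpen_ball.mem_nhds h0] with u hu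
    have h1 := hQ.ne_zero u hu
    have h2 := sub_smul_dslope α 0 u
    rw [sub_zero, smul_eq_mul] at h2
    field_simp
    linear_combination -h2
  induction K with
  | zero =>
    intro α hα
    refine ⟨fun _ => α 0, rfl, ?_⟩
    simpa using hα.differentiableAt.isBigO_sub
  | succ K ih =>
    intro α hα
    obtain ⟨β, hβ, hαβ⟩ := hstep hα
    obtain ⟨c, -, hc⟩ := ih hβ
    refine ⟨fun m => if m = 0 then α 0 else c (m - 1), by simp, ?_⟩
    have hσ : (fun u => u / Q u) =O[𝓝 0] fun u : ℂ => u := by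
      have h1 : (fun u => (Q u)⁻¹) =O[𝓝 0] fun _ => (1 : ℂ) :=
        (hQan.continuousAt.inv₀ (hQ.ne_zero 0 h0)).tendsto.isBigO_one ℂ
      simpa [div_eq_mul_inv] using (isBigO_refl (fun u : ℂ => u) (𝓝 0)).mul h1
    have h2 := hσ.mul hc
    refine (h2.congr' ?_ ?_)
    · filter_upwards [hαβ] with u hu
      rw [Finset.sum_range_succ' _ (K + 1), hu]
      simp only [Nat.succ_ne_zero, if_false, Nat.add_sub_cancel, if_true, pow_zero, mul_one]
      rw [mul_sub, Finset.mul_sum]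
      simp only [pow_succ]
      have : ∀ m, c m * ((u / Q u) ^ m * (u / Q u)) = u / Q u * (c m * (u / Q u) ^ m) := fun m => by ring
      simp only [this]
      ring
    · exact .of_forall fun u => by simp only; ring

/-- The coefficients of an expansion in powers of `u / Q(u)` as contour integrals. -/
theorem coeff_eq (hQ : Invertible₀ Q r) (hs : 0 < s) (hsr : s < r) {α : ℂ → ℂ}
    (hα : DifferentiableOn ℂ α (ball 0 r)) {K : ℕ} {c : ℕ → ℂ}
    (hO : (fun u => α u - ∑ m ∈ Finset.range (K + 1), c m * (u / Q u) ^ m)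
      =O[𝓝[≠] 0] fun u => u ^ (K + 1)) {k : ℕ} (hk : k ≤ K) :
    (2 * π * Complex.I)⁻¹ * (∮ u in C(0, s),
      α u * ((Q u / u) ^ ((k : ℤ) - 1) * ((deriv Q u * u - Q u) / u ^ 2))) = -c k := by
  have h0 : (0 : ℂ) ∈ ball (0 : ℂ) r := mem_ball_self hQ.pos
  -- W du = χ^(k-1) dχ for χ = Q / u. Multiplied by χ^(-m) it is exact unless m = k, when its
  -- residue is -1. The remainder is O(u^(K+1)) against a pole of order at most k + 1 and
  -- contributes nothing.
  set W : ℂ → ℂ := fun u => (Q u / u) ^ ((k : ℤ) - 1) * ((deriv Q u * u - Q u) / u ^ 2) with hW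
  have hWd : ∀ u : ℂ, u ≠ 0 → ‖u‖ < r → DifferentiableAt ℂ W u := by
    intro u hu0 hur
    have hu : u ∈ ball (0 : ℂ) r := by simpa using hur
    refine (((hQ.differentiableAt hu).fun_div differentiableAt_id hu0).zpow
      (.inl (div_ne_zero (hQ.ne_zero u hu) hu0))).mul ?_
    exact (((hQ.differentiableAt_deriv hu).mul differentiableAt_id).sub (hQ.differentiableAt hu)).div
      (differentiableAt_pow 2) (pow_ne_zero 2 hu0)
  have hσd : ∀ u : ℂ, ‖u‖ < r → DifferentiableAt ℂ (fun u => u / Q u) u := by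
    intro u hur
    have hu : u ∈ ball (0 : ℂ) r := by simpa using hur
    exact differentiableAt_id.fun_div (hQ.differentiableAt hu) (hQ.ne_zero u hu)
  have hαd : ∀ u : ℂ, ‖u‖ < r → DifferentiableAt ℂ α u := fun u hur =>
    hα.differentiableAt (isOpen_ball.mem_nhds (by simpa using hur))
  have hsd : ∀ u : ℂ, ‖u‖ < r → DifferentiableAt ℂ
      (fun u => ∑ m ∈ Finset.range (K + 1), c m * (u / Q u) ^ m) u := fun u hur =>
    DifferentiableAt.fun_sum fun m _ => ((hσd u hur).pow m).const_mul _
  have hWO : W =O[𝓝[≠] 0] fun u => (u ^ (k + 1))⁻¹ := by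
    have hB : ContinuousAt (fun u => Q u ^ ((k : ℤ) - 1) * (deriv Q u * u - Q u)) 0 := by
      have h1 := (hQ.differentiableAt h0).continuousAt
      exact (h1.zpow₀ _ (.inl (hQ.ne_zero 0 h0))).mul
        (((hQ.differentiableAt_deriv h0).continuousAt.mul continuousAt_id).sub h1)
    have h2 := ((hB.tendsto.isBigO_one ℂ).mono (nhdsWithin_le_nhds (s := {0}ᶜ))).mul
      (isBigO_refl (fun u : ℂ => (u ^ (k + 1))⁻¹) (𝓝[≠] 0))
    refine (h2.congr' ?_ (.of_forall fun u => one_mul _))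
    filter_upwards [self_mem_nhdsWithin] with u hu
    have hu0 : u ≠ 0 := hu
    simp only [hW]
    rw [div_zpow, zpow_sub_one₀ hu0, zpow_natCast]
    field_simp
    ring
  have hsph : ∀ u ∈ sphere (0 : ℂ) s, u ≠ 0 ∧ ‖u‖ < r := fun u hu => by
    rw [mem_sphere_zero_iff_norm] at hu
    exact ⟨norm_pos_iff.1 (hu ▸ hs), hu ▸ hsr⟩
  have hzero : (∮ u in C(0, s), (α u - ∑ m ∈ Finset.range (K + 1), c m * (u / Q u) ^ m) * W u) = 0 := by
    refine circleIntegral_eq_zero_of_bounded (r := r)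
      (fun u h1 h2 => ((hαd u h2).sub (hsd u h2)).mul (hWd u h1 h2)) hs hsr ?_
    have h3 : (fun u : ℂ => u ^ (K + 1) * (u ^ (k + 1))⁻¹) =O[𝓝[≠] 0] fun _ => (1 : ℂ) := by
      refine IsBigO.of_bound 1 ?_
      filter_upwards [self_mem_nhdsWithin, mem_nhdsWithin_of_mem_nhds (ball_mem_nhds (0 : ℂ) one_pos)]
        with u hu hu1
      have hu0 : u ≠ 0 := hu
      rw [mem_ball_zero_iff] at hu1
      obtain ⟨d, rfl⟩ := Nat.exists_eq_add_of_le hk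
      have e : u ^ (k + d + 1) * (u ^ (k + 1))⁻¹ = u ^ d := by
        rw [show k + d + 1 = (k + 1) + d by ring, pow_add]
        field_simp
      rw [e, norm_pow, norm_one, mul_one]
      exact pow_le_one₀ (norm_nonneg _) hu1.le
    exact (hO.mul hWO).trans h3
  have hterm : ∀ m ∈ Finset.range (K + 1), (∮ u in C(0, s), c m * (u / Q u) ^ m * W u)
      = c m * ((2 * π * Complex.I) * if m = k then -1 else 0) := by
    intro m _
    have e : (∮ u in C(0, s), c m * (u / Q u) ^ m * W u) = ∮ u in C(0, s),
        c m * ((Q u / u) ^ ((k : ℤ) - 1 - m) * ((deriv Q u * u - Q u) / u ^ 2)) := by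
      refine circleIntegral.integral_congr hs.le fun u hu => ?_
      obtain ⟨h1, h2⟩ := hsph u hu
      have hq := hQ.ne_zero u (by simpa using h2)
      have hne : Q u / u ≠ 0 := div_ne_zero hq h1
      simp only [hW]
      rw [zpow_sub₀ hne _ (m : ℤ), zpow_natCast, ← inv_div, inv_pow]
      field_simp
    have := hQ.circleIntegral_zpow_pole hs hsr ((k : ℤ) - 1 - m)
    rw [e, circleIntegral.integral_const_mul, ← mul_inv_cancel_left₀ Complex.two_pi_I_ne_zero
      (∮ u in C(0, s), (Q u / u) ^ ((k : ℤ) - 1 - m) * ((deriv Q u * u - Q u) / u ^ 2)), this]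
    congr 3
    simp only [eq_iff_iff]
    omega
  have hint : ∀ {f : ℂ → ℂ}, (∀ u : ℂ, u ≠ 0 → ‖u‖ < r → DifferentiableAt ℂ f u) →
      CircleIntegrable f 0 s := fun hf =>
    ContinuousOn.circleIntegrable hs.le fun u hu =>
      (hf u (hsph u hu).1 (hsph u hu).2).continuousAt.continuousWithinAt
  have hsplit : (∮ u in C(0, s), α u * W u) =
      (∮ u in C(0, s), (α u - ∑ m ∈ Finset.range (K + 1), c m * (u / Q u) ^ m) * W u)
      + ∑ m ∈ Finset.range (K + 1), ∮ u in C(0, s), c m * (u / Q u) ^ m * W u := by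
    have hi : ∀ m ∈ Finset.range (K + 1), CircleIntegrable (fun u => c m * (u / Q u) ^ m * W u) 0 s :=
      fun m _ => hint fun u h1 h2 => (((hσd u h2).fun_pow m).const_mul _).fun_mul (hWd u h1 h2)
    rw [← circleIntegral.integral_fun_sum hi, ← circleIntegral.integral_add
      (hint fun u h1 h2 => ((hαd u h2).fun_sub (hsd u h2)).fun_mul (hWd u h1 h2))
      (CircleIntegrable.fun_sum _ hi)]
    refine circleIntegral.integral_congr hs.le fun u _ => ?_
    rw [← Finset.sum_mul]
    ring
  rw [hsplit, hzero, zero_add, Finset.sum_congr rfl hterm]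
  have hkm : k ∈ Finset.range (K + 1) := by simpa using Nat.lt_succ_of_le hk
  simp only [mul_ite, mul_zero, mul_neg, mul_one]
  rw [Finset.sum_ite_eq' _ k, if_pos hkm]
  have := Complex.two_pi_I_ne_zero
  field_simp

end Invertible₀

/-! ### Roots of a function with a pole -/

/-- For r > 0 the punctured disc is the image of a half-plane under exp. -/
theorem isPreconnected_punctured_ball (r : ℝ) : IsPreconnected (ball (0 : ℂ) r \ {0}) := by
  rcases le_or_gt r 0 with hr | hr
  · rw [ball_eq_empty.2 hr, Set.empty_sdiff]
    exact isPreconnected_empty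
  have h : ball (0 : ℂ) r \ {0} = Complex.exp '' {z | z.re < Real.log r} := by
    ext z
    simp only [Set.mem_sdiff, mem_ball_zero_iff, Set.mem_singleton_iff, Set.mem_image, Set.mem_ofPred_eq]
    constructor
    · rintro ⟨h1, h2⟩
      refine ⟨Complex.log z, ?_, Complex.exp_log h2⟩
      rw [Complex.log_re]
      exact Real.log_lt_log (norm_pos_iff.2 h2) h1
    · rintro ⟨w, hw, rfl⟩
      refine ⟨?_, Complex.exp_ne_zero w⟩
      rw [Complex.norm_exp, ← Real.exp_log hr]
      exact Real.exp_lt_exp.2 hw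
  rw [h]
  exact (convex_halfSpace_re_lt _).isPreconnected.image _ Complex.continuous_exp.continuousOn

/-- `Λ` is a holomorphic logarithm of `P` on the disc of radius `r`. -/
structure IsLog (P Λ : ℂ → ℂ) (r : ℝ) : Prop where
  pos : 0 < r
  diff : DifferentiableOn ℂ Λ (ball 0 r)
  exp_eq : ∀ u ∈ ball (0 : ℂ) r, Complex.exp (Λ u) = P u

/-- `X` is a branch of the `n`-th root of `P(u) / uⁿ` near `0`. -/
def IsPoleRoot (P : ℂ → ℂ) (n : ℕ) (X : ℂ → ℂ) : Prop :=
  ∀ᶠ u in 𝓝[≠] (0 : ℂ), DifferentiableAt ℂ X u ∧ X u ^ n = P u / u ^ n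

variable {P Λ X : ℂ → ℂ} {r s : ℝ} {n K : ℕ}

namespace IsLog

theorem differentiableAt (h : IsLog P Λ r) {u : ℂ} (hu : u ∈ ball (0 : ℂ) r) : DifferentiableAt ℂ Λ u :=
  h.diff.differentiableAt (isOpen_ball.mem_nhds hu)

theorem exp_zero (h : IsLog P Λ r) : Complex.exp (Λ 0) = P 0 := h.exp_eq 0 (mem_ball_self h.pos)

/-- The root `exp (Λ / n)` of `P`. -/
theorem invertible (h : IsLog P Λ r) (n : ℕ) : Invertible₀ (fun u => Complex.exp (Λ u / n)) r :=
  ⟨h.pos, (h.diff.div_const _).cexp, fun _ _ => Complex.exp_ne_zero _⟩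

theorem add_const (h : IsLog P Λ r) {c : ℂ} (hc : Complex.exp c = 1) : IsLog P (fun u => Λ u + c) r :=
  ⟨h.pos, h.diff.add_const c, fun u hu => by rw [Complex.exp_add, hc, mul_one, h.exp_eq u hu]⟩

theorem isPoleRoot (h : IsLog P Λ r) (hn : 0 < n) : IsPoleRoot P n fun u => Complex.exp (Λ u / n) / u := by
  filter_upwards [self_mem_nhdsWithin, mem_nhdsWithin_of_mem_nhds (ball_mem_nhds (0 : ℂ) h.pos)] with u h0 hu
  refine ⟨((h.invertible n).hasDerivAt_pole h0 hu).differentiableAt, ?_⟩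
  rw [div_pow, ← Complex.exp_nat_mul, mul_div_cancel₀ _ (Nat.cast_ne_zero.2 hn.ne'), h.exp_eq u hu]

end IsLog

/-- The ratio of X to the root exp(Λ/n) / u maps a connected set continuously to the finite set of
n-th roots of unity. It is therefore a constant exp(c/n) with exp c = 1. -/
theorem IsPoleRoot.exists_log (hX : IsPoleRoot P n X) (hn : 0 < n) (h : IsLog P Λ r) :
    ∃ c, Complex.exp c = 1 ∧ X =ᶠ[𝓝[≠] 0] fun u => Complex.exp ((Λ u + c) / n) / u := by
  obtain ⟨ε, hε, hb⟩ := Metric.eventually_nhds_iff_ball.1 (eventually_nhdsWithin_iff.1 hX)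
  have hn' : (n : ℂ) ≠ 0 := Nat.cast_ne_zero.2 hn.ne'
  set m := min ε r with hm
  have hm0 : 0 < m := lt_min hε h.pos
  set g : ℂ → ℂ := fun u => u * X u / Complex.exp (Λ u / n) with hg
  have hfin : {w : ℂ | w ^ n = 1}.Finite := by
    refine (Polynomial.nthRoots n (1 : ℂ)).toFinset.finite_toSet.subset fun w hw => ?_
    simpa [Polynomial.mem_nthRoots hn] using hw
  have hcont : ContinuousOn g (ball 0 m \ {0}) := fun u hu => by
    have h1 := hb u (ball_subset_ball (min_le_left _ _) hu.1) hu.2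
    have h2 := h.differentiableAt (ball_subset_ball (min_le_right _ _) hu.1)
    exact ((differentiableAt_id.mul h1.1).div (h2.div_const _).cexp
      (Complex.exp_ne_zero _)).continuousAt.continuousWithinAt
  have hmaps : Set.MapsTo g (ball 0 m \ {0}) {w : ℂ | w ^ n = 1} := fun u hu => by
    have h1 := (hb u (ball_subset_ball (min_le_left _ _) hu.1) hu.2).2
    have h2 := h.exp_eq u (ball_subset_ball (min_le_right _ _) hu.1)
    have hu0 : u ≠ 0 := hu.2
    have h3 : P u ≠ 0 := h2 ▸ Complex.exp_ne_zero _
    simp only [hg, Set.mem_ofPred_eq]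
    rw [div_pow, mul_pow, h1, ← Complex.exp_nat_mul, mul_div_cancel₀ _ hn', h2]
    field_simp
  have hmem : ((m / 2 : ℝ) : ℂ) ∈ ball (0 : ℂ) m \ {0} := by
    refine ⟨?_, ?_⟩
    · rw [mem_ball_zero_iff, Complex.norm_real, Real.norm_eq_abs, abs_of_pos (by positivity)]
      linarith
    · simp [hm0.ne']
  set ω := g ((m / 2 : ℝ) : ℂ) with hω
  have hω1 : ω ^ n = 1 := hmaps hmem
  have hω0 : ω ≠ 0 := by
    intro h
    rw [h, zero_pow hn.ne'] at hω1
    exact zero_ne_one hω1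
  refine ⟨n * Complex.log ω, by rw [Complex.exp_nat_mul, Complex.exp_log hω0, hω1], ?_⟩
  filter_upwards [sdiff_mem_nhdsWithin_compl (ball_mem_nhds (0 : ℂ) hm0) {0}] with u hu
  have h1 := (isPreconnected_punctured_ball m).constant_of_mapsTo hfin.isDiscrete hcont hmaps hu hmem
  have hu0 : u ≠ 0 := hu.2
  have h2 := Complex.exp_ne_zero (Λ u / n)
  rw [← hω] at h1
  rw [add_div, Complex.exp_add, mul_div_cancel_left₀ _ hn', Complex.exp_log hω0, ← h1]
  simp only [hg]
  field_simp

/-- The coefficients of `n log (u χ(u))`, `χ = (P(u) / uⁿ) ^ (1/n)`, in powers of `χ⁻¹`, given by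
Lagrange's formula. -/
noncomputable def poleCoeff (Λ : ℂ → ℂ) (n : ℕ) (s : ℝ) (k : ℕ) : ℂ :=
  if k = 0 then Λ 0 else
    (n : ℂ) / k * ((2 * π * Complex.I)⁻¹ * ∮ u in C(0, s), (Complex.exp (Λ u / n) / u) ^ k / u)

theorem hasDerivAt_root (h : IsLog P Λ r) {u : ℂ} (hu : u ∈ ball (0 : ℂ) r) (n : ℕ) :
    HasDerivAt (fun u => Complex.exp (Λ u / n)) (Complex.exp (Λ u / n) * (deriv Λ u / n)) u :=
  ((h.differentiableAt hu).hasDerivAt.div_const _).cexp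

/-- Lagrange inversion. For χ = exp(Λ/n) / u the form d((Λ/n) χ^k - χ^k/k) equals χ^k du/u + k (Λ/n)
χ^(k-1) dχ. So the contour formula for the coefficients of Λ/n in powers of χ⁻¹ becomes an integral
of χ^k du/u alone. The coefficient of index 0 is the limit at u = 0. -/
theorem IsLog.lagrange (h : IsLog P Λ r) (hn : 0 < n) (hs : 0 < s) (hsr : s < r) {g : ℕ → ℂ}
    (hO : (fun u => Λ u / n - ∑ m ∈ Finset.range (K + 1), g m * (u / Complex.exp (Λ u / n)) ^ m)
      =O[𝓝[≠] 0] fun u => u ^ (K + 1)) {k : ℕ} (hk : k ≤ K) :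
    n * g k = poleCoeff Λ n s k := by
  have hn' : (n : ℂ) ≠ 0 := Nat.cast_ne_zero.2 hn.ne'
  have hQ := h.invertible n
  have key := fun {k} (hk : k ≤ K) => hQ.coeff_eq hs hsr (h.diff.div_const (n : ℂ)) hO hk
  have h0 : (0 : ℂ) ∈ ball (0 : ℂ) r := mem_ball_self h.pos
  rw [poleCoeff]
  split_ifs with hk0
  · subst hk0
    have h1 : Tendsto (fun u => Λ u / n - ∑ m ∈ Finset.range (K + 1), g m * (u / Complex.exp (Λ u / n)) ^ m)
        (𝓝[≠] 0) (𝓝 (Λ 0 / n - g 0)) := by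
      have hc : ContinuousAt (fun u => Λ u / n
          - ∑ m ∈ Finset.range (K + 1), g m * (u / Complex.exp (Λ u / n)) ^ m) 0 := by
        have h2 := (h.differentiableAt h0).continuousAt
        refine (h2.div_const _).sub (tendsto_finsetSum _ fun m _ => ?_)
        exact (continuousAt_const.mul ((continuousAt_id.div (h2.div_const _).cexp
          (Complex.exp_ne_zero _)).pow m))
      have h3 := hc.tendsto.mono_left (nhdsWithin_le_nhds (s := {0}ᶜ))
      rw [Finset.sum_range_succ'] at h3
      simpa using h3
    have h2 : Tendsto (fun u : ℂ => u ^ (K + 1)) (𝓝[≠] 0) (𝓝 0) := by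
      have : Continuous fun u : ℂ => u ^ (K + 1) := by fun_prop
      simpa using (this.tendsto 0).mono_left (nhdsWithin_le_nhds (s := {0}ᶜ))
    have h3 := tendsto_nhds_unique h1 (hO.trans_tendsto h2)
    field_simp at h3
    linear_combination -h3
  · have hk' : (k : ℂ) ≠ 0 := Nat.cast_ne_zero.2 hk0
    have hsph : ∀ u ∈ sphere (0 : ℂ) s, u ≠ 0 ∧ u ∈ ball (0 : ℂ) r := fun u hu => by
      rw [mem_sphere_zero_iff_norm] at hu
      exact ⟨norm_pos_iff.1 (hu ▸ hs), by rw [mem_ball_zero_iff, hu]; exact hsr⟩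
    set Q : ℂ → ℂ := fun u => Complex.exp (Λ u / n) with hQdef
    have hdQ : ∀ u ∈ ball (0 : ℂ) r, deriv Q u = Q u * (deriv Λ u / n) := fun u hu =>
      (hasDerivAt_root h hu n).deriv
    have hW : ∀ u ∈ sphere (0 : ℂ) s, HasDerivAt
        (fun u => Λ u / n * (Q u / u) ^ k - (Q u / u) ^ k / k)
        ((Q u / u) ^ k / u
          + k * (Λ u / n * ((Q u / u) ^ ((k : ℤ) - 1) * ((deriv Q u * u - Q u) / u ^ 2)))) u := by
      intro u hu
      obtain ⟨hu0, hur⟩ := hsph u hu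
      have h1 := (hQ.hasDerivAt_pole hu0 hur).fun_pow k
      have h2 := (h.differentiableAt hur).hasDerivAt.div_const (n : ℂ)
      refine ((h2.fun_mul h1).fun_sub (h1.div_const _)).congr_deriv ?_
      have hQ0 : Q u ≠ 0 := Complex.exp_ne_zero _
      have e : (Q u / u) ^ ((k : ℤ) - 1) = (Q u / u) ^ (k - 1) := by
        rw [← zpow_natCast]
        congr 1
        have := Nat.pos_of_ne_zero hk0
        omega
      obtain ⟨j, rfl⟩ := Nat.exists_eq_succ_of_ne_zero hk0
      rw [e, hdQ u hur, Nat.succ_eq_add_one, Nat.add_sub_cancel, pow_succ]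
      simp only [hQdef] at hQ0 ⊢
      field_simp
      ring
    have h1 := circleIntegral.integral_eq_zero_of_hasDerivWithinAt hs.le
      fun u hu => (hW u hu).hasDerivWithinAt
    have hc1 : ContinuousOn (fun u => (Q u / u) ^ k / u) (sphere 0 s) := fun u hu => by
      obtain ⟨hu0, hur⟩ := hsph u hu
      exact (((hQ.hasDerivAt_pole hu0 hur).continuousAt.pow k).div continuousAt_id hu0).continuousWithinAt
    have hc2 : ContinuousOn (fun u => k * (Λ u / n * ((Q u / u) ^ ((k : ℤ) - 1) *
        ((deriv Q u * u - Q u) / u ^ 2)))) (sphere 0 s) := fun u hu => by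
      obtain ⟨hu0, hur⟩ := hsph u hu
      refine ContinuousAt.continuousWithinAt ?_
      refine continuousAt_const.mul (((h.differentiableAt hur).continuousAt.div_const _).mul
        (((hQ.hasDerivAt_pole hu0 hur).continuousAt.zpow₀ _
          (.inl (div_ne_zero (Complex.exp_ne_zero _) hu0))).mul ?_))
      exact (((hQ.differentiableAt_deriv hur).continuousAt.mul continuousAt_id).sub
        (hQ.differentiableAt hur).continuousAt).div (continuousAt_id.pow 2) (pow_ne_zero 2 hu0)
    rw [circleIntegral.integral_add (hc1.circleIntegrable hs.le) (hc2.circleIntegrable hs.le),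
      circleIntegral.integral_const_mul] at h1
    have h3 := Complex.two_pi_I_ne_zero
    have h2 : (∮ u in C(0, s), Λ u / n * ((Q u / u) ^ ((k : ℤ) - 1) *
        ((deriv Q u * u - Q u) / u ^ 2))) = 2 * π * Complex.I * -g k :=
      (inv_mul_eq_iff_eq_mul₀ h3).1 (key hk)
    rw [eq_neg_of_add_eq_zero_left h1, h2]
    field_simp

theorem IsLog.exists_expansion (h : IsLog P Λ r) (hn : 0 < n) (hs : 0 < s) (hsr : s < r) (K : ℕ) :
    (fun u => Λ u - ∑ m ∈ Finset.range (K + 1), poleCoeff Λ n s m * (u / Complex.exp (Λ u / n)) ^ m)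
      =O[𝓝 0] fun u => u ^ (K + 1) := by
  have h0 : (0 : ℂ) ∈ ball (0 : ℂ) r := mem_ball_self h.pos
  have hn' : (n : ℂ) ≠ 0 := Nat.cast_ne_zero.2 hn.ne'
  obtain ⟨c, -, hc⟩ := (h.invertible n).exists_expansion K
    ((h.diff.div_const (n : ℂ)).analyticAt (isOpen_ball.mem_nhds h0))
  refine (hc.const_mul_left (n : ℂ)).congr_left fun u => ?_
  rw [mul_sub, mul_div_cancel₀ _ hn', Finset.mul_sum]
  congr 1
  refine Finset.sum_congr rfl fun m hm => ?_
  rw [← h.lagrange hn hs hsr (hc.mono nhdsWithin_le_nhds) (Finset.mem_range_succ_iff.1 hm), mul_assoc]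

/-- The numbers `yₖ / n` are the coefficients of `log (u χ(u))` in powers of `χ⁻¹`, where `χ` is
a branch of `(P(u) / uⁿ) ^ (1/n)`, formulated with the inverse function of `χ`. -/
def IsPoleInverse (P : ℂ → ℂ) (n K : ℕ) (y : ℕ → ℂ) : Prop :=
  ∃ X Z R : ℂ → ℂ, IsPoleRoot P n X ∧
    (∀ᶠ u in 𝓝[≠] (0 : ℂ), Z (X u) = u) ∧ (∀ᶠ w in cobounded ℂ, X (Z w) = w) ∧
    Tendsto Z (cobounded ℂ) (𝓝[≠] 0) ∧
    R =O[cobounded ℂ] (fun w => (w ^ (K + 1))⁻¹) ∧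
    ∀ᶠ w in cobounded ℂ,
      Z w = w⁻¹ * Complex.exp ((1 / n : ℂ) * ∑ k ∈ Finset.range (K + 1), y k * (w ^ k)⁻¹ + R w)

/-- The numbers `yₖ` are the coefficients in Lagrange's formula. -/
def IsPoleResidue (P : ℂ → ℂ) (n K : ℕ) (y : ℕ → ℂ) : Prop :=
  Complex.exp (y 0) = P 0 ∧ ∃ X, IsPoleRoot P n X ∧
    Tendsto (fun u => u * X u) (𝓝[≠] 0) (𝓝 (Complex.exp (y 0 / n))) ∧
    ∀ k, k ≠ 0 → k ≤ K → y k = (n : ℂ) / k * resZero fun u => X u ^ k / u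

theorem IsLog.poleCoeff_eq (h : IsLog P Λ r) (hs : 0 < s) (hsr : s < r) {k : ℕ} (hk : k ≠ 0) :
    poleCoeff Λ n s k = (n : ℂ) / k * resZero fun u => (Complex.exp (Λ u / n) / u) ^ k / u := by
  rw [poleCoeff, if_neg hk, resZero_eq (r := r) _ hs hsr]
  intro u hu0 hu
  exact (((h.invertible n).hasDerivAt_pole hu0 (by simpa using hu)).differentiableAt.pow k).div
    differentiableAt_id hu0

theorem IsLog.tendsto_mul_root (h : IsLog P Λ r) (n : ℕ) :
    Tendsto (fun u => u * (Complex.exp (Λ u / n) / u)) (𝓝[≠] 0) (𝓝 (Complex.exp (Λ 0 / n))) := by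
  have h0 : (0 : ℂ) ∈ ball (0 : ℂ) r := mem_ball_self h.pos
  have h1 := (((h.differentiableAt h0).continuousAt.div_const (n : ℂ)).cexp).tendsto.mono_left
    (nhdsWithin_le_nhds (s := {0}ᶜ))
  refine h1.congr' ?_
  filter_upwards [self_mem_nhdsWithin] with u hu
  rw [mul_div_cancel₀ _ hu]

/-- The prescribed limit of u X(u), together with y 0 = Λ 0, selects the root exp(Λ/n) / u among the
n branches; another branch would multiply the coefficients by powers of a root of unity. -/
theorem isPoleResidue_iff (h : IsLog P Λ r) (hn : 0 < n) (hs : 0 < s) (hsr : s < r) {y : ℕ → ℂ}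
    (h0 : y 0 = Λ 0) : IsPoleResidue P n K y ↔ ∀ k ≤ K, y k = poleCoeff Λ n s k := by
  constructor
  · rintro ⟨-, X, hX, hlim, hy⟩ k hk
    rcases eq_or_ne k 0 with rfl | hk0
    · simp [poleCoeff, h0]
    obtain ⟨c, hc, hXc⟩ := hX.exists_log hn h
    have h1 := (h.add_const hc).tendsto_mul_root n
    have h2 := tendsto_nhds_unique hlim (h1.congr' (by filter_upwards [hXc] with u hu using by rw [hu]))
    rw [h0, add_div, Complex.exp_add] at h2
    have h3 : Complex.exp (c / n) = 1 := by
      have := Complex.exp_ne_zero (Λ 0 / n)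
      field_simp at h2
      exact h2.symm
    rw [hy k hk0 hk, h.poleCoeff_eq hs hsr hk0]
    congr 1
    refine resZero_congr ?_
    filter_upwards [hXc] with u hu
    rw [hu, add_div, Complex.exp_add, h3, mul_one]
  · intro hy
    refine ⟨by rw [h0, h.exp_zero], _, h.isPoleRoot hn, by rw [h0]; exact h.tendsto_mul_root n, ?_⟩
    intro k hk hkK
    rw [hy k hkK, h.poleCoeff_eq hs hsr hk]

theorem IsLog.tendsto_pole (h : IsLog P Λ r) (n : ℕ) :
    Tendsto (fun u => Complex.exp (Λ u / n) / u) (𝓝[≠] 0) (cobounded ℂ) := by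
  have h0 : (0 : ℂ) ∈ ball (0 : ℂ) r := mem_ball_self h.pos
  have h1 : Tendsto (fun u => u / Complex.exp (Λ u / n)) (𝓝[≠] 0) (𝓝[≠] 0) := by
    refine tendsto_nhdsWithin_iff.2 ⟨?_, ?_⟩
    · have := (continuousAt_id.div ((h.differentiableAt h0).continuousAt.div_const (n : ℂ)).cexp
        (Complex.exp_ne_zero _)).tendsto.mono_left (nhdsWithin_le_nhds (s := {0}ᶜ))
      simpa [Pi.div_def] using this
    · filter_upwards [self_mem_nhdsWithin] with u hu
      exact div_ne_zero hu (Complex.exp_ne_zero _)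
  refine (tendsto_inv₀_nhdsNE_zero.comp h1).congr fun u => ?_
  simp

/-- If two logarithms of the same function agree in the limit, they agree near the limit point. -/
theorem eventually_eq_of_exp_eq {ι : Type*} {l : Filter ι} {f g : ι → ℂ} (h : ∀ᶠ x in l, Complex.exp (f x) = Complex.exp (g x))
    (hfg : Tendsto (fun x => f x - g x) l (𝓝 0)) : ∀ᶠ x in l, f x = g x := by
  have h1 : ∀ᶠ x in l, ‖f x - g x‖ < π := by
    have := hfg.norm
    rw [norm_zero] at this
    exact this.eventually (gt_mem_nhds Real.pi_pos)
  filter_upwards [h, h1] with x h2 h3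
  have him := (Complex.abs_im_le_norm (f x - g x)).trans_lt h3
  rw [abs_lt] at him
  have h4 : Complex.exp (f x - g x) = 1 := by
    rw [Complex.exp_sub, h2, div_self (Complex.exp_ne_zero _)]
  have h5 := Complex.log_exp him.1 him.2.le
  rw [h4, Complex.log_one] at h5
  exact sub_eq_zero.1 h5.symm

/-- The function `u / exp (Λ(u) / n)` is invertible near `0`. -/
theorem IsLog.exists_inverse (h : IsLog P Λ r) (n : ℕ) : ∃ U : ℂ → ℂ,
    (∀ᶠ u in 𝓝 0, U (u / Complex.exp (Λ u / n)) = u) ∧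
    (∀ᶠ v in 𝓝 0, U v / Complex.exp (Λ (U v) / n) = v) ∧ U =O[𝓝 0] (fun v => v) := by
  have h0 : (0 : ℂ) ∈ ball (0 : ℂ) r := mem_ball_self h.pos
  have han : AnalyticAt ℂ (fun u => u / Complex.exp (Λ u / n)) 0 :=
    analyticAt_id.fun_div ((h.invertible n).diff.analyticAt (isOpen_ball.mem_nhds h0)) (Complex.exp_ne_zero _)
  have hd : HasStrictDerivAt (fun u => u / Complex.exp (Λ u / n)) (Complex.exp (Λ 0 / n))⁻¹ 0 := by
    refine han.hasStrictDerivAt.congr_deriv ?_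
    refine ((hasDerivAt_id (0 : ℂ)).fun_div (hasDerivAt_root h h0 n) (Complex.exp_ne_zero _)).deriv.trans ?_
    have := Complex.exp_ne_zero (Λ 0 / n)
    simp only [id]
    field_simp
    ring
  have hne : (Complex.exp (Λ 0 / n))⁻¹ ≠ 0 := inv_ne_zero (Complex.exp_ne_zero _)
  have e0 : (0 : ℂ) / Complex.exp (Λ 0 / n) = 0 := zero_div _
  refine ⟨hd.localInverse _ _ _ hne, hd.eventually_left_inverse hne, ?_, ?_⟩
  · have := hd.eventually_right_inverse hne
    rwa [e0] at this
  · have h1 := (hd.to_localInverse hne).hasDerivAt.isBigO_sub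
    have h2 := (hd.eventually_left_inverse hne).self_of_nhds
    rw [e0] at h1
    rw [e0] at h2
    rw [h2] at h1
    simpa using h1

theorem tendsto_inv_pow_cobounded {k : ℕ} (hk : k ≠ 0) :
    Tendsto (fun w : ℂ => (w ^ k)⁻¹) (cobounded ℂ) (𝓝 0) := by
  simpa [hk] using (tendsto_inv₀_cobounded (α := ℂ)).pow k

theorem tendsto_poleSum (n : ℕ) {y : ℕ → ℂ} {R : ℂ → ℂ} (hR : R =O[cobounded ℂ] (fun w => (w ^ (K + 1))⁻¹)) :
    Tendsto (fun w => (1 / n : ℂ) * ∑ k ∈ Finset.range (K + 1), y k * (w ^ k)⁻¹ + R w)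
      (cobounded ℂ) (𝓝 (y 0 / n)) := by
  have h3 : Tendsto (fun w : ℂ => ∑ k ∈ Finset.range (K + 1), y k * (w ^ k)⁻¹) (cobounded ℂ) (𝓝 (y 0)) := by
    simp_rw [Finset.sum_range_succ']
    have := (tendsto_finsetSum (Finset.range K) fun k _ =>
      ((tendsto_inv_pow_cobounded k.succ_ne_zero).const_mul (y (k + 1)))).add_const (y 0)
    simpa using this
  have := (h3.const_mul (1 / n : ℂ)).add (hR.trans_tendsto (tendsto_inv_pow_cobounded K.succ_ne_zero))
  rw [add_zero, one_div, inv_mul_eq_div] at this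
  simpa using this

theorem IsPoleInverse.exp_zero {y : ℕ → ℂ} (hy : IsPoleInverse P n K y) (hn : 0 < n) (h : IsLog P Λ r) :
    Complex.exp (y 0) = P 0 := by
  obtain ⟨X, Z, R, hX, h1, h2, hZ, hR, hW⟩ := hy
  obtain ⟨c, hc, hXc⟩ := hX.exists_log hn h
  have hn' : (n : ℂ) ≠ 0 := Nat.cast_ne_zero.2 hn.ne'
  have l1 := (tendsto_poleSum n (y := y) hR).cexp
  have l2 : Tendsto (fun w => w * Z w) (cobounded ℂ) (𝓝 (Complex.exp ((Λ 0 + c) / n))) := by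
    have h3 := ((h.add_const hc).tendsto_mul_root n).comp hZ
    refine h3.congr' ?_
    filter_upwards [hZ.eventually hXc, h2] with w h4 h5
    simp only [Function.comp]
    rw [← h4, h5, mul_comm]
  have l3 := tendsto_nhds_unique l2 (l1.congr' (by
    filter_upwards [hW, eventually_ne_cobounded (0 : ℂ)] with w h4 h5
    rw [h4, mul_inv_cancel_left₀ h5]))
  have := congrArg (· ^ n) l3
  simp only [← Complex.exp_nat_mul, mul_div_cancel₀ _ hn', Complex.exp_add, hc, mul_one, h.exp_zero] at this
  exact this.symm

/-- Substituting w = χ(u) turns the expansion of the inverse function into an expansion of Λ/n in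
powers of χ⁻¹, to which `IsLog.lagrange` applies. Conversely u / exp(Λ/n) has a local inverse U at
0, and Z w = U(w⁻¹) has the required expansion. -/
theorem isPoleInverse_iff (h : IsLog P Λ r) (hn : 0 < n) (hs : 0 < s) (hsr : s < r) {y : ℕ → ℂ}
    (h0 : y 0 = Λ 0) : IsPoleInverse P n K y ↔ ∀ k ≤ K, y k = poleCoeff Λ n s k := by
  have hn' : (n : ℂ) ≠ 0 := Nat.cast_ne_zero.2 hn.ne'
  have hb0 : (0 : ℂ) ∈ ball (0 : ℂ) r := mem_ball_self h.pos
  constructor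
  · rintro ⟨X, Z, R, hX, h1, h2, hZ, hR, hW⟩ k hk
    obtain ⟨c, hc, hXc⟩ := hX.exists_log hn h
    have hXt : Tendsto X (𝓝[≠] 0) (cobounded ℂ) :=
      ((h.add_const hc).tendsto_pole n).congr' (by filter_upwards [hXc] with u hu using hu.symm)
    have l1 := (tendsto_poleSum n (y := y) hR).comp hXt
    have hev : ∀ᶠ u in 𝓝[≠] (0 : ℂ), Complex.exp ((Λ u + c) / n)
        = Complex.exp ((1 / n : ℂ) * ∑ k ∈ Finset.range (K + 1), y k * (X u ^ k)⁻¹ + R (X u)) := by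
      filter_upwards [hXt.eventually hW, hXc, h1, self_mem_nhdsWithin] with u e1 e2 e3 (e4 : u ≠ 0)
      have e5 : X u ≠ 0 := e2 ▸ div_ne_zero (Complex.exp_ne_zero _) e4
      rw [e3, inv_mul_eq_div, eq_div_iff e5] at e1
      rw [← e1, e2, mul_div_cancel₀ _ e4]
    have l2 : Tendsto (fun u => (Λ u + c) / n) (𝓝[≠] 0) (𝓝 ((Λ 0 + c) / n)) :=
      (((h.differentiableAt hb0).continuousAt.add_const c).div_const (n : ℂ)).tendsto.mono_left nhdsWithin_le_nhds
    have l3 := tendsto_nhds_unique l2.cexp (l1.cexp.congr' (hev.mono fun u hu => hu.symm))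
    -- Comparison of the limits at u = 0: since y 0 = Λ 0, the root can only be the one defined by
    -- Λ.
    have hc1 : Complex.exp (c / n) = 1 := by
      rw [h0, add_div, Complex.exp_add] at l3
      exact mul_right_eq_self₀.1 l3 |>.resolve_right (Complex.exp_ne_zero _)
    have hX' : ∀ᶠ u in 𝓝[≠] (0 : ℂ), X u = Complex.exp (Λ u / n) / u := by
      filter_upwards [hXc] with u hu
      rw [hu, add_div, Complex.exp_add, hc1, mul_one]
    have l4 : Tendsto (fun u => Λ u / n) (𝓝[≠] 0) (𝓝 (Λ 0 / n)) :=
      ((h.differentiableAt hb0).continuousAt.div_const (n : ℂ)).tendsto.mono_left nhdsWithin_le_nhds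
    -- The two sides have equal exponentials and their difference tends to Λ 0 / n - y 0 / n = 0, so
    -- they are equal and not merely congruent modulo 2πi.
    have hev2 : ∀ᶠ u in 𝓝[≠] (0 : ℂ), Λ u / n
        = (1 / n : ℂ) * ∑ k ∈ Finset.range (K + 1), y k * (X u ^ k)⁻¹ + R (X u) := by
      refine eventually_eq_of_exp_eq ?_ ?_
      · filter_upwards [hev] with u hu
        rw [← hu, add_div, Complex.exp_add, hc1, mul_one]
      · have := l4.sub l1
        rw [h0, sub_self] at this
        exact this
    have hO : (fun u => Λ u / n - ∑ m ∈ Finset.range (K + 1), y m / n * (u / Complex.exp (Λ u / n)) ^ m)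
        =O[𝓝[≠] 0] fun u => u ^ (K + 1) := by
      have h3 : (fun u => (X u ^ (K + 1))⁻¹) =O[𝓝[≠] 0] fun u : ℂ => u ^ (K + 1) := by
        have h4 : (fun u => (Complex.exp (Λ u / n))⁻¹) =O[𝓝[≠] 0] fun _ => (1 : ℂ) :=
          (l4.cexp.inv₀ (Complex.exp_ne_zero _)).isBigO_one ℂ
        have h5 := ((isBigO_refl (fun u : ℂ => u) (𝓝[≠] 0)).mul h4).pow (K + 1)
        refine h5.congr' ?_ (by simp)
        filter_upwards [hX'] with u hu
        rw [hu, ← inv_pow, inv_div, div_eq_mul_inv u]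
      refine ((hR.comp_tendsto hXt).trans h3).congr' ?_ .rfl
      filter_upwards [hX', hev2] with u e1 e2
      simp only [Function.comp]
      have e3 : ∑ m ∈ Finset.range (K + 1), y m / n * (u / Complex.exp (Λ u / n)) ^ m
          = (1 / n : ℂ) * ∑ k ∈ Finset.range (K + 1), y k * (X u ^ k)⁻¹ := by
        rw [Finset.mul_sum]
        refine Finset.sum_congr rfl fun k _ => ?_
        rw [← inv_div _ u, ← e1, inv_pow]
        ring
      rw [e3, e2, add_sub_cancel_left]
    have := h.lagrange hn hs hsr hO hk
    rwa [mul_div_cancel₀ _ hn'] at this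
  · intro hy
    obtain ⟨U, hU1, hU2, hU3⟩ := h.exists_inverse n
    have hinv : Tendsto (fun w : ℂ => w⁻¹) (cobounded ℂ) (𝓝 0) := tendsto_inv₀_cobounded
    have hUt : Tendsto U (𝓝 0) (𝓝 0) := hU3.trans_tendsto tendsto_id
    have hZ0 : Tendsto (fun w => U w⁻¹) (cobounded ℂ) (𝓝 0) := hUt.comp hinv
    have hZZ : ∀ᶠ w in cobounded ℂ, Complex.exp (Λ (U w⁻¹) / n) / U w⁻¹ = w := by
      filter_upwards [hinv.eventually hU2] with w hw
      rw [← inv_div, hw, inv_inv]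
    have hZ1 : ∀ᶠ w in cobounded ℂ, U w⁻¹ ≠ 0 := by
      filter_upwards [hZZ, eventually_ne_cobounded (0 : ℂ)] with w hw hw0 h3
      rw [h3, div_zero] at hw
      exact hw0 hw.symm
    have hexp := h.exists_expansion hn hs hsr K
    refine ⟨fun u => Complex.exp (Λ u / n) / u, fun w => U w⁻¹,
      fun w => (1 / n : ℂ) * (Λ (U w⁻¹) - ∑ k ∈ Finset.range (K + 1), y k * (w ^ k)⁻¹),
      h.isPoleRoot hn, ?_, hZZ, tendsto_nhdsWithin_iff.2 ⟨hZ0, hZ1⟩, ?_, ?_⟩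
    · filter_upwards [mem_nhdsWithin_of_mem_nhds hU1] with u hu
      rw [inv_div, hu]
    · refine IsBigO.const_mul_left ?_ _
      have h3 := hexp.comp_tendsto hZ0
      have h4 : (fun w : ℂ => (U w⁻¹) ^ (K + 1)) =O[cobounded ℂ] fun w => (w ^ (K + 1))⁻¹ := by
        have := (hU3.comp_tendsto hinv).pow (K + 1)
        simpa [Function.comp_def] using this
      refine (h3.trans h4).congr' ?_ .rfl
      filter_upwards [hZZ] with w hw
      simp only [Function.comp]
      congr 1
      refine Finset.sum_congr rfl fun k hk => ?_
      rw [← inv_div, hw, hy k (Finset.mem_range_succ_iff.1 hk), inv_pow]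
    · filter_upwards [hZZ, hZ1] with w hw hw1
      have hw0 : w ≠ 0 := by
        rintro rfl
        exact div_ne_zero (Complex.exp_ne_zero _) hw1 hw
      rw [← mul_add, add_sub_cancel, one_div_mul_eq_div, (div_eq_iff hw1).1 hw,
        inv_mul_cancel_left₀ hw0]


section Point

variable {N M : ℕ}

/-! ### The coordinates at the poles of `l` -/

theorem dL_eq_sum (hN : 0 < N) (X : Model N M) (z : ℂ) :
    dL X z = ∑ i ∈ Finset.Ico (-(M : ℤ)) N, lCoeff X i * z ^ i := by
  rw [dL_eq]
  refine tsum_eq_sum fun i hi => ?_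
  rw [Finset.mem_Ico] at hi
  rw [lCoeff]
  split_ifs
  · rw [coeff_eq_zero X (by omega), zero_mul]
  · omega
  · rw [zero_mul]

/-- The polynomial `u ^ M dL X u`. -/
noncomputable def dZeroPoly (X : Model N M) (u : ℂ) : ℂ :=
  ∑ m ∈ Finset.range (N + M), lCoeff X ((m : ℤ) - M) * u ^ m

/-- The polynomial `u ^ N dL X u⁻¹`. -/
noncomputable def dInftyPoly (X : Model N M) (u : ℂ) : ℂ :=
  ∑ m ∈ Finset.range (N + M), lCoeff X ((N : ℤ) - (m + 1)) * u ^ (m + 1)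

/-- The polynomial `u ^ M l(u)`. -/
noncomputable def zeroPoly (p : Model N M) (u : ℂ) : ℂ := u ^ (N + M) + dZeroPoly p u

/-- The polynomial `u ^ N l(u⁻¹)`. -/
noncomputable def inftyPoly (p : Model N M) (u : ℂ) : ℂ := 1 + dInftyPoly p u

theorem dL_eq_zeroPoly (hN : 0 < N) (X : Model N M) {u : ℂ} (hu : u ≠ 0) :
    dL X u = dZeroPoly X u / u ^ M := by
  rw [dL_eq_sum hN, dZeroPoly, Finset.sum_div]
  refine Finset.sum_nbij' (fun i => (i + M).toNat) (fun m => (m : ℤ) - M) ?_ ?_ ?_ ?_ ?_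
  · intro i hi
    rw [Finset.mem_Ico] at hi
    rw [Finset.mem_range]
    omega
  · intro m hm
    rw [Finset.mem_range] at hm
    rw [Finset.mem_Ico]
    omega
  · intro i hi
    rw [Finset.mem_Ico] at hi
    omega
  · intro m hm
    simp
  · intro i hi
    rw [Finset.mem_Ico] at hi
    have e : (((i + M).toNat : ℕ) : ℤ) = i + M := Int.toNat_of_nonneg (by omega)
    rw [e, add_sub_cancel_right, ← zpow_natCast u (i + M).toNat, e, zpow_add₀ hu, zpow_natCast]
    field_simp

theorem dL_eq_inftyPoly (hN : 0 < N) (X : Model N M) {u : ℂ} (hu : u ≠ 0) :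
    dL X u⁻¹ = dInftyPoly X u / u ^ N := by
  rw [dL_eq_sum hN, dInftyPoly, Finset.sum_div]
  refine Finset.sum_nbij' (fun i => (N - 1 - i).toNat) (fun m => (N : ℤ) - (m + 1)) ?_ ?_ ?_ ?_ ?_
  · intro i hi
    rw [Finset.mem_Ico] at hi
    rw [Finset.mem_range]
    omega
  · intro m hm
    rw [Finset.mem_range] at hm
    rw [Finset.mem_Ico]
    omega
  · intro i hi
    rw [Finset.mem_Ico] at hi
    omega
  · intro m hm
    rw [Finset.mem_range] at hm
    omega
  · intro i hi
    rw [Finset.mem_Ico] at hi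
    have e : (((N - 1 - i).toNat : ℕ) : ℤ) = N - 1 - i := Int.toNat_of_nonneg (by omega)
    have e1 : (N : ℤ) - (N - 1 - i + 1) = i := by ring
    rw [← zpow_natCast u ((N - 1 - i).toNat + 1)]
    push_cast [e]
    rw [e1, show (N : ℤ) - 1 - i + 1 = N - i by ring, zpow_sub₀ hu, inv_zpow, zpow_natCast]
    field_simp

theorem lFun_eq_zeroPoly (hN : 0 < N) (p : Model N M) {u : ℂ} (hu : u ≠ 0) :
    lFun p u = zeroPoly p u / u ^ M := by
  rw [lFun_eq, dL_eq_zeroPoly hN p hu, zeroPoly, pow_add]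
  field_simp

theorem lFun_eq_inftyPoly (hN : 0 < N) (p : Model N M) {u : ℂ} (hu : u ≠ 0) :
    lFun p u⁻¹ = inftyPoly p u / u ^ N := by
  rw [lFun_eq, dL_eq_inftyPoly hN p hu, inftyPoly, inv_pow]
  field_simp

theorem differentiable_dZeroPoly (X : Model N M) : Differentiable ℂ (dZeroPoly X) := fun _ =>
  DifferentiableAt.fun_sum fun m _ => (differentiableAt_pow m).const_mul _

theorem differentiable_dInftyPoly (X : Model N M) : Differentiable ℂ (dInftyPoly X) := fun _ =>
  DifferentiableAt.fun_sum fun m _ => (differentiableAt_pow (m + 1)).const_mul _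

theorem differentiable_zeroPoly (p : Model N M) : Differentiable ℂ (zeroPoly p) :=
  (differentiable_pow _).add (differentiable_dZeroPoly p)

theorem differentiable_inftyPoly (p : Model N M) : Differentiable ℂ (inftyPoly p) :=
  (differentiable_const _).add (differentiable_dInftyPoly p)

theorem dInftyPoly_zero (X : Model N M) : dInftyPoly X 0 = 0 := by
  rw [dInftyPoly]
  exact Finset.sum_eq_zero fun m _ => by simp

theorem inftyPoly_zero (p : Model N M) : inftyPoly p 0 = 1 := by
  rw [inftyPoly, dInftyPoly_zero, add_zero]

theorem dZeroPoly_zero (hM : 0 < M) (X : Model N M) : dZeroPoly X 0 = coeffHat X (-(M : ℤ)) := by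
  obtain ⟨K, hK⟩ : ∃ K, N + M = K + 1 := ⟨N + M - 1, by omega⟩
  rw [dZeroPoly, hK, Finset.sum_range_succ', Finset.sum_eq_zero fun m _ => by simp]
  rw [lCoeff, if_neg (by simp; omega), if_pos (by simp)]
  simp

theorem zeroPoly_zero (hM : 0 < M) (p : Model N M) : zeroPoly p 0 = coeffHat p (-(M : ℤ)) := by
  rw [zeroPoly, dZeroPoly_zero hM, zero_pow (by omega), zero_add]

theorem exists_isLog {P : ℂ → ℂ} (hP : Differentiable ℂ P) {ℓ : ℂ} (hℓ : Complex.exp ℓ = P 0) :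
    ∃ r Λ, IsLog P Λ r ∧ Λ 0 = ℓ := by
  have h0 : P 0 ≠ 0 := hℓ ▸ Complex.exp_ne_zero ℓ
  obtain ⟨r, hr, hb⟩ := Metric.eventually_nhds_iff_ball.1 (hP.continuous.continuousAt.eventually_ne h0)
  obtain ⟨Λ, h1, h2, h3⟩ := Invertible₀.exists_log ⟨hr, hP.differentiableOn, hb⟩ hℓ
  exact ⟨r, Λ, ⟨hr, h1, h3⟩, h2⟩

theorem isRootAtZero_iff (hN : 0 < N) {p : Model N M} {χ : ℂ → ℂ} :
    IsRootAtZero p χ ↔ IsPoleRoot (zeroPoly p) M χ := by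
  refine eventually_congr ?_
  filter_upwards [self_mem_nhdsWithin] with u hu
  rw [lFun_eq_zeroPoly hN p hu]

theorem sum_hHat {hHat : Fin (M + 1) → ℂ} {y : ℕ → ℂ} (hy : ∀ k : Fin (M + 1), y k = hHat k) (w : ℂ) :
    ∑ k, hHat k * (w ^ (k : ℕ))⁻¹ = ∑ k ∈ Finset.range (M + 1), y k * (w ^ k)⁻¹ := by
  rw [← Fin.sum_univ_eq_sum_range (fun k => y k * (w ^ k)⁻¹)]
  exact Finset.sum_congr rfl fun k _ => by rw [hy]

theorem isInverseHHat_iff (hN : 0 < N) {p : Model N M} {hHat : Fin (M + 1) → ℂ} {y : ℕ → ℂ}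
    (hy : ∀ k : Fin (M + 1), y k = hHat k) :
    IsInverseHHat p hHat ↔ IsPoleInverse (zeroPoly p) M M y := by
  simp only [IsInverseHHat, IsPoleInverse, isRootAtZero_iff hN, sum_hHat hy]

theorem isResidueHHat_iff (hN : 0 < N) (hM : 0 < M) {p : Model N M} {hHat : Fin (M + 1) → ℂ} {y : ℕ → ℂ}
    (hy : ∀ k : Fin (M + 1), y k = hHat k) :
    IsResidueHHat p hHat ↔ IsPoleResidue (zeroPoly p) M M y := by
  have h0 : y 0 = hHat 0 := hy 0
  simp only [IsResidueHHat, IsPoleResidue, isRootAtZero_iff hN, zeroPoly_zero hM, h0]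
  refine and_congr_right fun _ => exists_congr fun χ => and_congr_right fun _ => and_congr_right fun _ => ?_
  constructor
  · intro h k hk hkM
    have := h ⟨k, Nat.lt_succ_of_le hkM⟩ (by rw [Ne, Fin.ext_iff]; exact hk)
    rw [← hy] at this
    exact this
  · intro h k hk
    rw [← hy]
    exact h k (fun h0 => hk (Fin.ext h0)) (Nat.lt_succ_iff.1 k.2)

theorem isRootAtInfty_iff (hN : 0 < N) {p : Model N M} {χ : ℂ → ℂ} :
    IsRootAtInfty p χ ↔ IsPoleRoot (inftyPoly p) N (fun u => χ u⁻¹) ∧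
      Tendsto (fun u => u * χ u⁻¹) (𝓝[≠] 0) (𝓝 1) := by
  have e : (∀ᶠ u in 𝓝[≠] (0 : ℂ), DifferentiableAt ℂ (fun u => χ u⁻¹) u ∧ χ u⁻¹ ^ N = inftyPoly p u / u ^ N)
      ↔ ∀ᶠ u in 𝓝[≠] (0 : ℂ), DifferentiableAt ℂ χ u⁻¹ ∧ χ u⁻¹ ^ N = lFun p u⁻¹ := by
    refine eventually_congr ?_
    filter_upwards [self_mem_nhdsWithin] with u (hu : u ≠ 0)
    rw [lFun_eq_inftyPoly hN p hu]
    refine and_congr_left fun _ => ⟨fun h => ?_, fun h => ?_⟩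
    · have h1 : DifferentiableAt ℂ (fun u => χ u⁻¹) (u⁻¹)⁻¹ := by rwa [inv_inv]
      have := h1.comp u⁻¹ (differentiableAt_inv (inv_ne_zero hu))
      simpa [Function.comp_def] using this
    · exact DifferentiableAt.comp (g := χ) (f := fun u => u⁻¹) u h (differentiableAt_inv hu)
  rw [IsPoleRoot, e, IsRootAtInfty]
  refine and_congr ⟨fun h => tendsto_inv₀_nhdsNE_zero.eventually h, fun h => ?_⟩
    ⟨fun h => ?_, fun h => ?_⟩
  · have := tendsto_inv₀_cobounded'.eventually h
    simpa using this
  · refine (h.comp tendsto_inv₀_nhdsNE_zero).congr fun u => ?_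
    simp [div_eq_mul_inv, mul_comm]
  · refine (h.comp tendsto_inv₀_cobounded').congr fun u => ?_
    simp [div_eq_mul_inv, mul_comm]

/-- In the variable u = 1/z the polynomial `inftyPoly` is 1 at u = 0, so y 0 = 0 expresses the
normalization χ ~ z. The sign of the residue at infinity cancels the minus sign of the formula. -/
theorem isResidueH_iff (hN : 0 < N) {p : Model N M} {h : ↥(Finset.Icc 1 (N - 1)) → ℂ} {y : ℕ → ℂ}
    (h0 : y 0 = 0) (hy : ∀ j : ↥(Finset.Icc 1 (N - 1)), y j = h j) :
    IsResidueH p h ↔ IsPoleResidue (inftyPoly p) N (N - 1) y := by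
  have hres : ∀ (χ : ℂ → ℂ) (j : ℕ), -((N : ℂ) / j) * resInfty (fun z => χ z ^ j / z)
      = (N : ℂ) / j * resZero fun u => χ u⁻¹ ^ j / u := by
    intro χ j
    rw [resInfty_eq_resZero, neg_mul_neg]
    congr 2
    ext u
    rcases eq_or_ne u 0 with rfl | hu
    · simp
    · field_simp
  have hq : ∀ χ : ℂ → ℂ, (∀ j : ↥(Finset.Icc 1 (N - 1)), h j = -((N : ℂ) / (j : ℕ)) * resInfty fun z => χ z ^ (j : ℕ) / z)
      ↔ ∀ k, k ≠ 0 → k ≤ N - 1 → y k = (N : ℂ) / k * resZero fun u => χ u⁻¹ ^ k / u := by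
    intro χ
    constructor
    · intro H k hk hkN
      have := H ⟨k, Finset.mem_Icc.2 ⟨Nat.pos_of_ne_zero hk, hkN⟩⟩
      rw [← hy, hres] at this
      exact this
    · intro H j
      have hj := Finset.mem_Icc.1 j.2
      rw [← hy, hres]
      exact H j (by omega) hj.2
  simp only [IsResidueH, IsPoleResidue, h0, Complex.exp_zero, inftyPoly_zero, zero_div, true_and,
    isRootAtInfty_iff hN]
  constructor
  · rintro ⟨χ, ⟨h1, h2⟩, h3⟩
    exact ⟨_, h1, h2, (hq χ).1 h3⟩
  · rintro ⟨X, h1, h2, h3⟩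
    refine ⟨fun z => X z⁻¹, ?_, (hq _).2 ?_⟩ <;> simp only [inv_inv]
    · exact ⟨h1, h2⟩
    · exact h3

theorem sum_h {h : ↥(Finset.Icc 1 (N - 1)) → ℂ} {y : ℕ → ℂ}
    (h0 : y 0 = 0) (hy : ∀ j : ↥(Finset.Icc 1 (N - 1)), y j = h j) (w : ℂ) :
    ∑ j, h j * (w ^ (j : ℕ))⁻¹ = ∑ k ∈ Finset.range (N - 1 + 1), y k * (w ^ k)⁻¹ := by
  have : ∑ j, h j * (w ^ (j : ℕ))⁻¹ = ∑ k ∈ Finset.Icc 1 (N - 1), y k * (w ^ k)⁻¹ := by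
    rw [← Finset.sum_coe_sort (Finset.Icc 1 (N - 1)) fun k => y k * (w ^ k)⁻¹]
    exact Finset.sum_congr rfl fun j _ => by rw [hy]
  rw [this]
  refine Finset.sum_subset (fun k hk => ?_) fun k hk hk' => ?_
  · rw [Finset.mem_Icc] at hk
    rw [Finset.mem_range]
    omega
  · rw [Finset.mem_range] at hk
    rw [Finset.mem_Icc] at hk'
    have : k = 0 := by omega
    rw [this, h0, zero_mul]

/-- In the variable u = 1/z the inverse function is 1/Z, so log (Z w / w) changes sign; this is the
minus sign in the expansion at infinity. The exponent tends to y 0 / N = 0, which is why the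
principal logarithm may be used. -/
theorem isInverseH_iff (hN : 0 < N) {p : Model N M} {h : ↥(Finset.Icc 1 (N - 1)) → ℂ} {y : ℕ → ℂ}
    (h0 : y 0 = 0) (hy : ∀ j : ↥(Finset.Icc 1 (N - 1)), y j = h j) :
    IsInverseH p h ↔ IsPoleInverse (inftyPoly p) N (N - 1) y := by
  have hN' : N - 1 + 1 = N := Nat.sub_add_cancel hN
  constructor
  · rintro ⟨χ, Z, h1, h2, h3, h4, h5⟩
    rw [isRootAtInfty_iff hN] at h1
    refine ⟨fun u => χ u⁻¹, fun w => (Z w)⁻¹, fun w => -(Complex.log (Z w / w)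
      + (1 / N : ℂ) * ∑ j, h j * (w ^ (j : ℕ))⁻¹), h1.1, ?_, ?_, tendsto_inv₀_cobounded'.comp h4, ?_, ?_⟩
    · filter_upwards [tendsto_inv₀_nhdsNE_zero.eventually h2] with u hu
      rw [hu, inv_inv]
    · filter_upwards [h3] with w hw
      rw [inv_inv, hw]
    · rw [hN']
      exact h5.neg_left
    · filter_upwards [eventually_ne_cobounded (0 : ℂ), h4.eventually (eventually_ne_cobounded 0)] with w hw hw'
      rw [← sum_h h0 hy, neg_add, add_comm, neg_add_cancel_right, Complex.exp_neg,
        Complex.exp_log (div_ne_zero hw' hw)]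
      field_simp
  · intro hI
    obtain ⟨r, Λ, hΛ, -⟩ := exists_isLog (differentiable_inftyPoly p) (ℓ := 0) (by
      rw [inftyPoly_zero, Complex.exp_zero])
    obtain ⟨X, Z, R, h1, h2, h3, h4, h5, h6⟩ := hI
    have hlim := tendsto_poleSum N (y := y) h5
    rw [h0, zero_div] at hlim
    obtain ⟨c, hc, hXc⟩ := h1.exists_log hN hΛ
    have hXt : Tendsto X (𝓝[≠] 0) (cobounded ℂ) :=
      ((hΛ.add_const hc).tendsto_pole N).congr' (by filter_upwards [hXc] with u hu using hu.symm)
    have hZ0 : ∀ᶠ w in cobounded ℂ, Z w ≠ 0 := (tendsto_nhdsWithin_iff.1 h4).2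
    refine ⟨fun z => X z⁻¹, fun w => (Z w)⁻¹, (isRootAtInfty_iff hN).2 ?_, ?_, ?_,
      tendsto_inv₀_nhdsNE_zero.comp h4, ?_⟩
    · simp only [inv_inv]
      refine ⟨h1, ?_⟩
      have l1 := (hlim.comp hXt).cexp
      rw [Complex.exp_zero] at l1
      refine l1.congr' ?_
      filter_upwards [hXt.eventually h6, h2, hXt.eventually (eventually_ne_cobounded 0)] with u e1 e2 e3
      rw [e2, inv_mul_eq_div, eq_div_iff e3] at e1
      simpa using e1.symm
    · filter_upwards [tendsto_inv₀_cobounded'.eventually h2] with z hz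
      rw [hz, inv_inv]
    · filter_upwards [h3] with w hw
      rw [inv_inv, hw]
    · rw [hN'] at h5
      refine h5.neg_left.congr' ?_ .rfl
      have hsmall := hlim.norm
      rw [norm_zero] at hsmall
      filter_upwards [h6, eventually_ne_cobounded (0 : ℂ), hsmall.eventually (gt_mem_nhds Real.pi_pos)]
        with w e1 e2 e3
      have him := (Complex.abs_im_le_norm _).trans_lt e3
      rw [abs_lt] at him
      set S := (1 / N : ℂ) * ∑ k ∈ Finset.range (N - 1 + 1), y k * (w ^ k)⁻¹ with hS
      have e4 : (Z w)⁻¹ / w = Complex.exp (-(S + R w)) := by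
        rw [e1, Complex.exp_neg]
        have := Complex.exp_ne_zero (S + R w)
        field_simp
      rw [e4, Complex.log_exp (by rw [Complex.neg_im]; linarith [him.2]) (by
        rw [Complex.neg_im]; linarith [him.1]), sum_h h0 hy]
      ring

end Point


theorem IsLog.mono {P Λ : ℂ → ℂ} {r s : ℝ} (h : IsLog P Λ r) (hs : 0 < s) (hsr : s ≤ r) : IsLog P Λ s :=
  ⟨hs, h.diff.mono (ball_subset_ball hsr), fun u hu => h.exp_eq u (ball_subset_ball hsr hu)⟩

theorem tFun_add_const {f L : ℂ → ℂ} (hL : ContinuousOn L (sphere 0 1)) (c : ℂ) (i : ℤ) :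
    tFun f (fun z => L z + c) i = tFun f L i + if i = 0 then c else 0 := by
  have hz0 : ∀ z ∈ sphere (0 : ℂ) 1, z ≠ 0 := fun z hz => by
    rintro rfl
    simp at hz
  rw [tFun, tFun]
  split_ifs with h
  · have e := unitContour_add (f := fun z => L z / z) (g := fun z => c * z⁻¹)
      (hL.div continuousOn_id hz0) (continuousOn_const.mul (continuousOn_id.inv₀ hz0))
    rw [unitContour_const_mul, unitContour_inv, mul_one] at e
    rw [← e]
    exact unitContour_congr fun z _ => by rw [add_div, div_eq_mul_inv c]
  · rw [add_zero]

section Point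

variable {N M : ℕ} {p : Model N M}

/-! ### Charts -/

/-- Branches of `log (z / ζ)`, of `log (u ^ M l(u))` and of `log (u ^ N l(u⁻¹))`. -/
structure Chart (p : Model N M) where
  (σ δ r s : ℝ)
  (L ΛZ ΛI : ℂ → ℂ)
  loop : Loop (zeta p) σ δ
  hL : ∀ z ∈ annulus σ, HasDerivAt L (z⁻¹ - deriv (zeta p) z / zeta p z) z ∧
    Complex.exp (L z) = z / zeta p z
  pos : 0 < s
  lt : s < r
  logZ : IsLog (zeroPoly p) ΛZ r
  logI : IsLog (inftyPoly p) ΛI r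
  logI_zero : ΛI 0 = 0

namespace Chart

/-- The coordinates defined by a choice of branches. -/
noncomputable def coord (c : Chart p) : Label N M → ℂ
  | .t i => tFun (zeta p) c.L i
  | .h j => poleCoeff c.ΛI N c.s j
  | .hHat k => poleCoeff c.ΛZ M c.s k

theorem continuousOn_L (c : Chart p) : ContinuousOn c.L (sphere 0 1) := fun z hz =>
  (c.hL z (unit_sphere_subset_annulus c.loop.one_lt hz)).1.continuousAt.continuousWithinAt

theorem coord_hHat_zero (c : Chart p) : c.coord (.hHat 0) = c.ΛZ 0 := by
  simp [coord, poleCoeff]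

/-- Change of the branches by constants. -/
noncomputable def shift (c : Chart p) {a b : ℂ} (ha : Complex.exp a = 1) (hb : Complex.exp b = 1) : Chart p :=
  { c with
    L := fun z => c.L z + a
    ΛZ := fun u => c.ΛZ u + b
    hL := fun z hz => ⟨(c.hL z hz).1.add_const a, by rw [Complex.exp_add, ha, mul_one, (c.hL z hz).2]⟩
    logZ := c.logZ.add_const hb }

theorem shift_coord_t (c : Chart p) {a b : ℂ} (ha : Complex.exp a = 1) (hb : Complex.exp b = 1) :
    (c.shift ha hb).coord (.t 0) = c.coord (.t 0) + a := by
  simp only [coord, shift]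
  rw [tFun_add_const c.continuousOn_L, if_pos rfl]

theorem shift_coord_hHat (c : Chart p) {a b : ℂ} (ha : Complex.exp a = 1) (hb : Complex.exp b = 1) :
    (c.shift ha hb).coord (.hHat 0) = c.coord (.hHat 0) + b := by
  rw [coord_hHat_zero, coord_hHat_zero, shift]

theorem eq_coord_iff (c : Chart p) {u : Label N M → ℂ} (h0 : u (.t 0) = c.coord (.t 0)) :
    u = c.coord ↔ (Complex.exp (u (.t 0)) = Complex.exp (tFun (zeta p) c.L 0) ∧
      ∀ i, i ≠ 0 → u (.t i) = tFun (zeta p) c.L i) ∧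
      (∀ j, u (.h j) = poleCoeff c.ΛI N c.s j) ∧ (∀ k, u (.hHat k) = poleCoeff c.ΛZ M c.s k) := by
  constructor
  · rintro rfl
    exact ⟨⟨rfl, fun i _ => rfl⟩, fun _ => rfl, fun _ => rfl⟩
  · rintro ⟨⟨-, h1⟩, h2, h3⟩
    ext α
    rcases α with i | j | k
    · rcases eq_or_ne i 0 with rfl | hi
      · exact h0
      · exact h1 i hi
    · exact h2 j
    · exact h3 k

/-- The sequence of coordinates at `∞`, extended by zero. -/
theorem forall_h_iff (c : Chart p) (h : ↥(Finset.Icc 1 (N - 1)) → ℂ) : ∃ y : ℕ → ℂ, y 0 = 0 ∧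
    (∀ j : ↥(Finset.Icc 1 (N - 1)), y j = h j) ∧
    ((∀ k ≤ N - 1, y k = poleCoeff c.ΛI N c.s k) ↔ ∀ j, h j = poleCoeff c.ΛI N c.s j) := by
  have hy : ∀ j : ↥(Finset.Icc 1 (N - 1)), (if hk : (j : ℕ) ∈ Finset.Icc 1 (N - 1) then h ⟨j, hk⟩ else 0) = h j :=
    fun j => by rw [dif_pos j.2]
  refine ⟨fun k => if hk : k ∈ Finset.Icc 1 (N - 1) then h ⟨k, hk⟩ else 0, by simp, hy, ?_⟩
  constructor
  · intro H j
    rw [← hy j]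
    exact H j (Finset.mem_Icc.1 j.2).2
  · intro H k hk
    dsimp only
    split_ifs with h1
    · exact H ⟨k, h1⟩
    · have : k = 0 := by
        rw [Finset.mem_Icc] at h1
        omega
      rw [this, poleCoeff, if_pos rfl, c.logI_zero]

theorem forall_hHat_iff (c : Chart p) (h : Fin (M + 1) → ℂ) : ∃ y : ℕ → ℂ,
    (∀ k : Fin (M + 1), y k = h k) ∧
    ((∀ k ≤ M, y k = poleCoeff c.ΛZ M c.s k) ↔ ∀ k, h k = poleCoeff c.ΛZ M c.s k) := by
  have hy : ∀ k : Fin (M + 1), (if hk : (k : ℕ) < M + 1 then h ⟨k, hk⟩ else 0) = h k :=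
    fun k => by rw [dif_pos k.2]
  refine ⟨fun k => if hk : k < M + 1 then h ⟨k, hk⟩ else 0, hy, ?_⟩
  constructor
  · intro H k
    rw [← hy k]
    exact H k (Nat.lt_succ_iff.1 k.2)
  · intro H k hk
    dsimp only
    rw [dif_pos (Nat.lt_succ_of_le hk)]
    exact H ⟨k, _⟩

/-- Once t⁰ and ĥ⁰ have the values of the chart, no ambiguity of branches is left, and both
definitions reduce to the same equations between u and the contour integrals of the chart. -/
theorem isCoord_iff (hN : 0 < N) (hM : 0 < M) (c : Chart p) {u : Label N M → ℂ}
    (h0 : u (.t 0) = c.coord (.t 0)) (h1 : u (.hHat 0) = c.coord (.hHat 0)) :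
    (IsCoord p u ↔ u = c.coord) ∧ (IsFormulaCoord p u ↔ u = c.coord) := by
  obtain ⟨y, hy0, hy, hyc⟩ := c.forall_h_iff fun j => u (.h j)
  obtain ⟨w, hw, hwc⟩ := c.forall_hHat_iff fun k => u (.hHat k)
  have hw0 : w 0 = c.ΛZ 0 := by rw [← coord_hHat_zero, ← h1, ← hw 0]; rfl
  rw [c.eq_coord_iff h0, IsCoord, isFactorizationT_iff c.loop c.hL, isInverseH_iff hN hy0 hy,
    isInverseHHat_iff hN hw, isPoleInverse_iff c.logI hN c.pos c.lt (by rw [hy0, c.logI_zero]),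
    isPoleInverse_iff c.logZ hM c.pos c.lt hw0, hyc, hwc, IsFormulaCoord,
    isContourT_iff c.loop c.hL, isResidueH_iff hN hy0 hy, isResidueHHat_iff hN hM hw,
    isPoleResidue_iff c.logI hN c.pos c.lt (by rw [hy0, c.logI_zero]),
    isPoleResidue_iff c.logZ hM c.pos c.lt hw0, hyc, hwc]
  exact ⟨Iff.rfl, Iff.rfl⟩

theorem isCoord (hN : 0 < N) (hM : 0 < M) (c : Chart p) : IsCoord p c.coord :=
  (c.isCoord_iff hN hM rfl rfl).1.2 rfl

theorem isFormulaCoord (hN : 0 < N) (hM : 0 < M) (c : Chart p) : IsFormulaCoord p c.coord :=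
  (c.isCoord_iff hN hM rfl rfl).2.2 rfl

/-- The coordinates determine a choice of branches. -/
theorem exists_shift (hN : 0 < N) (hM : 0 < M) (c : Chart p) {u : Label N M → ℂ}
    (hu : IsCoord p u ∨ IsFormulaCoord p u) :
    ∃ (a b : ℂ) (ha : Complex.exp a = 1) (hb : Complex.exp b = 1), u = (c.shift ha hb).coord := by
  have h1 : Complex.exp (u (.t 0)) = Complex.exp (c.coord (.t 0)) := by
    rcases hu with hu | hu
    · exact ((isFactorizationT_iff c.loop c.hL).1 hu.1).1
    · exact ((isContourT_iff c.loop c.hL).1 hu.1).1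
  have h2 : Complex.exp (u (.hHat 0)) = Complex.exp (c.coord (.hHat 0)) := by
    rw [coord_hHat_zero, c.logZ.exp_zero]
    rcases hu with hu | hu
    · obtain ⟨w, hw, -⟩ := c.forall_hHat_iff fun k => u (.hHat k)
      have := ((isInverseHHat_iff hN hw).1 hu.2.2).exp_zero hM c.logZ
      rwa [← hw 0]
    · rw [zeroPoly_zero hM]
      exact hu.2.2.1
  have ha : Complex.exp (u (.t 0) - c.coord (.t 0)) = 1 := by
    rw [Complex.exp_sub, h1, div_self (Complex.exp_ne_zero _)]
  have hb : Complex.exp (u (.hHat 0) - c.coord (.hHat 0)) = 1 := by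
    rw [Complex.exp_sub, h2, div_self (Complex.exp_ne_zero _)]
  have h3 := (c.shift ha hb).isCoord_iff hN hM (u := u) (by rw [shift_coord_t, add_sub_cancel])
    (by rw [shift_coord_hHat, add_sub_cancel])
  exact ⟨_, _, ha, hb, hu.elim h3.1.1 h3.2.1⟩

/-- Admissible values of t⁰ and of ĥ⁰ differ by multiples of 2πi, so a distance less than π from the
values of the chart leaves only the coordinates of the chart. -/
theorem coord_unique (hN : 0 < N) (hM : 0 < M) (c : Chart p) {u : Label N M → ℂ} (hu : IsCoord p u)
    (h0 : ‖u (.t 0) - c.coord (.t 0)‖ < π) (h1 : ‖u (.hHat 0) - c.coord (.hHat 0)‖ < π) : u = c.coord := by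
  obtain ⟨a, b, ha, hb, h⟩ := c.exists_shift hN hM (.inl hu)
  have key : ∀ {x : ℂ}, Complex.exp x = 1 → ‖x‖ < π → x = 0 := fun {x} hx hx' => by
    have him := (Complex.abs_im_le_norm x).trans_lt hx'
    rw [abs_lt] at him
    have := Complex.log_exp him.1 him.2.le
    rw [hx, Complex.log_one] at this
    exact this.symm
  have ha0 : a = 0 := key ha (by rwa [h, shift_coord_t, add_sub_cancel_left] at h0)
  have hb0 : b = 0 := key hb (by rwa [h, shift_coord_hHat, add_sub_cancel_left] at h1)
  exact (c.isCoord_iff hN hM (by rw [h, shift_coord_t, ha0, add_zero])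
    (by rw [h, shift_coord_hHat, hb0, add_zero])).1.1 hu

end Chart

theorem IsPoint.exists_chart (hM : 0 < M) (hp : IsPoint p) : Nonempty (Chart p) := by
  obtain ⟨σ₁, hσ₁, C, h1, h2⟩ := exists_decay p
  obtain ⟨σ, hσ, -, δ, hf⟩ := hp.exists_loop hσ₁ h1 h2
  obtain ⟨L, hL⟩ := hf.exists_log
  obtain ⟨r, ΛZ, hZ, -⟩ := exists_isLog (differentiable_zeroPoly p)
    (ℓ := Complex.log (coeffHat p (-(M : ℤ)))) (by rw [zeroPoly_zero hM, Complex.exp_log hp.pole])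
  obtain ⟨r', ΛI, hI, hI0⟩ := exists_isLog (differentiable_inftyPoly p) (ℓ := 0) (by
    rw [inftyPoly_zero, Complex.exp_zero])
  have hm : 0 < min r r' := lt_min hZ.pos hI.pos
  exact ⟨{ σ := σ, δ := δ, r := min r r', s := min r r' / 2, L := L, ΛZ := ΛZ, ΛI := ΛI
           loop := hf, hL := hL, pos := half_pos hm, lt := half_lt_self hm
           logZ := hZ.mono hm (min_le_left _ _), logI := hI.mono hm (min_le_right _ _)
           logI_zero := hI0 }⟩

theorem IsCoord.exists_chart (hN : 0 < N) (hM : 0 < M) (hp : IsPoint p) {u : Label N M → ℂ}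
    (hu : IsCoord p u) : ∃ c : Chart p, c.coord = u := by
  obtain ⟨c⟩ := hp.exists_chart hM
  obtain ⟨a, b, ha, hb, h⟩ := c.exists_shift hN hM (.inl hu)
  exact ⟨_, h.symm⟩

theorem isCoord_iff_isFormulaCoord (hN : 0 < N) (hM : 0 < M) (hp : IsPoint p) {u : Label N M → ℂ} :
    IsCoord p u ↔ IsFormulaCoord p u := by
  obtain ⟨c⟩ := hp.exists_chart hM
  constructor
  · intro hu
    obtain ⟨a, b, ha, hb, rfl⟩ := c.exists_shift hN hM (.inl hu)
    exact Chart.isFormulaCoord hN hM _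
  · intro hu
    obtain ⟨a, b, ha, hb, rfl⟩ := c.exists_shift hN hM (.inr hu)
    exact Chart.isCoord hN hM _

end Point


/-! ### Derivatives of contour integrals -/

/-- `(2πi)⁻¹ ∮_{|z| = r} f(z) dz`. -/
noncomputable def cInt (r : ℝ) (f : ℂ → ℂ) : ℂ := (2 * π * Complex.I)⁻¹ * ∮ z in C(0, r), f z

section Contour

variable {r : ℝ} {f g : ℂ → ℂ}

theorem cInt_congr (hr : 0 ≤ r) (h : Set.EqOn f g (sphere 0 r)) : cInt r f = cInt r g := by
  rw [cInt, cInt, circleIntegral.integral_congr hr h]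

theorem cInt_sub (hr : 0 ≤ r) (hf : ContinuousOn f (sphere 0 r)) (hg : ContinuousOn g (sphere 0 r)) :
    cInt r (fun z => f z - g z) = cInt r f - cInt r g := by
  rw [cInt, cInt, cInt, circleIntegral.integral_sub (hf.circleIntegrable hr) (hg.circleIntegrable hr), mul_sub]

theorem cInt_add (hr : 0 ≤ r) (hf : ContinuousOn f (sphere 0 r)) (hg : ContinuousOn g (sphere 0 r)) :
    cInt r (fun z => f z + g z) = cInt r f + cInt r g := by
  rw [cInt, cInt, cInt, circleIntegral.integral_add (hf.circleIntegrable hr) (hg.circleIntegrable hr), mul_add]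

theorem cInt_const_mul (c : ℂ) (f : ℂ → ℂ) : cInt r (fun z => c * f z) = c * cInt r f := by
  rw [cInt, cInt, circleIntegral.integral_const_mul]
  ring

theorem cInt_div_eq (hr : 0 < r) (hf : DifferentiableOn ℂ f (closedBall 0 r)) :
    cInt r (fun z => f z / z) = f 0 := by
  have := hf.circleIntegral_sub_inv_smul (mem_ball_self hr)
  rw [cInt, inv_mul_eq_iff_eq_mul₀ Complex.two_pi_I_ne_zero]
  simpa [div_eq_inv_mul] using this

/-- Strict differentiability at the constant function `1` of the functional
`e ↦ (2πi)⁻¹ ∮ ψ(z) g(e(z)) dz`. -/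
theorem cInt_strict {ψ : ℂ → ℂ} {g' : ℂ} (hg : HasStrictDerivAt g g' 1) (hgc : ContinuousOn g (ball 1 1))
    (hr : 0 < r) (hψ : ContinuousOn ψ (sphere 0 r)) {ε : ℝ} (hε : 0 < ε) :
    ∃ d, 0 < d ∧ d ≤ 1 ∧ ∀ e₁ e₂ : ℂ → ℂ, ContinuousOn e₁ (sphere 0 r) → ContinuousOn e₂ (sphere 0 r) →
      (∀ z ∈ sphere (0 : ℂ) r, ‖e₁ z - 1‖ < d) → (∀ z ∈ sphere (0 : ℂ) r, ‖e₂ z - 1‖ < d) →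
      ∀ κ, (∀ z ∈ sphere (0 : ℂ) r, ‖e₁ z - e₂ z‖ ≤ κ) →
        ‖cInt r (fun z => ψ z * g (e₁ z)) - cInt r (fun z => ψ z * g (e₂ z))
          - cInt r (fun z => ψ z * (g' * (e₁ z - e₂ z)))‖ ≤ ε * κ := by
  obtain ⟨B, hB0, hB⟩ := exists_bound_sphere hψ
  -- The factor r from the length of the circle and the bound B of ψ are divided out in advance; B +
  -- 1 avoids division by zero.
  have hε' : 0 < ε / (r * (B + 1)) := by positivity
  have h1 := hg.isLittleO.def hε'
  obtain ⟨d, hd, h2⟩ := Metric.eventually_nhds_iff_ball.1 h1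
  refine ⟨min d 1, lt_min hd one_pos, min_le_right _ _, fun e₁ e₂ hc₁ hc₂ hn₁ hn₂ κ hκ => ?_⟩
  have hm : ∀ {e : ℂ → ℂ}, (∀ z ∈ sphere (0 : ℂ) r, ‖e z - 1‖ < min d 1) →
      Set.MapsTo e (sphere 0 r) (ball 1 1) := fun hn z hz => by
    rw [mem_ball, dist_eq_norm]
    exact (hn z hz).trans_le (min_le_right _ _)
  have hi₁ : ContinuousOn (fun z => ψ z * g (e₁ z)) (sphere 0 r) := hψ.mul (hgc.comp hc₁ (hm hn₁))
  have hi₂ : ContinuousOn (fun z => ψ z * g (e₂ z)) (sphere 0 r) := hψ.mul (hgc.comp hc₂ (hm hn₂))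
  have hi₃ : ContinuousOn (fun z => ψ z * (g' * (e₁ z - e₂ z))) (sphere 0 r) :=
    hψ.mul (continuousOn_const.mul (hc₁.sub hc₂))
  rw [← cInt_sub hr.le hi₁ hi₂, ← cInt_sub hr.le (hi₁.fun_sub hi₂) hi₃]
  have hle : ∀ z ∈ sphere (0 : ℂ) r, ‖ψ z * g (e₁ z) - ψ z * g (e₂ z) - ψ z * (g' * (e₁ z - e₂ z))‖
      ≤ B * (ε / (r * (B + 1)) * κ) := by
    intro z hz
    have h3 : ‖g (e₁ z) - g (e₂ z) - (e₁ z - e₂ z) * g'‖ ≤ ε / (r * (B + 1)) * ‖e₁ z - e₂ z‖ := by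
      have := h2 (e₁ z, e₂ z) (by
        rw [mem_ball, Prod.dist_eq, max_lt_iff, dist_eq_norm, dist_eq_norm]
        exact ⟨(hn₁ z hz).trans_le (min_le_left _ _), (hn₂ z hz).trans_le (min_le_left _ _)⟩)
      simpa using this
    have e : ψ z * g (e₁ z) - ψ z * g (e₂ z) - ψ z * (g' * (e₁ z - e₂ z))
        = ψ z * (g (e₁ z) - g (e₂ z) - (e₁ z - e₂ z) * g') := by ring
    rw [e, norm_mul]
    exact mul_le_mul (hB z hz) (h3.trans (mul_le_mul_of_nonneg_left (hκ z hz) hε'.le)) (norm_nonneg _) hB0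
  refine (norm_two_pi_I_inv_mul_le hr.le hle).trans ?_
  have hκ0 : 0 ≤ κ := by
    have hz : (r : ℂ) ∈ sphere (0 : ℂ) r := by simp [hr.le]
    exact (norm_nonneg _).trans (hκ _ hz)
  have : r * (B * (ε / (r * (B + 1)) * κ)) = ε * κ * (B / (B + 1)) := by field_simp
  rw [this]
  exact mul_le_of_le_one_right (by positivity) ((div_le_one (by positivity)).2 (by linarith))

theorem ball_one_subset_slitPlane : ball (1 : ℂ) 1 ⊆ Complex.slitPlane := fun z hz => by
  have : z = 1 + (z - 1) := by ring
  rw [this]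
  exact Complex.mem_slitPlane_of_norm_lt_one (by rwa [mem_ball, dist_eq_norm] at hz)

theorem continuousOn_log_ball : ContinuousOn Complex.log (ball 1 1) := fun _ hz =>
  (continuousAt_clog (ball_one_subset_slitPlane hz)).continuousWithinAt

theorem hasStrictDerivAt_log_one : HasStrictDerivAt Complex.log 1 1 := by
  simpa using Complex.hasStrictDerivAt_log Complex.one_mem_slitPlane

/-- Strict differentiability of the coefficients in Lagrange's formula. -/
theorem IsLog.poleCoeff_strict {P Λ : ℂ → ℂ} {s : ℝ} {n : ℕ} (h : IsLog P Λ r) (hn : 0 < n) (hs : 0 < s)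
    (hsr : s < r) (k : ℕ) {ε : ℝ} (hε : 0 < ε) :
    ∃ d, 0 < d ∧ d ≤ 1 ∧ ∀ P₁ P₂ : ℂ → ℂ, Differentiable ℂ P₁ → Differentiable ℂ P₂ →
      (∀ u ∈ closedBall (0 : ℂ) s, ‖P₁ u / P u - 1‖ < d) →
      (∀ u ∈ closedBall (0 : ℂ) s, ‖P₂ u / P u - 1‖ < d) →
      ∀ κ, (∀ u ∈ closedBall (0 : ℂ) s, ‖P₁ u / P u - P₂ u / P u‖ ≤ κ) →
        ‖poleCoeff (fun u => Λ u + Complex.log (P₁ u / P u)) n s k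
          - poleCoeff (fun u => Λ u + Complex.log (P₂ u / P u)) n s k
          - cInt s (fun u => (Complex.exp (Λ u / n) / u) ^ k / u * ((P₁ u - P₂ u) / P u))‖ ≤ ε * κ := by
  have hn' : (n : ℂ) ≠ 0 := Nat.cast_ne_zero.2 hn.ne'
  have hsph : ∀ u ∈ sphere (0 : ℂ) s, u ≠ 0 := fun u hu => by
    rw [mem_sphere_zero_iff_norm] at hu
    exact norm_pos_iff.1 (hu ▸ hs)
  have hPd : DifferentiableOn ℂ P (closedBall 0 s) :=
    (h.diff.mono (closedBall_subset_ball hsr)).cexp.congr fun u hu =>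
      (h.exp_eq u (closedBall_subset_ball hsr hu)).symm
  have hP0 : ∀ u ∈ closedBall (0 : ℂ) s, P u ≠ 0 := fun u hu =>
    h.exp_eq u (closedBall_subset_ball hsr hu) ▸ Complex.exp_ne_zero _
  have hsub : sphere (0 : ℂ) s ⊆ closedBall 0 s := sphere_subset_closedBall
  have hψ : ContinuousOn (fun u => (Complex.exp (Λ u / n) / u) ^ k / u) (sphere 0 s) := by
    have h1 : ContinuousOn Λ (sphere 0 s) :=
      (h.diff.continuousOn.mono (closedBall_subset_ball hsr)).mono hsub
    exact (((h1.div_const _).cexp.div continuousOn_id hsph).pow k).div continuousOn_id hsph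
  have hed : ∀ {P₁ : ℂ → ℂ}, Differentiable ℂ P₁ → DifferentiableOn ℂ (fun u => P₁ u / P u) (closedBall 0 s) :=
    fun h1 => h1.differentiableOn.div hPd hP0
  by_cases hk : k = 0
  · subst hk
    obtain ⟨d, hd, hd1, key⟩ := cInt_strict hasStrictDerivAt_log_one continuousOn_log_ball hs hψ hε
    refine ⟨d, hd, hd1, fun P₁ P₂ h1 h2 hn₁ hn₂ κ hκ => ?_⟩
    have := key _ _ ((hed h1).continuousOn.mono hsub) ((hed h2).continuousOn.mono hsub)
      (fun z hz => hn₁ z (hsub hz)) (fun z hz => hn₂ z (hsub hz)) κ fun z hz => hκ z (hsub hz)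
    -- For k = 0 the coefficient is a value at 0 and not an integral. Cauchy's formula rewrites log
    -- (P₁ 0 / P 0) as an integral, so that the derivative has the same form for all k.
    have hlog : ∀ {P₁ : ℂ → ℂ}, Differentiable ℂ P₁ → (∀ u ∈ closedBall (0 : ℂ) s, ‖P₁ u / P u - 1‖ < d) →
        cInt s (fun u => (Complex.exp (Λ u / n) / u) ^ 0 / u * Complex.log (P₁ u / P u))
          = Complex.log (P₁ 0 / P 0) := by
      intro P₁ h1 hn₁
      rw [← cInt_div_eq (f := fun u => Complex.log (P₁ u / P u)) hs ((hed h1).clog fun u hu =>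
        ball_one_subset_slitPlane (by
          rw [mem_ball, dist_eq_norm]
          exact (hn₁ u hu).trans_le hd1))]
      refine cInt_congr hs.le fun u _ => ?_
      simp [div_eq_inv_mul]
    rw [hlog h1 hn₁, hlog h2 hn₂] at this
    simp only [poleCoeff, if_true]
    refine le_of_eq_of_le (congrArg norm ?_) this
    congr 1
    · ring
    · refine cInt_congr hs.le fun u _ => ?_
      simp only [one_mul, sub_div]
  · have hk' : (k : ℂ) ≠ 0 := Nat.cast_ne_zero.2 hk
    -- The factor n / k in Lagrange's formula is exactly what gives x ↦ (n/k) x^(k/n) the derivative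
    -- 1 at 1.
    have hg : HasStrictDerivAt (fun x => (n : ℂ) / k * Complex.exp ((k : ℂ) / n * Complex.log x)) 1 1 := by
      refine ((hasStrictDerivAt_log_one.const_mul ((k : ℂ) / n)).cexp.const_mul ((n : ℂ) / k)).congr_deriv ?_
      simp only [Complex.log_one, mul_zero, Complex.exp_zero, mul_one, one_mul]
      field_simp
    have hgc : ContinuousOn (fun x => (n : ℂ) / k * Complex.exp ((k : ℂ) / n * Complex.log x)) (ball 1 1) :=
      continuousOn_const.mul (continuousOn_const.mul continuousOn_log_ball).cexp
    obtain ⟨d, hd, hd1, key⟩ := cInt_strict hg hgc hs hψ hε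
    refine ⟨d, hd, hd1, fun P₁ P₂ h1 h2 hn₁ hn₂ κ hκ => ?_⟩
    have := key _ _ ((hed h1).continuousOn.mono hsub) ((hed h2).continuousOn.mono hsub)
      (fun z hz => hn₁ z (hsub hz)) (fun z hz => hn₂ z (hsub hz)) κ fun z hz => hκ z (hsub hz)
    have hcoef : ∀ P₁ : ℂ → ℂ, poleCoeff (fun u => Λ u + Complex.log (P₁ u / P u)) n s k
        = cInt s (fun u => (Complex.exp (Λ u / n) / u) ^ k / u
          * ((n : ℂ) / k * Complex.exp ((k : ℂ) / n * Complex.log (P₁ u / P u)))) := by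
      intro P₁
      rw [poleCoeff, if_neg hk]
      refine (cInt_const_mul _ _).symm.trans (cInt_congr hs.le fun u _ => ?_)
      rw [add_div, Complex.exp_add, show (k : ℂ) / n * Complex.log (P₁ u / P u)
        = k * (Complex.log (P₁ u / P u) / n) by ring, Complex.exp_nat_mul]
      rw [div_pow, div_pow, mul_pow]
      ring
    rw [hcoef, hcoef]
    refine le_of_eq_of_le (congrArg norm ?_) this
    congr 1
    refine cInt_congr hs.le fun u _ => ?_
    simp only [one_mul, sub_div]

/-- Strict differentiability of the contour integrals `tFun`. -/
theorem tFun_strict {f L : ℂ → ℂ} (hf : ContinuousOn f (sphere 0 1)) (hf0 : ∀ z ∈ sphere (0 : ℂ) 1, f z ≠ 0)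
    (hL : ContinuousOn L (sphere 0 1)) (i : ℤ) {ε : ℝ} (hε : 0 < ε) :
    ∃ d, 0 < d ∧ d ≤ 1 ∧ ∀ f₁ f₂ : ℂ → ℂ, ContinuousOn f₁ (sphere 0 1) → ContinuousOn f₂ (sphere 0 1) →
      (∀ z ∈ sphere (0 : ℂ) 1, ‖f₁ z / f z - 1‖ < d) → (∀ z ∈ sphere (0 : ℂ) 1, ‖f₂ z / f z - 1‖ < d) →
      ∀ κ, (∀ z ∈ sphere (0 : ℂ) 1, ‖f₁ z / f z - f₂ z / f z‖ ≤ κ) →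
        ‖tFun f₁ (fun z => L z - Complex.log (f₁ z / f z)) i - tFun f₂ (fun z => L z - Complex.log (f₂ z / f z)) i
          + unitContour (fun z => f z ^ (-i - 1) * (f₁ z - f₂ z) / z)‖ ≤ ε * κ := by
  have hz0 : ∀ z ∈ sphere (0 : ℂ) 1, z ≠ 0 := fun z hz => by
    rintro rfl
    simp at hz
  by_cases hi : i = 0
  · subst hi
    have hψ : ContinuousOn (fun z : ℂ => -z⁻¹) (sphere 0 1) := (continuousOn_id.inv₀ hz0).neg
    obtain ⟨d, hd, hd1, key⟩ := cInt_strict hasStrictDerivAt_log_one continuousOn_log_ball one_pos hψ hε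
    refine ⟨d, hd, hd1, fun f₁ f₂ h1 h2 hn₁ hn₂ κ hκ => ?_⟩
    have := key (fun z => f₁ z / f z) (fun z => f₂ z / f z) (h1.div hf hf0) (h2.div hf hf0) hn₁ hn₂ κ hκ
    have hT : ∀ {f₁ : ℂ → ℂ}, ContinuousOn f₁ (sphere 0 1) → (∀ z ∈ sphere (0 : ℂ) 1, ‖f₁ z / f z - 1‖ < d) →
        tFun f₁ (fun z => L z - Complex.log (f₁ z / f z)) 0
          = cInt 1 (fun z => L z / z) + cInt 1 (fun z => -z⁻¹ * Complex.log (f₁ z / f z)) := by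
      intro f₁ h1 hn₁
      have hc : ContinuousOn (fun z => Complex.log (f₁ z / f z)) (sphere 0 1) :=
        (h1.div hf hf0).clog fun z hz => ball_one_subset_slitPlane (by
          rw [mem_ball, dist_eq_norm]
          exact (hn₁ z hz).trans_le hd1)
      have e1 : ContinuousOn (fun z => L z / z) (sphere 0 1) := hL.div continuousOn_id hz0
      have e2 : ContinuousOn (fun z => -z⁻¹ * Complex.log (f₁ z / f z)) (sphere 0 1) := hψ.mul hc
      rw [tFun, if_pos rfl, ← cInt_add zero_le_one e1 e2]
      exact unitContour_congr fun z _ => by ring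
    rw [hT h1 hn₁, hT h2 hn₂]
    refine le_of_eq_of_le (congrArg norm ?_) this
    rw [add_sub_add_left_eq_sub, sub_eq_add_neg _ (cInt 1 fun z => -z⁻¹ * (1 * (f₁ z / f z - f₂ z / f z)))]
    congr 1
    rw [← neg_one_mul (cInt 1 _), ← cInt_const_mul]
    refine unitContour_congr fun z hz => ?_
    have := hf0 z hz
    have := hz0 z hz
    simp only [neg_zero, zero_sub, zpow_neg_one]
    field_simp
  · have hi' : (i : ℂ) ≠ 0 := Int.cast_ne_zero.2 hi
    have hψ : ContinuousOn (fun z => f z ^ (-i) / i / z) (sphere 0 1) :=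
      ((hf.zpow₀ _ fun z hz => .inl (hf0 z hz)).div_const _).div continuousOn_id hz0
    have hg : HasStrictDerivAt (fun x : ℂ => x ^ (-i)) (-(i : ℂ)) 1 := by
      simpa using hasStrictDerivAt_zpow (-i) (1 : ℂ) (.inl one_ne_zero)
    have hgc : ContinuousOn (fun x : ℂ => x ^ (-i)) (ball 1 1) :=
      continuousOn_id.zpow₀ _ fun x hx => .inl (Complex.slitPlane_ne_zero (ball_one_subset_slitPlane hx))
    obtain ⟨d, hd, hd1, key⟩ := cInt_strict hg hgc one_pos hψ hε
    refine ⟨d, hd, hd1, fun f₁ f₂ h1 h2 hn₁ hn₂ κ hκ => ?_⟩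
    have := key (fun z => f₁ z / f z) (fun z => f₂ z / f z) (h1.div hf hf0) (h2.div hf hf0) hn₁ hn₂ κ hκ
    have hT : ∀ f₁ L : ℂ → ℂ, tFun f₁ L i = cInt 1 (fun z => f z ^ (-i) / i / z * (f₁ z / f z) ^ (-i)) := by
      intro f₁ L
      rw [tFun, if_neg hi]
      refine unitContour_congr fun z hz => ?_
      have := zpow_ne_zero (-i) (hf0 z hz)
      simp only [div_zpow]
      field_simp
    rw [hT f₁, hT f₂]
    refine le_of_eq_of_le (congrArg norm ?_) this
    rw [sub_eq_add_neg _ (cInt 1 fun z => f z ^ (-i) / i / z * (-i * (f₁ z / f z - f₂ z / f z)))]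
    congr 1
    rw [← neg_one_mul (cInt 1 _), ← cInt_const_mul]
    refine unitContour_congr fun z hz => ?_
    have := hf0 z hz
    have := hz0 z hz
    rw [zpow_sub_one₀ (hf0 z hz)]
    field_simp

end Contour


section Point

variable {N M : ℕ} {p q q' : Model N M} {ρ κ : ℝ}

/-! ### Derivatives of the coordinates -/

theorem coeff_add (X Y : Model N M) (i : ℤ) : coeff (X + Y) i = coeff X i + coeff Y i := rfl
theorem coeff_sub (X Y : Model N M) (i : ℤ) : coeff (X - Y) i = coeff X i - coeff Y i := rfl
theorem coeff_smul (s : ℂ) (X : Model N M) (i : ℤ) : coeff (s • X) i = s * coeff X i := rfl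
theorem coeffHat_add (X Y : Model N M) (i : ℤ) : coeffHat (X + Y) i = coeffHat X i + coeffHat Y i := rfl
theorem coeffHat_sub (X Y : Model N M) (i : ℤ) : coeffHat (X - Y) i = coeffHat X i - coeffHat Y i := rfl
theorem coeffHat_smul (s : ℂ) (X : Model N M) (i : ℤ) : coeffHat (s • X) i = s * coeffHat X i := rfl

theorem lCoeff_add (X Y : Model N M) (i : ℤ) : lCoeff (X + Y) i = lCoeff X i + lCoeff Y i := by
  simp only [lCoeff, coeff_add, coeffHat_add]
  split_ifs <;> simp

theorem lCoeff_smul (s : ℂ) (X : Model N M) (i : ℤ) : lCoeff (s • X) i = s * lCoeff X i := by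
  simp only [lCoeff, coeff_smul, coeffHat_smul]
  split_ifs <;> simp

theorem lCoeff_sub (X Y : Model N M) (i : ℤ) : lCoeff (X - Y) i = lCoeff X i - lCoeff Y i := by
  simp only [lCoeff, coeff_sub, coeffHat_sub]
  split_ifs <;> simp

theorem zCoeff_sub (X Y : Model N M) : zCoeff (X - Y) = zCoeff X - zCoeff Y := by
  ext i
  simp only [zCoeff, Pi.sub_apply, coeff_sub, coeffHat_sub]
  ring

theorem zCoeff_add (X Y : Model N M) : zCoeff (X + Y) = zCoeff X + zCoeff Y := by
  ext i
  simp only [zCoeff, Pi.sub_apply, Pi.add_apply, coeff_add, coeffHat_add]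
  ring

theorem zCoeff_smul (s : ℂ) (X : Model N M) : zCoeff (s • X) = s • zCoeff X := by
  ext i
  simp only [zCoeff, Pi.sub_apply, Pi.smul_apply, coeff_smul, coeffHat_smul, smul_eq_mul]
  ring

theorem exists_decay_zCoeff (X : Model N M) : ∃ ρ, 1 < ρ ∧ ∃ C, Decay ρ C (zCoeff X) ∧
    ∀ z ∈ annulus ρ, dZeta X z = laurentSum (zCoeff X) z := by
  obtain ⟨ρ, hρ, C, h1, h2⟩ := exists_decay X
  exact ⟨ρ, hρ, C + C, h1.sub h2, fun z hz => dZeta_eq hρ h1 h2 hz⟩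

theorem dZeta_sub (X Y : Model N M) {z : ℂ} (hz : z ∈ sphere (0 : ℂ) 1) :
    dZeta (X - Y) z = dZeta X z - dZeta Y z := by
  obtain ⟨ρ, hρ, C, h1, h2⟩ := exists_decay_zCoeff X
  obtain ⟨ρ', hρ', C', h1', h2'⟩ := exists_decay_zCoeff Y
  obtain ⟨ρ'', hρ'', C'', h1'', h2''⟩ := exists_decay_zCoeff (X - Y)
  have hm : 1 < min ρ ρ' := lt_min hρ hρ'
  rw [h2 z (unit_sphere_subset_annulus hρ hz), h2' z (unit_sphere_subset_annulus hρ' hz),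
    h2'' z (unit_sphere_subset_annulus hρ'' hz), zCoeff_sub]
  exact (h1.mono (by linarith) (min_le_left _ _)).laurentSum_sub hm
    (h1'.mono (by linarith) (min_le_right _ _)) (unit_sphere_subset_annulus hm hz)

theorem zeta_sub (X Y : Model N M) {z : ℂ} (hz : z ∈ sphere (0 : ℂ) 1) :
    zeta X z - zeta Y z = dZeta (X - Y) z := by
  rw [zeta_eq, zeta_eq, dZeta_sub X Y hz]
  ring

theorem dZeta_smul (s : ℂ) (X : Model N M) {z : ℂ} (hz : z ∈ sphere (0 : ℂ) 1) :
    dZeta (s • X) z = s * dZeta X z := by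
  obtain ⟨ρ, hρ, C, h1, h2⟩ := exists_decay_zCoeff X
  obtain ⟨ρ', hρ', C', h1', h2'⟩ := exists_decay_zCoeff (s • X)
  rw [h2 z (unit_sphere_subset_annulus hρ hz), h2' z (unit_sphere_subset_annulus hρ' hz), zCoeff_smul,
    laurentSum_smul]

theorem dZeta_add (X Y : Model N M) {z : ℂ} (hz : z ∈ sphere (0 : ℂ) 1) :
    dZeta (X + Y) z = dZeta X z + dZeta Y z := by
  have h := dZeta_sub (X + Y) Y hz
  rw [add_sub_cancel_right] at h
  rw [h, sub_add_cancel]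

theorem continuousOn_dZeta (X : Model N M) : ContinuousOn (dZeta X) (sphere 0 1) := by
  obtain ⟨ρ, hρ, C, h1, h2⟩ := exists_decay X
  exact (differentiableOn_dZeta hρ h1 h2).continuousOn.mono (unit_sphere_subset_annulus hρ)

theorem continuousOn_zeta (p : Model N M) : ContinuousOn (zeta p) (sphere 0 1) :=
  ((continuous_pow N).continuousOn.add (continuousOn_dZeta p)).congr fun z _ => zeta_eq p z

theorem Near.norm_dZeta_le (h : Near ρ κ q q') {τ : ℝ} (hτ : 1 < τ) (hρ : τ < ρ) {z : ℂ}
    (hz : z ∈ sphere (0 : ℂ) 1) : ‖dZeta (q - q') z‖ ≤ 2 * lipConst ρ τ * κ := by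
  obtain ⟨σ, hσ, C, -, h2⟩ := exists_decay_zCoeff (q - q')
  have hzτ := unit_sphere_subset_annulus hτ hz
  rw [h2 z (unit_sphere_subset_annulus hσ hz), zCoeff_sub]
  refine (h.decay_zCoeff.norm_laurentSum_le hτ.le hρ hzτ.1.le hzτ.2.le).trans (le_of_eq (by ring))

theorem Near.nonneg (h : Near ρ κ q q') : 0 ≤ κ := by
  have := (norm_nonneg _).trans (h 0).1
  simpa using this

theorem Near.norm_lCoeff_le (h : Near ρ κ q q') (hρ : 1 < ρ) (i : ℤ) : ‖lCoeff (q - q') i‖ ≤ κ := by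
  have hκ := h.nonneg
  have h1 : κ * ρ ^ (-|i|) ≤ κ :=
    mul_le_of_le_one_right hκ (zpow_le_one_of_nonpos₀ hρ.le (by simp))
  rw [lCoeff]
  split_ifs
  · exact (h i).1.trans h1
  · exact (h i).2.trans h1
  · simpa using hκ

theorem dZeroPoly_sub (X Y : Model N M) (u : ℂ) : dZeroPoly (X - Y) u = dZeroPoly X u - dZeroPoly Y u := by
  simp only [dZeroPoly, lCoeff_sub, sub_mul, Finset.sum_sub_distrib]

theorem dInftyPoly_sub (X Y : Model N M) (u : ℂ) : dInftyPoly (X - Y) u = dInftyPoly X u - dInftyPoly Y u := by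
  simp only [dInftyPoly, lCoeff_sub, sub_mul, Finset.sum_sub_distrib]

theorem dZeroPoly_add (X Y : Model N M) (u : ℂ) : dZeroPoly (X + Y) u = dZeroPoly X u + dZeroPoly Y u := by
  simp only [dZeroPoly, lCoeff_add, add_mul, Finset.sum_add_distrib]

theorem dInftyPoly_add (X Y : Model N M) (u : ℂ) : dInftyPoly (X + Y) u = dInftyPoly X u + dInftyPoly Y u := by
  simp only [dInftyPoly, lCoeff_add, add_mul, Finset.sum_add_distrib]

theorem dZeroPoly_smul (s : ℂ) (X : Model N M) (u : ℂ) : dZeroPoly (s • X) u = s * dZeroPoly X u := by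
  simp only [dZeroPoly, lCoeff_smul, Finset.mul_sum, mul_assoc]

theorem dInftyPoly_smul (s : ℂ) (X : Model N M) (u : ℂ) : dInftyPoly (s • X) u = s * dInftyPoly X u := by
  simp only [dInftyPoly, lCoeff_smul, Finset.mul_sum, mul_assoc]

theorem zeroPoly_sub (X Y : Model N M) (u : ℂ) : zeroPoly X u - zeroPoly Y u = dZeroPoly (X - Y) u := by
  rw [dZeroPoly_sub, zeroPoly, zeroPoly]
  ring

theorem inftyPoly_sub (X Y : Model N M) (u : ℂ) : inftyPoly X u - inftyPoly Y u = dInftyPoly (X - Y) u := by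
  rw [dInftyPoly_sub, inftyPoly, inftyPoly]
  ring

theorem Near.norm_poly_le (h : Near ρ κ q q') (hρ : 1 < ρ) {r : ℝ} (hr : 0 ≤ r) {u : ℂ}
    (hu : u ∈ closedBall (0 : ℂ) r) :
    ‖zeroPoly q u - zeroPoly q' u‖ ≤ (∑ m ∈ Finset.range (N + M), (r ^ m + r ^ (m + 1))) * κ ∧
    ‖inftyPoly q u - inftyPoly q' u‖ ≤ (∑ m ∈ Finset.range (N + M), (r ^ m + r ^ (m + 1))) * κ := by
  have hκ := h.nonneg
  have hu' : ‖u‖ ≤ r := by simpa using hu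
  rw [zeroPoly_sub, inftyPoly_sub, dZeroPoly, dInftyPoly, Finset.sum_mul]
  have key : ∀ (i : ℤ) (m : ℕ), ‖lCoeff (q - q') i * u ^ m‖ ≤ r ^ m * κ := fun i m => by
    rw [norm_mul, norm_pow, mul_comm]
    exact mul_le_mul (pow_le_pow_left₀ (norm_nonneg u) hu' m) (h.norm_lCoeff_le hρ i) (norm_nonneg _)
      (by positivity)
  constructor
  · refine (norm_sum_le _ _).trans (Finset.sum_le_sum fun m _ => (key _ m).trans ?_)
    exact mul_le_mul_of_nonneg_right (le_add_of_nonneg_right (by positivity)) hκ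
  · refine (norm_sum_le _ _).trans (Finset.sum_le_sum fun m _ => (key _ (m + 1)).trans ?_)
    exact mul_le_mul_of_nonneg_right (le_add_of_nonneg_left (by positivity)) hκ

/-- If `P` is bounded below and `P₁ - P₂` is controlled by `κ`, the quotients are controlled. -/
theorem norm_div_sub_div_le {P P₁ P₂ : ℂ} {m K κ : ℝ} (hm : 0 < m) (h : m ≤ ‖P‖) (h1 : ‖P₁ - P₂‖ ≤ K * κ) :
    ‖P₁ / P - P₂ / P‖ ≤ K / m * κ := by
  have hP : 0 < ‖P‖ := hm.trans_le h
  rw [← sub_div, norm_div, div_le_iff₀ hP]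
  have h2 : 0 ≤ K * κ := (norm_nonneg _).trans h1
  calc ‖P₁ - P₂‖ ≤ K * κ := h1
    _ = K * κ / m * m := by field_simp
    _ ≤ K * κ / m * ‖P‖ := mul_le_mul_of_nonneg_left h (by positivity)
    _ = K / m * κ * ‖P‖ := by ring

theorem exists_lower_bound_closedBall {P Λ : ℂ → ℂ} {r s : ℝ} (h : IsLog P Λ r) (hsr : s < r) :
    ∃ m, 0 < m ∧ ∀ u ∈ closedBall (0 : ℂ) s, m ≤ ‖P u‖ := by
  rcases lt_or_ge s 0 with hs | hs
  · exact ⟨1, one_pos, fun u hu => by simp [closedBall_eq_empty.2 hs] at hu⟩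
  have hsub := closedBall_subset_ball (x := (0 : ℂ)) hsr
  have hc : ContinuousOn P (closedBall 0 s) :=
    (h.diff.continuousOn.mono hsub).cexp.congr fun u hu => (h.exp_eq u (hsub hu)).symm
  obtain ⟨u, hu, hu'⟩ := (isCompact_closedBall (0 : ℂ) s).exists_isMinOn ⟨0, by simp [hs]⟩ hc.norm
  exact ⟨‖P u‖, norm_pos_iff.2 (h.exp_eq u (hsub hu) ▸ Complex.exp_ne_zero _), fun y hy => hu' hy⟩

theorem IsLog.add_log {P P₁ Λ : ℂ → ℂ} {r s : ℝ} (h : IsLog P Λ r) (hs : 0 < s) (hsr : s ≤ r)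
    (hP : Differentiable ℂ P) (hP₁ : Differentiable ℂ P₁)
    (h1 : ∀ u ∈ ball (0 : ℂ) s, ‖P₁ u / P u - 1‖ < 1) :
    IsLog P₁ (fun u => Λ u + Complex.log (P₁ u / P u)) s := by
  have hmem : ∀ u ∈ ball (0 : ℂ) s, P₁ u / P u ∈ Complex.slitPlane := fun u hu =>
    ball_one_subset_slitPlane (by rw [mem_ball, dist_eq_norm]; exact h1 u hu)
  have hP0 : ∀ u ∈ ball (0 : ℂ) s, P u ≠ 0 := fun u hu =>
    h.exp_eq u (ball_subset_ball hsr hu) ▸ Complex.exp_ne_zero _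
  refine ⟨hs, (h.diff.mono (ball_subset_ball hsr)).add
    ((hP₁.differentiableOn.div hP.differentiableOn hP0).clog hmem), fun u hu => ?_⟩
  rw [Complex.exp_add, Complex.exp_log (Complex.slitPlane_ne_zero (hmem u hu)),
    h.exp_eq u (ball_subset_ball hsr hu), mul_div_cancel₀ _ (hP0 u hu)]

namespace Chart

variable (c : Chart p)

/-- The coordinates of nearby points, with branches obtained by continuation. -/
noncomputable def nearCoord (q : Model N M) : Label N M → ℂ
  | .t i => tFun (zeta q) (fun z => c.L z - Complex.log (zeta q z / zeta p z)) i
  | .h j => poleCoeff (fun u => c.ΛI u + Complex.log (inftyPoly q u / inftyPoly p u)) N c.s j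
  | .hHat k => poleCoeff (fun u => c.ΛZ u + Complex.log (zeroPoly q u / zeroPoly p u)) M c.s k

/-- The derivatives of the coordinates along a tangent vector. -/
noncomputable def dCoord (X : Model N M) : Label N M → ℂ
  | .t i => -unitContour fun z => zeta p z ^ (-i - 1) * dZeta X z / z
  | .h j => cInt c.s fun u => (Complex.exp (c.ΛI u / N) / u) ^ (j : ℕ) / u * (dInftyPoly X u / inftyPoly p u)
  | .hHat k => cInt c.s fun u => (Complex.exp (c.ΛZ u / M) / u) ^ (k : ℕ) / u * (dZeroPoly X u / zeroPoly p u)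

theorem zeta_ne_zero (c : Chart p) : ∀ z ∈ sphere (0 : ℂ) 1, zeta p z ≠ 0 := fun z hz =>
  c.loop.ne_zero z (unit_sphere_subset_annulus c.loop.one_lt hz)

/-- The radius (s + r)/2 lies strictly between the contour radius s and r. The logarithms continued
to a nearby point thus live on a disc that still contains the contour in its interior. -/
theorem exists_ratio_bound (hρ : 1 < ρ) : ∃ K, 0 < K ∧ ∀ (q q' : Model N M) (κ : ℝ), Near ρ κ q q' →
    (∀ z ∈ sphere (0 : ℂ) 1, ‖zeta q z / zeta p z - zeta q' z / zeta p z‖ ≤ K * κ) ∧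
    (∀ u ∈ closedBall (0 : ℂ) ((c.s + c.r) / 2),
      ‖zeroPoly q u / zeroPoly p u - zeroPoly q' u / zeroPoly p u‖ ≤ K * κ) ∧
    (∀ u ∈ closedBall (0 : ℂ) ((c.s + c.r) / 2),
      ‖inftyPoly q u / inftyPoly p u - inftyPoly q' u / inftyPoly p u‖ ≤ K * κ) := by
  have h1 := c.pos
  have h2 := c.lt
  obtain ⟨τ, hτ, hτρ⟩ := exists_between hρ
  obtain ⟨m₁, hm₁, b₁⟩ := exists_min_sphere (continuousOn_zeta p) c.zeta_ne_zero
  obtain ⟨m₂, hm₂, b₂⟩ := exists_lower_bound_closedBall c.logZ (s := (c.s + c.r) / 2) (by linarith)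
  obtain ⟨m₃, hm₃, b₃⟩ := exists_lower_bound_closedBall c.logI (s := (c.s + c.r) / 2) (by linarith)
  set K := ∑ m ∈ Finset.range (N + M), (((c.s + c.r) / 2) ^ m + ((c.s + c.r) / 2) ^ (m + 1)) with hK
  have hK0 : 0 ≤ K := Finset.sum_nonneg fun m _ => by
    have : 0 ≤ (c.s + c.r) / 2 := by linarith
    positivity
  have hlip := lipConst_pos (by linarith : 0 < τ) hτρ
  refine ⟨2 * lipConst ρ τ / m₁ + K / m₂ + K / m₃, by positivity, fun q q' κ h => ?_⟩
  have hκ := h.nonneg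
  refine ⟨fun z hz => ?_, fun u hu => ?_, fun u hu => ?_⟩
  · refine (norm_div_sub_div_le hm₁ (b₁ z hz) (by rw [zeta_sub q q' hz]; exact h.norm_dZeta_le hτ hτρ hz)).trans ?_
    exact mul_le_mul_of_nonneg_right (by linarith [div_nonneg hK0 hm₂.le, div_nonneg hK0 hm₃.le]) hκ
  · refine (norm_div_sub_div_le hm₂ (b₂ u hu) (h.norm_poly_le hρ (by linarith) hu).1).trans ?_
    refine mul_le_mul_of_nonneg_right ?_ hκ
    have : 0 ≤ 2 * lipConst ρ τ / m₁ := by positivity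
    linarith [div_nonneg hK0 hm₃.le]
  · refine (norm_div_sub_div_le hm₃ (b₃ u hu) (h.norm_poly_le hρ (by linarith) hu).2).trans ?_
    refine mul_le_mul_of_nonneg_right ?_ hκ
    have : 0 ≤ 2 * lipConst ρ τ / m₁ := by positivity
    linarith [div_nonneg hK0 hm₂.le]

theorem closedBall_subset : closedBall (0 : ℂ) c.s ⊆ closedBall (0 : ℂ) ((c.s + c.r) / 2) :=
  closedBall_subset_closedBall (by linarith [c.lt])

theorem zeroPoly_ne_zero (c : Chart p) {u : ℂ} (hu : u ∈ ball (0 : ℂ) c.r) : zeroPoly p u ≠ 0 :=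
  c.logZ.exp_eq u hu ▸ Complex.exp_ne_zero _

theorem inftyPoly_ne_zero (c : Chart p) {u : ℂ} (hu : u ∈ ball (0 : ℂ) c.r) : inftyPoly p u ≠ 0 :=
  c.logI.exp_eq u hu ▸ Complex.exp_ne_zero _

theorem exists_small (hρ : 1 < ρ) {d : ℝ} (hd : 0 < d) : ∃ η, 0 < η ∧ ∀ q : Model N M, Near ρ η q p →
    (∀ z ∈ sphere (0 : ℂ) 1, ‖zeta q z / zeta p z - 1‖ < d) ∧
    (∀ u ∈ closedBall (0 : ℂ) ((c.s + c.r) / 2), ‖zeroPoly q u / zeroPoly p u - 1‖ < d) ∧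
    (∀ u ∈ closedBall (0 : ℂ) ((c.s + c.r) / 2), ‖inftyPoly q u / inftyPoly p u - 1‖ < d) := by
  obtain ⟨K, hK, h⟩ := c.exists_ratio_bound hρ
  have hlt : (c.s + c.r) / 2 < c.r := by linarith [c.lt]
  refine ⟨d / (2 * K), by positivity, fun q hq => ?_⟩
  obtain ⟨h1, h2, h3⟩ := h q p _ hq
  have e : K * (d / (2 * K)) < d := by
    have : K * (d / (2 * K)) = d / 2 := by field_simp
    linarith
  refine ⟨fun z hz => ?_, fun u hu => ?_, fun u hu => ?_⟩
  · have := h1 z hz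
    rw [div_self (c.zeta_ne_zero z hz)] at this
    exact this.trans_lt e
  · have := h2 u hu
    rw [div_self (c.zeroPoly_ne_zero (closedBall_subset_ball hlt hu))] at this
    exact this.trans_lt e
  · have := h3 u hu
    rw [div_self (c.inftyPoly_ne_zero (closedBall_subset_ball hlt hu))] at this
    exact this.trans_lt e

/-- The bound concerns pairs q, q' near p, that is, strict differentiability. It serves for the
derivative along curves, for the inverse function theorem and for the separation of points. -/
theorem strict (hN : 0 < N) (hM : 0 < M) (hρ : 1 < ρ) (β : Label N M) {ε : ℝ} (hε : 0 < ε) :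
    ∃ η, 0 < η ∧ ∀ (q q' : Model N M) (κ : ℝ), Near ρ η q p → Near ρ η q' p → Near ρ κ q q' →
      ‖c.nearCoord q β - c.nearCoord q' β - c.dCoord (q - q') β‖ ≤ ε * κ := by
  obtain ⟨K, hK, hKb⟩ := c.exists_ratio_bound hρ
  have hεK : 0 < ε / K := by positivity
  have e : ∀ κ : ℝ, ε / K * (K * κ) = ε * κ := fun κ => by field_simp
  rcases β with i | j | k
  · obtain ⟨d, hd, -, key⟩ := tFun_strict (continuousOn_zeta p) c.zeta_ne_zero c.continuousOn_L i hεK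
    obtain ⟨η, hη, hs⟩ := c.exists_small hρ hd
    refine ⟨η, hη, fun q q' κ h1 h2 h3 => ?_⟩
    have := key _ _ (continuousOn_zeta q) (continuousOn_zeta q') (hs q h1).1 (hs q' h2).1 _ (hKb q q' κ h3).1
    rw [e] at this
    refine le_of_eq_of_le (congrArg norm ?_) this
    simp only [nearCoord, dCoord, sub_neg_eq_add]
    congr 1
    exact unitContour_congr fun z hz => by simp only [zeta_sub q q' hz]
  · obtain ⟨d, hd, -, key⟩ := c.logI.poleCoeff_strict hN c.pos c.lt j hεK
    obtain ⟨η, hη, hs⟩ := c.exists_small hρ hd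
    refine ⟨η, hη, fun q q' κ h1 h2 h3 => ?_⟩
    have := key _ _ (differentiable_inftyPoly q) (differentiable_inftyPoly q')
      (fun u hu => (hs q h1).2.2 u (c.closedBall_subset hu))
      (fun u hu => (hs q' h2).2.2 u (c.closedBall_subset hu)) _
      (fun u hu => (hKb q q' κ h3).2.2 u (c.closedBall_subset hu))
    simp only [e, inftyPoly_sub] at this
    exact this
  · obtain ⟨d, hd, -, key⟩ := c.logZ.poleCoeff_strict hM c.pos c.lt k hεK
    obtain ⟨η, hη, hs⟩ := c.exists_small hρ hd
    refine ⟨η, hη, fun q q' κ h1 h2 h3 => ?_⟩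
    have := key _ _ (differentiable_zeroPoly q) (differentiable_zeroPoly q')
      (fun u hu => (hs q h1).2.1 u (c.closedBall_subset hu))
      (fun u hu => (hs q' h2).2.1 u (c.closedBall_subset hu)) _
      (fun u hu => (hKb q q' κ h3).2.1 u (c.closedBall_subset hu))
    simp only [e, zeroPoly_sub] at this
    exact this

theorem nearCoord_self : c.nearCoord p = c.coord := by
  have hs0 := c.pos
  have hP : ∀ u ∈ closedBall (0 : ℂ) c.s, u ∈ ball (0 : ℂ) c.r := closedBall_subset_ball c.lt
  have hpc : ∀ {P Λ : ℂ → ℂ} (n k : ℕ), (∀ u ∈ closedBall (0 : ℂ) c.s, P u ≠ 0) →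
      poleCoeff (fun u => Λ u + Complex.log (P u / P u)) n c.s k = poleCoeff Λ n c.s k := by
    intro P Λ n k h
    rw [poleCoeff, poleCoeff, div_self (h 0 (by simp [hs0.le])), Complex.log_one, add_zero]
    split_ifs
    · rfl
    · congr 2
      refine circleIntegral.integral_congr hs0.le fun u hu => ?_
      simp only [div_self (h u (sphere_subset_closedBall hu)), Complex.log_one, add_zero]
  ext β
  rcases β with i | j | k
  · simp only [nearCoord, coord, tFun]
    split_ifs
    · refine unitContour_congr fun z hz => ?_
      simp only [div_self (c.zeta_ne_zero z hz), Complex.log_one, sub_zero]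
    · rfl
  · exact hpc N j fun u hu => c.inftyPoly_ne_zero (hP u hu)
  · exact hpc M k fun u hu => c.zeroPoly_ne_zero (hP u hu)

/-- Adding or subtracting the principal logarithm of a ratio close to 1 continues each branch from p
to q, so the continued values are the coordinates of a genuine chart at q. -/
theorem exists_nearby (hρ : 1 < ρ) : ∃ η, 0 < η ∧ ∀ q : Model N M, Near ρ η q p →
    ∃ c' : Chart q, c'.coord = c.nearCoord q := by
  obtain ⟨σ₁, hσ₁, C, hd1, hd2⟩ := exists_decay p
  obtain ⟨σ, hσ, hσ'⟩ := exists_between (lt_min c.loop.one_lt hσ₁)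
  rw [lt_min_iff] at hσ'
  have hloop : Loop (zeta p) σ c.δ := ⟨c.loop.toUnivalent.mono hσ hσ'.1.le,
    fun z hz => c.loop.ne_zero z (annulus_mono (by linarith) hσ'.1.le hz), c.loop.wind⟩
  obtain ⟨τ, hτ, hτ'⟩ := exists_between (lt_min hσ hρ)
  rw [lt_min_iff] at hτ'
  obtain ⟨m, hm, hmb⟩ := exists_lower_bound hloop hτ hτ'.1
  obtain ⟨η₁, hη₁, hnear⟩ := exists_near_loop hloop hτ hτ'.1 hσ'.2 hd1 hd2 hτ'.2 hm
  obtain ⟨η₂, hη₂, hsmall⟩ := c.exists_small hρ one_pos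
  have hpos := c.pos
  have hlt := c.lt
  refine ⟨min η₁ η₂, lt_min hη₁ hη₂, fun q hq => ?_⟩
  obtain ⟨hLq, hclose⟩ := hnear q (hq.mono (by linarith) (min_le_left _ _))
  obtain ⟨-, hZ, hI⟩ := hsmall q (hq.mono (by linarith) (min_le_right _ _))
  have hsubτ : annulus τ ⊆ annulus c.σ := annulus_mono (by linarith) (by linarith)
  have hL : ∀ z ∈ annulus τ, HasDerivAt (fun z => c.L z - Complex.log (zeta q z / zeta p z))
      (z⁻¹ - deriv (zeta q) z / zeta q z) z ∧
      Complex.exp (c.L z - Complex.log (zeta q z / zeta p z)) = z / zeta q z := by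
    intro z hz
    obtain ⟨h1, h2⟩ := c.hL z (hsubτ hz)
    have hp0 := c.loop.ne_zero z (hsubτ hz)
    have hq0 := hLq.ne_zero z hz
    have hmem : zeta q z / zeta p z ∈ Complex.slitPlane := by
      refine ball_one_subset_slitPlane ?_
      rw [mem_ball, dist_eq_norm, div_sub_one hp0, norm_div, div_lt_one (norm_pos_iff.2 hp0)]
      exact (hclose z hz).trans_le (hmb z hz)
    refine ⟨?_, ?_⟩
    · refine (h1.fun_sub (((hLq.differentiableAt hz).hasDerivAt.fun_div
        (c.loop.differentiableAt (hsubτ hz)).hasDerivAt hp0).clog hmem)).congr_deriv ?_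
      field_simp
      ring
    · rw [Complex.exp_sub, h2, Complex.exp_log (div_ne_zero hq0 hp0)]
      field_simp
  exact ⟨{ σ := τ, δ := c.δ / 2, r := (c.s + c.r) / 2, s := c.s
           L := fun z => c.L z - Complex.log (zeta q z / zeta p z)
           ΛZ := fun u => c.ΛZ u + Complex.log (zeroPoly q u / zeroPoly p u)
           ΛI := fun u => c.ΛI u + Complex.log (inftyPoly q u / inftyPoly p u)
           loop := hLq, hL := hL, pos := hpos, lt := by linarith
           logZ := c.logZ.add_log (by linarith) (by linarith) (differentiable_zeroPoly p)
             (differentiable_zeroPoly q) fun u hu => hZ u (ball_subset_closedBall hu)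
           logI := c.logI.add_log (by linarith) (by linarith) (differentiable_inftyPoly p)
             (differentiable_inftyPoly q) fun u hu => hI u (ball_subset_closedBall hu)
           logI_zero := by simp [c.logI_zero, inftyPoly_zero] }, by
    ext β
    rcases β with i | j | k <;> rfl⟩

end Chart
end Point

/-! ### The pairing at a pole -/

/-- The derivative of `poleCoeff` in the direction `A`. -/
noncomputable def poleD (P Λ : ℂ → ℂ) (n : ℕ) (s : ℝ) (A : ℂ → ℂ) (k : ℕ) : ℂ :=
  cInt s fun u => (Complex.exp (Λ u / n) / u) ^ k / u * (A u / P u)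

section Pole

variable {P Λ A B : ℂ → ℂ} {r s : ℝ} {n K : ℕ}

theorem IsLog.ne_zero (h : IsLog P Λ r) {u : ℂ} (hu : u ∈ ball (0 : ℂ) r) : P u ≠ 0 :=
  h.exp_eq u hu ▸ Complex.exp_ne_zero _

theorem IsLog.poleD_eq (h : IsLog P Λ r) (hA : DifferentiableOn ℂ A (ball 0 r)) (hs : 0 < s) (hsr : s < r)
    {s' : ℝ} (hs' : 0 < s') (hsr' : s' < r) (k : ℕ) : poleD P Λ n s A k = poleD P Λ n s' A k := by
  have hPd : DifferentiableOn ℂ P (ball 0 r) := h.diff.cexp.congr fun u hu => (h.exp_eq u hu).symm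
  rw [poleD, poleD, cInt, cInt, circleIntegral_eq_of_punctured' (r := r) _ hs' hsr' hs hsr]
  intro u hu0 hur
  have hu : u ∈ ball (0 : ℂ) r := by simpa using hur
  have hn := isOpen_ball.mem_nhds hu
  exact ((((h.invertible n).hasDerivAt_pole hu0 hu).differentiableAt.fun_pow k).fun_div differentiableAt_id hu0).fun_mul
    ((hA.differentiableAt hn).fun_div (hPd.differentiableAt hn) (h.ne_zero hu))

/-- The function with expansion coefficients `poleD`. -/
theorem IsLog.exists_poleD_expansion (h : IsLog P Λ r) (hn : 0 < n) (hs : 0 < s) (hsr : s < r) :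
    ∃ r', 0 < r' ∧ r' ≤ r ∧ (∀ u ∈ ball (0 : ℂ) r', 1 - u * deriv Λ u / n ≠ 0) ∧
      ∀ A : ℂ → ℂ, DifferentiableOn ℂ A (ball 0 r) →
        DifferentiableOn ℂ (fun u => A u / P u / (1 - u * deriv Λ u / n)) (ball 0 r') ∧
        (∀ K, (fun u => A u / P u / (1 - u * deriv Λ u / n)
          - ∑ m ∈ Finset.range (K + 1), poleD P Λ n s A m * (u / Complex.exp (Λ u / n)) ^ m)
            =O[𝓝 0] fun u => u ^ (K + 1)) ∧
        ∀ s', 0 < s' → s' < r' → ∀ k : ℕ, cInt s' (fun u => A u / P u / (1 - u * deriv Λ u / n) *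
          ((Complex.exp (Λ u / n) / u) ^ ((k : ℤ) - 1) *
            ((deriv (fun u => Complex.exp (Λ u / n)) u * u - Complex.exp (Λ u / n)) / u ^ 2)))
              = -poleD P Λ n s A k := by
  have hdΛ : DifferentiableOn ℂ (deriv Λ) (ball 0 r) := h.diff.deriv isOpen_ball
  have hden : DifferentiableOn ℂ (fun u => 1 - u * deriv Λ u / n) (ball 0 r) :=
    (differentiableOn_const _).sub ((differentiableOn_id.mul hdΛ).div_const _)
  have h0 : (0 : ℂ) ∈ ball (0 : ℂ) r := mem_ball_self h.pos
  have hn' : (n : ℂ) ≠ 0 := Nat.cast_ne_zero.2 hn.ne'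
  have hne : ∀ᶠ u in 𝓝 (0 : ℂ), 1 - u * deriv Λ u / n ≠ 0 :=
    (hden.differentiableAt (isOpen_ball.mem_nhds h0)).continuousAt.eventually_ne (by simp)
  obtain ⟨ε, hε, hb⟩ := Metric.eventually_nhds_iff_ball.1 hne
  have hr' : 0 < min ε r := lt_min hε h.pos
  have hsub : ball (0 : ℂ) (min ε r) ⊆ ball 0 r := ball_subset_ball (min_le_right _ _)
  have hb' : ∀ u ∈ ball (0 : ℂ) (min ε r), 1 - u * deriv Λ u / n ≠ 0 := fun u hu =>
    hb u (ball_subset_ball (min_le_left _ _) hu)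
  have hPd : DifferentiableOn ℂ P (ball 0 r) := h.diff.cexp.congr fun u hu => (h.exp_eq u hu).symm
  refine ⟨min ε r, hr', min_le_right _ _, hb', fun A hA => ?_⟩
  have hQ := (h.invertible n).mono hr' (min_le_right _ _)
  -- Since χ^(k-1) dχ = -χ^k (1 - u Λ'/n) du/u, dividing A / P by 1 - u Λ'/n turns `poleD` into the
  -- coefficient functional of `Invertible₀.coeff_eq`.
  have hα : DifferentiableOn ℂ (fun u => A u / P u / (1 - u * deriv Λ u / n)) (ball 0 (min ε r)) :=
    ((hA.mono hsub).fun_div (hPd.mono hsub) fun u hu => h.ne_zero (hsub hu)).fun_div (hden.mono hsub) hb'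
  have hint : ∀ s', 0 < s' → s' < min ε r → ∀ k : ℕ, cInt s' (fun u => A u / P u / (1 - u * deriv Λ u / n) *
          ((Complex.exp (Λ u / n) / u) ^ ((k : ℤ) - 1) *
            ((deriv (fun u => Complex.exp (Λ u / n)) u * u - Complex.exp (Λ u / n)) / u ^ 2)))
              = -poleD P Λ n s A k := by
    intro s' hs' hsr' k
    rw [h.poleD_eq hA hs hsr hs' (hsr'.trans_le (min_le_right _ _)), poleD, ← neg_one_mul, ← cInt_const_mul]
    refine cInt_congr hs'.le fun u hu => ?_
    rw [mem_sphere_zero_iff_norm] at hu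
    have hu0 : u ≠ 0 := norm_pos_iff.1 (hu ▸ hs')
    have hur : u ∈ ball (0 : ℂ) (min ε r) := by rw [mem_ball_zero_iff, hu]; exact hsr'
    have hd := hb' u hur
    have hP := h.ne_zero (hsub hur)
    have hE := Complex.exp_ne_zero (Λ u / n)
    simp only [(hasDerivAt_root h (hsub hur) n).deriv]
    rw [zpow_sub_one₀ (div_ne_zero hE hu0), zpow_natCast]
    have hd' : (n : ℂ) - u * deriv Λ u ≠ 0 := by
      intro e
      apply hd
      field_simp
      rw [mul_zero]
      exact e
    field_simp
    ring
  refine ⟨hα, fun K => ?_, hint⟩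
  obtain ⟨c, -, hc⟩ := hQ.exists_expansion K (hα.analyticAt (ball_mem_nhds 0 hr'))
  refine hc.congr_left fun u => ?_
  congr 1
  refine Finset.sum_congr rfl fun m hm => ?_
  congr 1
  have h1 := hQ.coeff_eq (half_pos hr') (half_lt_self hr') hα (hc.mono nhdsWithin_le_nhds)
    (Finset.mem_range_succ_iff.1 hm)
  have h2 := hint _ (half_pos hr') (half_lt_self hr') m
  rw [cInt] at h2
  exact neg_injective (h1.symm.trans h2)

/-- The residue pairing of two functions with a pole, in terms of `poleD`. -/
theorem IsLog.resZero_pairing (h : IsLog P Λ r) (hn : 0 < n) (hs : 0 < s) (hsr : s < r)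
    (hA : DifferentiableOn ℂ A (ball 0 r)) (hB : DifferentiableOn ℂ B (ball 0 r)) {ℓ : ℂ → ℂ}
    (hℓ : ∀ u, u ≠ 0 → ℓ u = P u / u ^ n) :
    resZero (fun u => A u / u ^ n * (B u / u ^ n) / (u ^ 2 * deriv ℓ u))
      = -(1 / (n : ℂ)) * ∑ j ∈ Finset.range (n + 1), poleD P Λ n s A (n - j) * poleD P Λ n s B j := by
  have hn' : (n : ℂ) ≠ 0 := Nat.cast_ne_zero.2 hn.ne'
  obtain ⟨r', hr', hrr, hden, hexp⟩ := h.exists_poleD_expansion hn hs hsr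
  obtain ⟨hα, -, hαk⟩ := hexp A hA
  obtain ⟨hβ, hβO, -⟩ := hexp B hB
  set α : ℂ → ℂ := fun u => A u / P u / (1 - u * deriv Λ u / n) with hαdef
  set β : ℂ → ℂ := fun u => B u / P u / (1 - u * deriv Λ u / n) with hβdef
  set Q : ℂ → ℂ := fun u => Complex.exp (Λ u / n) with hQdef
  have hQ := (h.invertible n).mono hr' hrr
  set W : ℤ → ℂ → ℂ := fun k u => (Q u / u) ^ (k - 1) * ((deriv Q u * u - Q u) / u ^ 2) with hW
  have hWd : ∀ k : ℤ, ∀ u : ℂ, u ≠ 0 → ‖u‖ < r' → DifferentiableAt ℂ (W k) u := by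
    intro k u hu0 hur
    have hu : u ∈ ball (0 : ℂ) r' := by simpa using hur
    refine (((hQ.differentiableAt hu).fun_div differentiableAt_id hu0).zpow
      (.inl (div_ne_zero (hQ.ne_zero u hu) hu0))).mul ?_
    exact (((hQ.differentiableAt_deriv hu).mul differentiableAt_id).sub (hQ.differentiableAt hu)).div
      (differentiableAt_pow 2) (pow_ne_zero 2 hu0)
  have hsub : ball (0 : ℂ) r' ⊆ ball 0 r := ball_subset_ball hrr
  -- Here l = χⁿ and u l' = -n l (1 - u Λ'/n). The two factors 1 - u Λ'/n hidden in A and B combine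
  -- with l' to give (1/n) α β χ^(n-1) dχ.
  have hcongr : (fun u => A u / u ^ n * (B u / u ^ n) / (u ^ 2 * deriv ℓ u))
      =ᶠ[𝓝[≠] 0] fun u => 1 / (n : ℂ) * (α u * β u * W n u) := by
    filter_upwards [sdiff_mem_nhdsWithin_compl (ball_mem_nhds (0 : ℂ) hr') {0}] with u hu
    have hu0 : u ≠ 0 := hu.2
    have hub := hu.1
    have hP := h.ne_zero (hsub hub)
    have hE : Q u ≠ 0 := Complex.exp_ne_zero _
    have hQn : Q u ^ n = P u := by
      rw [hQdef, ← Complex.exp_nat_mul, mul_div_cancel₀ _ hn', h.exp_eq u (hsub hub)]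
    have hev : ℓ =ᶠ[𝓝 u] fun u => Complex.exp (Λ u) / u ^ n := by
      filter_upwards [isOpen_ball.mem_nhds hub, isOpen_ne.mem_nhds hu0] with y hy hy0
      rw [hℓ y hy0, h.exp_eq y (hsub hy)]
    have hd : deriv ℓ u = (P u * deriv Λ u * u ^ n - P u * (n * u ^ (n - 1))) / (u ^ n) ^ 2 := by
      rw [hev.deriv_eq, ← h.exp_eq u (hsub hub)]
      exact ((h.differentiableAt (hsub hub)).hasDerivAt.cexp.fun_div (hasDerivAt_pow n u) (pow_ne_zero n hu0)).deriv
    have hden' : (n : ℂ) - u * deriv Λ u ≠ 0 := by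
      intro e
      apply hden u hub
      field_simp
      rw [mul_zero]
      exact e
    have hpow : u ^ n = u ^ (n - 1) * u := by rw [← pow_succ, Nat.sub_add_cancel hn]
    have hu1 : u ^ (n - 1) ≠ 0 := pow_ne_zero _ hu0
    have hd2 : deriv ℓ u = -(P u * (n - u * deriv Λ u)) / (u ^ n * u) := by
      rw [hd, hpow]
      field_simp
      ring
    have hW2 : W n u = -(P u / u ^ n) * (n - u * deriv Λ u) / (n * u) := by
      simp only [hW]
      rw [zpow_sub_one₀ (div_ne_zero hE hu0), zpow_natCast, (hasDerivAt_root h (hsub hub) n).deriv, div_pow, hQn]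
      simp only [hQdef]
      have := Complex.exp_ne_zero (Λ u / n)
      field_simp
      ring
    have hden2 : 1 - u * deriv Λ u / n = (n - u * deriv Λ u) / n := by field_simp
    rw [hd2, hW2]
    simp only [hαdef, hβdef, hden2]
    have hun : u ^ n ≠ 0 := pow_ne_zero n hu0
    field_simp
  have hαd : ∀ u : ℂ, ‖u‖ < r' → DifferentiableAt ℂ α u := fun u hur =>
    hα.differentiableAt (isOpen_ball.mem_nhds (by simpa using hur))
  have hβd : ∀ u : ℂ, ‖u‖ < r' → DifferentiableAt ℂ β u := fun u hur =>
    hβ.differentiableAt (isOpen_ball.mem_nhds (by simpa using hur))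
  have hSd : ∀ u : ℂ, ‖u‖ < r' → DifferentiableAt ℂ (fun u =>
      ∑ j ∈ Finset.range (n + 1), poleD P Λ n s B j * (u / Q u) ^ j) u := fun u hur => by
    have hu : u ∈ ball (0 : ℂ) r' := by simpa using hur
    exact DifferentiableAt.fun_sum fun m _ => ((differentiableAt_id.fun_div (hQ.differentiableAt hu)
      (hQ.ne_zero u hu)).fun_pow m).const_mul _
  set S : ℂ → ℂ := fun u => ∑ j ∈ Finset.range (n + 1), poleD P Λ n s B j * (u / Q u) ^ j with hS
  rw [resZero_congr hcongr, resZero_eq (r := r') (fun u hu0 hur =>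
    (((hαd u hur).fun_mul (hβd u hur)).fun_mul (hWd n u hu0 hur)).const_mul _) (half_pos hr') (half_lt_self hr')]
  change cInt (r' / 2) _ = _
  set s' := r' / 2 with hs'
  have hs'0 : 0 < s' := half_pos hr'
  have hs'r : s' < r' := half_lt_self hr'
  have hsph : ∀ u ∈ sphere (0 : ℂ) s', u ≠ 0 ∧ ‖u‖ < r' := fun u hu => by
    rw [mem_sphere_zero_iff_norm] at hu
    exact ⟨norm_pos_iff.1 (hu ▸ hs'0), hu ▸ hs'r⟩
  have hc : ∀ {f : ℂ → ℂ}, (∀ u : ℂ, u ≠ 0 → ‖u‖ < r' → DifferentiableAt ℂ f u) →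
      ContinuousOn f (sphere 0 s') := fun hf u hu =>
    (hf u (hsph u hu).1 (hsph u hu).2).continuousAt.continuousWithinAt
  have hWO : W n =O[𝓝[≠] 0] fun u => (u ^ (n + 1))⁻¹ := by
    have h0 : (0 : ℂ) ∈ ball (0 : ℂ) r' := mem_ball_self hr'
    have hB : ContinuousAt (fun u => Q u ^ ((n : ℤ) - 1) * (deriv Q u * u - Q u)) 0 := by
      have h1 := (hQ.differentiableAt h0).continuousAt
      exact (h1.zpow₀ _ (.inl (hQ.ne_zero 0 h0))).mul
        (((hQ.differentiableAt_deriv h0).continuousAt.mul continuousAt_id).sub h1)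
    have h2 := ((hB.tendsto.isBigO_one ℂ).mono (nhdsWithin_le_nhds (s := {0}ᶜ))).mul
      (isBigO_refl (fun u : ℂ => (u ^ (n + 1))⁻¹) (𝓝[≠] 0))
    refine (h2.congr' ?_ (.of_forall fun u => one_mul _))
    filter_upwards [self_mem_nhdsWithin] with u hu
    have hu0 : u ≠ 0 := hu
    simp only [hW]
    rw [div_zpow, zpow_sub_one₀ hu0, zpow_natCast]
    field_simp
    ring
  -- β - S is O(u^(n+1)) and χ^(n-1) dχ has a pole of order at most n + 1, so β may be truncated at
  -- order n. The term χ^(-j) of S then extracts the coefficient of index n - j of α.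
  have hzero : cInt s' (fun u => α u * (β u - S u) * W n u) = 0 := by
    rw [cInt, circleIntegral_eq_zero_of_bounded (r := r') (fun u h1 h2 =>
      ((hαd u h2).fun_mul ((hβd u h2).fun_sub (hSd u h2))).fun_mul (hWd n u h1 h2)) hs'0 hs'r, mul_zero]
    have h1 : α =O[𝓝[≠] 0] fun _ => (1 : ℂ) :=
      ((hαd 0 (by simpa using hr')).continuousAt.tendsto.isBigO_one ℂ).mono nhdsWithin_le_nhds
    refine ((h1.mul ((hβO n).mono nhdsWithin_le_nhds)).mul hWO).trans (IsBigO.of_bound 1 ?_)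
    filter_upwards [self_mem_nhdsWithin] with u hu
    have hu0 : u ≠ 0 := hu
    rw [one_mul, mul_inv_cancel₀ (pow_ne_zero _ hu0)]
    simp
  have hterm : ∀ j ∈ Finset.range (n + 1), cInt s' (fun u => poleD P Λ n s B j * (α u * W ((n : ℤ) - (j : ℤ)) u))
      = -(poleD P Λ n s A (n - j) * poleD P Λ n s B j) := by
    intro j hj
    have hj' : j ≤ n := Finset.mem_range_succ_iff.1 hj
    have e : ((n : ℤ) - j) = ((n - j : ℕ) : ℤ) := by omega
    rw [cInt_const_mul, e, hαk s' hs'0 hs'r]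
    ring
  have hsum : cInt s' (fun u => α u * S u * W n u)
      = ∑ j ∈ Finset.range (n + 1), cInt s' (fun u => poleD P Λ n s B j * (α u * W ((n : ℤ) - (j : ℤ)) u)) := by
    simp only [cInt]
    rw [← Finset.mul_sum, ← circleIntegral.integral_fun_sum
      (f := fun (j : ℕ) u => poleD P Λ n s B j * (α u * W ((n : ℤ) - (j : ℤ)) u))
      fun j _ => ContinuousOn.circleIntegrable hs'0.le
      (hc fun u h1 h2 => ((hαd u h2).fun_mul (hWd (n - j) u h1 h2)).const_mul _)]
    congr 1
    refine circleIntegral.integral_congr hs'0.le fun u hu => ?_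
    obtain ⟨hu0, hur⟩ := hsph u hu
    have hq := hQ.ne_zero u (by simpa using hur)
    have hne : Q u / u ≠ 0 := div_ne_zero hq hu0
    simp only [hS, Finset.mul_sum, Finset.sum_mul]
    refine Finset.sum_congr rfl fun j _ => ?_
    have : W (n - j) u = (u / Q u) ^ j * W n u := by
      simp only [hW]
      rw [← inv_div (Q u) u]
      generalize Q u / u = a at hne
      rw [show (n : ℤ) - j - 1 = n - 1 - j by ring, zpow_sub₀ hne _ (j : ℤ), zpow_natCast]
      ring
    rw [this]
    ring
  have hsplit : cInt s' (fun u => α u * β u * W n u)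
      = cInt s' (fun u => α u * (β u - S u) * W n u) + cInt s' (fun u => α u * S u * W n u) := by
    rw [← cInt_add hs'0.le (hc fun u h1 h2 => ((hαd u h2).fun_mul ((hβd u h2).fun_sub (hSd u h2))).fun_mul (hWd n u h1 h2))
      (hc fun u h1 h2 => ((hαd u h2).fun_mul (hSd u h2)).fun_mul (hWd n u h1 h2))]
    exact cInt_congr hs'0.le fun u _ => by ring
  rw [cInt_const_mul, hsplit, hzero, zero_add, hsum, Finset.sum_congr rfl hterm, Finset.sum_neg_distrib]
  ring

/-- The function A / (P (1 - u Λ'/n)) has no terms up to order K in powers of χ⁻¹; multiplication by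
the bounded denominator recovers A. -/
theorem IsLog.isBigO_of_poleD (h : IsLog P Λ r) (hn : 0 < n) (hs : 0 < s) (hsr : s < r)
    (hA : DifferentiableOn ℂ A (ball 0 r)) (h0 : ∀ k ≤ K, poleD P Λ n s A k = 0) :
    A =O[𝓝 0] fun u => u ^ (K + 1) := by
  obtain ⟨r', hr', hrr, hden, hexp⟩ := h.exists_poleD_expansion hn hs hsr
  obtain ⟨-, hO, -⟩ := hexp A hA
  have hsub : ball (0 : ℂ) r' ⊆ ball 0 r := ball_subset_ball hrr
  have hb0 : (0 : ℂ) ∈ ball (0 : ℂ) r := mem_ball_self h.pos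
  have hPd : DifferentiableOn ℂ P (ball 0 r) := h.diff.cexp.congr fun u hu => (h.exp_eq u hu).symm
  have hc : (fun u => P u * (1 - u * deriv Λ u / n)) =O[𝓝 0] fun _ => (1 : ℂ) := by
    refine Tendsto.isBigO_one ℂ (c := P 0 * (1 - 0 * deriv Λ 0 / n)) ?_
    have h1 := ((h.diff.deriv isOpen_ball).differentiableAt (isOpen_ball.mem_nhds hb0)).continuousAt
    exact (hPd.differentiableAt (isOpen_ball.mem_nhds hb0)).continuousAt.mul
      (continuousAt_const.sub ((continuousAt_id.mul h1).div_const _))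
  refine ((hO K).mul hc).congr' ?_ (.of_forall fun u => mul_one _)
  filter_upwards [ball_mem_nhds (0 : ℂ) hr'] with u hu
  have h1 := h.ne_zero (hsub hu)
  have h2 := hden u hu
  rw [Finset.sum_eq_zero fun m hm => by rw [h0 m (Finset.mem_range_succ_iff.1 hm), zero_mul], sub_zero,
    div_div, mul_comm (P u), div_mul_cancel₀]
  rw [mul_comm]
  exact mul_ne_zero h2 h1 |> fun h => by rwa [mul_comm]

/-- Division by u^(k+1) leaves a function bounded near 0, whose integral vanishes; that integral is
also 2πi times the coefficient. -/
theorem coeff_eq_zero_of_isBigO {D : ℕ} {b : ℕ → ℂ}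
    (h : (fun u : ℂ => ∑ m ∈ Finset.range D, b m * u ^ m) =O[𝓝[≠] 0] fun u => u ^ K) {k : ℕ} (hk : k < K)
    (hkD : k < D) : b k = 0 := by
  have h1 : (∮ u in C((0 : ℂ), 1), (∑ m ∈ Finset.range D, b m * u ^ m) * (u ^ (k + 1))⁻¹) = 0 := by
    refine circleIntegral_eq_zero_of_bounded (r := 2) (fun u hu _ => ?_) one_pos one_lt_two ?_
    · exact (DifferentiableAt.fun_sum fun m _ => (differentiableAt_pow m).const_mul _).fun_mul
        ((differentiableAt_pow _).inv (pow_ne_zero _ hu))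
    · refine (h.mul (isBigO_refl (fun u : ℂ => (u ^ (k + 1))⁻¹) _)).trans (IsBigO.of_bound 1 ?_)
      filter_upwards [self_mem_nhdsWithin, mem_nhdsWithin_of_mem_nhds (ball_mem_nhds (0 : ℂ) one_pos)]
        with u hu hu1
      have hu0 : u ≠ 0 := hu
      rw [mem_ball_zero_iff] at hu1
      obtain ⟨d, rfl⟩ := Nat.exists_eq_add_of_le hk
      have e : u ^ (k.succ + d) * (u ^ (k + 1))⁻¹ = u ^ d := by
        rw [Nat.succ_eq_add_one, pow_add]
        field_simp
      rw [e, norm_pow, norm_one, mul_one]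
      exact pow_le_one₀ (norm_nonneg _) hu1.le
  have h2 : (∮ u in C((0 : ℂ), 1), (∑ m ∈ Finset.range D, b m * u ^ m) * (u ^ (k + 1))⁻¹)
      = ∑ m ∈ Finset.range D, b m * (if m = k then 2 * π * Complex.I else 0) := by
    have hne : ∀ u ∈ sphere (0 : ℂ) 1, u ≠ 0 := fun u hu => by
      rintro rfl
      simp at hu
    have h3 : ∀ m, (∮ u in C((0 : ℂ), 1), b m * (u ^ m * (u ^ (k + 1))⁻¹))
        = b m * (if m = k then 2 * π * Complex.I else 0) := by
      intro m
      rw [circleIntegral.integral_const_mul]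
      congr 1
      have := circleIntegral_zpow one_pos ((m : ℤ) - (k + 1))
      rw [if_congr (show (m : ℤ) - (k + 1) = -1 ↔ m = k by omega) rfl rfl] at this
      rw [← this]
      refine circleIntegral.integral_congr zero_le_one fun u hu => ?_
      have hu0 := hne u hu
      rw [zpow_sub₀ hu0, zpow_natCast, div_eq_mul_inv]
      norm_cast
    rw [← Finset.sum_congr rfl fun m _ => h3 m, ← circleIntegral.integral_fun_sum
      (f := fun (m : ℕ) (u : ℂ) => b m * (u ^ m * (u ^ (k + 1))⁻¹)) fun m _ =>
      ContinuousOn.circleIntegrable zero_le_one (continuousOn_const.mul ((continuousOn_pow m).mul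
        ((continuousOn_pow _).inv₀ fun u hu => pow_ne_zero _ (hne u hu))))]
    refine circleIntegral.integral_congr zero_le_one fun u _ => ?_
    simp only [Finset.sum_mul, mul_assoc]
  rw [h1] at h2
  simp only [mul_ite, mul_zero] at h2
  rw [Finset.sum_ite_eq' _ k, if_pos (Finset.mem_range.2 hkD)] at h2
  exact (mul_eq_zero.1 h2.symm).resolve_right Complex.two_pi_I_ne_zero

end Pole


/-! ### Linearity of the derivatives of the pole coefficients -/

section Pole

variable {P Λ A B : ℂ → ℂ} {r s : ℝ} {n : ℕ}

theorem IsLog.continuousOn_poleD (h : IsLog P Λ r) (hs : 0 < s) (hsr : s < r) (hA : Differentiable ℂ A) (k : ℕ) :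
    ContinuousOn (fun u => (Complex.exp (Λ u / n) / u) ^ k / u * (A u / P u)) (sphere 0 s) := by
  have hsub : sphere (0 : ℂ) s ⊆ ball 0 r := sphere_subset_closedBall.trans (closedBall_subset_ball hsr)
  have h0 : ∀ u ∈ sphere (0 : ℂ) s, u ≠ 0 := fun u hu => norm_pos_iff.1 (by rw [mem_sphere_zero_iff_norm.1 hu]; exact hs)
  have hΛ := h.diff.continuousOn.mono hsub
  have hP : ContinuousOn P (sphere 0 s) := hΛ.cexp.congr fun u hu => (h.exp_eq u (hsub hu)).symm
  exact ((((hΛ.div_const _).cexp.div continuousOn_id h0).pow k).div continuousOn_id h0).mul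
    (hA.continuous.continuousOn.div hP fun u hu => h.ne_zero (hsub hu))

theorem IsLog.poleD_add (h : IsLog P Λ r) (hs : 0 < s) (hsr : s < r) (hA : Differentiable ℂ A)
    (hB : Differentiable ℂ B) (k : ℕ) :
    poleD P Λ n s (fun u => A u + B u) k = poleD P Λ n s A k + poleD P Λ n s B k := by
  rw [poleD, poleD, poleD, ← cInt_add hs.le (h.continuousOn_poleD hs hsr hA k) (h.continuousOn_poleD hs hsr hB k)]
  exact cInt_congr hs.le fun u _ => by ring

theorem poleD_const_mul (a : ℂ) (k : ℕ) : poleD P Λ n s (fun u => a * A u) k = a * poleD P Λ n s A k := by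
  rw [poleD, poleD, ← cInt_const_mul]
  congr 1
  ext u
  ring

theorem IsLog.poleD_eq_zero (h : IsLog P Λ r) (hs : 0 < s) (hsr : s < r) (hA : Differentiable ℂ A) (h0 : A 0 = 0) :
    poleD P Λ n s A 0 = 0 := by
  have hcb : closedBall (0 : ℂ) s ⊆ ball 0 r := closedBall_subset_ball hsr
  have hPd : DifferentiableOn ℂ P (ball 0 r) := h.diff.cexp.congr fun u hu => (h.exp_eq u hu).symm
  have h1 := cInt_div_eq hs (f := fun u => A u / P u)
    (hA.differentiableOn.div (hPd.mono hcb) fun u hu => h.ne_zero (hcb hu))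
  rw [h0, zero_div] at h1
  rw [poleD, ← h1]
  exact cInt_congr hs.le fun u _ => by simp only [pow_zero]; ring

end Pole

/-! ### The bilinear form in terms of the derivatives of the coordinates -/

section Point

variable {N M : ℕ} {p : Model N M} {ρ κ : ℝ}

namespace Chart

variable (c : Chart p) (X Y : Model N M)

/-- The pole expansion of a tangent vector at infinity. -/
noncomputable def dInfty (k : ℕ) : ℂ := poleD (inftyPoly p) c.ΛI N c.s (dInftyPoly X) k

/-- The pole expansion of a tangent vector at zero. -/
noncomputable def dZero (k : ℕ) : ℂ := poleD (zeroPoly p) c.ΛZ M c.s (dZeroPoly X) k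

theorem dCoord_hHat (k : Fin (M + 1)) : c.dCoord X (.hHat k) = c.dZero X k := rfl

theorem dInfty_zero : c.dInfty X 0 = 0 :=
  c.logI.poleD_eq_zero c.pos c.lt (differentiable_dInftyPoly X) (dInftyPoly_zero X)

theorem dInfty_add (k : ℕ) : c.dInfty (X + Y) k = c.dInfty X k + c.dInfty Y k := by
  rw [dInfty, dInfty, dInfty, ← c.logI.poleD_add c.pos c.lt (differentiable_dInftyPoly X) (differentiable_dInftyPoly Y)]
  congr 1
  ext u
  exact dInftyPoly_add X Y u

theorem dZero_add (k : ℕ) : c.dZero (X + Y) k = c.dZero X k + c.dZero Y k := by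
  rw [dZero, dZero, dZero, ← c.logZ.poleD_add c.pos c.lt (differentiable_dZeroPoly X) (differentiable_dZeroPoly Y)]
  congr 1
  ext u
  exact dZeroPoly_add X Y u

theorem dInfty_smul (a : ℂ) (k : ℕ) : c.dInfty (a • X) k = a * c.dInfty X k := by
  rw [dInfty, dInfty, ← poleD_const_mul]
  congr 1
  ext u
  exact dInftyPoly_smul a X u

theorem dZero_smul (a : ℂ) (k : ℕ) : c.dZero (a • X) k = a * c.dZero X k := by
  rw [dZero, dZero, ← poleD_const_mul]
  congr 1
  ext u
  exact dZeroPoly_smul a X u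

theorem sphere_ne_zero {z : ℂ} (hz : z ∈ sphere (0 : ℂ) 1) : z ≠ 0 :=
  ne_zero_of_mem_unit_sphere ⟨z, hz⟩

theorem continuousOn_dCoord_t (c : Chart p) (X : Model N M) (i : ℤ) :
    ContinuousOn (fun z => zeta p z ^ (-i - 1) * dZeta X z / z) (sphere 0 1) :=
  (((continuousOn_zeta p).zpow₀ _ fun z hz => .inl (c.zeta_ne_zero z hz)).mul (continuousOn_dZeta X)).div
    continuousOn_id fun _ hz => sphere_ne_zero hz

theorem dCoord_add (β : Label N M) : c.dCoord (X + Y) β = c.dCoord X β + c.dCoord Y β := by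
  rcases β with i | j | k
  · simp only [dCoord]
    rw [← neg_add, ← unitContour_add (c.continuousOn_dCoord_t X i) (c.continuousOn_dCoord_t Y i)]
    congr 1
    exact unitContour_congr fun z hz => by simp only [dZeta_add X Y hz]; ring
  · exact c.dInfty_add X Y j
  · exact c.dZero_add X Y k

theorem dCoord_smul (a : ℂ) (β : Label N M) : c.dCoord (a • X) β = a * c.dCoord X β := by
  rcases β with i | j | k
  · simp only [dCoord]
    rw [mul_neg, ← unitContour_const_mul]
    congr 1
    exact unitContour_congr fun z hz => by simp only [dZeta_smul a X hz]; ring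
  · exact c.dInfty_smul X a j
  · exact c.dZero_smul X a k

theorem dCoord_sub (β : Label N M) : c.dCoord (X - Y) β = c.dCoord X β - c.dCoord Y β := by
  have h := c.dCoord_add (X - Y) Y β
  rw [sub_add_cancel] at h
  rw [h, add_sub_cancel_right]

/-- Both residues are pole pairings, in the local coordinates u = z and u = 1/z. The indices 0 and N
at infinity belong to no coordinate, but the terms containing them vanish by `dInfty_zero`. -/
theorem metric_eq (hN : 0 < N) (hM : 0 < M) : metric p X Y
    = -unitContour (fun z => dZeta X z * dZeta Y z / (z ^ 2 * deriv (zeta p) z))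
      + 1 / (N : ℂ) * ∑ j ∈ Finset.range (N + 1), c.dInfty X (N - j) * c.dInfty Y j
      + 1 / (M : ℂ) * ∑ k ∈ Finset.range (M + 1), c.dZero X (M - k) * c.dZero Y k := by
  have h0 : resZero (fun z => dL X z * dL Y z / (z ^ 2 * deriv (lFun p) z))
      = -(1 / (M : ℂ)) * ∑ k ∈ Finset.range (M + 1), c.dZero X (M - k) * c.dZero Y k := by
    have := c.logZ.resZero_pairing hM c.pos c.lt (differentiable_dZeroPoly X).differentiableOn
      (differentiable_dZeroPoly Y).differentiableOn (ℓ := lFun p) fun u hu => lFun_eq_zeroPoly hN p hu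
    refine Eq.trans (resZero_congr ?_) this
    filter_upwards [self_mem_nhdsWithin] with u hu
    rw [dL_eq_zeroPoly hN X hu, dL_eq_zeroPoly hN Y hu]
  have h1 : resInfty (fun z => dL X z * dL Y z / (z ^ 2 * deriv (lFun p) z))
      = -(1 / (N : ℂ)) * ∑ j ∈ Finset.range (N + 1), c.dInfty X (N - j) * c.dInfty Y j := by
    -- The factor -1 comes from u² (d/du) l(u⁻¹) = -l'(u⁻¹).
    have := c.logI.resZero_pairing hN c.pos c.lt ((differentiable_dInftyPoly X).const_mul (-1)).differentiableOn
      (differentiable_dInftyPoly Y).differentiableOn (ℓ := fun u => lFun p u⁻¹) fun u hu => lFun_eq_inftyPoly hN p hu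
    simp only [poleD_const_mul] at this
    have key : (fun u : ℂ => dL X u⁻¹ * dL Y u⁻¹ / (u⁻¹ ^ 2 * deriv (lFun p) u⁻¹) / u ^ 2) =ᶠ[𝓝[≠] 0]
        fun u => (-1 * dInftyPoly X u) / u ^ N * (dInftyPoly Y u / u ^ N)
          / (u ^ 2 * deriv (fun u => lFun p u⁻¹) u) := by
      filter_upwards [self_mem_nhdsWithin] with u hu
      have hu : u ≠ 0 := hu
      have hd : deriv (fun u => lFun p u⁻¹) u = deriv (lFun p) u⁻¹ * -(u ^ 2)⁻¹ :=
        ((differentiableAt_lFun p (inv_ne_zero hu)).hasDerivAt.comp u (hasDerivAt_inv hu)).deriv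
      rw [hd, dL_eq_inftyPoly hN X hu, dL_eq_inftyPoly hN Y hu]
      by_cases hl : deriv (lFun p) u⁻¹ = 0
      · simp [hl]
      field_simp
    rw [resInfty_eq_resZero, resZero_congr key, this]
    simp only [dInfty, mul_assoc, ← Finset.mul_sum]
    ring
  rw [metric, h0, h1]
  ring

theorem symm_metric (p X Y : Model N M) : metric p X Y = metric p Y X := by
  simp only [metric, mul_comm (dZeta X _), mul_comm (dL X _)]

theorem deriv_zeta_ne_zero (c : Chart p) {z : ℂ} (hz : z ∈ sphere (0 : ℂ) 1) : deriv (zeta p) z ≠ 0 :=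
  c.loop.deriv_ne_zero (unit_sphere_subset_annulus c.loop.one_lt hz)

theorem continuousOn_deriv_zeta (c : Chart p) : ContinuousOn (deriv (zeta p)) (sphere 0 1) :=
  (differentiableOn_deriv_annulus c.loop.diff).continuousOn.mono (unit_sphere_subset_annulus c.loop.one_lt)

theorem continuousOn_metric_t (c : Chart p) (X Y : Model N M) :
    ContinuousOn (fun z => dZeta X z * dZeta Y z / (z ^ 2 * deriv (zeta p) z)) (sphere 0 1) :=
  ((continuousOn_dZeta X).mul (continuousOn_dZeta Y)).div ((continuousOn_pow 2).mul c.continuousOn_deriv_zeta)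
    fun _ hz => mul_ne_zero (pow_ne_zero 2 (sphere_ne_zero hz)) (c.deriv_zeta_ne_zero hz)

theorem metric_add (hN : 0 < N) (hM : 0 < M) (c : Chart p) (X X' Y : Model N M) :
    metric p (X + X') Y = metric p X Y + metric p X' Y := by
  have h : unitContour (fun z => dZeta (X + X') z * dZeta Y z / (z ^ 2 * deriv (zeta p) z))
      = unitContour (fun z => dZeta X z * dZeta Y z / (z ^ 2 * deriv (zeta p) z))
        + unitContour (fun z => dZeta X' z * dZeta Y z / (z ^ 2 * deriv (zeta p) z)) := by
    rw [← unitContour_add (c.continuousOn_metric_t X Y) (c.continuousOn_metric_t X' Y)]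
    exact unitContour_congr fun z hz => by simp only [dZeta_add X X' hz]; ring
  simp only [c.metric_eq _ _ hN hM, h, dInfty_add, dZero_add, add_mul, Finset.sum_add_distrib]
  ring

theorem metric_smul (hN : 0 < N) (hM : 0 < M) (c : Chart p) (a : ℂ) (X Y : Model N M) :
    metric p (a • X) Y = a * metric p X Y := by
  have h : unitContour (fun z => dZeta (a • X) z * dZeta Y z / (z ^ 2 * deriv (zeta p) z))
      = a * unitContour (fun z => dZeta X z * dZeta Y z / (z ^ 2 * deriv (zeta p) z)) := by
    rw [← unitContour_const_mul]
    exact unitContour_congr fun z hz => by simp only [dZeta_smul a X hz]; ring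
  simp only [c.metric_eq _ _ hN hM, h, dInfty_smul, dZero_smul, mul_assoc, ← Finset.mul_sum]
  ring

theorem zCoeff_eq_zero {X : Model N M} (hz : ∀ z ∈ sphere (0 : ℂ) 1, dZeta X z = 0) : zCoeff X = 0 := by
  obtain ⟨ρ, hρ, C, h1, h2⟩ := exists_decay_zCoeff X
  refine funext fun i => ?_
  rw [← h1.coeff_eq hρ i, unitContour_congr (g := fun z => 0 * 0) fun z hz' => by
    simp only [← h2 z (unit_sphere_subset_annulus hρ hz'), hz z hz', zero_mul], unitContour_const_mul, zero_mul]
  rfl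

/-- A tangent vector is determined by `∂ζ` and the pole expansions of `∂l`. -/
theorem eq_zero_of_dZeta_of_lCoeff {X : Model N M} (hz : ∀ z ∈ sphere (0 : ℂ) 1, dZeta X z = 0)
    (hl : ∀ i, lCoeff X i = 0) : X = 0 := by
  have hzc : ∀ i, zCoeff X i = 0 := congrFun (zCoeff_eq_zero hz)
  have h3 : ∀ i, coeff X i = 0 ∧ coeffHat X i = 0 := by
    intro i
    have h4 := hl i
    have h5 := hzc i
    rw [zCoeff, Pi.sub_apply, sub_eq_zero] at h5
    rw [lCoeff] at h4
    split_ifs at h4 with h6 h7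
    · exact ⟨h4, h5 ▸ h4⟩
    · exact ⟨h5.trans h4, h4⟩
    · have h8 := coeffHat_eq_zero X (not_le.1 h7)
      exact ⟨h5.trans h8, h8⟩
  exact Prod.ext (Subtype.ext (funext fun i => (h3 i).1)) (Subtype.ext (funext fun i => (h3 i).2))

/-- The function `∂ζ` is determined by its pairings with the powers of `ζ`. -/
theorem dZeta_eq_of_dCoord (c : Chart p) {X : Model N M} {φ : ℂ → ℂ} {σ : ℝ} (hσ : 1 < σ)
    (hφ : DifferentiableOn ℂ φ (annulus σ))
    (h : ∀ i, c.dCoord X (.t i) = -unitContour fun z => zeta p z ^ (-i - 1) * φ z / z) :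
    ∀ z ∈ sphere (0 : ℂ) 1, dZeta X z = φ z := by
  obtain ⟨ρ, hρ, C, h1, h2⟩ := exists_decay_zCoeff X
  obtain ⟨τ, hτ, hτ'⟩ := exists_between (lt_min (lt_min hρ hσ) c.loop.one_lt)
  simp only [lt_min_iff] at hτ'
  have hloop : Loop (zeta p) τ c.δ := ⟨c.loop.toUnivalent.mono hτ hτ'.2.le,
    fun z hz => c.loop.ne_zero z (annulus_mono (by linarith) hτ'.2.le hz), c.loop.wind⟩
  have hd : DifferentiableOn ℂ (fun z => (laurentSum (zCoeff X) z - φ z) / z) (annulus τ) :=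
    (((h1.differentiableOn hρ).mono (annulus_mono (by linarith) hτ'.1.1.le)).sub
      (hφ.mono (annulus_mono (by linarith) hτ'.1.2.le))).div
      differentiableOn_id fun z hz => ne_zero_of_mem_annulus hτ hz
  have hφc : ContinuousOn φ (sphere 0 1) := hφ.continuousOn.mono (unit_sphere_subset_annulus hσ)
  -- The pairing with ζⁱ dz/z is, up to sign, the derivative of the coordinate with label -i - 1.
  have h3 := hloop.eq_zero_of_orthogonal hd fun i => by
    have h4 := h (-i - 1)
    simp only [dCoord, neg_inj] at h4
    rw [← sub_eq_zero, ← unitContour_sub (c.continuousOn_dCoord_t X _)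
      (g := fun z => zeta p z ^ (-(-i - 1) - 1) * φ z / z) ((((continuousOn_zeta p).zpow₀ _ fun z hz => .inl (c.zeta_ne_zero z hz)).mul hφc).div
        continuousOn_id fun _ hz => sphere_ne_zero hz)] at h4
    rw [← h4]
    refine unitContour_congr fun z hz => ?_
    simp only [← h2 z (unit_sphere_subset_annulus hρ hz)]
    rw [show -(-i - 1) - 1 = i by ring]
    ring
  intro z hz
  have h4 := h3 z hz
  rw [← h2 z (unit_sphere_subset_annulus hρ hz), div_eq_zero_iff, sub_eq_zero] at h4
  exact h4.resolve_right (sphere_ne_zero hz)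

theorem dZeta_eq_zero_of_dCoord (c : Chart p) {X : Model N M} (h : ∀ i, c.dCoord X (.t i) = 0) :
    ∀ z ∈ sphere (0 : ℂ) 1, dZeta X z = 0 :=
  c.dZeta_eq_of_dCoord one_lt_two (differentiableOn_const 0) fun i => by
    rw [h i, unitContour_congr (g := fun z => 0 * 0) fun z _ => by simp, unitContour_const_mul]
    simp

/-- Vanishing of all derivatives of the tⁱ gives ∂ζ = 0, because the powers of ζ are total. At
infinity, vanishing up to order N - 1 makes u^N ∂l(1/u) = O(u^N), which kills the coefficients of z,
…, z^(N-1). At zero, u^M ∂l = O(u^(M+1)) kills those of z^(-M), …, 1. -/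
theorem eq_zero_of_dCoord (hN : 0 < N) (hM : 0 < M) (c : Chart p) {X : Model N M} (h : ∀ β, c.dCoord X β = 0) :
    X = 0 := by
  refine eq_zero_of_dZeta_of_lCoeff (c.dZeta_eq_zero_of_dCoord fun i => h (.t i)) ?_
  · have hI : ∀ k ≤ N - 1, c.dInfty X k = 0 := fun k hk => by
      rcases Nat.eq_zero_or_pos k with rfl | hk0
      · exact c.dInfty_zero X
      · exact h (.h ⟨k, Finset.mem_Icc.2 ⟨hk0, hk⟩⟩)
    have hZ : ∀ k ≤ M, c.dZero X k = 0 := fun k hk => h (.hHat ⟨k, Nat.lt_succ_of_le hk⟩)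
    have hbigI := c.logI.isBigO_of_poleD hN c.pos c.lt (differentiable_dInftyPoly X).differentiableOn hI
    have hbigZ := c.logZ.isBigO_of_poleD hM c.pos c.lt (differentiable_dZeroPoly X).differentiableOn hZ
    have hbigI' : (fun u : ℂ => ∑ m ∈ Finset.range (N + M), lCoeff X ((N : ℤ) - (m + 1)) * u ^ m)
        =O[𝓝[≠] 0] fun u => u ^ (N - 1) := by
      refine ((hbigI.mono nhdsWithin_le_nhds).mul (isBigO_refl (fun u : ℂ => u⁻¹) (𝓝[≠] 0))).congr' ?_ ?_ <;>
        filter_upwards [self_mem_nhdsWithin] with u hu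
      · have hu : u ≠ 0 := hu
        rw [dInftyPoly, Finset.sum_mul]
        refine Finset.sum_congr rfl fun m _ => ?_
        rw [pow_succ]
        field_simp
      · rw [pow_succ, mul_inv_cancel_right₀ hu]
    intro i
    rcases lt_or_ge i (-(M : ℤ)) with h1 | h1
    · rw [lCoeff, if_neg (by omega), if_neg (by omega)]
    rcases le_or_gt i 0 with h2 | h2
    · have := coeff_eq_zero_of_isBigO (hbigZ.mono nhdsWithin_le_nhds) (k := (i + M).toNat) (by omega) (by omega)
      rwa [show (((i + M).toNat : ℕ) : ℤ) - M = i by omega] at this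
    rcases lt_or_ge i N with h3 | h3
    · have := coeff_eq_zero_of_isBigO hbigI' (k := (N - 1 - i).toNat) (by omega) (by omega)
      rwa [show (N : ℤ) - ((((N - 1 - i).toNat : ℕ) : ℤ) + 1) = i by omega] at this
    · rw [lCoeff, if_pos (by omega), coeff_eq_zero X h3]

theorem exists_dCoord_bound (c : Chart p) (hρ : 1 < ρ) (β : Label N M) : ∃ K, 0 < K ∧ ∀ (q q' : Model N M) (κ : ℝ),
    Near ρ κ q q' → ‖c.dCoord (q - q') β‖ ≤ K * κ := by
  obtain ⟨K, hK, hKb⟩ := c.exists_ratio_bound hρ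
  have main : ∀ {s : ℝ} {ψ : ℂ → ℂ}, 0 < s → ContinuousOn ψ (sphere 0 s) → ∃ K', 0 < K' ∧
      ∀ (F : ℂ → ℂ) (κ : ℝ), (∀ z ∈ sphere (0 : ℂ) s, ‖F z‖ ≤ K * κ) → 0 ≤ κ →
        ‖cInt s (fun z => ψ z * F z)‖ ≤ K' * κ := by
    intro s ψ hs hψ
    obtain ⟨B, hB, hB'⟩ := exists_bound_sphere hψ
    refine ⟨s * ((B + 1) * K), by positivity, fun F κ hF hκ => ?_⟩
    rw [mul_assoc]
    refine norm_two_pi_I_inv_mul_le hs.le fun z hz => ?_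
    rw [norm_mul, mul_assoc]
    exact mul_le_mul ((hB' z hz).trans (by linarith)) (hF z hz) (norm_nonneg _) (by linarith)
  have hs : ∀ u ∈ sphere (0 : ℂ) c.s, u ∈ closedBall (0 : ℂ) ((c.s + c.r) / 2) := fun u hu =>
    c.closedBall_subset (sphere_subset_closedBall hu)
  rcases β with i | j | k
  · obtain ⟨K', hK', h⟩ := main one_pos (ψ := fun z => -(zeta p z ^ (-i - 1) * zeta p z / z))
      ((((continuousOn_zeta p).zpow₀ _ fun z hz => .inl (c.zeta_ne_zero z hz)).mul (continuousOn_zeta p)).div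
        continuousOn_id fun _ hz => sphere_ne_zero hz).neg
    refine ⟨K', hK', fun q q' κ hq => le_of_eq_of_le (congrArg norm ?_)
      (h (fun z => zeta q z / zeta p z - zeta q' z / zeta p z) κ (hKb q q' κ hq).1 hq.nonneg)⟩
    rw [dCoord, ← neg_one_mul, ← unitContour_const_mul]
    refine unitContour_congr fun z hz => ?_
    have := c.zeta_ne_zero z hz
    simp only [← zeta_sub q q' hz]
    field_simp
  · have h1 := c.logI.continuousOn_poleD (n := N) c.pos c.lt (differentiable_inftyPoly p) j
    obtain ⟨K', hK', h⟩ := main c.pos h1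
    refine ⟨K', hK', fun q q' κ hq => le_of_eq_of_le (congrArg norm ?_)
      (h (fun z => inftyPoly q z / inftyPoly p z - inftyPoly q' z / inftyPoly p z) κ
        (fun u hu => (hKb q q' κ hq).2.2 u (hs u hu)) hq.nonneg)⟩
    refine cInt_congr c.pos.le fun u hu => ?_
    rw [div_self (c.inftyPoly_ne_zero (closedBall_subset_ball c.lt (sphere_subset_closedBall hu))), mul_one,
      ← sub_div, inftyPoly_sub]
  · have h1 := c.logZ.continuousOn_poleD (n := M) c.pos c.lt (differentiable_zeroPoly p) k
    obtain ⟨K', hK', h⟩ := main c.pos h1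
    refine ⟨K', hK', fun q q' κ hq => le_of_eq_of_le (congrArg norm ?_)
      (h (fun z => zeroPoly q z / zeroPoly p z - zeroPoly q' z / zeroPoly p z) κ
        (fun u hu => (hKb q q' κ hq).2.1 u (hs u hu)) hq.nonneg)⟩
    refine cInt_congr c.pos.le fun u hu => ?_
    rw [div_self (c.zeroPoly_ne_zero (closedBall_subset_ball c.lt (sphere_subset_closedBall hu))), mul_one,
      ← sub_div, zeroPoly_sub]

end Chart

/-! ### Velocities of curves and derivatives along coordinate vectors -/

theorem Near.mono_radius {q q' : Model N M} {ρ' : ℝ} (h : Near ρ κ q q') (h0 : 0 < ρ') (hρ : ρ' ≤ ρ) :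
    Near ρ' κ q q' := fun i =>
  ⟨Decay.mono (X := fun i => coeff q i - coeff q' i) (fun i => (h i).1) h0 hρ i,
    Decay.mono (X := fun i => coeffHat q i - coeffHat q' i) (fun i => (h i).2) h0 hρ i⟩

theorem Near.trans {q q' q'' : Model N M} {κ' : ℝ} (h : Near ρ κ q q') (h' : Near ρ κ' q' q'') :
    Near ρ (κ + κ') q q'' := fun i => by
  rw [add_mul]
  exact ⟨(norm_sub_le_norm_sub_add_norm_sub _ (coeff q' i) _).trans (add_le_add (h i).1 (h' i).1),
    (norm_sub_le_norm_sub_add_norm_sub _ (coeffHat q' i) _).trans (add_le_add (h i).2 (h' i).2)⟩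

theorem near_add_smul {X : Model N M} {C : ℝ} (h1 : Decay ρ C (coeff X)) (h2 : Decay ρ C (coeffHat X)) (s : ℂ) :
    Near ρ (C * ‖s‖) (p + s • X) p := fun i => by
  rw [coeff_add, coeffHat_add, coeff_smul, coeffHat_smul, add_sub_cancel_left, add_sub_cancel_left, norm_mul,
    norm_mul, mul_comm C, mul_assoc]
  exact ⟨mul_le_mul_of_nonneg_left (h1 i) (norm_nonneg _), mul_le_mul_of_nonneg_left (h2 i) (norm_nonneg _)⟩

/-- The weights attached to the curve and to X may differ; for the smaller one both the first-order
estimate and a linear bound for γ s - γ 0 hold. -/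
theorem HasVelocity.exists_near {γ : ℂ → Model N M} {X : Model N M} (h : HasVelocity γ X) :
    ∃ ρ, 1 < ρ ∧ (∃ C, 0 ≤ C ∧ ∀ᶠ s in 𝓝 (0 : ℂ), Near ρ (C * ‖s‖) (γ s) (γ 0)) ∧
      ∀ ε, 0 < ε → ∀ᶠ s in 𝓝 (0 : ℂ), Near ρ (ε * ‖s‖) (γ s) (γ 0 + s • X) := by
  obtain ⟨ρ, hρ, h⟩ := h
  obtain ⟨ρ', hρ', C, h1, h2⟩ := exists_decay X
  have hm : 1 < min ρ ρ' := lt_min hρ hρ'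
  have hm0 : 0 < min ρ ρ' := one_pos.trans hm
  have h3 : ∀ ε, 0 < ε → ∀ᶠ s in 𝓝 (0 : ℂ), Near (min ρ ρ') (ε * ‖s‖) (γ s) (γ 0 + s • X) := fun ε hε =>
    (h ε hε).mono fun s hs => hs.mono_radius hm0 (min_le_left _ _)
  refine ⟨min ρ ρ', hm, ⟨1 + C, by linarith [h1.nonneg], ?_⟩, h3⟩
  filter_upwards [h3 1 one_pos] with s hs
  rw [add_mul]
  exact hs.trans (near_add_smul (h1.mono hm0 (min_le_right _ _)) (h2.mono hm0 (min_le_right _ _)) s)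

theorem eventually_mul_norm_lt (C : ℝ) {η : ℝ} (hη : 0 < η) : ∀ᶠ s in 𝓝 (0 : ℂ), C * ‖s‖ < η := by
  have : Tendsto (fun s : ℂ => C * ‖s‖) (𝓝 0) (𝓝 0) := by
    have h : Continuous fun s : ℂ => C * ‖s‖ := continuous_const.mul continuous_norm
    exact h.tendsto' 0 0 (by simp)
  exact this.eventually_lt_const hη

namespace Chart

/-- The error splits into the strict differentiability error for γ s - p and the value of the
bounded functional `dCoord` on the o(s) deviation from s • X. -/
theorem hasDerivAt_nearCoord (hN : 0 < N) (hM : 0 < M) (c : Chart p) {γ : ℂ → Model N M} {X : Model N M}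
    (h0 : γ 0 = p) (h : HasVelocity γ X) (β : Label N M) :
    HasDerivAt (fun s => c.nearCoord (γ s) β) (c.dCoord X β) 0 := by
  obtain ⟨ρ, hρ, ⟨C, hC, hnear⟩, hvel⟩ := h.exists_near
  rw [h0] at hnear hvel
  obtain ⟨K, hK, hKb⟩ := c.exists_dCoord_bound hρ β
  rw [hasDerivAt_iff_isLittleO, isLittleO_iff]
  intro ε hε
  obtain ⟨η, hη, hstrict⟩ := c.strict hN hM hρ β (ε := ε / (2 * (C + 1))) (by positivity)
  filter_upwards [hnear, hvel (ε / (2 * K)) (by positivity), eventually_mul_norm_lt C hη] with s h1 h2 h3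
  have hp0 : Near ρ η p p := fun i => by
    rw [sub_self, sub_self, norm_zero]
    have : 0 ≤ η * ρ ^ (-|i|) := by positivity
    exact ⟨this, this⟩
  have h4 := hstrict _ _ _ (h1.mono (by linarith) h3.le) hp0 h1
  have h5 := hKb _ _ _ h2
  have h6 : c.dCoord (γ s - p) β = c.dCoord (γ s - (p + s • X)) β + s * c.dCoord X β := by
    rw [← dCoord_smul, ← dCoord_add]
    congr 1
    abel
  rw [h6] at h4
  rw [h0, sub_zero, smul_eq_mul]
  have e : c.nearCoord (γ s) β - c.nearCoord p β - s * c.dCoord X β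
      = (c.nearCoord (γ s) β - c.nearCoord p β - (c.dCoord (γ s - (p + s • X)) β + s * c.dCoord X β))
        + c.dCoord (γ s - (p + s • X)) β := by ring
  rw [e]
  refine (norm_add_le _ _).trans ((add_le_add h4 h5).trans ?_)
  have e1 : K * (ε / (2 * K) * ‖s‖) = ε / 2 * ‖s‖ := by field_simp
  have e2 : ε / (2 * (C + 1)) * (C * ‖s‖) ≤ ε / 2 * ‖s‖ := by
    have : ε / (2 * (C + 1)) * (C * ‖s‖) = ε / 2 * ‖s‖ * (C / (C + 1)) := by field_simp
    rw [this]
    exact mul_le_of_le_one_right (by positivity) ((div_le_one (by positivity)).2 (by linarith))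
  rw [e1]
  linarith

/-- Along the curve both the prescribed values and the continued ones `nearCoord` are coordinates of
γ s, and by continuity their t⁰ and ĥ⁰ are closer than π. They therefore coincide for small s and
can be differentiated at s = 0. -/
theorem dCoord_of_isCoordVector (hN : 0 < N) (hM : 0 < M) (c : Chart p) {α : Label N M} {X : Model N M}
    (h : IsCoordVector p c.coord α X) (β : Label N M) : c.dCoord X β = if β = α then 1 else 0 := by
  obtain ⟨γ, h0, hγ, hX⟩ := h
  have hd := c.hasDerivAt_nearCoord hN hM h0 hX
  obtain ⟨ρ, hρ, ⟨C, hC, hnear⟩, -⟩ := hX.exists_near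
  rw [h0] at hnear
  obtain ⟨η, hη, hchart⟩ := c.exists_nearby hρ
  have hclose : ∀ β, ∀ᶠ s in 𝓝 (0 : ℂ), ‖Function.update c.coord α (c.coord α + s) β - c.nearCoord (γ s) β‖ < π := by
    intro β
    have h1 : Tendsto (fun s : ℂ => Function.update c.coord α (c.coord α + s) β - c.nearCoord (γ s) β) (𝓝 0)
        (𝓝 (Function.update c.coord α (c.coord α + 0) β - c.nearCoord (γ 0) β)) := by
      refine Tendsto.sub ?_ (hd β).continuousAt.tendsto
      by_cases hβ : β = α
      · subst hβ
        simp only [Function.update_self]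
        exact (continuous_const.add continuous_id).tendsto 0
      · simp only [Function.update_of_ne hβ]
        exact tendsto_const_nhds
    rw [h0, nearCoord_self, add_zero, Function.update_eq_self, sub_self] at h1
    have h2 := h1.norm
    rw [norm_zero] at h2
    exact h2.eventually_lt_const Real.pi_pos
  have key : ∀ᶠ s in 𝓝 (0 : ℂ), c.nearCoord (γ s) = Function.update c.coord α (c.coord α + s) := by
    filter_upwards [hnear, hγ, eventually_mul_norm_lt C hη, hclose (.t 0), hclose (.hHat 0)] with s h1 h2 h3 h4 h5
    obtain ⟨c', hc'⟩ := hchart (γ s) (h1.mono (by linarith) h3.le)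
    rw [← hc'] at h4 h5 ⊢
    exact (c'.coord_unique hN hM h2.2 h4 h5).symm
  refine (hd β).unique (HasDerivAt.congr_of_eventuallyEq ?_ (key.mono fun s hs => congrFun hs β))
  split_ifs with hβ
  · subst hβ
    simp only [Function.update_self]
    exact (hasDerivAt_id 0).const_add _
  · simp only [Function.update_of_ne hβ]
    exact hasDerivAt_const _ _

/-- The label of the coordinate paired with a given one. -/
def _root_.TodaFrobenius.Label.dual : Label N M → Label N M
  | .t i => .t (-i - 1)
  | .h j => .h ⟨N - j, Finset.mem_Icc.2 (by have := Finset.mem_Icc.1 j.2; omega)⟩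
  | .hHat k => .hHat k.rev

/-- The nonzero entries of the Gram matrix. -/
noncomputable def _root_.TodaFrobenius.Label.weight : Label N M → ℂ
  | .t _ => -1
  | .h _ => 1 / (N : ℂ)
  | .hHat _ => 1 / (M : ℂ)

theorem _root_.TodaFrobenius.Label.dual_dual (α : Label N M) : α.dual.dual = α := by
  rcases α with i | j | k
  · simp only [Label.dual]
    congr 1
    ring
  · simp only [Label.dual]
    congr 1
    refine Subtype.ext ?_
    have := Finset.mem_Icc.1 j.2
    simp only
    omega
  · simp [Label.dual]

theorem gram_eq (α β : Label N M) : gram α β = β.weight * if β.dual = α then 1 else 0 := by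
  rcases α with i | j | k <;> rcases β with i' | j' | k' <;>
    simp only [gram, Label.dual, Label.weight, reduceCtorEq, if_false, mul_zero, Label.t.injEq, Label.h.injEq,
      Label.hHat.injEq, mul_ite, mul_one]
  · exact if_congr (by omega) rfl rfl
  · refine if_congr ?_ rfl rfl
    have h1 := Finset.mem_Icc.1 j.2
    have h2 := Finset.mem_Icc.1 j'.2
    rw [Subtype.ext_iff]
    simp only
    omega
  · refine if_congr ?_ rfl rfl
    rw [Fin.ext_iff, Fin.val_rev]
    omega

/-- For m = i this is the winding number; otherwise the integrand is the derivative of f^(i-m) /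
(i-m). -/
theorem _root_.TodaFrobenius.Loop.contour_zpow {f : ℂ → ℂ} {σ δ : ℝ} (hf : Loop f σ δ) (i m : ℤ) :
    unitContour (fun z => deriv f z * f z ^ (i - m - 1)) = if m = i then 1 else 0 := by
  have hsub := unit_sphere_subset_annulus hf.one_lt
  have hfc : ContinuousOn f (sphere 0 1) := hf.diff.continuousOn.mono hsub
  split_ifs with hm
  · subst hm
    rw [sub_self, ← hf.wind, windNum, cauchyTr]
    refine unitContour_congr fun z hz => ?_
    simp only [sub_zero]
    rw [zero_sub, zpow_neg_one, div_eq_mul_inv]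
  · have hm' : ((i - m : ℤ) : ℂ) ≠ 0 := by exact_mod_cast sub_ne_zero.2 (Ne.symm hm)
    have h2 := unitContour_sub_eq_zero (g := fun z => deriv f z * f z ^ (i - m - 1)) (h := fun _ => 0)
      (P := fun z => f z ^ (i - m) / (i - m : ℤ))
      (((differentiableOn_deriv_annulus hf.diff).continuousOn.mono hsub).mul
        (hfc.zpow₀ _ fun z hz => .inl (hf.ne_zero z (hsub hz))))
      continuousOn_const fun z hz => by
        have h3 := (hf.differentiableAt (hsub hz)).hasDerivAt
        refine (((hasDerivAt_zpow (i - m) _ (.inl (hf.ne_zero z (hsub hz)))).comp z h3).div_const _).congr_deriv ?_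
        rw [sub_zero]
        field_simp
    rw [h2, unitContour_congr (g := fun z => 0 * 0) fun z _ => by simp, unitContour_const_mul, zero_mul]

/-- By `Loop.contour_zpow` the function -z ζ' ζⁱ has the prescribed pairings with the powers of ζ,
and these pairings determine ∂ζ. -/
theorem dZeta_of_dCoord_t (c : Chart p) {i : ℤ} {Y : Model N M}
    (hY : ∀ β, c.dCoord Y β = if β = .t i then 1 else 0) {z : ℂ} (hz : z ∈ sphere (0 : ℂ) 1) :
    dZeta Y z = -(z * deriv (zeta p) z * zeta p z ^ i) := by
  refine c.dZeta_eq_of_dCoord (φ := fun z => -(z * deriv (zeta p) z * zeta p z ^ i)) c.loop.one_lt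
    ((differentiableOn_id.mul (differentiableOn_deriv_annulus c.loop.diff)).mul (c.loop.differentiableOn_zpow i)).neg
    (fun m => ?_) z hz
  have h1 : unitContour (fun z => zeta p z ^ (-m - 1) * -(z * deriv (zeta p) z * zeta p z ^ i) / z)
      = -unitContour fun z => deriv (zeta p) z * zeta p z ^ (i - m - 1) := by
    rw [← neg_one_mul (unitContour _), ← unitContour_const_mul]
    refine unitContour_congr fun z hz => ?_
    have h1 := sphere_ne_zero hz
    rw [show i - m - 1 = (-m - 1) + i by ring, zpow_add₀ (c.zeta_ne_zero z hz)]
    field_simp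
  rw [hY, h1, neg_neg, c.loop.contour_zpow]
  simp only [Label.t.injEq]

/-- Pairing with a vector dual to one coordinate reads off the derivative of X in the dual
coordinate. For tⁱ this is the substitution ∂ζ = -z ζ' ζⁱ; at a pole one term of the convolution
survives. The Gram matrix and nondegeneracy both follow from this. -/
theorem metric_of_dCoord (hN : 0 < N) (hM : 0 < M) (c : Chart p) {α : Label N M} {Y : Model N M}
    (hY : ∀ β, c.dCoord Y β = if β = α then 1 else 0) (X : Model N M) :
    metric p X Y = α.weight * c.dCoord X α.dual := by
  rw [c.metric_eq X Y hN hM]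
  have hT : (∀ i, α ≠ .t i) → unitContour (fun z => dZeta X z * dZeta Y z / (z ^ 2 * deriv (zeta p) z)) = 0 := by
    intro h
    have h1 := c.dZeta_eq_zero_of_dCoord (X := Y) fun i => by rw [hY, if_neg (h i).symm]
    rw [unitContour_congr (g := fun z => 0 * 0) fun z hz => by simp [h1 z hz], unitContour_const_mul, zero_mul]
  have hI : ∀ j ∈ Finset.range (N + 1), c.dInfty X (N - j) * c.dInfty Y j
      = if ∃ h : j ∈ Finset.Icc 1 (N - 1), α = .h ⟨j, h⟩ then c.dInfty X (N - j) else 0 := by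
    intro j hj
    rw [Finset.mem_range] at hj
    by_cases h1 : j ∈ Finset.Icc 1 (N - 1)
    · have h2 : c.dInfty Y j = _ := hY (.h ⟨j, h1⟩)
      rw [h2]
      by_cases h3 : α = .h ⟨j, h1⟩
      · rw [if_pos h3.symm, if_pos ⟨h1, h3⟩, mul_one]
      · rw [if_neg (Ne.symm h3), if_neg (fun h => h3 h.2), mul_zero]
    · rw [if_neg (by rintro ⟨h, -⟩; exact h1 h)]
      rcases Nat.eq_zero_or_pos j with rfl | h2
      · rw [c.dInfty_zero Y, mul_zero]
      -- Only j = N is left. There `dInfty Y N` is not a coordinate derivative and may be nonzero,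
      -- but it is multiplied by `dInfty X 0`, which is 0.
      · have : N - j = 0 := by
          rw [Finset.mem_Icc] at h1
          omega
        rw [this, c.dInfty_zero X, zero_mul]
  have hZ : ∀ k ∈ Finset.range (M + 1), c.dZero X (M - k) * c.dZero Y k
      = if ∃ h : k < M + 1, α = .hHat ⟨k, h⟩ then c.dZero X (M - k) else 0 := by
    intro k hk
    rw [Finset.mem_range] at hk
    have h2 : c.dZero Y k = _ := hY (.hHat ⟨k, hk⟩)
    rw [h2]
    by_cases h3 : α = .hHat ⟨k, hk⟩
    · rw [if_pos h3.symm, if_pos ⟨hk, h3⟩, mul_one]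
    · rw [if_neg (Ne.symm h3), if_neg (fun h => h3 h.2), mul_zero]
  rw [Finset.sum_congr rfl hI, Finset.sum_congr rfl hZ]
  rcases α with i | j | k
  · simp only [reduceCtorEq, exists_false, if_false, Finset.sum_const_zero, mul_zero, add_zero, Label.weight, Label.dual]
    rw [neg_one_mul, dCoord, neg_neg, ← neg_one_mul, ← unitContour_const_mul]
    refine unitContour_congr fun z hz => ?_
    have h1 := sphere_ne_zero hz
    have h2 := c.deriv_zeta_ne_zero hz
    simp only [c.dZeta_of_dCoord_t hY hz]
    rw [show -(-i - 1) - 1 = i by ring]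
    field_simp
  · rw [hT (by simp)]
    simp only [reduceCtorEq, exists_false, if_false, Finset.sum_const_zero, mul_zero, add_zero, neg_zero, zero_add,
      Label.weight, Label.dual]
    congr 1
    have h1 := Finset.mem_Icc.1 j.2
    rw [Finset.sum_eq_single (j : ℕ), if_pos ⟨j.2, rfl⟩]
    · rfl
    · rintro b - hb
      rw [if_neg]
      rintro ⟨h, h2⟩
      simp only [Label.h.injEq, Subtype.ext_iff] at h2
      exact hb h2.symm
    · intro h
      exact absurd (Finset.mem_range.2 (by omega)) h
  · rw [hT (by simp)]
    simp only [reduceCtorEq, exists_false, if_false, Finset.sum_const_zero, mul_zero, add_zero, neg_zero, zero_add,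
      Label.weight, Label.dual]
    congr 1
    rw [Finset.sum_eq_single (k : ℕ), if_pos ⟨k.2, rfl⟩]
    · rw [dCoord_hHat, Fin.val_rev]
      congr 1
      omega
    · rintro b - hb
      rw [if_neg]
      rintro ⟨h, h2⟩
      simp only [Label.hHat.injEq, Fin.ext_iff] at h2
      exact hb h2.symm
    · intro h
      exact absurd (Finset.mem_range.2 k.2) h

end Chart
end Point

/-! ### Uniform estimates on annuli -/

section Estimates

variable {f g h : ℂ → ℂ} {σ τ δ : ℝ}

/-- A sup bound controls the Laurent coefficients, and these control the Lipschitz constant on a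
smaller annulus. This is a Cauchy estimate on a nonconvex domain, linear in C. -/
theorem norm_sub_le_of_bound {C : ℝ} {ρ : ℝ} (hτ : 1 < τ) (hτρ : τ < ρ) (hρσ : ρ < σ)
    (hf : DifferentiableOn ℂ f (annulus σ)) (hC : ∀ z ∈ annulus σ, ‖f z‖ ≤ C) {z y : ℂ} (hz : z ∈ annulus τ)
    (hy : y ∈ annulus τ) : ‖f z - f y‖ ≤ C * lipConst ρ τ * ‖z - y‖ := by
  have hρ : 1 < ρ := hτ.trans hτρ
  have hσ : 1 < σ := hρ.trans hρσ
  have hinv : σ⁻¹ < ρ⁻¹ := inv_strictAnti₀ (by linarith) hρσ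
  have hd := decay_laurentCoeff hρ hρσ hf
    (fun z hz => hC z (sphere_subset_annulus (hinv.trans ((inv_lt_one_of_one_lt₀ hρ).trans hρ)) hρσ hz))
    (fun z hz => hC z (sphere_subset_annulus hinv ((inv_lt_one_of_one_lt₀ hρ).trans hσ) hz))
  have hsub : annulus τ ⊆ annulus σ := annulus_mono (by linarith) (by linarith)
  rw [← laurentSum_laurentCoeff hσ hf (hsub hz), ← laurentSum_laurentCoeff hσ hf (hsub hy)]
  exact hd.norm_laurentSum_sub_le hτ.le hτρ hz.1.le hz.2.le hy.1.le hy.2.le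

theorem exists_bound_annulus (hτ : 1 < τ) (hτσ : τ < σ) (hf : DifferentiableOn ℂ f (annulus σ)) :
    ∃ K, 0 < K ∧ (∀ z ∈ annulus τ, ‖f z‖ ≤ K) ∧ ∀ z ∈ annulus τ, ∀ y ∈ annulus τ, ‖f z - f y‖ ≤ K * ‖z - y‖ := by
  obtain ⟨ρ, hτρ, hρσ⟩ := exists_between hτσ
  obtain ⟨C, hd⟩ := exists_decay_laurentCoeff (hτ.trans hτρ) hρσ hf
  have hsub : annulus τ ⊆ annulus σ := annulus_mono (by linarith) (by linarith)
  have hl := lipConst_pos (by linarith : 0 < τ) hτρ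
  have hC := hd.nonneg
  refine ⟨C * lipConst ρ τ + 1, by positivity, fun z hz => ?_, fun z hz y hy => ?_⟩
  · rw [← laurentSum_laurentCoeff (hτ.trans hτσ) hf (hsub hz)]
    exact (hd.norm_laurentSum_le hτ.le hτρ hz.1.le hz.2.le).trans (by linarith)
  · rw [← laurentSum_laurentCoeff (hτ.trans hτσ) hf (hsub hz), ← laurentSum_laurentCoeff (hτ.trans hτσ) hf (hsub hy)]
    refine (hd.norm_laurentSum_sub_le hτ.le hτρ hz.1.le hz.2.le hy.1.le hy.2.le).trans ?_
    exact mul_le_mul_of_nonneg_right (by linarith) (norm_nonneg _)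

theorem exists_closedBall_subset_annulus (hτ : 1 < τ) (hτσ : τ < σ) :
    ∃ r, 0 < r ∧ ∀ z ∈ annulus τ, closedBall z r ⊆ annulus σ := by
  have hinv : σ⁻¹ < τ⁻¹ := inv_strictAnti₀ (by linarith) hτσ
  refine ⟨min (σ - τ) (τ⁻¹ - σ⁻¹), lt_min (by linarith) (by linarith), fun z hz y hy => ?_⟩
  rw [mem_closedBall, dist_eq_norm, le_min_iff] at hy
  have h1 : ‖y‖ ≤ ‖y - z‖ + ‖z‖ := by simpa using norm_add_le (y - z) z
  have h2 : ‖z‖ ≤ ‖y - z‖ + ‖y‖ := by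
    rw [norm_sub_rev]
    simpa using norm_add_le (z - y) y
  exact ⟨by linarith [hz.1, hy.2], by linarith [hz.2, hy.1]⟩

theorem exists_taylor_annulus (hτ : 1 < τ) (hτσ : τ < σ) (hf : DifferentiableOn ℂ f (annulus σ)) :
    ∃ K r, 0 < K ∧ 0 < r ∧ ∀ z ∈ annulus τ, ∀ y, ‖y - z‖ ≤ r →
      ‖f y - f z - deriv f z * (y - z)‖ ≤ K * ‖y - z‖ ^ 2 := by
  obtain ⟨ρ, hτρ, hρσ⟩ := exists_between hτσ
  have hρ := hτ.trans hτρ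
  obtain ⟨K, hK, -, hlip⟩ := exists_bound_annulus hρ hρσ (differentiableOn_deriv_annulus hf)
  obtain ⟨r, hr, hball⟩ := exists_closedBall_subset_annulus hτ hτρ
  refine ⟨K, r, hK, hr, fun z hz y hy => ?_⟩
  have hs : closedBall z ‖y - z‖ ⊆ annulus ρ := (closedBall_subset_closedBall hy).trans (hball z hz)
  have hsub : annulus ρ ⊆ annulus σ := annulus_mono (by linarith) hρσ.le
  have hzm : z ∈ closedBall z ‖y - z‖ := mem_closedBall_self (norm_nonneg _)
  have key := (convex_closedBall z ‖y - z‖).norm_image_sub_le_of_norm_hasDerivWithin_le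
    (f := fun w => f w - deriv f z * w) (f' := fun w => deriv f w - deriv f z) (C := K * ‖y - z‖)
    (fun w hw => (((hf.differentiableAt (annulus_mem_nhds (hsub (hs hw)))).hasDerivAt.fun_sub
      ((hasDerivAt_id w).const_mul (deriv f z))).congr_deriv (by rw [mul_one])).hasDerivWithinAt)
    (fun w hw => (hlip w (hs hw) z (hs hzm)).trans
      (mul_le_mul_of_nonneg_left (by rwa [mem_closedBall, dist_eq_norm] at hw) hK.le))
    hzm (y := y) (by rw [mem_closedBall, dist_eq_norm])
  refine le_of_eq_of_le (congrArg norm ?_) (key.trans (le_of_eq ?_)) <;> ring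

/-- A univalent function takes near `h z` every value, with a uniform radius. -/
theorem Univalent.exists_eq_of_near (hh : Univalent h σ δ) {z w : ℂ} {r : ℝ} (hr : 0 < r)
    (hz : closedBall z r ⊆ annulus σ) (hw : ‖w - h z‖ < δ * r / 2) : ∃ y ∈ closedBall z r, h y = w := by
  have hzm : z ∈ annulus σ := hz (mem_closedBall_self hr.le)
  have hd : DifferentiableOn ℂ h (closure (ball z r)) := by
    rw [closure_ball z hr.ne']
    exact hh.diff.mono hz
  have h1 : ∃ᶠ y in 𝓝 z, h y ≠ h z := by
    have h2 : ∃ᶠ y in 𝓝[≠] z, y ∈ annulus σ := by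
      exact (eventually_nhdsWithin_of_eventually_nhds (annulus_mem_nhds hzm)).frequently
    refine (h2.and_eventually self_mem_nhdsWithin).filter_mono nhdsWithin_le_nhds |>.mono fun y hy e => ?_
    exact hy.2 (hh.injOn hy.1 hzm e)
  have := hd.diffContOnCl.ball_subset_image_closedBall hr (ε := δ * r) (fun y hy => by
    have := hh.bound y (hz (sphere_subset_closedBall hy)) z hzm
    rwa [← dist_eq_norm y z, mem_sphere.1 hy] at this) h1
  obtain ⟨y, hy, e⟩ := this (by rwa [mem_ball, dist_eq_norm])
  exact ⟨y, hy, e⟩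

/-- The inverse of `y ↦ y exp (s g(y))` for small `s`. -/
theorem exists_reparam (hτ : 1 < τ) (hτσ : τ < σ) (hg : DifferentiableOn ℂ g (annulus σ)) :
    ∃ C, 0 < C ∧ ∀ᶠ s in 𝓝 (0 : ℂ), ∃ Ψ : ℂ → ℂ, DifferentiableOn ℂ Ψ (annulus τ) ∧
      ∀ z ∈ annulus τ, Ψ z ∈ annulus σ ∧ Ψ z * Complex.exp (s * g (Ψ z)) = z ∧ ‖Ψ z - z‖ ≤ C * ‖s‖ := by
  obtain ⟨σ₃, hσ₃, hσ₃'⟩ := exists_between hτσ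
  obtain ⟨ρ, hρ, hρ'⟩ := exists_between hσ₃'
  obtain ⟨σ₂, hσ₂, hσ₂'⟩ := exists_between hρ'
  obtain ⟨K, hK, hgK, -⟩ := exists_bound_annulus (by linarith) hσ₂' hg
  obtain ⟨r, hr, hball⟩ := exists_closedBall_subset_annulus hτ hσ₃
  have hl := lipConst_pos (by linarith : 0 < σ₃) hρ
  have hs2 : annulus σ₂ ⊆ annulus σ := annulus_mono (by linarith) hσ₂'.le
  have hs3 : annulus σ₃ ⊆ annulus σ₂ := annulus_mono (by linarith) (by linarith)
  set C : ℝ := σ₂ * (2 * K) with hC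
  have hC0 : 0 < C := by
    have : 0 < σ₂ := by linarith
    positivity
  refine ⟨C, hC0, ?_⟩
  filter_upwards [eventually_mul_norm_lt K one_pos, eventually_mul_norm_lt (C * lipConst ρ σ₃) (half_pos one_pos),
    eventually_mul_norm_lt C (by positivity : 0 < 1 / 2 * r / 2)] with s h1 h2 h3
  set Θ : ℂ → ℂ := fun y => y * Complex.exp (s * g y) with hΘ
  have hΘd : DifferentiableOn ℂ Θ (annulus σ) := differentiableOn_id.mul ((hg.const_mul s).cexp)
  have hb : ∀ y ∈ annulus σ₂, ‖Θ y - y‖ ≤ C * ‖s‖ := by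
    intro y hy
    have h4 : ‖s * g y‖ ≤ K * ‖s‖ := by
      rw [norm_mul, mul_comm]
      exact mul_le_mul_of_nonneg_right (hgK y hy) (norm_nonneg _)
    have h5 := Complex.norm_exp_sub_one_le (h4.trans h1.le)
    have e : Θ y - y = y * (Complex.exp (s * g y) - 1) := by simp only [hΘ]; ring
    rw [e, norm_mul, hC, mul_assoc]
    exact mul_le_mul hy.2.le (h5.trans (by linarith)) (norm_nonneg _) (by linarith)
  -- Θ - id is O(s) on the larger annulus, so for small s its Lipschitz constant on the smaller one
  -- is at most 1/2 and Θ is univalent there. `Univalent.exists_eq_of_near` then inverts it over the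
  -- annulus of radius τ.
  have hu : Univalent Θ σ₃ (1 / 2) := by
    refine ⟨by linarith, by norm_num, hΘd.mono (hs3.trans hs2), fun z hz y hy => ?_⟩
    have h4 := norm_sub_le_of_bound (f := fun y => Θ y - y) (by linarith) hρ hσ₂
      ((hΘd.mono hs2).sub differentiableOn_id) hb hz hy
    have e : z - y = (Θ z - Θ y) - ((Θ z - z) - (Θ y - y)) := by ring
    have h5 : ‖z - y‖ ≤ ‖Θ z - Θ y‖ + ‖(Θ z - z) - (Θ y - y)‖ := by
      nth_rewrite 1 [e]
      exact norm_sub_le _ _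
    have h6 : C * ‖s‖ * lipConst ρ σ₃ * ‖z - y‖ ≤ 1 / 2 * ‖z - y‖ :=
      mul_le_mul_of_nonneg_right (by linarith [mul_right_comm C ‖s‖ (lipConst ρ σ₃)]) (norm_nonneg _)
    linarith
  have hex : ∀ z, ∃ y, z ∈ annulus τ → y ∈ annulus σ₃ ∧ Θ y = z := by
    intro z
    by_cases hz : z ∈ annulus τ
    · have h4 : ‖z - Θ z‖ < 1 / 2 * r / 2 := by
        rw [norm_sub_rev]
        exact (hb z (annulus_mono (by linarith) (by linarith) hz)).trans_lt h3
      obtain ⟨y, hy, e⟩ := hu.exists_eq_of_near hr (hball z hz) h4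
      exact ⟨y, fun _ => ⟨hball z hz hy, e⟩⟩
    · exact ⟨0, fun h => absurd h hz⟩
  choose Ψ hΨ using hex
  refine ⟨Ψ, fun z hz => ?_, fun z hz => ⟨hs2 (hs3 (hΨ z hz).1), (hΨ z hz).2, ?_⟩⟩
  · have hc : ContinuousAt Ψ z := by
      have h4 : ∀ᶠ y in 𝓝 z, ‖Ψ y - Ψ z‖ ≤ 2 * ‖y - z‖ := by
        filter_upwards [annulus_mem_nhds hz] with y hy
        have h5 := hu.bound _ (hΨ y hy).1 _ (hΨ z hz).1
        rw [(hΨ y hy).2, (hΨ z hz).2] at h5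
        linarith
      refine tendsto_iff_norm_sub_tendsto_zero.2 (squeeze_zero' (.of_forall fun _ => norm_nonneg _) h4 ?_)
      have h6 : Continuous fun y : ℂ => 2 * ‖y - z‖ := by fun_prop
      exact h6.tendsto' z 0 (by simp)
    exact (HasDerivAt.of_local_left_inverse hc (hu.differentiableAt (hΨ z hz).1).hasDerivAt
      (hu.deriv_ne_zero (hΨ z hz).1)
      (Filter.mem_of_superset (annulus_mem_nhds hz) fun y hy => (hΨ y hy).2)).differentiableAt.differentiableWithinAt
  · have := hb _ (hs3 (hΨ z hz).1)
    rwa [(hΨ z hz).2, norm_sub_rev] at this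

/-- The first variation of `f` under the reparametrization. -/
theorem exists_reparam_bound (hτ : 1 < τ) (hτσ : τ < σ) (hf : DifferentiableOn ℂ f (annulus σ))
    (hg : DifferentiableOn ℂ g (annulus σ)) (C : ℝ) : ∃ K, ∀ᶠ s in 𝓝 (0 : ℂ), ∀ z ∈ annulus τ, ∀ y ∈ annulus τ,
      y * Complex.exp (s * g y) = z → ‖y - z‖ ≤ C * ‖s‖ →
        ‖f y - f z - s * -(z * deriv f z * g z)‖ ≤ K * ‖s‖ ^ 2 := by
  obtain ⟨K₁, r, hK₁, hr, htay⟩ := exists_taylor_annulus hτ hτσ hf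
  obtain ⟨K₂, hK₂, hfb, -⟩ := exists_bound_annulus hτ hτσ (differentiableOn_deriv_annulus hf)
  obtain ⟨K₃, hK₃, hgb, hgl⟩ := exists_bound_annulus hτ hτσ hg
  refine ⟨K₁ * C ^ 2 + K₂ * (τ * K₃ ^ 2) + τ * K₂ * (K₃ * C), ?_⟩
  filter_upwards [eventually_mul_norm_lt C hr, eventually_mul_norm_lt K₃ one_pos] with s h1 h2 z hz y hy e hyz
  have hs0 := norm_nonneg s
  set a := s * g y with ha
  have hτ0 : 0 < τ := by linarith
  have ha1 : ‖a‖ ≤ K₃ * ‖s‖ := by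
    rw [ha, norm_mul, mul_comm]
    exact mul_le_mul_of_nonneg_right (hgb y hy) hs0
  have hy' : y = z * Complex.exp (-a) := by
    rw [← e, mul_assoc, ← Complex.exp_add, add_neg_cancel, Complex.exp_zero, mul_one]
  -- Three errors of order s² are estimated: the Taylor remainder of f, the quadratic part of exp(-s
  -- g(y)), and the replacement of g(y) by g(z).
  have t1 : ‖f y - f z - deriv f z * (y - z)‖ ≤ K₁ * C ^ 2 * ‖s‖ ^ 2 := by
    refine (htay z hz y (hyz.trans h1.le)).trans ?_
    rw [mul_assoc, ← mul_pow]
    exact mul_le_mul_of_nonneg_left (pow_le_pow_left₀ (norm_nonneg _) hyz 2) hK₁.le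
  have t2 : ‖deriv f z * (y - z + z * a)‖ ≤ K₂ * (τ * K₃ ^ 2) * ‖s‖ ^ 2 := by
    have e1 : y - z + z * a = z * (Complex.exp (-a) - 1 - -a) := by
      nth_rewrite 1 [hy']
      ring
    have e2 := Complex.norm_exp_sub_one_sub_id_le (x := -a) (by rw [norm_neg]; linarith)
    rw [norm_neg] at e2
    have e3 : ‖a‖ ^ 2 ≤ K₃ ^ 2 * ‖s‖ ^ 2 := by
      rw [← mul_pow]
      exact pow_le_pow_left₀ (norm_nonneg _) ha1 2
    rw [e1, norm_mul, norm_mul, mul_assoc, mul_assoc]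
    exact mul_le_mul (hfb z hz) (mul_le_mul hz.2.le (e2.trans e3) (norm_nonneg _) hτ0.le) (by positivity) hK₂.le
  have t3 : ‖z * deriv f z * (s * (g y - g z))‖ ≤ τ * K₂ * (K₃ * C) * ‖s‖ ^ 2 := by
    have e1 : ‖g y - g z‖ ≤ K₃ * (C * ‖s‖) := (hgl y hy z hz).trans (mul_le_mul_of_nonneg_left hyz hK₃.le)
    rw [norm_mul, norm_mul, norm_mul]
    have e2 : ‖s‖ * ‖g y - g z‖ ≤ K₃ * C * ‖s‖ ^ 2 := by
      calc ‖s‖ * ‖g y - g z‖ ≤ ‖s‖ * (K₃ * (C * ‖s‖)) := mul_le_mul_of_nonneg_left e1 hs0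
        _ = _ := by ring
    rw [mul_assoc (τ * K₂)]
    exact mul_le_mul (mul_le_mul hz.2.le (hfb z hz) (norm_nonneg _) hτ0.le) e2 (by positivity) (by positivity)
  have e4 : f y - f z - s * -(z * deriv f z * g z) = (f y - f z - deriv f z * (y - z))
      + deriv f z * (y - z + z * a) - z * deriv f z * (s * (g y - g z)) := by
    rw [ha]
    ring
  rw [e4]
  refine (norm_sub_le _ _).trans ((add_le_add ((norm_add_le _ _).trans (add_le_add t1 t2)) t3).trans (le_of_eq ?_))
  ring

end Estimates

/-! ### Change of variables in contour integrals -/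

section Reparam

variable {f g H Ψ : ℂ → ℂ} {σ τ δ : ℝ} {s : ℂ}

/-- The logarithmic derivative of the identity Ψ exp(s g ∘ Ψ) = z. -/
theorem reparam_deriv (hσ : 1 < σ) (hg : DifferentiableOn ℂ g (annulus σ))
    (hΨ : DifferentiableOn ℂ Ψ (annulus τ)) (h : ∀ z ∈ annulus τ, Ψ z ∈ annulus σ ∧ Ψ z * Complex.exp (s * g (Ψ z)) = z)
    {z : ℂ} (hz : z ∈ annulus τ) : z⁻¹ = deriv Ψ z / Ψ z + s * deriv g (Ψ z) * deriv Ψ z := by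
  have h1 := (hΨ.differentiableAt (annulus_mem_nhds hz)).hasDerivAt
  have h2 := (hg.differentiableAt (annulus_mem_nhds (h z hz).1)).hasDerivAt
  have h3 : HasDerivAt (fun y => Ψ y * Complex.exp (s * g (Ψ y))) _ z := h1.fun_mul (((h2.comp z h1).const_mul s).cexp)
  have h4 : HasDerivAt (fun y => Ψ y * Complex.exp (s * g (Ψ y))) 1 z :=
    (hasDerivAt_id z).congr_of_eventuallyEq (Filter.mem_of_superset (annulus_mem_nhds hz) fun y hy => (h y hy).2)
  have h5 := h3.unique h4
  have hΨ0 := ne_zero_of_mem_annulus hσ (h z hz).1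
  have hE := Complex.exp_ne_zero (s * g (Ψ z))
  have h6 : z⁻¹ = (Ψ z)⁻¹ * (Complex.exp (s * g (Ψ z)))⁻¹ := by rw [← mul_inv, (h z hz).2]
  simp only [Function.comp] at h5
  rw [h6, ← mul_one (_ * _), ← h5]
  field_simp

/-- Split off from H its residue term c/z; the rest has a primitive F. Since Ψ'/Ψ differs from 1/z
by the derivative of -s g ∘ Ψ, the forms H(Ψ) dΨ and c dz/z differ by an exact one. No homotopy of
contours is needed. -/
theorem contour_reparam (hτ : 1 < τ) (hσ : 1 < σ) (hg : DifferentiableOn ℂ g (annulus σ))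
    (hΨ : DifferentiableOn ℂ Ψ (annulus τ)) (h : ∀ z ∈ annulus τ, Ψ z ∈ annulus σ ∧ Ψ z * Complex.exp (s * g (Ψ z)) = z)
    (hH : DifferentiableOn ℂ H (annulus σ)) : unitContour (fun z => H (Ψ z) * deriv Ψ z) = unitContour H := by
  have hsub := unit_sphere_subset_annulus hσ
  have hsubτ := unit_sphere_subset_annulus hτ
  have hi : ContinuousOn (fun z : ℂ => unitContour H * z⁻¹) (sphere 0 1) :=
    continuousOn_const.mul (continuousOn_id.inv₀ fun z hz => ne_zero_of_mem_annulus hσ (hsub hz))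
  obtain ⟨F, hF⟩ := exists_primitive hσ (f := fun z => H z - unitContour H * z⁻¹)
    (hH.sub ((differentiableOn_id.inv fun z hz => ne_zero_of_mem_annulus hσ hz).const_mul _)) (by
      rw [unitContour_sub (hH.continuousOn.mono hsub) hi, unitContour_const_mul, unitContour_inv, mul_one, sub_self])
  have hmaps : Set.MapsTo Ψ (annulus τ) (annulus σ) := fun z hz => (h z hz).1
  have key := unitContour_sub_eq_zero (g := fun z => H (Ψ z) * deriv Ψ z) (h := fun z => unitContour H * z⁻¹)
    (P := fun z => F (Ψ z) - unitContour H * (s * g (Ψ z)))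
    (((hH.continuousOn.comp hΨ.continuousOn hmaps).mul (differentiableOn_deriv_annulus hΨ).continuousOn).mono hsubτ)
    hi fun z hz => by
      have h1 := (hΨ.differentiableAt (annulus_mem_nhds (hsubτ hz))).hasDerivAt
      have h2 := (hg.differentiableAt (annulus_mem_nhds (hmaps (hsubτ hz)))).hasDerivAt
      refine (((hF _ (hmaps (hsubτ hz))).comp z h1).sub (((h2.comp z h1).const_mul s).const_mul _)).congr_deriv ?_
      rw [reparam_deriv hσ hg hΨ h (hsubτ hz)]
      ring
  rw [key, unitContour_const_mul, unitContour_inv, mul_one]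

end Reparam

/-! ### Coordinate vectors of the tⁱ -/

section Point

variable {N M : ℕ} {p : Model N M} {ρ C D : ℝ}

/-- The coefficients of ζ and l can be prescribed independently: for i ≥ 1 the coefficient of a is
that of l and the one of â is l - ζ; for i ≤ 0 the coefficient of â is that of l and the one of a is
ζ + l. This produces tangent vectors with ∂l = 0 or with ∂ζ = 0. -/
theorem exists_model {E L : ℤ → ℂ} (hρ : 1 < ρ) (hE : Decay ρ C E) (hL : Decay ρ D L)
    (h0 : ∀ i, i < -(M : ℤ) ∨ (N : ℤ) ≤ i → L i = 0) (hN : 0 < N) : ∃ X : Model N M, zCoeff X = E ∧ lCoeff X = L := by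
  have hC := hE.nonneg
  have hD := hL.nonneg
  have h1 : Decay ρ (D + C) fun i => if 1 ≤ i then L i else E i + L i := fun i => by
    have hp : 0 ≤ ρ ^ (-|i|) := by positivity
    rw [add_mul]
    beta_reduce
    split_ifs
    · exact (hL i).trans (le_add_of_nonneg_right (by positivity))
    · exact (norm_add_le _ _).trans ((add_comm _ _).le.trans (add_le_add (hL i) (hE i)))
  have h2 : Decay ρ (D + C) fun i => if 1 ≤ i then L i - E i else L i := fun i => by
    have hp : 0 ≤ ρ ^ (-|i|) := by positivity
    rw [add_mul]
    beta_reduce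
    split_ifs
    · exact (norm_sub_le _ _).trans (add_le_add (hL i) (hE i))
    · exact (hL i).trans (le_add_of_nonneg_right (by positivity))
  refine ⟨(⟨_, h1.mem hρ, fun i hi => ?_⟩, ⟨_, h2.mem hρ, fun i hi => ?_⟩), ?_, ?_⟩
  · rw [if_pos (by omega), h0 i (by omega)]
  · rw [if_neg (by omega), h0 i (by omega)]
  · ext i
    simp only [zCoeff, Pi.sub_apply, coeff, coeffHat]
    split_ifs <;> ring
  · ext i
    simp only [lCoeff, coeff, coeffHat]
    split_ifs with h3 h4
    · rfl
    · rfl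
    · exact (h0 i (by omega)).symm

theorem decay_of_zCoeff_lCoeff {X : Model N M} (hE : Decay ρ C (zCoeff X)) (hL : Decay ρ D (lCoeff X)) :
    Decay ρ (D + C) (coeff X) ∧ Decay ρ (D + C) (coeffHat X) := by
  have hC := hE.nonneg
  have hD := hL.nonneg
  have key : ∀ i, ‖coeff X i‖ ≤ ‖lCoeff X i‖ + ‖zCoeff X i‖ ∧ ‖coeffHat X i‖ ≤ ‖lCoeff X i‖ + ‖zCoeff X i‖ := by
    intro i
    simp only [zCoeff, Pi.sub_apply, lCoeff]
    split_ifs with h1 h2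
    · refine ⟨le_add_of_nonneg_right (norm_nonneg _), ?_⟩
      simpa using norm_sub_le (coeff X i) (coeff X i - coeffHat X i)
    · refine ⟨?_, le_add_of_nonneg_right (norm_nonneg _)⟩
      simpa using norm_add_le (coeffHat X i) (coeff X i - coeffHat X i)
    · rw [coeffHat_eq_zero X (not_le.1 h2)]
      simp
  refine ⟨fun i => ?_, fun i => ?_⟩ <;> rw [add_mul]
  · exact (key i).1.trans (add_le_add (hL i) (hE i))
  · exact (key i).2.trans (add_le_add (hL i) (hE i))

theorem zeta_add {X : Model N M} {ρ' C' : ℝ} (hρ' : 1 < ρ') (h1 : Decay ρ C (coeff p)) (h2 : Decay ρ C (coeffHat p))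
    (h3 : Decay ρ' C' (coeff X)) (h4 : Decay ρ' C' (coeffHat X)) (h : ρ' ≤ ρ) {z : ℂ} (hz : z ∈ annulus ρ') :
    zeta (p + X) z = zeta p z + laurentSum (zCoeff X) z := by
  have h0 : 0 < ρ' := by linarith
  have h1' := h1.mono h0 h
  have h2' := h2.mono h0 h
  have h5 : laurentSum (zCoeff p + zCoeff X) z = laurentSum (zCoeff p) z + laurentSum (zCoeff X) z :=
    (h1'.sub h2').laurentSum_add hρ' (h3.sub h4) hz
  rw [zeta_eq, zeta_eq, dZeta_eq (X := p + X) hρ' (h1'.add h3) (h2'.add h4) hz, dZeta_eq hρ' h1' h2' hz, zCoeff_add,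
    h5, add_assoc]

theorem lFun_add_of_lCoeff {X : Model N M} (h : lCoeff X = 0) : lFun (p + X) = lFun p := by
  ext z
  have h1 : lCoeff (p + X) = lCoeff p := by
    ext i
    rw [lCoeff_add, h, Pi.zero_apply, add_zero]
  rw [lFun_eq, lFun_eq, dL_eq, dL_eq, h1]

theorem near_add {X Y : Model N M} (h1 : Decay ρ C (coeff (X - Y))) (h2 : Decay ρ C (coeffHat (X - Y))) :
    Near ρ C (p + X) (p + Y) := fun i => by
  rw [coeff_add, coeff_add, coeffHat_add, coeffHat_add, add_sub_add_left_eq_sub, add_sub_add_left_eq_sub]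
  exact ⟨h1 i, h2 i⟩

theorem isCoordVector_of_curve (hp : IsPoint p) {u : Label N M → ℂ} {α : Label N M} {X : Model N M} {γ : ℂ → Model N M}
    (h0 : γ 0 = p) (hγ : ∀ᶠ s in 𝓝 (0 : ℂ), IsCoord (γ s) (Function.update u α (u α + s))) (hX : HasVelocity γ X) :
    IsCoordVector p u α X := by
  obtain ⟨ρ, hρ, ⟨C, hC, hnear⟩, -⟩ := hX.exists_near
  obtain ⟨η, hη, hpt⟩ := isPoint_of_near hp hρ
  refine ⟨γ, h0, ?_, hX⟩
  rw [h0] at hnear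
  filter_upwards [hnear, hγ, eventually_mul_norm_lt C hη] with s h1 h2 h3
  exact ⟨hpt _ (h1.mono (by linarith) h3.le), h2⟩

theorem near_zero {q : Model N M} (h : Near ρ 0 q p) : q = p := by
  refine Prod.ext (Subtype.ext (funext fun i => ?_)) (Subtype.ext (funext fun i => ?_))
  · have := (h i).1
    rwa [zero_mul, norm_le_zero_iff, sub_eq_zero] at this
  · have := (h i).2
    rwa [zero_mul, norm_le_zero_iff, sub_eq_zero] at this

namespace Chart

/-- The coordinates of a point whose `ζ` is a reparametrization of `ζ` at `p`. -/
theorem isFactorizationT_reparam (c : Chart p) {q : Model N M} (c' : Chart q) {i : ℤ} {Ψ : ℂ → ℂ} {σ τ : ℝ} {s : ℂ}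
    (hτ : 1 < τ) (hσ : 1 < σ) (hσc : σ ≤ c.σ) (hΨ : DifferentiableOn ℂ Ψ (annulus τ))
    (h : ∀ z ∈ annulus τ, Ψ z ∈ annulus σ ∧ Ψ z * Complex.exp (s * zeta p (Ψ z) ^ i) = z)
    (hq : ∀ z ∈ annulus τ, zeta q z = zeta p (Ψ z)) :
    IsFactorizationT q fun k => Function.update c.coord (.t i) (c.coord (.t i) + s) (.t k) := by
  obtain ⟨τ', hτ', hτ''⟩ := exists_between (lt_min hτ c'.loop.one_lt)
  rw [lt_min_iff] at hτ''
  have hsub : annulus τ' ⊆ annulus τ := annulus_mono (by linarith) hτ''.1.le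
  have hsubσ : annulus σ ⊆ annulus c.σ := annulus_mono (by linarith) hσc
  have hloop : Loop (zeta q) τ' c'.δ := ⟨c'.loop.toUnivalent.mono hτ' hτ''.2.le,
    fun z hz => c'.loop.ne_zero z (annulus_mono (by linarith) hτ''.2.le hz), c'.loop.wind⟩
  have hg : DifferentiableOn ℂ (fun z => zeta p z ^ i) (annulus σ) := (c.loop.differentiableOn_zpow i).mono hsubσ
  -- From z = Ψ exp(s ζ(Ψ)ⁱ), where ζ is taken at p, the logarithm for q = ζ ∘ Ψ is log (Ψ / ζ(Ψ)) +
  -- s ζ(Ψ)ⁱ.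
  have hL : ∀ z ∈ annulus τ', HasDerivAt (fun z => c.L (Ψ z) + s * zeta p (Ψ z) ^ i)
      (z⁻¹ - deriv (zeta q) z / zeta q z) z ∧
      Complex.exp (c.L (Ψ z) + s * zeta p (Ψ z) ^ i) = z / zeta q z := by
    intro z hz
    have hm := hsubσ (h z (hsub hz)).1
    obtain ⟨h1, h2⟩ := c.hL (Ψ z) hm
    have h3 := (hΨ.differentiableAt (annulus_mem_nhds (hsub hz))).hasDerivAt
    have h4 := (hg.differentiableAt (annulus_mem_nhds (h z (hsub hz)).1)).hasDerivAt
    have h5 : deriv (zeta q) z = deriv (zeta p) (Ψ z) * deriv Ψ z := by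
      have : zeta q =ᶠ[𝓝 z] zeta p ∘ Ψ := Filter.mem_of_superset (annulus_mem_nhds (hsub hz)) fun y hy => hq y hy
      rw [this.deriv_eq]
      exact ((c.loop.differentiableAt hm).hasDerivAt.comp z h3).deriv
    refine ⟨((h1.comp z h3).add ((h4.comp z h3).const_mul s)).congr_deriv ?_, ?_⟩
    · rw [reparam_deriv hσ hg hΨ h (hsub hz), h5, hq z (hsub hz)]
      ring
    · rw [Complex.exp_add, h2, hq z (hsub hz), div_mul_eq_mul_div, (h z (hsub hz)).2]
  have ht : ∀ k, Function.update c.coord (.t i) (c.coord (.t i) + s) (.t k)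
      = tFun (zeta q) (fun z => c.L (Ψ z) + s * zeta p (Ψ z) ^ i) k := by
    intro k
    have hm : ∀ z ∈ sphere (0 : ℂ) 1, z ∈ annulus τ := fun z hz => unit_sphere_subset_annulus hτ hz
    have hz0 := fun z hz => c.loop.ne_zero z (hsubσ hz)
    rw [← hloop.contour_log fun z hz => (hL z hz).1]
    -- After the change of variables y = Ψ(z), t^k at q is t^k at p plus s times the integral of
    -- ζ^(i-k-1) dζ, which is 1 for k = i and 0 otherwise.
    have e1 := contour_reparam (H := fun z => c.L z * deriv (zeta p) z * zeta p z ^ (-k - 1)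
        + s * (deriv (zeta p) z * zeta p z ^ (i - k - 1))) hτ hσ hg hΨ h (by
      have hLd : DifferentiableOn ℂ c.L (annulus σ) := fun z hz =>
        (c.hL z (hsubσ hz)).1.differentiableAt.differentiableWithinAt
      have hd := (differentiableOn_deriv_annulus c.loop.diff).mono hsubσ
      exact ((hLd.mul hd).mul ((c.loop.differentiableOn_zpow _).mono hsubσ)).add
        ((hd.mul ((c.loop.differentiableOn_zpow _).mono hsubσ)).const_mul s))
    have e2 : unitContour (fun z => (c.L (Ψ z) + s * zeta p (Ψ z) ^ i) * deriv (zeta q) z * zeta q z ^ (-k - 1))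
        = unitContour fun z => (fun z => c.L z * deriv (zeta p) z * zeta p z ^ (-k - 1)
        + s * (deriv (zeta p) z * zeta p z ^ (i - k - 1))) (Ψ z) * deriv Ψ z := by
      refine unitContour_congr fun z hz => ?_
      have hz' := hm z hz
      have h3 := (hΨ.differentiableAt (annulus_mem_nhds hz')).hasDerivAt
      have h5 : deriv (zeta q) z = deriv (zeta p) (Ψ z) * deriv Ψ z := by
        have : zeta q =ᶠ[𝓝 z] zeta p ∘ Ψ := Filter.mem_of_superset (annulus_mem_nhds hz') fun y hy => hq y hy
        rw [this.deriv_eq]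
        exact ((c.loop.differentiableAt (hsubσ (h z hz').1)).hasDerivAt.comp z h3).deriv
      simp only
      rw [h5, hq z hz', show i - k - 1 = i + (-k - 1) by ring, zpow_add₀ (hz0 _ (h z hz').1)]
      ring
    have hpc : ∀ m : ℤ, ContinuousOn (fun z => zeta p z ^ m) (sphere 0 1) := fun m =>
      (continuousOn_zeta p).zpow₀ _ fun z hz => .inl (c.zeta_ne_zero z hz)
    rw [e2, e1, unitContour_add (f := fun z => c.L z * deriv (zeta p) z * zeta p z ^ (-k - 1))
      (g := fun z => s * (deriv (zeta p) z * zeta p z ^ (i - k - 1))) ((c.continuousOn_L.mul c.continuousOn_deriv_zeta).mul (hpc _))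
      (continuousOn_const.mul (c.continuousOn_deriv_zeta.mul (hpc _))), unitContour_const_mul, c.loop.contour_zpow,
      c.loop.contour_log fun z hz => (c.hL z hz).1]
    by_cases hk : k = i
    · subst hk
      rw [Function.update_self, if_pos rfl, mul_one]
      rfl
    · rw [Function.update_of_ne (by simpa using hk), if_neg hk, mul_zero, add_zero]
      rfl
  rw [isFactorizationT_iff hloop hL]
  exact ⟨congrArg _ (ht 0), fun k _ => ht k⟩

theorem laurentCoeff_sub_const_mul {f g : ℂ → ℂ} (hf : ContinuousOn f (sphere 0 1)) (hg : ContinuousOn g (sphere 0 1))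
    (s : ℂ) : laurentCoeff (fun z => f z - s * g z) = laurentCoeff f - s • laurentCoeff g := by
  ext i
  have hz : ContinuousOn (fun z : ℂ => z ^ (-i - 1)) (sphere 0 1) :=
    continuousOn_id.zpow₀ _ fun z hz => .inl (sphere_ne_zero hz)
  simp only [laurentCoeff, Pi.sub_apply, Pi.smul_apply, smul_eq_mul]
  rw [← unitContour_const_mul, ← unitContour_sub (f := fun z => f z * z ^ (-i - 1))
    (g := fun z => s * (g z * z ^ (-i - 1))) (hf.mul hz) (continuousOn_const.mul (hg.mul hz))]
  exact unitContour_congr fun z _ => by ring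

/-- Let Ψ be inverse to y ↦ y exp(s ζ(y)ⁱ), replace ζ by ζ ∘ Ψ and keep l. The pole coordinates are
unchanged, `isFactorizationT_reparam` shows that tⁱ grows by exactly s, and `exists_reparam_bound`
gives the velocity ∂ζ = -z ζ' ζⁱ with an error O(s²). -/
theorem exists_isCoordVector_t (hN : 0 < N) (hM : 0 < M) (hp : IsPoint p) (c : Chart p) (i : ℤ) :
    ∃ X, IsCoordVector p c.coord (.t i) X := by
  obtain ⟨ρ₀, hρ₀, C₀, hp1, hp2⟩ := exists_decay p
  obtain ⟨σ, hσ, hσc⟩ := exists_between c.loop.one_lt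
  obtain ⟨τ₁, hτ₁, hτσ⟩ := exists_between hσ
  obtain ⟨τ, hτ, hττ⟩ := exists_between (lt_min hτ₁ hρ₀)
  rw [lt_min_iff] at hττ
  have hsubσ : annulus σ ⊆ annulus c.σ := annulus_mono (by linarith) hσc.le
  have hg := c.loop.differentiableOn_zpow i
  have hφd : DifferentiableOn ℂ (fun z => -(z * deriv (zeta p) z * zeta p z ^ i)) (annulus c.σ) :=
    ((differentiableOn_id.mul (differentiableOn_deriv_annulus c.loop.diff)).mul hg).neg
  set φ : ℂ → ℂ := fun z => -(z * deriv (zeta p) z * zeta p z ^ i) with hφ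
  obtain ⟨C, hC, hrep⟩ := exists_reparam hτ₁ hτσ (hg.mono hsubσ)
  obtain ⟨K, hK⟩ := exists_reparam_bound hσ hσc c.loop.diff hg C
  obtain ⟨B, hB⟩ := exists_decay_laurentCoeff hτ (hττ.1.trans (hτσ.trans hσc)) hφd
  have hzd : ∀ Z : ℤ → ℂ, Decay τ 0 (0 : ℤ → ℂ) := fun _ i => by simp
  obtain ⟨X, hX1, hX2⟩ := exists_model (M := M) hτ hB (hzd 0) (fun _ _ => rfl) hN
  obtain ⟨η, hη, hchart⟩ := c.exists_nearby hτ
  have hXd := decay_of_zCoeff_lCoeff (C := B) (D := 0) (by rw [hX1]; exact hB) (by rw [hX2]; exact hzd 0)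
  have hsubτ₁ : annulus τ₁ ⊆ annulus σ := annulus_mono (by linarith) hτσ.le
  have hττ₁ : annulus τ ⊆ annulus τ₁ := annulus_mono (by linarith) hττ.1.le
  have hK0 : 0 ≤ |K| := abs_nonneg K
  have main : ∀ᶠ s in 𝓝 (0 : ℂ), ∃ q : Model N M, Near τ (|K| * ‖s‖ ^ 2) q (p + s • X) ∧
      IsCoord q (Function.update c.coord (.t i) (c.coord (.t i) + s)) := by
    filter_upwards [hrep, hK, eventually_mul_norm_lt (|K| + (0 + B)) hη, eventually_mul_norm_lt 1 one_pos]
      with s ⟨Ψ, hΨd, hΨ⟩ h2 h3 h4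
    have hmaps : Set.MapsTo Ψ (annulus τ₁) (annulus σ) := fun z hz => (hΨ z hz).1
    have hFd : DifferentiableOn ℂ (fun z => zeta p (Ψ z) - zeta p z) (annulus τ₁) :=
      ((c.loop.diff.mono hsubσ).comp hΨd hmaps).sub (c.loop.diff.mono (hsubτ₁.trans hsubσ))
    set F : ℂ → ℂ := fun z => zeta p (Ψ z) - zeta p z with hF
    obtain ⟨B', hB'⟩ := exists_decay_laurentCoeff hτ hττ.1 hFd
    obtain ⟨Y, hY1, hY2⟩ := exists_model (M := M) hτ hB' (hzd 0) (fun _ _ => rfl) hN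
    have hYd := decay_of_zCoeff_lCoeff (C := B') (D := 0) (by rw [hY1]; exact hB') (by rw [hY2]; exact hzd 0)
    have hbd : ∀ z ∈ annulus τ₁, ‖F z - s * φ z‖ ≤ |K| * ‖s‖ ^ 2 := fun z hz =>
      (h2 z (hsubτ₁ hz) (Ψ z) (hmaps hz) (hΨ z hz).2.1 (hΨ z hz).2.2).trans
        (mul_le_mul_of_nonneg_right (le_abs_self K) (by positivity))
    have hinv : τ₁⁻¹ < τ⁻¹ := inv_strictAnti₀ (by linarith) hττ.1
    have hτi := inv_lt_one_of_one_lt₀ hτ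
    have hsph := unit_sphere_subset_annulus hτ₁
    have hdec : Decay τ (|K| * ‖s‖ ^ 2) (zCoeff (Y - s • X)) := by
      rw [zCoeff_sub, zCoeff_smul, hX1, hY1, ← laurentCoeff_sub_const_mul (hFd.continuousOn.mono hsph)
        (hφd.continuousOn.mono (hsph.trans (hsubτ₁.trans hsubσ)))]
      exact decay_laurentCoeff hτ hττ.1 (hFd.sub ((hφd.mono (hsubτ₁.trans hsubσ)).const_mul s))
        (fun z hz => hbd z (sphere_subset_annulus (by linarith) hττ.1 hz))
        (fun z hz => hbd z (sphere_subset_annulus hinv (by linarith) hz))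
    have hdl : Decay τ 0 (lCoeff (Y - s • X)) := by
      have : lCoeff (Y - s • X) = 0 := by
        ext m
        rw [lCoeff_sub, lCoeff_smul, hX2, hY2]
        simp
      rw [this]
      exact hzd 0
    have hYX := decay_of_zCoeff_lCoeff hdec hdl
    rw [zero_add] at hYX
    have hnear := near_add (p := p) hYX.1 hYX.2
    refine ⟨p + Y, hnear, ?_⟩
    have hnear' : Near τ η (p + Y) p := by
      refine (hnear.trans (near_add_smul hXd.1 hXd.2 s)).mono (by linarith) (le_trans ?_ h3.le)
      rw [add_mul |K|]
      refine add_le_add (mul_le_mul_of_nonneg_left ?_ hK0) le_rfl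
      rw [one_mul] at h4
      rw [pow_two]
      exact mul_le_of_le_one_left (norm_nonneg _) h4.le
    obtain ⟨c', hc'⟩ := hchart _ hnear'
    have hq : ∀ z ∈ annulus τ, zeta (p + Y) z = zeta p (Ψ z) := fun z hz => by
      rw [zeta_add hτ hp1 hp2 hYd.1 hYd.2 hττ.2.le hz, hY1, laurentSum_laurentCoeff hτ₁ hFd (hττ₁ hz)]
      simp only [hF]
      ring
    have hl : lFun (p + Y) = lFun p := lFun_add_of_lCoeff hY2
    have hco := c.isCoord hN hM
    refine ⟨c.isFactorizationT_reparam c' hτ hσ hσc.le (hΨd.mono hττ₁)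
      (fun z hz => ⟨(hΨ z (hττ₁ hz)).1, (hΨ z (hττ₁ hz)).2.1⟩) hq, ?_, ?_⟩
    · have := hco.2.1
      simp only [IsInverseH, IsRootAtInfty] at this ⊢
      rw [hl]
      simpa using this
    · have := hco.2.2
      simp only [IsInverseHHat, IsRootAtZero] at this ⊢
      rw [hl]
      simpa using this
  -- The curve has to be defined for all s, but the construction works only for small s; elsewhere
  -- the value p is used.
  have hex : ∀ s : ℂ, ∃ q : Model N M, (∃ q : Model N M, Near τ (|K| * ‖s‖ ^ 2) q (p + s • X) ∧
      IsCoord q (Function.update c.coord (.t i) (c.coord (.t i) + s))) → Near τ (|K| * ‖s‖ ^ 2) q (p + s • X) ∧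
      IsCoord q (Function.update c.coord (.t i) (c.coord (.t i) + s)) := fun s => by
    by_cases h : ∃ q : Model N M, Near τ (|K| * ‖s‖ ^ 2) q (p + s • X) ∧
      IsCoord q (Function.update c.coord (.t i) (c.coord (.t i) + s))
    · obtain ⟨q, hq⟩ := h
      exact ⟨q, fun _ => hq⟩
    · exact ⟨p, fun h' => absurd h' h⟩
  choose γ hγ using hex
  -- At s = 0 the error bound is 0, so the chosen point is p itself.
  have h0 : γ 0 = p := by
    have h1 := (hγ 0 main.self_of_nhds).1
    rw [norm_zero, zero_pow two_ne_zero, mul_zero, zero_smul, add_zero] at h1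
    exact near_zero h1
  refine ⟨X, isCoordVector_of_curve hp h0 (main.mono fun s hs => (hγ s hs).2) ⟨τ, hτ, fun ε hε => ?_⟩⟩
  filter_upwards [main, eventually_mul_norm_lt |K| hε] with s h1 h2
  rw [h0]
  refine (hγ s h1).1.mono (by linarith) ?_
  rw [pow_two, ← mul_assoc]
  exact mul_le_mul_of_nonneg_right h2.le (norm_nonneg _)

end Chart
end Point

/-! ### Coordinate vectors of the hʲ and ĥᵏ -/

section Point

variable {N M : ℕ} {p : Model N M}

theorem model_ext {X Y : Model N M} (h1 : zCoeff X = zCoeff Y) (h2 : lCoeff X = lCoeff Y) : X = Y := by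
  have h3 : Decay 1 0 (zCoeff (X - Y)) := fun i => by rw [zCoeff_sub, h1, sub_self]; simp
  have h4 : Decay 1 0 (lCoeff (X - Y)) := fun i => by rw [lCoeff_sub, h2, sub_self]; simp
  obtain ⟨h5, h6⟩ := decay_of_zCoeff_lCoeff h3 h4
  rw [add_zero] at h5 h6
  exact near_zero (ρ := 1) fun i => ⟨h5 i, h6 i⟩

/-- The tangent vectors with `∂ζ = 0`, as a function of the coefficients of `∂l`. -/
theorem exists_poleModel (hN : 0 < N) : ∃ m : (Fin (N + M) → ℂ) →ₗ[ℂ] Model N M, Function.Injective m ∧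
    (∀ v, zCoeff (m v) = 0) ∧ (∀ X, zCoeff X = 0 → ∃ v, m v = X) ∧ ∀ v, Decay 2 (2 ^ (N + M) * ‖v‖) (coeff (m v)) ∧
      Decay 2 (2 ^ (N + M) * ‖v‖) (coeffHat (m v)) := by
  set D : (Fin (N + M) → ℂ) → ℤ → ℂ := fun v i => if h : 0 ≤ i + M ∧ i + M < N + M then v ⟨(i + M).toNat, by omega⟩ else 0
    with hD
  have hdec : ∀ v, Decay 2 (2 ^ (N + M) * ‖v‖) (D v) := fun v i => by
    simp only [hD]
    split_ifs with h
    · refine (norm_le_pi_norm v _).trans ?_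
      -- The indices lie between -M and N - 1, so 2^(N+M) dominates the weight 2^|i|. For finite
      -- sums any weight would do; 2 is a convenient one.
      have h1 : (1 : ℝ) ≤ 2 ^ (N + M) * 2 ^ (-|i|) := by
        rw [← zpow_natCast, ← zpow_add₀ two_ne_zero]
        refine one_le_zpow₀ one_le_two ?_
        have : |i| ≤ (N + M : ℕ) := abs_le.2 ⟨by omega, by omega⟩
        omega
      calc ‖v‖ = 1 * ‖v‖ := (one_mul _).symm
        _ ≤ 2 ^ (N + M) * 2 ^ (-|i|) * ‖v‖ := mul_le_mul_of_nonneg_right h1 (norm_nonneg _)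
        _ = _ := by ring
    · rw [norm_zero]
      positivity
  have h0 : Decay 2 0 (0 : ℤ → ℂ) := fun i => by simp
  have hex : ∀ v, ∃ X : Model N M, zCoeff X = 0 ∧ lCoeff X = D v := fun v =>
    exists_model one_lt_two h0 (hdec v) (fun i hi => by simp only [hD]; rw [dif_neg (by omega)]) hN
  choose m hm1 hm2 using hex
  refine ⟨{ toFun := m, map_add' := fun v w => model_ext ?_ ?_, map_smul' := fun a v => model_ext ?_ ?_ }, ?_, hm1,
    fun X hX => ⟨fun k => lCoeff X ((k : ℤ) - M), model_ext (hX ▸ hm1 _) ?_⟩, fun v => ?_⟩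
  · rw [zCoeff_add, hm1, hm1, hm1, add_zero]
  · ext i
    rw [lCoeff_add, hm2, hm2, hm2]
    simp only [hD]
    split_ifs <;> simp
  · rw [zCoeff_smul, hm1, hm1, smul_zero]
  · ext i
    rw [RingHom.id_apply, lCoeff_smul, hm2, hm2]
    simp only [hD]
    split_ifs <;> simp
  · intro v w h
    have h1 : D v = D w := by rw [← hm2, ← hm2]; exact congrArg lCoeff h
    ext k
    have h2 := congrFun h1 ((k : ℤ) - M)
    simp only [hD] at h2
    have hk := k.2
    rw [dif_pos (by omega), dif_pos (by omega)] at h2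
    have h3 : (⟨((k : ℤ) - M + M).toNat, by omega⟩ : Fin (N + M)) = k := Fin.ext (by simp)
    rwa [h3] at h2
  · refine (hm2 _).trans (funext fun i => ?_)
    simp only [hD]
    split_ifs with h
    · congr 1
      omega
    · rw [lCoeff]
      split_ifs with h3 h4
      · rw [coeff_eq_zero X (by omega)]
      · omega
      · rfl
  · have := decay_of_zCoeff_lCoeff (C := 0) (X := m v) (by rw [hm1]; exact h0) (by rw [hm2]; exact hdec v)
    rwa [add_zero] at this

/-- The labels of the coordinates `h` and `ĥ`. -/
def poleLabel : ↥(Finset.Icc 1 (N - 1)) ⊕ Fin (M + 1) → Label N M := Sum.elim .h .hHat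

theorem poleLabel_injective : Function.Injective (poleLabel (N := N) (M := M)) := by
  rintro (j | k) (j' | k') h <;> simp [poleLabel] at h <;> rw [h]

theorem dZeta_eq_zero {X : Model N M} (h : zCoeff X = 0) {z : ℂ} (hz : z ∈ sphere (0 : ℂ) 1) : dZeta X z = 0 := by
  obtain ⟨ρ, hρ, C, -, h2⟩ := exists_decay_zCoeff X
  rw [h2 z (unit_sphere_subset_annulus hρ hz), h, laurentSum]
  simp

namespace Chart

theorem nearCoord_t_congr (c : Chart p) {q q' : Model N M} (h : ∀ z ∈ sphere (0 : ℂ) 1, zeta q z = zeta q' z) (i : ℤ) :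
    c.nearCoord q (.t i) = c.nearCoord q' (.t i) := by
  simp only [nearCoord, tFun]
  split_ifs
  · exact unitContour_congr fun z hz => by simp only [h z hz]
  · exact unitContour_congr fun z hz => by simp only [h z hz]

/-- The coordinates `h, ĥ` as functions of the coefficients of `l`: a local diffeomorphism. -/
theorem exists_poleEquiv (hN : 0 < N) (hM : 0 < M) (c : Chart p) {m : (Fin (N + M) → ℂ) →ₗ[ℂ] Model N M}
    (hinj : Function.Injective m) (hz : ∀ v, zCoeff (m v) = 0)
    (hm : ∀ v, Decay 2 (2 ^ (N + M) * ‖v‖) (coeff (m v)) ∧ Decay 2 (2 ^ (N + M) * ‖v‖) (coeffHat (m v))) :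
    ∃ e : (Fin (N + M) → ℂ) ≃L[ℂ] (↥(Finset.Icc 1 (N - 1)) ⊕ Fin (M + 1) → ℂ),
      (∀ v b, e v b = c.dCoord (m v) (poleLabel b)) ∧
      HasStrictFDerivAt (fun v b => c.nearCoord (p + m v) (poleLabel b)) (e : _ →L[ℂ] _) 0 := by
  set d : (Fin (N + M) → ℂ) →ₗ[ℂ] (↥(Finset.Icc 1 (N - 1)) ⊕ Fin (M + 1) → ℂ) :=
    { toFun := fun v b => c.dCoord (m v) (poleLabel b)
      map_add' := fun v w => by ext b; rw [map_add, dCoord_add]; rfl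
      map_smul' := fun a v => by ext b; rw [map_smul, dCoord_smul]; rfl } with hd
  have hdinj : Function.Injective d := by
    rw [injective_iff_map_eq_zero]
    intro v hv
    refine hinj ((map_zero m).symm ▸ c.eq_zero_of_dCoord hN hM fun β => ?_)
    rcases β with i | j | k
    · rw [dCoord, unitContour_congr (g := fun z => 0 * 0) fun z hz' => by simp [dZeta_eq_zero (hz v) hz'],
        unitContour_const_mul, zero_mul, neg_zero]
    · exact congrFun hv (.inl j)
    · exact congrFun hv (.inr k)
  -- There are N + M coefficients of l and (N - 1) + (M + 1) pole coordinates, so injectivity, from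
  -- `eq_zero_of_dCoord`, makes the derivative an isomorphism.
  have hdim : Module.finrank ℂ (Fin (N + M) → ℂ) = Module.finrank ℂ (↥(Finset.Icc 1 (N - 1)) ⊕ Fin (M + 1) → ℂ) := by
    simp
    omega
  set e := (LinearMap.linearEquivOfInjective d hdinj hdim).toContinuousLinearEquiv with he
  refine ⟨e, fun _ _ => rfl, hasStrictFDerivAt_pi'.2 fun b => ?_⟩
  rw [hasStrictFDerivAt_iff_isLittleO, isLittleO_iff]
  intro ε hε
  obtain ⟨η, hη, hs⟩ := c.strict hN hM one_lt_two (poleLabel b) (ε := ε / 2 ^ (N + M)) (by positivity)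
  have hsmall : ∀ᶠ v in 𝓝 (0 : Fin (N + M) → ℂ), 2 ^ (N + M) * ‖v‖ < η := by
    have h : Continuous fun v : Fin (N + M) → ℂ => (2 : ℝ) ^ (N + M) * ‖v‖ := by fun_prop
    exact (h.tendsto' 0 0 (by simp)).eventually_lt_const hη
  have hnear : ∀ v, Near 2 (2 ^ (N + M) * ‖v‖) (p + m v) p := fun v i => by
    rw [coeff_add, coeffHat_add, add_sub_cancel_left, add_sub_cancel_left]
    exact ⟨(hm v).1 i, (hm v).2 i⟩
  have hev := hsmall.prod_nhds hsmall
  filter_upwards [hev] with ⟨v, w⟩ ⟨h1, h2⟩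
  have h3 : Near 2 (2 ^ (N + M) * ‖v - w‖) (p + m v) (p + m w) :=
    near_add (by rw [← map_sub]; exact (hm _).1) (by rw [← map_sub]; exact (hm _).2)
  have h4 := hs _ _ _ ((hnear v).mono two_pos h1.le) ((hnear w).mono two_pos h2.le) h3
  refine le_of_eq_of_le (congrArg norm ?_) (h4.trans (le_of_eq ?_))
  · rw [add_sub_add_left_eq_sub, ← map_sub]
    rfl
  · field_simp

/-- The coefficients of l move through the local inverse of the pole coordinates; ζ stays fixed, so
the tⁱ do not change. -/
theorem exists_isCoordVector_pole (hN : 0 < N) (hM : 0 < M) (hp : IsPoint p) (c : Chart p)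
    (b : ↥(Finset.Icc 1 (N - 1)) ⊕ Fin (M + 1)) : ∃ X, IsCoordVector p c.coord (poleLabel b) X := by
  obtain ⟨m, hinj, hz, -, hm⟩ := exists_poleModel (M := M) hN
  obtain ⟨e, -, hF⟩ := c.exists_poleEquiv hN hM hinj hz hm
  set F : (Fin (N + M) → ℂ) → (↥(Finset.Icc 1 (N - 1)) ⊕ Fin (M + 1) → ℂ) :=
    fun v b => c.nearCoord (p + m v) (poleLabel b) with hFdef
  have hF0 : ∀ b, F 0 b = c.coord (poleLabel b) := fun b => by
    simp only [hFdef, map_zero, add_zero, nearCoord_self]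
  set v : ℂ → (Fin (N + M) → ℂ) := fun s => hF.localInverse F e 0 (F 0 + s • Pi.single b 1) with hv
  have hw : HasDerivAt (fun s : ℂ => F 0 + s • (Pi.single b 1 : ↥(Finset.Icc 1 (N - 1)) ⊕ Fin (M + 1) → ℂ)) (Pi.single b 1) 0 :=
    (((hasDerivAt_id (0 : ℂ)).smul_const _).const_add _).congr_deriv (one_smul _ _)
  have hw0 : F 0 + (0 : ℂ) • (Pi.single b 1 : ↥(Finset.Icc 1 (N - 1)) ⊕ Fin (M + 1) → ℂ) = F 0 := by
    rw [zero_smul, add_zero]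
  have hv0 : v 0 = 0 := by
    simp only [hv]
    rw [hw0]
    exact hF.localInverse_apply_image
  have hvd : HasDerivAt v (e.symm (Pi.single b 1)) 0 := by
    have h1 : HasFDerivAt (hF.localInverse F e 0) (e.symm : _ →L[ℂ] _)
        (F 0 + (0 : ℂ) • (Pi.single b 1 : ↥(Finset.Icc 1 (N - 1)) ⊕ Fin (M + 1) → ℂ)) := by
      rw [hw0]
      exact hF.to_localInverse.hasFDerivAt
    exact h1.comp_hasDerivAt 0 hw
  have hvF : ∀ᶠ s in 𝓝 (0 : ℂ), F (v s) = F 0 + s • Pi.single b 1 := by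
    have h1 := hF.eventually_right_inverse
    have h2 := hw.continuousAt.tendsto
    rw [hw0] at h2
    exact h2.eventually h1
  set X := e.symm (Pi.single b 1)
  have hvel : HasVelocity (fun s => p + m (v s)) (m X) := by
    refine ⟨2, one_lt_two, fun ε hε => ?_⟩
    have h1 := (isLittleO_iff.1 (hasDerivAt_iff_isLittleO.1 hvd)) (c := ε / 2 ^ (N + M)) (by positivity)
    filter_upwards [h1] with s hs
    rw [hv0, sub_zero, sub_zero] at hs
    have e1 : m (v s) - s • m X = m (v s - s • X) := by rw [map_sub, map_smul]
    have h2 : Near 2 (2 ^ (N + M) * ‖v s - s • X‖) (p + m (v s)) (p + s • m X) :=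
      near_add (by rw [e1]; exact (hm _).1) (by rw [e1]; exact (hm _).2)
    simp only [hv0, map_zero, add_zero]
    refine h2.mono two_pos ((mul_le_mul_of_nonneg_left hs (by positivity)).trans (le_of_eq ?_))
    field_simp
  have hp0 : p + m (v 0) = p := by rw [hv0, map_zero, add_zero]
  refine ⟨m X, isCoordVector_of_curve hp hp0 ?_ hvel⟩
  obtain ⟨ρ, hρ, ⟨C, hC, hnear⟩, -⟩ := hvel.exists_near
  obtain ⟨η, hη, hchart⟩ := c.exists_nearby hρ
  rw [hp0] at hnear
  filter_upwards [hvF, hnear, eventually_mul_norm_lt C hη] with s h1 h2 h3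
  obtain ⟨c', hc'⟩ := hchart _ (h2.mono (by linarith) h3.le)
  have hpole : ∀ b', c.nearCoord (p + m (v s)) (poleLabel b')
      = Function.update c.coord (poleLabel b) (c.coord (poleLabel b) + s) (poleLabel b') := by
    intro b'
    have h4 := congrFun h1 b'
    rw [Pi.add_apply, Pi.smul_apply, hF0] at h4
    refine h4.trans ?_
    by_cases hb : b' = b
    · subst hb
      simp
    · rw [Function.update_of_ne (poleLabel_injective.ne hb), Pi.single_eq_of_ne hb]
      simp
  have hcoord : Function.update c.coord (poleLabel b) (c.coord (poleLabel b) + s) = c'.coord := by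
    rw [hc']
    ext β
    rcases β with i | j | k
    · rw [Function.update_of_ne (by rcases b with b | b <;> simp [poleLabel]), ← nearCoord_self]
      refine (c.nearCoord_t_congr (fun z hz' => ?_) i).symm
      rw [← sub_eq_zero, zeta_sub _ _ hz', add_sub_cancel_left, dZeta_eq_zero (hz _) hz']
    · exact (hpole (.inl j)).symm
    · exact (hpole (.inr k)).symm
  rw [hcoord]
  exact c'.isCoord hN hM

theorem exists_isCoordVector (hN : 0 < N) (hM : 0 < M) (hp : IsPoint p) (c : Chart p) (α : Label N M) :
    ∃ X, IsCoordVector p c.coord α X := by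
  rcases α with i | j | k
  · exact c.exists_isCoordVector_t hN hM hp i
  · exact c.exists_isCoordVector_pole hN hM hp (.inl j)
  · exact c.exists_isCoordVector_pole hN hM hp (.inr k)

end Chart
end Point

/-! ### The coordinates separate points -/

section Separation

variable {f g φ : ℂ → ℂ} {σ δ R r : ℝ}

theorem Loop.analyticAt_cauchyTr (hg : Loop g σ δ) (hφ : ContinuousOn φ (sphere 0 R)) (hR0 : 0 ≤ R)
    (h1 : σ⁻¹ < R) (h2 : R < σ) {w : ℂ} (hw : w ∉ g '' sphere 0 R) : AnalyticAt ℂ (cauchyTr φ g R) w :=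
  cauchyTr_analyticAt hR0 hφ (hg.diff.continuousOn.mono (sphere_subset_annulus h1 h2)) hw

/-- The contour integrals defining the `tⁱ` determine the Cauchy transforms of `1 / z`. -/
theorem Loop.eq_cauchyTr (hf : Loop f σ δ) (hg : Loop g σ δ)
    (h : ∀ k : ℤ, unitContour (fun z => z⁻¹ * f z ^ k) = unitContour fun z => z⁻¹ * g z ^ k)
    (h1 : σ⁻¹ < R) (h2 : R < σ) :
    (∀ᶠ w in 𝓝 (0 : ℂ), cauchyTr (fun z => z⁻¹) f R w = cauchyTr (fun z => z⁻¹) g R w) ∧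
    ∀ᶠ w in cobounded ℂ, cauchyTr (fun z => z⁻¹) f R w = cauchyTr (fun z => z⁻¹) g R w := by
  have hσ := hf.one_lt
  have hR : 0 < R := (inv_pos.2 (by linarith)).trans h1
  have hsub := sphere_subset_annulus h1 h2
  have hφ : ContinuousOn (fun z : ℂ => z⁻¹) (sphere 0 R) :=
    continuousOn_id.inv₀ fun z hz => ne_zero_of_mem_annulus hσ (hsub hz)
  have key : ∀ k : ℤ, (2 * π * Complex.I)⁻¹ * (∮ z in C(0, R), z⁻¹ * f z ^ k)
      = (2 * π * Complex.I)⁻¹ * ∮ z in C(0, R), z⁻¹ * g z ^ k := by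
    intro k
    have hd : ∀ {f : ℂ → ℂ}, Loop f σ δ → DifferentiableOn ℂ (fun z => z⁻¹ * f z ^ k) (annulus σ) := fun hf =>
      (differentiableOn_id.inv fun z hz => ne_zero_of_mem_annulus hσ hz).mul (hf.differentiableOn_zpow k)
    rw [← unitContour_eq_of_annulus hσ (hd hf) h1 h2, ← unitContour_eq_of_annulus hσ (hd hg) h1 h2, h k]
  have hfc := hf.diff.continuousOn.mono hsub
  have hgc := hg.diff.continuousOn.mono hsub
  constructor
  · filter_upwards [cauchyTr_hasSum_zero hR.le hφ hfc fun z hz => hf.ne_zero z (hsub hz),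
      cauchyTr_hasSum_zero hR.le hφ hgc fun z hz => hg.ne_zero z (hsub hz)] with w e1 e2
    refine e1.unique (HasSum.of_eq e2 (fun n => ?_) rfl)
    have := key (-(n + 1 : ℕ))
    simp only [zpow_neg, zpow_natCast] at this
    rw [this]
  · filter_upwards [cauchyTr_hasSum_infty hR.le hφ hfc, cauchyTr_hasSum_infty hR.le hφ hgc] with w e1 e2
    refine e1.unique (HasSum.of_eq e2 (fun n => ?_) rfl)
    have := key n
    simp only [zpow_natCast] at this
    rw [this]

/-- Two nearby loops with the same contour integrals are reparametrizations of each other, and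
`z dz⁻¹` is preserved. -/
theorem Loop.exists_same_value (hf : Loop f σ δ) (hg : Loop g σ δ) {b : ℝ} (hb : 1 < b) (hr : 0 < r) (hbR : b + r < R)
    (hbR' : R⁻¹ + r < b⁻¹) (hRσ : R < σ) (hball : ∀ z ∈ annulus σ, ‖z‖ ≤ R → R⁻¹ ≤ ‖z‖ → closedBall z r ⊆ annulus σ)
    (hd : ∀ z ∈ annulus σ, ‖f z - g z‖ < δ * r / 2)
    (h : ∀ k : ℤ, unitContour (fun z => z⁻¹ * f z ^ k) = unitContour fun z => z⁻¹ * g z ^ k) {z : ℂ}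
    (hz : z ∈ annulus b) : ∃ y, ‖y - z‖ ≤ r ∧ y ∈ annulus R ∧ g y = f z ∧ z * deriv f z = y * deriv g y := by
  have hσ := hf.one_lt
  have hR : 1 < R := by linarith
  have hRi : R⁻¹ < 1 := inv_lt_one_of_one_lt₀ hR
  have hbi : b⁻¹ < 1 := inv_lt_one_of_one_lt₀ hb
  have hσR : σ⁻¹ < R⁻¹ := inv_strictAnti₀ (by linarith) hRσ
  have hsub : annulus R ⊆ annulus σ := annulus_mono (by linarith) hRσ.le
  have hbR0 : annulus b ⊆ annulus R := annulus_mono (by linarith) (by linarith)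
  have hmatch : ∀ {f g : ℂ → ℂ}, Loop f σ δ → Loop g σ δ → (∀ z ∈ annulus σ, ‖f z - g z‖ < δ * r / 2) →
      ∀ z ∈ annulus σ, ‖z‖ ≤ R → R⁻¹ ≤ ‖z‖ → ∃ y, y ∈ annulus σ ∧ ‖z‖ ≤ ‖y‖ + r ∧ ‖y‖ ≤ ‖z‖ + r ∧ ‖y - z‖ ≤ r ∧
        g y = f z := by
    intro f g _ hg hd z hz h1 h2
    obtain ⟨y, hy, e⟩ := hg.exists_eq_of_near hr (hball z hz h1 h2) (hd z hz)
    have hy' : ‖y - z‖ ≤ r := by rwa [mem_closedBall, dist_eq_norm] at hy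
    have h3 := norm_sub_norm_le z y
    have h4 := norm_sub_norm_le y z
    rw [norm_sub_rev] at h3
    exact ⟨y, hball z hz h1 h2 hy, by linarith, by linarith, hy', e⟩
  have hd' : ∀ z ∈ annulus σ, ‖g z - f z‖ < δ * r / 2 := fun z hz => norm_sub_rev (f z) (g z) ▸ hd z hz
  have hinv : ∀ {a : ℝ}, σ⁻¹ < a → a < σ → ContinuousOn (fun z : ℂ => z⁻¹) (sphere 0 a) := fun h1 h2 =>
    continuousOn_id.inv₀ fun z hz => ne_zero_of_mem_annulus hσ (sphere_subset_annulus h1 h2 hz)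
  -- The transforms of dz/z along f and g agree near 0 and are holomorphic off the images of |z| = R
  -- under f and g. A value of g on that circle is a value of f at some x with |x| > b, because b +
  -- r < R. So the agreement extends to f z for |z| < b.
  have hout : cauchyTr (fun z => z⁻¹) f R (f z) = cauchyTr (fun z => z⁻¹) g R (f z) := by
    have ha : ∀ w, w ∉ f '' sphere 0 R → w ∉ g '' sphere 0 R →
        AnalyticAt ℂ (fun w => cauchyTr (fun z => z⁻¹) f R w - cauchyTr (fun z => z⁻¹) g R w) w := fun w e1 e2 =>
      (hf.analyticAt_cauchyTr (hinv (by linarith) hRσ) (by linarith) (by linarith) hRσ e1).sub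
        (hg.analyticAt_cauchyTr (hinv (by linarith) hRσ) (by linarith) (by linarith) hRσ e2)
    have hg' : ∀ w, w ∈ g '' sphere 0 R → ∃ x ∈ annulus σ, b < ‖x‖ ∧ w = f x := by
      rintro _ ⟨y, hy, rfl⟩
      have hyR := mem_sphere_zero_iff_norm.1 hy
      obtain ⟨x, hx, h1, h2, -, e⟩ := hmatch hg hf hd' y (sphere_subset_annulus (by linarith) hRσ hy) hyR.le (by linarith)
      exact ⟨x, hx, by linarith, e.symm⟩
    refine sub_eq_zero.1 (hf.vanish_inner hb (by linarith) (fun w hw => ha w ?_ ?_) (fun x hx1 hx2 => ha _ ?_ ?_)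
      ((hf.eq_cauchyTr hg h (by linarith) hRσ).1.mono fun w hw => sub_eq_zero.2 hw) (by linarith [hz.1]) hz.2)
    · exact hf.notMem_image_outer hR hRσ (.inr hw)
    · intro hw'
      obtain ⟨x, hx, hbx, rfl⟩ := hg' w hw'
      exact hw.2 ((hf.mem_outside hx (by linarith)).2)
    · exact hf.notMem_image_sphere (by linarith) hRσ ⟨by linarith, by linarith⟩ (by linarith)
    · intro hw'
      obtain ⟨y, hy, hby, e⟩ := hg' _ hw'
      rw [hf.injOn (show x ∈ annulus σ from ⟨by linarith, by linarith⟩) hy e] at hx2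
      linarith
  have hinn : cauchyTr (fun z => z⁻¹) f R⁻¹ (f z) = cauchyTr (fun z => z⁻¹) g R⁻¹ (f z) := by
    have hR0 : 0 ≤ R⁻¹ := inv_nonneg.2 (by linarith)
    have ha : ∀ w, w ∉ f '' sphere 0 R⁻¹ → w ∉ g '' sphere 0 R⁻¹ →
        AnalyticAt ℂ (fun w => cauchyTr (fun z => z⁻¹) f R⁻¹ w - cauchyTr (fun z => z⁻¹) g R⁻¹ w) w := fun w e1 e2 =>
      (hf.analyticAt_cauchyTr (hinv hσR (by linarith)) hR0 hσR (by linarith) e1).sub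
        (hg.analyticAt_cauchyTr (hinv hσR (by linarith)) hR0 hσR (by linarith) e2)
    have hg' : ∀ w, w ∈ g '' sphere 0 R⁻¹ → ∃ x ∈ annulus σ, ‖x‖ < b⁻¹ ∧ w = f x := by
      rintro _ ⟨y, hy, rfl⟩
      have hyR := mem_sphere_zero_iff_norm.1 hy
      obtain ⟨x, hx, h1, h2, -, e⟩ := hmatch hg hf hd' y (sphere_subset_annulus hσR (by linarith) hy) (by linarith) hyR.ge
      exact ⟨x, hx, by linarith, e.symm⟩
    refine sub_eq_zero.1 (hf.vanish_outer hbi (by linarith) (fun w hw => ha w ?_ ?_) (fun x hx1 hx2 => ha _ ?_ ?_)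
      ((hf.eq_cauchyTr hg h hσR (by linarith)).2.mono fun w hw => sub_eq_zero.2 hw) hz.1 (by linarith [hz.2]))
    · exact hf.notMem_image_inner hRi hσR (.inr hw)
    · intro hw'
      obtain ⟨x, hx, hbx, rfl⟩ := hg' w hw'
      rw [outsideOf, Set.mem_ofPred_eq, hf.windNum_outer.2.1 x hx (by linarith)] at hw
      exact one_ne_zero hw.2
    · exact hf.notMem_image_sphere hσR (by linarith) ⟨by linarith, by linarith⟩ (by linarith)
    · intro hw'
      obtain ⟨y, hy, hby, e⟩ := hg' _ hw'
      rw [hf.injOn (show x ∈ annulus σ from ⟨by linarith, by linarith⟩) hy e] at hx1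
      linarith
  have hzR := hbR0 hz
  obtain ⟨y, hy, h1, h2, h3, e⟩ := hmatch hf hg hd z (hsub hzR) hzR.2.le hzR.1.le
  have hyR : y ∈ annulus R := ⟨by linarith [hz.1], by linarith [hz.2]⟩
  refine ⟨y, h3, hyR, e, ?_⟩
  have hid : DifferentiableOn ℂ (fun z : ℂ => z⁻¹) (annulus σ) :=
    differentiableOn_id.inv fun z hz => ne_zero_of_mem_annulus hσ hz
  -- The jumps of the transforms at the common value f z = g y are 1/(z f'(z)) and 1/(y g'(y)). They
  -- coincide because the outer and the inner transforms do.
  have c1 := hf.circleIntegral_sub hid hσR hRσ hzR.1 hzR.2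
  have c2 := hg.circleIntegral_sub hid hσR hRσ hyR.1 hyR.2
  rw [e] at c2
  simp only [cauchyTr] at hout hinn
  have hpi := inv_ne_zero Complex.two_pi_I_ne_zero
  rw [mul_left_cancel₀ hpi hout, mul_left_cancel₀ hpi hinn, c2] at c1
  have c3 := mul_left_cancel₀ Complex.two_pi_I_ne_zero c1
  have hz0 := ne_zero_of_mem_annulus hσ (hsub hzR)
  have hy0 := ne_zero_of_mem_annulus hσ (hsub hyR)
  have hfz := hf.deriv_ne_zero (hsub hzR)
  have hgy := hg.deriv_ne_zero (hsub hyR)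
  field_simp at c3
  linear_combination c3

/-- Nearby loops with the same coordinates `tⁱ` agree. -/
theorem Loop.exists_eqOn_of_contours (hσ : 1 < σ) (hδ : 0 < δ) : ∃ d, 0 < d ∧ ∀ f g Lf Lg : ℂ → ℂ, Loop f σ δ → Loop g σ δ →
    (∀ z ∈ annulus σ, ‖f z - g z‖ < d) →
    (∀ k : ℤ, unitContour (fun z => z⁻¹ * f z ^ k) = unitContour fun z => z⁻¹ * g z ^ k) →
    (∀ z ∈ annulus σ, HasDerivAt Lf (z⁻¹ - deriv f z / f z) z ∧ Complex.exp (Lf z) = z / f z) →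
    (∀ z ∈ annulus σ, HasDerivAt Lg (z⁻¹ - deriv g z / g z) z ∧ Complex.exp (Lg z) = z / g z) →
    Complex.exp (tFun f Lf 0) = Complex.exp (tFun g Lg 0) → ∀ z ∈ sphere (0 : ℂ) 1, f z = g z := by
  obtain ⟨R', hR', hR'σ⟩ := exists_between hσ
  obtain ⟨R, hR, hRR'⟩ := exists_between hR'
  obtain ⟨b, hb, hbR⟩ := exists_between hR
  obtain ⟨r₀, hr₀, hball⟩ := exists_closedBall_subset_annulus hR' hR'σ
  have hinv : R⁻¹ < b⁻¹ := inv_strictAnti₀ (by linarith) hbR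
  have hinv' : R'⁻¹ < R⁻¹ := inv_strictAnti₀ (by linarith) hRR'
  set r := min r₀ (min ((R - b) / 2) ((b⁻¹ - R⁻¹) / 2)) with hrdef
  have hr : 0 < r := lt_min hr₀ (lt_min (by linarith) (by linarith))
  have hr1 : r ≤ r₀ := min_le_left _ _
  have hr2 : r ≤ (R - b) / 2 := (min_le_right _ _).trans (min_le_left _ _)
  have hr3 : r ≤ (b⁻¹ - R⁻¹) / 2 := (min_le_right _ _).trans (min_le_right _ _)
  refine ⟨δ * r / 2, by positivity, fun f g Lf Lg hf hg hd h hLf hLg hexp => ?_⟩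
  have hex : ∀ z, ∃ y, z ∈ annulus b → y ∈ annulus R ∧ g y = f z ∧ z * deriv f z = y * deriv g y := by
    intro z
    by_cases hz : z ∈ annulus b
    · obtain ⟨y, -, hy⟩ := hf.exists_same_value hg hb hr (R := R) (by linarith) (by linarith) (by linarith)
        (fun z _ h1 h2 => (closedBall_subset_closedBall hr1).trans (hball z ⟨by linarith, by linarith⟩)) hd h hz
      exact ⟨y, fun _ => hy⟩
    · exact ⟨0, fun h => absurd h hz⟩
  choose κ hκ using hex
  have hRσ : annulus R ⊆ annulus σ := annulus_mono (by linarith) (by linarith)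
  have hbσ : annulus b ⊆ annulus σ := annulus_mono (by linarith) (by linarith)
  have hκc : ∀ z ∈ annulus b, ContinuousAt κ z := by
    intro z hz
    have h4 : ∀ᶠ y in 𝓝 z, ‖κ y - κ z‖ ≤ δ⁻¹ * ‖f y - f z‖ := by
      filter_upwards [annulus_mem_nhds hz] with y hy
      have h5 := hg.bound _ (hRσ (hκ y hy).1) _ (hRσ (hκ z hz).1)
      rw [(hκ y hy).2.1, (hκ z hz).2.1] at h5
      rwa [inv_mul_eq_div, le_div_iff₀' hδ]
    refine tendsto_iff_norm_sub_tendsto_zero.2 (squeeze_zero' (.of_forall fun _ => norm_nonneg _) h4 ?_)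
    have h6 := (tendsto_iff_norm_sub_tendsto_zero.1 (hf.differentiableAt (hbσ hz)).continuousAt.tendsto).const_mul δ⁻¹
    rwa [mul_zero] at h6
  have hκd : ∀ z ∈ annulus b, HasDerivAt κ ((deriv g (κ z))⁻¹ * deriv f z) z := by
    intro z hz
    have hm := hRσ (hκ z hz).1
    have hs : HasStrictDerivAt g (deriv g (κ z)) (κ z) :=
      ((hg.diff.analyticAt (annulus_mem_nhds hm)).hasStrictDerivAt)
    have hne := hg.deriv_ne_zero hm
    have h1 := (hs.to_localInverse hne).hasDerivAt
    rw [(hκ z hz).2.1] at h1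
    refine (h1.comp z (hf.differentiableAt (hbσ hz)).hasDerivAt).congr_of_eventuallyEq ?_
    have h2 := (hκc z hz).tendsto.eventually (hs.hasStrictFDerivAt_equiv hne).eventually_left_inverse
    filter_upwards [h2, annulus_mem_nhds hz] with y hy hyb
    rw [(hκ y hyb).2.1] at hy
    exact hy.symm
  have h1b : (1 : ℂ) ∈ annulus b := unit_sphere_subset_annulus hb (by simp)
  have hz0 : ∀ {z}, z ∈ annulus b → z ≠ 0 := fun hz => ne_zero_of_mem_annulus hb hz
  have hconst : ∀ {P : ℂ → ℂ}, (∀ z ∈ annulus b, HasDerivAt P 0 z) → ∀ z ∈ annulus b, P z = P 1 := fun {P} hP z hz =>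
    (isOpen_annulus b).is_const_of_deriv_eq_zero (isPreconnected_annulus hb)
      (fun z hz => (hP z hz).differentiableAt.differentiableWithinAt) (fun z hz => (hP z hz).deriv) hz h1b
  -- g ∘ κ = f together with z f'(z) = κ g'(κ) gives z κ' = κ, so κ(z)/z is constant.
  have hc : ∀ z ∈ annulus b, κ z = κ 1 * z := by
    intro z hz
    have := hconst (P := fun z => κ z / z) (fun z hz => ((hκd z hz).fun_div (hasDerivAt_id z) (hz0 hz)).congr_deriv (by
      have h1 := hg.deriv_ne_zero (hRσ (hκ z hz).1)
      have h2 := (hκ z hz).2.2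
      have h3 := hz0 hz
      rw [div_eq_zero_iff]
      left
      field_simp
      simp only [id]
      linear_combination h2)) z hz
    simp only [div_one] at this
    rw [← this, div_mul_cancel₀ _ (hz0 hz)]
  set c := κ 1 with hcdef
  have hc0 : c ≠ 0 := ne_zero_of_mem_annulus hσ (hRσ (hκ 1 h1b).1)
  have hmem : ∀ z ∈ annulus b, c * z ∈ annulus R := fun z hz => hc z hz ▸ (hκ z hz).1
  have hgf : ∀ z ∈ annulus b, g (c * z) = f z := fun z hz => hc z hz ▸ (hκ z hz).2.1
  set ℓ := Lg (c * 1) - Lf 1 with hℓ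
  have hL : ∀ z ∈ annulus b, Lg (c * z) - Lf z = ℓ := hconst fun z hz => by
    have h1 := (hLg _ (hRσ (hmem z hz))).1
    have h2 : HasDerivAt (fun z => c * z) c z := ((hasDerivAt_id z).const_mul c).congr_deriv (mul_one c)
    refine ((h1.comp z h2).sub (hLf z (hbσ hz)).1).congr_deriv ?_
    have h3 := (hκ z hz).2.2
    rw [hc z hz] at h3
    have h4 := hz0 hz
    have h5 := hf.ne_zero z (hbσ hz)
    have h6 : deriv f z = c * deriv g (c * z) := mul_left_cancel₀ h4 (by rw [h3]; ring)
    rw [hgf z hz, h6]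
    field_simp
    ring
  have hexpℓ : Complex.exp ℓ = c := by
    have h5 := hf.ne_zero 1 (hbσ h1b)
    rw [hℓ, Complex.exp_sub, (hLg _ (hRσ (hmem 1 h1b))).2, (hLf 1 (hbσ h1b)).2, hgf 1 h1b]
    field_simp
  have hH : DifferentiableOn ℂ (fun y => Lg y / y) (annulus R) := fun y hy =>
    ((hLg y (hRσ hy)).1.differentiableAt.div differentiableAt_id (ne_zero_of_mem_annulus hR hy)).differentiableWithinAt
  -- The dilation z ↦ c z is the reparametrization with constant exponent -ℓ, where exp ℓ = c. It
  -- shows that the two values of t⁰ differ by ℓ; as their exponentials are equal, c = 1.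
  have key := contour_reparam (g := fun _ => 1) (s := -ℓ) (Ψ := fun z => c * z) hb hR (differentiableOn_const 1)
    (differentiableOn_id.const_mul c) (fun z hz => ⟨hmem z hz, by
      rw [mul_one, Complex.exp_neg, hexpℓ]
      field_simp⟩) hH
  have hsph := unit_sphere_subset_annulus hb
  have hLfc : ContinuousOn (fun z => Lf z / z) (sphere 0 1) := fun z hz =>
    ((hLf z (hbσ (hsph hz))).1.continuousAt.div continuousAt_id (hz0 (hsph hz))).continuousWithinAt
  have e1 : unitContour (fun z => Lg (c * z) / (c * z) * deriv (fun z => c * z) z)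
      = unitContour (fun z => Lf z / z) + ℓ := by
    have : unitContour (fun z => ℓ * z⁻¹) = ℓ := by rw [unitContour_const_mul, unitContour_inv, mul_one]
    refine Eq.trans ?_ ((unitContour_add (f := fun z => Lf z / z) (g := fun z => ℓ * z⁻¹) hLfc
      (continuousOn_const.mul (continuousOn_id.inv₀ fun z hz => hz0 (hsph hz)))).trans (by rw [this]))
    refine unitContour_congr fun z hz => ?_
    have h2 : HasDerivAt (fun z => c * z) c z := ((hasDerivAt_id z).const_mul c).congr_deriv (mul_one c)
    have h3 := hz0 (hsph hz)
    rw [h2.deriv, ← sub_add_cancel (Lg (c * z)) (Lf z), hL z (hsph hz)]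
    field_simp
    ring
  rw [e1] at key
  have hc1 : c = 1 := by
    simp only [tFun, if_true] at hexp
    rw [← key, Complex.exp_add, hexpℓ] at hexp
    exact (mul_left_cancel₀ (Complex.exp_ne_zero _) (by rw [mul_one]; exact hexp)).symm
  intro z hz
  rw [← hgf z (hsph hz), hc1, one_mul]

end Separation

/-- Adding a constant to the logarithm rescales the coefficients. -/
theorem poleCoeff_add_const (Λ : ℂ → ℂ) (b : ℂ) (n : ℕ) (s : ℝ) (k : ℕ) :
    poleCoeff (fun u => Λ u + b) n s k
      = if k = 0 then poleCoeff Λ n s k + b else Complex.exp (b / n) ^ k * poleCoeff Λ n s k := by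
  rw [poleCoeff, poleCoeff]
  split_ifs with hk
  · rfl
  · change _ * cInt s _ = _ * (_ * cInt s _)
    rw [mul_left_comm, ← cInt_const_mul (Complex.exp (b / n) ^ k), ← cInt_const_mul, ← cInt_const_mul]
    congr 1
    funext u
    rw [add_div, Complex.exp_add]
    ring

/-! ### Local injectivity of the coordinates on the manifold -/

section Point

variable {N M : ℕ} {p q q' : Model N M} {u : Label N M → ℂ}

namespace Chart

theorem shift_coord_pole (c : Chart p) {a b : ℂ} (ha : Complex.exp a = 1) (hb : Complex.exp b = 1)
    (i : ↥(Finset.Icc 1 (N - 1)) ⊕ Fin (M + 1)) : (c.shift ha hb).coord (poleLabel i) = match i with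
      | .inl j => c.coord (.h j)
      | .inr k => if (k : ℕ) = 0 then c.coord (.hHat k) + b else Complex.exp (b / M) ^ (k : ℕ) * c.coord (.hHat k) := by
  match i with
  | .inl j => rfl
  | .inr k => exact poleCoeff_add_const _ _ _ _ _

/-- Points with common coordinates and close values of `ĥ⁰` have charts with equal `hʲ` and `ĥᵏ`. -/
theorem coord_pole_eq (hN : 0 < N) (hM : 0 < M) (c : Chart q) (c' : Chart q') (hu : IsCoord q u)
    (hu' : IsCoord q' u) (h : ‖c.coord (.hHat 0) - c'.coord (.hHat 0)‖ < π)
    (i : ↥(Finset.Icc 1 (N - 1)) ⊕ Fin (M + 1)) : c.coord (poleLabel i) = c'.coord (poleLabel i) := by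
  obtain ⟨a, b, ha, hb, e⟩ := c.exists_shift hN hM (.inl hu)
  obtain ⟨a', b', ha', hb', e'⟩ := c'.exists_shift hN hM (.inl hu')
  have h0 := (shift_coord_hHat c ha hb).symm.trans ((congrFun (e.symm.trans e') (.hHat 0)).trans
    (shift_coord_hHat c' ha' hb'))
  have hbb : b' - b = c.coord (.hHat 0) - c'.coord (.hHat 0) := by linear_combination -h0
  have hb0 : b' - b = 0 := by
    rw [← hbb] at h
    have him := (Complex.abs_im_le_norm _).trans_lt h
    rw [abs_lt] at him
    have := Complex.log_exp him.1 him.2.le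
    rwa [Complex.exp_sub, hb, hb', div_one, Complex.log_one, eq_comm] at this
  have key := (shift_coord_pole c ha hb i).symm.trans ((congrFun (e.symm.trans e') (poleLabel i)).trans
    (shift_coord_pole c' ha' hb' i))
  rw [sub_eq_zero.1 hb0] at key
  match i with
  | .inl j => exact key
  | .inr k =>
    simp only at key
    split_ifs at key
    · exact add_right_cancel key
    · exact mul_left_cancel₀ (pow_ne_zero _ (Complex.exp_ne_zero _)) key

end Chart

/-- Near a point, the coordinates `tⁱ` determine `ζ`. -/
theorem IsPoint.exists_zeta_eq (hp : IsPoint p) {ρ : ℝ} (hρ : 1 < ρ) : ∃ η, 0 < η ∧ ∀ q q' : Model N M,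
    Near ρ η q p → Near ρ η q' p → ∀ t : ℤ → ℂ, IsFactorizationT q t → IsFactorizationT q' t →
      ∀ z ∈ sphere (0 : ℂ) 1, zeta q z = zeta q' z := by
  obtain ⟨σ₁, hσ₁, C, h1, h2⟩ := exists_decay p
  obtain ⟨σ, hσ, hσσ, δ, hf⟩ := hp.exists_loop hσ₁ h1 h2
  obtain ⟨τ, hτ, hτ'⟩ := exists_between (lt_min hσ hρ)
  rw [lt_min_iff] at hτ'
  obtain ⟨d, hd, H⟩ := Loop.exists_eqOn_of_contours hτ (half_pos hf.pos)
  obtain ⟨η, hη, hloop⟩ := exists_near_loop hf hτ hτ'.1 hσσ h1 h2 hτ'.2 (half_pos hd)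
  refine ⟨η, hη, fun q q' hq hq' t ht ht' => ?_⟩
  obtain ⟨hl, hn⟩ := hloop q hq
  obtain ⟨hl', hn'⟩ := hloop q' hq'
  obtain ⟨L, hL⟩ := hl.exists_log
  obtain ⟨L', hL'⟩ := hl'.exists_log
  have e := (isFactorizationT_iff hl hL).1 ht
  have e' := (isFactorizationT_iff hl' hL').1 ht'
  refine H _ _ L L' hl hl' (fun z hz => ?_) (fun k => ?_) hL hL' (e.1.symm.trans e'.1)
  · have h3 := hn z hz
    have h4 := hn' z hz
    rw [norm_sub_rev] at h4
    have := norm_sub_le_norm_sub_add_norm_sub (zeta q z) (zeta p z) (zeta q' z)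
    linarith
  · rcases eq_or_ne k 0 with rfl | hk
    · simp only [zpow_zero]
    have h3 := (e.2 (-k) (neg_ne_zero.2 hk)).symm.trans (e'.2 (-k) (neg_ne_zero.2 hk))
    have hk' : (k : ℂ) ≠ 0 := Int.cast_ne_zero.2 hk
    simp only [tFun, neg_eq_zero, hk, if_false, neg_neg] at h3
    have h4 : ∀ f : ℂ → ℂ, unitContour (fun z => z⁻¹ * f z ^ k)
        = -k * unitContour fun z => f z ^ k / ((-k : ℤ) : ℂ) / z := fun f => by
      rw [← unitContour_const_mul]
      refine unitContour_congr fun z _ => ?_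
      push_cast
      field_simp
    rw [h4, h4, h3]

namespace Chart

theorem exists_nearCoord_close (hN : 0 < N) (hM : 0 < M) (c : Chart p) {ρ : ℝ} (hρ : 1 < ρ) (β : Label N M) {ε : ℝ}
    (hε : 0 < ε) : ∃ η, 0 < η ∧ ∀ q : Model N M, Near ρ η q p → ‖c.nearCoord q β - c.coord β‖ < ε := by
  obtain ⟨K, hK, hb⟩ := c.exists_dCoord_bound hρ β
  obtain ⟨η, hη, hs⟩ := c.strict hN hM hρ β one_pos
  have hη' : 0 < min η (ε / 2 / (1 + K)) := lt_min hη (by positivity)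
  refine ⟨min η (ε / 2 / (1 + K)), hη', fun q hq => ?_⟩
  have hpp : Near ρ η p p := fun i => by
    rw [sub_self, sub_self, norm_zero]
    exact ⟨by positivity, by positivity⟩
  have h1 := hs q p _ (hq.mono (by linarith) (min_le_left _ _)) hpp hq
  have h2 := hb q p _ hq
  rw [nearCoord_self] at h1
  have h3 := norm_le_norm_add_norm_sub' (c.nearCoord q β - c.coord β) (c.dCoord (q - p) β)
  have h4 : (1 + K) * min η (ε / 2 / (1 + K)) ≤ ε / 2 := by
    rw [← le_div_iff₀' (by positivity)]
    exact min_le_right _ _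
  linarith

/-- Near a point, `ζ`, `hʲ` and `ĥᵏ` determine the point. -/
theorem exists_eq_of_nearCoord (hN : 0 < N) (hM : 0 < M) (c : Chart p) {ρ : ℝ} (hρ : 1 < ρ) : ∃ η, 0 < η ∧
    ∀ q q' : Model N M, Near ρ η q p → Near ρ η q' p → (∀ z ∈ sphere (0 : ℂ) 1, zeta q z = zeta q' z) →
      (∀ i, c.nearCoord q (poleLabel i) = c.nearCoord q' (poleLabel i)) → q = q' := by
  obtain ⟨m, hinj, hz, hsurj, hm⟩ := exists_poleModel (M := M) hN
  obtain ⟨e, he, -⟩ := c.exists_poleEquiv hN hM hinj hz hm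
  have hr : 1 < min ρ 2 := lt_min hρ one_lt_two
  set A := ‖(e.symm : (↥(Finset.Icc 1 (N - 1)) ⊕ Fin (M + 1) → ℂ) →L[ℂ] (Fin (N + M) → ℂ))‖ with hA
  have hA0 : 0 ≤ A := norm_nonneg _
  -- ε is small against the norm of the inverse of the derivative, so that equal pole coordinates
  -- force ‖v‖ ≤ ‖v‖ / 2.
  set ε := (2 * ((A + 1) * 2 ^ (N + M)))⁻¹ with hε
  have hε0 : 0 < ε := by positivity
  choose η hη H using fun i => c.strict hN hM hr (poleLabel i) hε0
  obtain ⟨η₀, hη₀, hη₁⟩ : ∃ η₀, 0 < η₀ ∧ ∀ i, η₀ ≤ η i := by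
    obtain ⟨i, hi⟩ := Finite.exists_min η
    exact ⟨η i, hη i, hi⟩
  refine ⟨η₀, hη₀, fun q q' hq hq' hζ hc => ?_⟩
  obtain ⟨v, hv⟩ := hsurj (q - q') (zCoeff_eq_zero fun z hz => by rw [← zeta_sub _ _ hz, hζ z hz, sub_self])
  have hnear : Near (min ρ 2) (2 ^ (N + M) * ‖v‖) q q' := by
    have h1 := near_add (p := q') (X := q - q') (Y := 0) (ρ := 2) (C := 2 ^ (N + M) * ‖v‖)
      (by rw [sub_zero, ← hv]; exact (hm v).1) (by rw [sub_zero, ← hv]; exact (hm v).2)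
    rw [add_sub_cancel, add_zero] at h1
    exact h1.mono_radius (by linarith) (min_le_right _ _)
  have hev : ‖e v‖ ≤ ε * (2 ^ (N + M) * ‖v‖) := by
    refine (pi_norm_le_iff_of_nonneg (by positivity)).2 fun i => ?_
    have h1 := H i q q' _ ((hq.mono_radius (by linarith) (min_le_left _ _)).mono (by linarith) (hη₁ i))
      ((hq'.mono_radius (by linarith) (min_le_left _ _)).mono (by linarith) (hη₁ i)) hnear
    rwa [hc i, sub_self, zero_sub, norm_neg, ← hv, ← he] at h1
  have hv1 : ‖v‖ ≤ A * ‖e v‖ := by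
    have := (e.symm : (↥(Finset.Icc 1 (N - 1)) ⊕ Fin (M + 1) → ℂ) →L[ℂ] (Fin (N + M) → ℂ)).le_opNorm (e v)
    simpa using this
  have hv2 : A * ‖e v‖ ≤ (A + 1) * (ε * (2 ^ (N + M) * ‖v‖)) := by gcongr; linarith
  have hv3 : (A + 1) * (ε * (2 ^ (N + M) * ‖v‖)) = ‖v‖ / 2 := by
    rw [hε]
    field_simp
  have hv0 : v = 0 := norm_le_zero_iff.1 (by linarith)
  rw [hv0, map_zero, eq_comm, sub_eq_zero] at hv
  exact hv

end Chart

/-- Equal tⁱ give equal ζ. A common value u fixes the pole coordinates only up to the choice of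
branch; the closeness of the continued ĥ⁰ at q and q' removes this discrepancy, and then the local
injectivity of the pole coordinates applies. -/
theorem IsPoint.separates (hN : 0 < N) (hM : 0 < M) (hp : IsPoint p) {ρ : ℝ} (hρ : 1 < ρ) : ∃ ε, 0 < ε ∧
    ∀ q q' : Model N M, Near ρ ε q p → Near ρ ε q' p → ∀ u, IsCoord q u → IsCoord q' u → q = q' := by
  obtain ⟨c⟩ := hp.exists_chart hM
  obtain ⟨η₁, h₁, H₁⟩ := hp.exists_zeta_eq hρ
  obtain ⟨η₂, h₂, H₂⟩ := c.exists_nearCoord_close hN hM hρ (.hHat 0) (half_pos Real.pi_pos)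
  obtain ⟨η₃, h₃, H₃⟩ := c.exists_eq_of_nearCoord hN hM hρ
  obtain ⟨η₄, h₄, H₄⟩ := c.exists_nearby hρ
  refine ⟨min (min η₁ η₂) (min η₃ η₄), lt_min (lt_min h₁ h₂) (lt_min h₃ h₄), fun q q' hq hq' u hu hu' => ?_⟩
  have hρ0 : 0 < ρ := by linarith
  have le1 : min (min η₁ η₂) (min η₃ η₄) ≤ η₁ := (min_le_left _ _).trans (min_le_left _ _)
  have le2 : min (min η₁ η₂) (min η₃ η₄) ≤ η₂ := (min_le_left _ _).trans (min_le_right _ _)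
  have le3 : min (min η₁ η₂) (min η₃ η₄) ≤ η₃ := (min_le_right _ _).trans (min_le_left _ _)
  have le4 : min (min η₁ η₂) (min η₃ η₄) ≤ η₄ := (min_le_right _ _).trans (min_le_right _ _)
  obtain ⟨c₁, e₁⟩ := H₄ q (hq.mono hρ0 le4)
  obtain ⟨c₂, e₂⟩ := H₄ q' (hq'.mono hρ0 le4)
  refine H₃ q q' (hq.mono hρ0 le3) (hq'.mono hρ0 le3)
    (H₁ q q' (hq.mono hρ0 le1) (hq'.mono hρ0 le1) _ hu.1 hu'.1) fun i => ?_
  rw [← e₁, ← e₂]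
  refine c₁.coord_pole_eq hN hM c₂ hu hu' ?_ i
  have h5 := H₂ q (hq.mono hρ0 le2)
  have h6 := H₂ q' (hq'.mono hρ0 le2)
  rw [norm_sub_rev] at h6
  rw [e₁, e₂]
  have := norm_sub_le_norm_sub_add_norm_sub (c.nearCoord q (.hHat 0)) (c.coord (.hHat 0)) (c.nearCoord q' (.hHat 0))
  linarith

end Point

/-! ### Gram matrix, nondegeneracy and flatness -/

theorem Label.weight_ne_zero {N M : ℕ} (hN : 0 < N) (hM : 0 < M) (α : Label N M) : α.weight ≠ 0 := by
  have h1 : (N : ℂ) ≠ 0 := Nat.cast_ne_zero.2 hN.ne'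
  have h2 : (M : ℂ) ≠ 0 := Nat.cast_ne_zero.2 hM.ne'
  cases α <;> simp [Label.weight, h1, h2]

section Point

variable {N M : ℕ} {p : Model N M} {u : Label N M → ℂ}

theorem metric_of_isCoordVector (hN : 0 < N) (hM : 0 < M) (hp : IsPoint p) (hu : IsCoord p u) {α β : Label N M}
    {X Y : Model N M} (hX : IsCoordVector p u α X) (hY : IsCoordVector p u β Y) : metric p X Y = gram α β := by
  obtain ⟨c, rfl⟩ := hu.exists_chart hN hM hp
  rw [c.metric_of_dCoord hN hM (c.dCoord_of_isCoordVector hN hM hY), c.dCoord_of_isCoordVector hN hM hX,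
    Chart.gram_eq]

/-- Pairing X with the coordinate vector of the dual label returns the coordinate derivative of X
times a nonzero weight, so orthogonality to all coordinate vectors makes every coordinate derivative
of X vanish. -/
theorem eq_zero_of_metric (hN : 0 < N) (hM : 0 < M) (hp : IsPoint p) (hu : IsCoord p u) {X : Model N M}
    (h : ∀ α Y, IsCoordVector p u α Y → metric p X Y = 0) : X = 0 := by
  obtain ⟨c, rfl⟩ := hu.exists_chart hN hM hp
  refine c.eq_zero_of_dCoord hN hM fun β => ?_
  obtain ⟨Y, hY⟩ := c.exists_isCoordVector hN hM hp β.dual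
  have h1 := h _ Y hY
  rw [c.metric_of_dCoord hN hM (c.dCoord_of_isCoordVector hN hM hY), Label.dual_dual] at h1
  exact (mul_eq_zero.1 h1).resolve_left (Label.weight_ne_zero hN hM _)

theorem exists_bilinForm (hN : 0 < N) (hM : 0 < M) (hp : IsPoint p) : ∃ B : LinearMap.BilinForm ℂ (Model N M),
    (∀ X Y, B X Y = metric p X Y) ∧ B.IsSymm ∧ B.Nondegenerate := by
  obtain ⟨c⟩ := hp.exists_chart hM
  let B : LinearMap.BilinForm ℂ (Model N M) := LinearMap.mk₂ ℂ (metric p) (fun X X' Y => c.metric_add hN hM X X' Y)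
    (fun a X Y => c.metric_smul hN hM a X Y)
    (fun X Y Y' => by rw [Chart.symm_metric, c.metric_add hN hM, Chart.symm_metric p Y, Chart.symm_metric p Y'])
    (fun a X Y => by rw [Chart.symm_metric, c.metric_smul hN hM, Chart.symm_metric p Y, smul_eq_mul])
  have hB : ∀ X Y, B X Y = metric p X Y := fun _ _ => rfl
  have hs : B.IsSymm := ⟨fun X Y => Chart.symm_metric p X Y⟩
  refine ⟨B, hB, hs, (hs.isRefl.nondegenerate_iff_separatingLeft).2 fun X hX => ?_⟩
  exact eq_zero_of_metric hN hM hp (c.isCoord hN hM) fun α Y _ => hX Y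

theorem isFlatCoordinateSystem (hN : 0 < N) (hM : 0 < M) : IsFlatCoordinateSystem N M where
  exists_coord p hp := by
    obtain ⟨c⟩ := IsPoint.exists_chart hM hp
    exact ⟨_, c.isCoord hN hM⟩
  separates p hp ρ hρ := by
    obtain ⟨ε, hε, h⟩ := IsPoint.separates hN hM hp hρ
    exact ⟨ε, hε, fun q _ q' _ => h q q'⟩
  coordVector p hp u hu α := by
    obtain ⟨c, rfl⟩ := hu.exists_chart hN hM hp
    obtain ⟨X, hX⟩ := c.exists_isCoordVector hN hM hp α
    refine ⟨X, hX, fun Y hY => sub_eq_zero.1 (c.eq_zero_of_dCoord hN hM fun β => ?_)⟩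
    rw [c.dCoord_sub, c.dCoord_of_isCoordVector hN hM hX, c.dCoord_of_isCoordVector hN hM hY, sub_self]
  total p hp u hu X h := eq_zero_of_metric hN hM hp hu h
  constant := ⟨gram, fun p hp u hu α β X Y hX hY => metric_of_isCoordVector hN hM hp hu hX hY⟩

end Point
end TodaFrobenius

theorem mainTheorem2 (N M : ℕ) (hN : 0 < N) (hM : 0 < M) :
    (∀ p ∈ TodaFrobenius.manifold N M, ∀ u : TodaFrobenius.Label N M → ℂ,
      TodaFrobenius.IsCoord p u ↔ TodaFrobenius.IsFormulaCoord p u) ∧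
    (∀ p ∈ TodaFrobenius.manifold N M, ∀ u : TodaFrobenius.Label N M → ℂ,
      TodaFrobenius.IsCoord p u →
        ∀ (α β : TodaFrobenius.Label N M) (X Y : TodaFrobenius.Model N M),
          TodaFrobenius.IsCoordVector p u α X → TodaFrobenius.IsCoordVector p u β Y →
            TodaFrobenius.metric p X Y = TodaFrobenius.gram α β) ∧
    (∀ p ∈ TodaFrobenius.manifold N M,
      ∃ B : LinearMap.BilinForm ℂ (TodaFrobenius.Model N M),
        (∀ X Y, B X Y = TodaFrobenius.metric p X Y) ∧ B.IsSymm ∧ B.Nondegenerate) ∧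
    TodaFrobenius.IsFlatCoordinateSystem N M :=
  ⟨fun _ hp _ => TodaFrobenius.isCoord_iff_isFormulaCoord hN hM hp,
    fun _ hp _ hu _ _ _ _ hX hY => TodaFrobenius.metric_of_isCoordVector hN hM hp hu hX hY,
    fun _ hp => TodaFrobenius.exists_bilinForm hN hM hp, TodaFrobenius.isFlatCoordinateSystem hN hM⟩
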